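/- **Setting.** Let $d\ge 1$, equip $\mathbb Z^d$ with the $\ell^\infty$ distance, and let $\Omega=\mathbb R^{\mathbb Z^d}$ with the product $\sigma$-algebra; write $\Lambda\subset\subset\mathbb Z^d$ for finite $\Lambda$. For each $X\subset\subset\mathbb Z^d$ let $J_X:\mathbb R^X\to\mathbb R$ be twice differentiable, with $J_X\equiv0$ whenever $\operatorname{diam}X>R$ (for a fixed $R\in\mathbb N$). Put $U_\Lambda(x)=\sum_{X\cap\Lambda\ne\varnothing}J_X(x_X)$ and assume $0<\int_{\mathbb R^\Lambda}e^{-U_\Lambda(x_\Lambda|\omega_{\Lambda^c})}dx_\Lambda<\infty$ for all $\Lambda\subset\subset\mathbb Z^d$ and $\omega\in\Omega$. Let $\mathbb E^\omega_\Lambda$ be the probability measure under which $x_{\Lambda^c}=\omega_{\Lambda^c}$ and $x_\Lambda$ has Lebesgue density proportional to $e^{-U_\Lambda(x_\Lambda|\omega_{\Lambda^c})}$, and let $\mu$ be a Gibbs measure, i.e. a probability measure on $\Omega$ with $\mu\,\mathbb E_\Lambda=\mu$ for all $\Lambda\subset\subset\mathbb Z^d$ (DLR equations). Put $\mathcal L_\Lambda=\sum_{j\in\Lambda}\big(\nabla_j^2-(\nabla_jU_\Lambda)\nabla_j\big)$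 with $\nabla_j=\partial/\partial x_j$. A *test function* is a smooth function $g:\Omega\to\mathbb C$ of finitely many coordinates $x_\Gamma$, compactly supported as a function on $\mathbb R^\Gamma$. For $f\in L^2(\mu)$ the weak derivative $\nabla_jf\in L^2(\mu)$ is characterised by $\mu(g\nabla_jf)=\mu\big((g\nabla_jU_{\{j\}}-\nabla_jg)f\big)$ for all test functions $g$ whose $\Gamma$ contains all sites at distance at most $R$ from $j$. Write $\|\nabla_\Lambda f\|_\mu^2=\sum_{j\in\Lambda}\mu|\nabla_jf|^2$, $\|\nabla f\|_\mu^2=\sum_{j\in\mathbb Z^d}\mu|\nabla_jf|^2$ (a term being $+\infty$ if the weak derivative does not exist in $L^2(\mu)$), and $H^1(\mu)=\{f\in L^2(\mu):\|\nabla f\|_\mu<\infty\}$. For $F\ge0$ integrable, $\mathrm{Ent}_\mu F=\mu\big(F\log\frac{F}{\mu F}\big)\in[0,\infty]$. One says that $\mu$ satisfies a log-Sobolev inequality with coefficient $c$ if $\mathrm{Ent}_\mu|h|^2\le c\|\nabla h\|_\mu^2$ for all $h\in H^1(\mu)$. **Theorem.** Let $\lambda\in\mathbb R$ and $\Lambda\subset\subset\mathbb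 Z^d$, let $f\in H^1(\mu)$ be a measurable function of finitely many coordinates, and let $\phi$ be a solution of $$i\partial_t\phi=-\mathcal L_\Lambda\phi+\lambda\,\phi\log\frac{|\phi|^2}{\mu|\phi|^2},\qquad \phi|_{t=0}=f,\tag{LSE$_\Lambda$}$$ that is, $\phi\in C([0,\infty);L^2(\mu))$, $\sup_{0\le t\le T}\|\nabla_\Lambda\phi(\cdot,t)\|_\mu<\infty$ for every $T$, $\phi(\cdot,0)=f$, and for every test function $g$ whose $\Gamma$ contains all sites at distance at most $R$ from $\Lambda$, and every $t\ge0$, $$i\frac{d}{dt}\mu\big(g\,\phi(\cdot,t)\big)=\mu\Big((-\mathcal L_\Lambda g)\phi(\cdot,t)+\lambda\,g\,\phi(\cdot,t)\log\frac{|\phi(\cdot,t)|^2}{\mu|\phi(\cdot,t)|^2}\Big)$$ (with $0\log(\cdot)=0$, and a one-sided derivative at $t=0$). Then, for all $t\ge0$: 1. $\|\nabla_\Lambda\phi(\cdot,t)\|_\mu^2\le e^{2|\lambda|t}\,\|\nabla f\|_\mu^2$; 2. if $\lambda\ne0$, then $\mathrm{Ent}_\mu|\phi(\cdot,t)|^2\le\mathrm{Ent}_\mu|f|^2+\frac1{|\lambda|}\big(e^{2|\lambda|t}-1\big)\|\nabla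 f\|_\mu^2$; 3. if $\lambda>0$ and $\mu$ satisfies a log-Sobolev inequality with coefficient $c>0$, then $\|\nabla_\Lambda\phi(\cdot,t)\|_\mu^2\le(1+\lambda c)\|\nabla f\|_\mu^2$ and $\mathrm{Ent}_\mu|\phi(\cdot,t)|^2\le\big(\frac1\lambda+c\big)\|\nabla f\|_\mu^2$. -/

import Mathlib

open MeasureTheory Set Filter Topology
open scoped ENNReal

noncomputable section

namespace LSE

/-- The lattice `ℤ^d`; its `dist` is the `l^∞` distance. -/
abbrev Lattice (d : ℕ) : Type := Fin d → ℤ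

/-- The configuration space `Ω = ℝ^(ℤ^d)`, with the product σ-algebra. -/
abbrev Config (d : ℕ) : Type := Lattice d → ℝ

/-- The partial derivative `∇_j F = ∂F/∂x_j` of a function on the configuration space. -/
def pderiv {d : ℕ} {E : Type*} [NormedAddCommGroup E] [NormedSpace ℝ E]
    (j : Lattice d) (F : Config d → E) (x : Config d) : E :=
  lineDeriv ℝ F x (Pi.single j 1)

/-- A family `{J_X}` of twice differentiable functions on `ℝ^X`, indexed by the finite subsets `X`
of the lattice, of finite range: `J_X = 0` as soon as `diam X > R`. -/
structure Interaction (d : ℕ) where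
  /-- The range of the interaction. -/
  R : ℕ
  /-- The potential `J_X`, as a function on `ℝ^X`. -/
  J : (X : Finset (Lattice d)) → (X → ℝ) → ℝ
  differentiable : ∀ X, Differentiable ℝ (J X)
  differentiable_fderiv : ∀ X, Differentiable ℝ (fderiv ℝ (J X))
  finite_range : ∀ X : Finset (Lattice d),
    (R : ℝ) < Metric.diam (X : Set (Lattice d)) → J X = 0

/-- The potential energy `U_Λ(x) = ∑_{X ∩ Λ ≠ ∅} J_X(x_X)`. By the finite range, only finitely many
terms are non-zero. -/
def Interaction.U {d : ℕ} (Φ : Interaction d) (Λ : Finset (Lattice d)) (x : Config d) : ℝ :=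
  ∑ᶠ (X : Finset (Lattice d)) (_ : ¬ Disjoint X Λ), Φ.J X (X.restrict x)

/-- The partition function `∫_{ℝ^Λ} exp(-U_Λ(x_Λ | x_{Λᶜ} = ω_{Λᶜ})) dx_Λ`. -/
def Interaction.Z {d : ℕ} (Φ : Interaction d) (Λ : Finset (Lattice d)) (ω : Config d) : ℝ≥0∞ :=
  ∫⁻ y : Λ → ℝ, ENNReal.ofReal (Real.exp (-Φ.U Λ (Function.updateFinset ω Λ y)))

/-- All partition functions are positive and finite. -/
def Interaction.Normalizable {d : ℕ} (Φ : Interaction d) : Prop :=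
  ∀ (Λ : Finset (Lattice d)) (ω : Config d), 0 < Φ.Z Λ ω ∧ Φ.Z Λ ω < ∞

/-- The local Gibbs measure `𝔼_Λ^ω` with boundary condition `ω`, as a measure on the configuration
space: the coordinates outside `Λ` are frozen to those of `ω`, those in `Λ` have density
`exp(-U_Λ^ω) / Z` with respect to Lebesgue measure on `ℝ^Λ`. -/
def Interaction.localGibbs {d : ℕ} (Φ : Interaction d) (Λ : Finset (Lattice d)) (ω : Config d) :
    Measure (Config d) :=
  (Φ.Z Λ ω)⁻¹ • ((volume : Measure (Λ → ℝ)).withDensity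
    (fun y => ENNReal.ofReal (Real.exp (-Φ.U Λ (Function.updateFinset ω Λ y))))).map
      (Function.updateFinset ω Λ)

/-- The DLR equations `μ 𝔼_Λ = μ` for all finite `Λ` (`μ` will be a probability measure). -/
def Interaction.IsGibbs {d : ℕ} (Φ : Interaction d) (μ : Measure (Config d)) : Prop :=
  ∀ (Λ : Finset (Lattice d)) (A : Set (Config d)), MeasurableSet A →
    ∫⁻ ω, Φ.localGibbs Λ ω A ∂μ = μ A

/-- The generator `𝓛_Λ g = Δ_Λ g - ∇_Λ U_Λ · ∇_Λ g`. -/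
def Interaction.gen {d : ℕ} (Φ : Interaction d) (Λ : Finset (Lattice d)) (g : Config d → ℂ)
    (x : Config d) : ℂ :=
  ∑ j ∈ Λ, (pderiv j (pderiv j g) x - ((pderiv j (Φ.U Λ) x : ℝ) : ℂ) * pderiv j g x)

/-- `Γ` contains all sites at distance at most `R` from `Λ`. All the `J_X` in the sum
for `U_Λ` that do not vanish are then functions of the coordinates in `Γ`. -/
def Interaction.Covers {d : ℕ} (Φ : Interaction d) (Λ Γ : Finset (Lattice d)) : Prop :=
  ∀ i ∈ Λ, ∀ k, dist i k ≤ (Φ.R : ℝ) → k ∈ Γ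

/-- `f` is localised in the finite set `Γ`: it is a measurable function of `x_Γ`. -/
def IsLocalisedIn {d : ℕ} (Γ : Finset (Lattice d)) (f : Config d → ℂ) : Prop :=
  ∃ f₀ : (Γ → ℝ) → ℂ, Measurable f₀ ∧ f = fun x => f₀ (Γ.restrict x)

/-- Test functions: smooth compactly supported complex functions of the coordinates in `Γ`. -/
def IsTest {d : ℕ} (Γ : Finset (Lattice d)) (g : Config d → ℂ) : Prop :=
  ∃ h : (Γ → ℝ) → ℂ, ContDiff ℝ ((⊤ : ℕ∞) : WithTop ℕ∞) h ∧ HasCompactSupport h ∧ g = fun x => h (Γ.restrict x)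

/-- `D ∈ L²(μ)` is the weak derivative `∇_j f` of `f ∈ L²(μ)` with respect to the Gibbs measure
`μ`, that is, `μ(g ∇_j f) = μ((g ∇_j U - ∇_j g) f)` for all test functions `g`. Here `∇_j U` stands
for `∇_j U_{j}`, which equals `∇_j U_Λ` for every `Λ` containing `j`; the coordinates on which it
depends are among those in which `g` has compact support, so that all integrals converge. -/
def Interaction.IsWeakDeriv {d : ℕ} (Φ : Interaction d) (μ : Measure (Config d)) (j : Lattice d)
    (f D : Config d → ℂ) : Prop :=
  MemLp f 2 μ ∧ MemLp D 2 μ ∧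
    ∀ Γ : Finset (Lattice d), Φ.Covers {j} Γ → ∀ g : Config d → ℂ, IsTest Γ g →
      ∫ x, g x * D x ∂μ =
        ∫ x, (g x * ((pderiv j (Φ.U {j}) x : ℝ) : ℂ) - pderiv j g x) * f x ∂μ

/-- `‖∇_j f‖²_μ = μ|∇_j f|²`, which is `∞` if `f` has no weak derivative `∇_j f` in `L²(μ)`.
(The weak derivative is unique almost everywhere, so the infimum is over one value only.) -/
def Interaction.partialSq {d : ℕ} (Φ : Interaction d) (μ : Measure (Config d)) (j : Lattice d)
    (f : Config d → ℂ) : ℝ≥0∞ :=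
  ⨅ (D : Config d → ℂ) (_ : Φ.IsWeakDeriv μ j f D), ∫⁻ x, ‖D x‖ₑ ^ 2 ∂μ

/-- `‖∇_Λ f‖²_μ = ∑_{j ∈ Λ} μ|∇_j f|²`. -/
def Interaction.gradSqOn {d : ℕ} (Φ : Interaction d) (μ : Measure (Config d))
    (Λ : Finset (Lattice d)) (f : Config d → ℂ) : ℝ≥0∞ :=
  ∑ j ∈ Λ, Φ.partialSq μ j f

/-- `‖∇f‖²_μ = ∑_{j ∈ ℤ^d} μ|∇_j f|²`. -/
def Interaction.gradSq {d : ℕ} (Φ : Interaction d) (μ : Measure (Config d))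
    (f : Config d → ℂ) : ℝ≥0∞ :=
  ∑' j : Lattice d, Φ.partialSq μ j f

/-- The Sobolev space `H¹(μ)`. -/
def Interaction.InH1 {d : ℕ} (Φ : Interaction d) (μ : Measure (Config d))
    (f : Config d → ℂ) : Prop :=
  MemLp f 2 μ ∧ Φ.gradSq μ f < ∞

/-- The entropy `Ent_μ F = μ(F log(F / μF))` of a nonnegative integrable `F`, with values in the
extended reals: the integral of the positive part minus that of the negative part. The latter is
finite for a probability measure, because `s log(s / m) ≥ -m / e`. -/
def entropy {d : ℕ} (μ : Measure (Config d)) (F : Config d → ℝ) : EReal :=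
  ((∫⁻ x, ENNReal.ofReal (F x * Real.log (F x / ∫ y, F y ∂μ)) ∂μ : ℝ≥0∞) : EReal) -
    ((∫⁻ x, ENNReal.ofReal (-(F x * Real.log (F x / ∫ y, F y ∂μ))) ∂μ : ℝ≥0∞) : EReal)

/-- The logarithmic Sobolev inequality `Ent_μ |f|² ≤ c ‖∇f‖²_μ` for all `f ∈ H¹(μ)`. -/
def Interaction.LogSobolev {d : ℕ} (Φ : Interaction d) (μ : Measure (Config d)) (c : ℝ) : Prop :=
  ∀ f : Config d → ℂ, Φ.InH1 μ f →
    entropy μ (fun x => ‖f x‖ ^ 2) ≤ ((ENNReal.ofReal c * Φ.gradSq μ f : ℝ≥0∞) : EReal)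

/-- `φ` is a (weak) solution on `[0, ∞)` of the Cauchy problem
`i ∂_t φ = -𝓛_Λ φ + lam φ log(|φ|² / μ|φ|²)`, `φ(·, 0) = f`, in the class
`C([0, ∞); L²(μ)) ∩ L^∞_loc([0, ∞); H¹_Λ(μ))`, where `H¹_Λ` is the space of `L²` functions with
`∇_Λ` in `L²`. The equation is tested with smooth compactly supported local functions `g`:
`i d/dt μ(g φ) = μ((-𝓛_Λ g) φ + g lam φ log(|φ|² / μ|φ|²))` for every `t ≥ 0`. -/
structure Interaction.IsSolution {d : ℕ} (Φ : Interaction d) (μ : Measure (Config d)) (lam : ℝ)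
    (Λ : Finset (Lattice d)) (f : Config d → ℂ) (φ : ℝ → Lp ℂ 2 μ) : Prop where
  initial : φ 0 =ᵐ[μ] f
  continuousOn : ContinuousOn φ (Ici 0)
  bounded_grad : ∀ T : ℝ, ∃ C : ℝ≥0∞, C < ∞ ∧ ∀ t ∈ Icc 0 T, Φ.gradSqOn μ Λ (φ t) ≤ C
  equation : ∀ Γ : Finset (Lattice d), Φ.Covers Λ Γ → ∀ g : Config d → ℂ, IsTest Γ g →
    ∀ t : ℝ, 0 ≤ t →
      HasDerivWithinAt (fun s => Complex.I * ∫ x, g x * φ s x ∂μ)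
        (∫ x, (-(Φ.gen Λ g x) * φ t x + g x * ((lam : ℂ) * φ t x *
          ((Real.log (‖φ t x‖ ^ 2 / ∫ y, ‖φ t y‖ ^ 2 ∂μ) : ℝ) : ℂ))) ∂μ)
        (Ici 0) t

end LSE

end

set_option linter.unusedSectionVars false

/-! Let Y(t) be the sum over j in Λ of the integrals of 2 Re(φ̄ ∇_jφ) Im(φ̄ ∇_jφ) / |φ|²
(`totalTwist`). Formally the equation conserves the mass ‖φ‖² and gives d/dt ‖∇_Λφ‖² = -2λY and d/dt
Ent|φ|² = 2Y, so that ‖∇_Λφ‖² + λ Ent|φ|² is conserved. Since |2 Re a Im a| ≤ |a|², one has |Y| ≤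
‖∇_Λφ‖². Grönwall's inequality then yields the first claim together with a bound for the integral of
Y, and hence the second. For λ > 0 both terms of the conserved quantity are nonnegative, so each is
at most its initial value, which the log-Sobolev inequality for f controls; this is the third claim.

The difficulty is regularity: ∂_tφ may be paired only with bounded functions whose gradient is in
L², and ‖∇_Λφ‖² cannot be differentiated directly. It is replaced by a constrained Moreau envelope,
d(t) = min ‖φ(t) - w‖² + ε‖∇w‖² over |w| ≤ M. The difference ‖φ‖² - d is a supremum of functions
affine in φ, so the minimiser w(t) supplies a subgradient; this makes the difference Lipschitz in
time, with derivative 2 Re⟨w, ∂_tφ⟩ almost everywhere (`integral_of_subgradient`,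
`IsWeakSol.integral_functional`). The contribution of the generator to this derivative vanishes up
to O(ε²) (`Approx.abs_im_le`). The nonlinear contribution is computed by rotating w to exp(is
log|w|²) w, a variation that respects the constraint and whose Euler–Lagrange equation produces the
twist (`eulerLagrange`). Passing from log|φ|² to log|w|² costs at most ‖φ - w‖² = o(ε), by the
pointwise inequality `abs_im_conj_mul_log_sub_log_le`. Dividing by ε and letting ε tend to zero
gives the energy balance (`IsWeakSol.conservation`).

The entropy is approached by convex radial functionals. Their subgradients c(|φ|²)φ are admissible
test functions, and the nonlinearity does not contribute because c(|φ|²)|φ|² log|φ|² is real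
(`IsWeakSol.radial_balance`). Removing the regularisation uses Fatou's lemma at the final time, so
only an inequality survives (`IsWeakSol.entropy_balance`), and it is the inequality that is needed.

All this uses only the abstract properties collected in `IsGradRel` and `IsWeakSol`. That they hold
for a Gibbs measure rests on the density of test functions in the Sobolev space
(`gradApprox_of_isWeakDeriv`). By the DLR equations the measure e^{U_Λ}μ is invariant under
translations of x_Λ, so mollification in these coordinates is available. Density gives the chain
rule, and extends the equation from test functions to bounded Sobolev functions
(`Interaction.IsSolution.isWeakSol`). -/

namespace LSE

/-! ### The sharp pointwise inequality for the logarithmic nonlinearity -/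

/-- With s = log|z| - log|w| one has |z|² + |w|² = 2|z||w| cosh s, so the claim reads |Im(w̄z)||s| +
Re(w̄z) ≤ |z||w| cosh s. This is Cauchy–Schwarz for the vectors (|Im|, Re) and (|s|, 1), combined
with 1 + s² ≤ 1 + sinh² s = cosh² s. -/
lemma abs_im_conj_mul_log_sub_log_le (z w : ℂ) :
    |(star w * z).im * (Real.log (‖z‖ ^ 2) - Real.log (‖w‖ ^ 2))| ≤ ‖z - w‖ ^ 2 := by
  rcases eq_or_ne z 0 with rfl | hz
  · simp
  rcases eq_or_ne w 0 with rfl | hw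
  · simp
  have ha : 0 < ‖z‖ := norm_pos_iff.2 hz
  have hb : 0 < ‖w‖ := norm_pos_iff.2 hw
  set s : ℝ := Real.log ‖z‖ - Real.log ‖w‖ with hs
  have hlog : Real.log (‖z‖ ^ 2) - Real.log (‖w‖ ^ 2) = 2 * s := by
    rw [Real.log_pow, Real.log_pow, hs]; push_cast; ring
  have hexp : Real.exp s = ‖z‖ / ‖w‖ := by
    rw [hs, Real.exp_sub, Real.exp_log ha, Real.exp_log hb]
  have hcosh : ‖z‖ * ‖w‖ * Real.cosh s = (‖z‖ ^ 2 + ‖w‖ ^ 2) / 2 := by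
    rw [Real.cosh_eq, Real.exp_neg, hexp]
    field_simp
  have hnorm : (star w * z).re ^ 2 + (star w * z).im ^ 2 = (‖z‖ * ‖w‖) ^ 2 := by
    have : ‖star w * z‖ ^ 2 = (‖z‖ * ‖w‖) ^ 2 := by simp [mul_comm]
    rw [← this, Complex.sq_norm, Complex.normSq_apply]; ring
  have hsub : ‖z - w‖ ^ 2 = ‖z‖ ^ 2 + ‖w‖ ^ 2 - 2 * (star w * z).re := by
    simp only [Complex.sq_norm, Complex.normSq_apply]
    simp
    ring
  have hsinh : s ^ 2 ≤ Real.sinh s ^ 2 := by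
    rw [sq_le_sq]
    rcases le_total 0 s with h | h
    · rw [abs_of_nonneg h, abs_of_nonneg (Real.sinh_nonneg_iff.2 h)]
      exact Real.self_le_sinh_iff.2 h
    · rw [abs_of_nonpos h, abs_of_nonpos (Real.sinh_nonpos_iff.2 h)]
      exact neg_le_neg (Real.sinh_le_self_iff.2 h)
  -- Cauchy–Schwarz is applied after squaring; the discarded square is (|Im| - Re·|s|)².
  have hkey : |(star w * z).im| * |s| + (star w * z).re ≤ ‖z‖ * ‖w‖ * Real.cosh s := by
    apply le_of_abs_le
    rw [← abs_of_nonneg (by positivity : 0 ≤ ‖z‖ * ‖w‖ * Real.cosh s), ← sq_le_sq]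
    have h1 : Real.cosh s ^ 2 = 1 + Real.sinh s ^ 2 := by rw [Real.cosh_sq]; ring
    have h2 : (‖z‖ * ‖w‖ * Real.cosh s) ^ 2
        = ((star w * z).re ^ 2 + |(star w * z).im| ^ 2) * (1 + Real.sinh s ^ 2) := by
      rw [sq_abs, hnorm, ← h1]; ring
    rw [h2]
    have h3 : |s| ^ 2 ≤ Real.sinh s ^ 2 := by rwa [sq_abs]
    nlinarith [sq_nonneg (|(star w * z).im| - (star w * z).re * |s|),
      mul_le_mul_of_nonneg_left h3 (add_nonneg (sq_nonneg (star w * z).re)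
        (sq_nonneg |(star w * z).im|))]
  rw [hlog, abs_mul, abs_mul, abs_two, hsub]
  linarith

/-! ### Functions of one variable with subgradients -/

/-- The subgradient inequalities at the two endpoints bound the increment of `F` from both sides. -/
lemma lipschitzOnWith_of_subgradient {F : ℝ → ℝ} {p : ℝ → ℝ → ℝ} {s : Set ℝ} {C : NNReal}
    (hsub : ∀ t ∈ s, ∀ r ∈ s, p t r ≤ F r - F t)
    (hp : ∀ t ∈ s, ∀ r ∈ s, |p t r| ≤ C * |r - t|) : LipschitzOnWith C F s := by
  refine LipschitzOnWith.of_dist_le_mul fun x hx y hy => ?_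
  rw [Real.dist_eq, Real.dist_eq, abs_le]
  have h1 := hsub x hx y hy
  have h2 := hsub y hy x hx
  have h3 := abs_le.1 (hp x hx y hy)
  have h4 := abs_le.1 (hp y hy x hx)
  rw [abs_sub_comm y x] at h3
  constructor <;> linarith

/-- `F` is Lipschitz, hence absolutely continuous. Wherever it is differentiable, `F - p t` has a
local minimum at `t`, which identifies the derivative as `q t`. Measurability of `q`, which in the
applications depends on an arbitrary choice of minimisers, comes for free from that of `deriv F`. -/
lemma integral_of_subgradient {F q : ℝ → ℝ} {p : ℝ → ℝ → ℝ} {T : ℝ} {C : NNReal} (hT : 0 ≤ T)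
    (hsub : ∀ t ∈ Icc 0 T, ∀ r ∈ Icc 0 T, p t r ≤ F r - F t)
    (hp : ∀ t ∈ Icc 0 T, ∀ r ∈ Icc 0 T, |p t r| ≤ C * |r - t|)
    (hd : ∀ t ∈ Ioo 0 T, HasDerivAt (p t) (q t) t) :
    F T - F 0 = ∫ t in (0 : ℝ)..T, q t ∧
      AEStronglyMeasurable q (volume.restrict (Ioc 0 T)) := by
  have hlip := lipschitzOnWith_of_subgradient hsub hp
  have hac : AbsolutelyContinuousOnInterval F 0 T :=
    LipschitzOnWith.absolutelyContinuousOnInterval (by rwa [uIcc_of_le hT])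
  have hae : ∀ᵐ t, t ∈ Ioc 0 T → deriv F t = q t := by
    have hT' : ∀ᵐ t : ℝ, t ≠ T := by simp [ae_iff]
    filter_upwards [hac.ae_differentiableAt, hT'] with t ht htT htI
    have htI' : t ∈ Ioo 0 T := ⟨htI.1, lt_of_le_of_ne htI.2 htT⟩
    have hmem : t ∈ Icc 0 T := Ioo_subset_Icc_self htI'
    have hF := (ht (by rwa [uIcc_of_le hT])).hasDerivAt
    have hmin : IsLocalMin (fun r => F r - p t r) t := by
      filter_upwards [Icc_mem_nhds htI'.1 htI'.2] with r hr
      have h0 : p t t = 0 := by simpa using hp t hmem t hmem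
      have := hsub t hmem r hr
      simp only [h0]; linarith
    have := hmin.hasDerivAt_eq_zero (hF.sub (hd t htI'))
    linarith
  have hae' : deriv F =ᵐ[volume.restrict (Ioc 0 T)] q := by
    rw [EventuallyEq, ae_restrict_iff' measurableSet_Ioc]; exact hae
  refine ⟨?_, (measurable_deriv F).aestronglyMeasurable.congr hae'⟩
  rw [← hac.integral_deriv_eq_sub, intervalIntegral.integral_of_le hT,
    intervalIntegral.integral_of_le hT, integral_congr_ae hae']

/-! ### The current density -/

/-- The quantity `2 Re(z̄ p) Im(z̄ p) / |z|²`. Its integral, for `z` a function and `p` its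
gradient, is the rate at which the logarithmic nonlinearity produces energy. -/
noncomputable def twist (z p : ℂ) : ℝ := 2 * (star z * p).re * (star z * p).im / ‖z‖ ^ 2

lemma abs_two_mul_re_mul_im_le (a : ℂ) : |2 * a.re * a.im| ≤ ‖a‖ ^ 2 := by
  rw [Complex.sq_norm, Complex.normSq_apply, abs_le]
  constructor <;> nlinarith [sq_nonneg (a.re + a.im), sq_nonneg (a.re - a.im)]

lemma abs_twist_le (z p : ℂ) : |twist z p| ≤ ‖p‖ ^ 2 := by
  rcases eq_or_ne z 0 with rfl | hz
  · simp [twist]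
  have : 0 < ‖z‖ ^ 2 := by positivity
  rw [twist, abs_div, abs_of_pos this, div_le_iff₀ this]
  refine (abs_two_mul_re_mul_im_le _).trans (le_of_eq ?_)
  simp [mul_pow, mul_comm]

lemma norm_sq_mul_twist (z p : ℂ) :
    ‖z‖ ^ 2 * twist z p = 2 * (star z * p).re * (star z * p).im := by
  rcases eq_or_ne z 0 with rfl | hz
  · simp [twist]
  · have : ‖z‖ ≠ 0 := norm_ne_zero_iff.2 hz
    rw [twist]; field_simp

lemma measurable_twist : Measurable fun x : ℂ × ℂ => twist x.1 x.2 := by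
  unfold twist
  have h1 : Measurable fun x : ℂ × ℂ => star x.1 * x.2 := by fun_prop
  have h2 : Measurable fun x : ℂ × ℂ => (star x.1 * x.2).re := Complex.measurable_re.comp h1
  have h3 : Measurable fun x : ℂ × ℂ => (star x.1 * x.2).im := Complex.measurable_im.comp h1
  exact ((h2.const_mul 2).mul h3).div (by fun_prop)

lemma continuousAt_twist {z p : ℂ} (hz : z ≠ 0) :
    ContinuousAt (fun x : ℂ × ℂ => twist x.1 x.2) (z, p) := by
  unfold twist
  refine ContinuousAt.div (by fun_prop) (by fun_prop) ?_
  simpa using hz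

/-! ### Square norms and pairings in L². -/

section L2

variable {Ω : Type*} [MeasurableSpace Ω] {μ : Measure Ω}

/-- The squared `L²` norm as a Bochner integral. -/
noncomputable def l2sq (μ : Measure Ω) (f : Ω → ℂ) : ℝ := ∫ x, ‖f x‖ ^ 2 ∂μ

/-- The `L²` pairing, conjugate linear in the first variable. -/
noncomputable def pair (μ : Measure Ω) (f g : Ω → ℂ) : ℂ := ∫ x, star (f x) * g x ∂μ

lemma l2sq_nonneg (f : Ω → ℂ) : 0 ≤ l2sq μ f := integral_nonneg fun _ => by positivity

lemma l2sq_congr {f g : Ω → ℂ} (h : f =ᵐ[μ] g) : l2sq μ f = l2sq μ g :=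
  integral_congr_ae (by filter_upwards [h] with x hx; rw [hx])

lemma pair_congr {f f' g g' : Ω → ℂ} (h : f =ᵐ[μ] f') (h' : g =ᵐ[μ] g') :
    pair μ f g = pair μ f' g' :=
  integral_congr_ae (by filter_upwards [h, h'] with x hx hx'; rw [hx, hx'])

lemma integrable_norm_sq {f : Ω → ℂ} (hf : MemLp f 2 μ) : Integrable (fun x => ‖f x‖ ^ 2) μ := by
  have := hf.integrable_norm_rpow (by norm_num) (by norm_num)
  simpa using this

lemma integrable_star_mul {f g : Ω → ℂ} (hf : MemLp f 2 μ) (hg : MemLp g 2 μ) :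
    Integrable (fun x => star (f x) * g x) μ := by
  have := hf.star.integrable_mul hg
  simpa [Pi.mul_def] using this

lemma integrable_norm_mul_norm {f g : Ω → ℂ} (hf : MemLp f 2 μ) (hg : MemLp g 2 μ) :
    Integrable (fun x => ‖f x‖ * ‖g x‖) μ := by
  have := hf.norm.integrable_mul hg.norm
  simpa [Pi.mul_def] using this

lemma l2sq_coe (u : Lp ℂ 2 μ) : l2sq μ u = ‖u‖ ^ 2 := by
  have h := L2.inner_def (𝕜 := ℂ) u u
  rw [inner_self_eq_norm_sq_to_K] at h
  have h2 : (∫ x, inner ℂ (u x) (u x) ∂μ) = ((l2sq μ u : ℝ) : ℂ) := by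
    rw [l2sq, ← integral_complex_ofReal]
    exact integral_congr_ae (Eventually.of_forall fun x => by
      simp [inner_self_eq_norm_sq_to_K])
  rw [h2] at h
  apply Complex.ofReal_injective
  rw [← h]
  simp

lemma pair_coe (u v : Lp ℂ 2 μ) : pair μ u v = inner ℂ u v := by
  rw [L2.inner_def]
  exact integral_congr_ae (Eventually.of_forall fun x => by
    simp [RCLike.inner_apply, mul_comm])

lemma l2sq_eq_norm_toLp {f : Ω → ℂ} (hf : MemLp f 2 μ) : l2sq μ f = ‖hf.toLp f‖ ^ 2 := by
  rw [← l2sq_coe, l2sq_congr hf.coeFn_toLp]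

lemma l2sq_eq_eLpNorm {f : Ω → ℂ} (hf : MemLp f 2 μ) : l2sq μ f = (eLpNorm f 2 μ).toReal ^ 2 := by
  rw [l2sq_eq_norm_toLp hf, Lp.norm_toLp]

lemma norm_pair_le {f g : Ω → ℂ} (hf : MemLp f 2 μ) (hg : MemLp g 2 μ) :
    ‖pair μ f g‖ ≤ √(l2sq μ f) * √(l2sq μ g) := by
  rw [pair_congr hf.coeFn_toLp.symm hg.coeFn_toLp.symm, pair_coe, l2sq_eq_norm_toLp hf,
    l2sq_eq_norm_toLp hg, Real.sqrt_sq (norm_nonneg _), Real.sqrt_sq (norm_nonneg _)]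
  exact norm_inner_le_norm _ _

lemma pair_sub_left {f f' g : Ω → ℂ} (hf : MemLp f 2 μ) (hf' : MemLp f' 2 μ)
    (hg : MemLp g 2 μ) :
    pair μ (fun x => f x - f' x) g = pair μ f g - pair μ f' g := by
  rw [pair, pair, pair, ← integral_sub (integrable_star_mul hf hg) (integrable_star_mul hf' hg)]
  simp only [star_sub, sub_mul]

lemma pair_sub_right {f g g' : Ω → ℂ} (hf : MemLp f 2 μ) (hg : MemLp g 2 μ)
    (hg' : MemLp g' 2 μ) :
    pair μ f (fun x => g x - g' x) = pair μ f g - pair μ f g' := by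
  rw [pair, pair, pair, ← integral_sub (integrable_star_mul hf hg) (integrable_star_mul hf hg')]
  simp only [mul_sub]

lemma im_pair {f g : Ω → ℂ} (hf : MemLp f 2 μ) (hg : MemLp g 2 μ) :
    (pair μ f g).im = ∫ x, (star (f x) * g x).im ∂μ :=
  (integral_im (𝕜 := ℂ) (integrable_star_mul hf hg)).symm

lemma re_pair {f g : Ω → ℂ} (hf : MemLp f 2 μ) (hg : MemLp g 2 μ) :
    (pair μ f g).re = ∫ x, (star (f x) * g x).re ∂μ :=
  (integral_re (𝕜 := ℂ) (integrable_star_mul hf hg)).symm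

lemma l2sq_sub {f g : Ω → ℂ} (hf : MemLp f 2 μ) (hg : MemLp g 2 μ) :
    l2sq μ (fun x => f x - g x) = l2sq μ f + l2sq μ g - 2 * (pair μ f g).re := by
  rw [re_pair hf hg, l2sq, l2sq, l2sq, ← integral_const_mul,
    ← integral_add (integrable_norm_sq hf) (integrable_norm_sq hg), ← integral_sub]
  · refine integral_congr_ae (Eventually.of_forall fun x => ?_)
    simp only [Complex.sq_norm, Complex.normSq_apply]
    simp
    ring
  · exact (integrable_norm_sq hf).add (integrable_norm_sq hg)
  · exact ((integrable_star_mul hf hg).re.const_mul 2)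

lemma l2sq_sub_le {f g h : Ω → ℂ} (hf : MemLp f 2 μ) (hg : MemLp g 2 μ) (hh : MemLp h 2 μ) :
    l2sq μ (fun x => f x - h x) ≤
      2 * l2sq μ (fun x => f x - g x) + 2 * l2sq μ (fun x => g x - h x) := by
  have i1 := integrable_norm_sq (hf.sub hg)
  have i2 := integrable_norm_sq (hg.sub hh)
  have i3 := integrable_norm_sq (hf.sub hh)
  simp only [Pi.sub_apply] at i1 i2 i3
  rw [l2sq, l2sq, l2sq, ← integral_const_mul, ← integral_const_mul,
    ← integral_add (i1.const_mul 2) (i2.const_mul 2)]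
  refine integral_mono i3 ((i1.const_mul 2).add (i2.const_mul 2)) fun x => ?_
  have h1 : ‖f x - h x‖ ≤ ‖f x - g x‖ + ‖g x - h x‖ := norm_sub_le_norm_sub_add_norm_sub _ _ _
  have h2 : ‖f x - h x‖ ^ 2 ≤ (‖f x - g x‖ + ‖g x - h x‖) ^ 2 := by gcongr
  simp only
  nlinarith [sq_nonneg (‖f x - g x‖ - ‖g x - h x‖)]

lemma exists_subseq_tendsto_ae {u : ℕ → Ω → ℂ} {v : Ω → ℂ} (hu : ∀ n, MemLp (u n) 2 μ)
    (hv : MemLp v 2 μ) (h : Tendsto (fun n => l2sq μ (fun x => u n x - v x)) atTop (𝓝 0)) :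
    ∃ ns : ℕ → ℕ, StrictMono ns ∧ ∀ᵐ x ∂μ, Tendsto (fun k => u (ns k) x) atTop (𝓝 (v x)) := by
  have h' : Tendsto (fun n => eLpNorm (u n - v) 2 μ) atTop (𝓝 0) := by
    have h1 : Tendsto (fun n => √(l2sq μ (fun x => u n x - v x))) atTop (𝓝 0) := by
      simpa using h.sqrt
    have h2 : ∀ n, eLpNorm (u n - v) 2 μ = ENNReal.ofReal (√(l2sq μ (fun x => u n x - v x))) := by
      intro n
      have h3 := l2sq_eq_eLpNorm ((hu n).sub hv)
      rw [show (fun x => u n x - v x) = u n - v from rfl, h3, Real.sqrt_sq ENNReal.toReal_nonneg,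
        ENNReal.ofReal_toReal ((hu n).sub hv).2.ne]
    simp_rw [h2]
    simpa using ENNReal.tendsto_ofReal h1
  exact (tendstoInMeasure_of_tendsto_eLpNorm (by norm_num) (fun n => (hu n).1) hv.1
    h').exists_seq_tendsto_ae

/-- Dominated convergence for integrands that depend on an `L²`-convergent sequence. -/
lemma tendsto_integral_of_subseq {E : Type*} [NormedAddCommGroup E] [NormedSpace ℝ E]
    {f : ℕ → E} {a : E} (h : ∀ ns : ℕ → ℕ, StrictMono ns →
      ∃ ms : ℕ → ℕ, StrictMono ms ∧ Tendsto (fun k => f (ns (ms k))) atTop (𝓝 a)) :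
    Tendsto f atTop (𝓝 a) := by
  refine tendsto_of_subseq_tendsto fun ns hns => ?_
  obtain ⟨ks, hks, hks'⟩ := strictMono_subseq_of_tendsto_atTop hns
  obtain ⟨ms, hms, hm⟩ := h (ns ∘ ks) hks'
  exact ⟨ks ∘ ms, hm⟩

end L2

/-! ### Gradient relations -/

/-- The properties of the relation "`D` is the weak gradient of `u`" used below. -/
structure IsGradRel {Ω ι : Type*} [MeasurableSpace Ω] (μ : Measure Ω)
    (W : (Ω → ℂ) → (ι → Ω → ℂ) → Prop) : Prop where
  memLp : ∀ {u D}, W u D → MemLp u 2 μ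
  memLp_grad : ∀ {u D}, W u D → ∀ j, MemLp (D j) 2 μ
  congr : ∀ {u u' D D'}, W u D → u =ᵐ[μ] u' → (∀ j, D j =ᵐ[μ] D' j) → W u' D'
  zero : W (fun _ => 0) fun _ _ => 0
  add : ∀ {u u' D D'}, W u D → W u' D' → W (fun x => u x + u' x) fun j x => D j x + D' j x
  smul : ∀ {u D} (c : ℂ), W u D → W (fun x => c * u x) fun j x => c * D j x
  closed : ∀ {u : ℕ → Ω → ℂ} {D : ℕ → ι → Ω → ℂ} {v : Ω → ℂ} {E : ι → Ω → ℂ},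
    (∀ n, W (u n) (D n)) → MemLp v 2 μ → (∀ j, MemLp (E j) 2 μ) →
    Tendsto (fun n => l2sq μ (fun x => u n x - v x)) atTop (𝓝 0) →
    (∀ j, Tendsto (fun n => l2sq μ (fun x => D n j x - E j x)) atTop (𝓝 0)) → W v E
  unique : ∀ {u D D'}, W u D → W u D' → ∀ j, D j =ᵐ[μ] D' j
  chain : ∀ {u D} {F : ℂ → ℂ} {C : ℝ}, W u D → ContDiff ℝ 1 F → (∀ z, ‖fderiv ℝ F z‖ ≤ C) →
    W (fun x => F (u x)) fun j x => fderiv ℝ F (u x) (D j x)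

/-- A weak solution of the logarithmic Schrödinger equation whose time derivative may be tested
with bounded functions in the domain of the gradient. -/
structure IsWeakSol {Ω ι : Type*} [MeasurableSpace Ω] [Fintype ι] (μ : Measure Ω)
    (W : (Ω → ℂ) → (ι → Ω → ℂ) → Prop) (lam : ℝ) (φ : ℝ → Lp ℂ 2 μ) (Dφ : ℝ → ι → Ω → ℂ) :
    Prop where
  cont : ContinuousOn φ (Ici 0)
  grad : ∀ t, 0 ≤ t → W (φ t) (Dφ t)
  bdd : ∀ T, ∃ C : ℝ, ∀ t ∈ Icc 0 T, ∑ j, l2sq μ (Dφ t j) ≤ C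
  eqn : ∀ {g G M}, W g G → (∀ᵐ x ∂μ, ‖g x‖ ≤ M) → ∀ t, 0 ≤ t →
    HasDerivWithinAt (fun s => pair μ g (φ s))
      (-Complex.I * (∑ j, pair μ (G j) (Dφ t j) + lam * pair μ g (fun x => φ t x *
        ((Real.log (‖φ t x‖ ^ 2 / l2sq μ (φ t)) : ℝ) : ℂ)))) (Ici 0) t

lemma mul_abs_log_sq_le {b : ℝ} (hb : 0 ≤ b) : b * |Real.log (b ^ 2)| ≤ 2 * (1 + b ^ 2) := by
  rcases hb.eq_or_lt with rfl | hb
  · simp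
  rw [Real.log_pow, abs_mul]
  have h1 := Real.log_le_sub_one_of_pos hb
  have h2 := Real.log_le_sub_one_of_pos (inv_pos.2 hb)
  rw [Real.log_inv] at h2
  have h3 : b * b⁻¹ = 1 := mul_inv_cancel₀ hb.ne'
  have h4 : b * |Real.log b| ≤ 1 + b ^ 2 := by
    rcases abs_cases (Real.log b) with ⟨h, _⟩ | ⟨h, _⟩ <;> rw [h] <;> nlinarith
  calc b * (|((2 : ℕ) : ℝ)| * |Real.log b|) = 2 * (b * |Real.log b|) := by norm_num; ring
    _ ≤ _ := by linarith

lemma mul_abs_log_sq_div_le {a m : ℝ} (ha : 0 ≤ a) (hm : 0 < m) :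
    a * |Real.log (a ^ 2 / m)| ≤ 2 * √m * (1 + a ^ 2 / m) := by
  have h := mul_abs_log_sq_le (b := a / √m) (by positivity)
  rw [div_pow, Real.sq_sqrt hm.le] at h
  have h2 : 0 < √m := Real.sqrt_pos.2 hm
  calc a * |Real.log (a ^ 2 / m)| = √m * (a / √m * |Real.log (a ^ 2 / m)|) := by
        field_simp
    _ ≤ √m * (2 * (1 + a ^ 2 / m)) := by gcongr
    _ = _ := by ring

/-! ### The logarithmic term, and functionals of a weak solution. -/

section

variable {Ω : Type*} [MeasurableSpace Ω] {μ : Measure Ω}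

/-- The nonlinearity `u log (|u|² / ‖u‖²)`. -/
noncomputable def logTerm (μ : Measure Ω) (u : Ω → ℂ) (x : Ω) : ℂ :=
  u x * ((Real.log (‖u x‖ ^ 2 / l2sq μ u) : ℝ) : ℂ)

lemma ae_eq_zero_of_l2sq_eq_zero {u : Ω → ℂ} (hu : MemLp u 2 μ) (h : l2sq μ u = 0) :
    u =ᵐ[μ] 0 := by
  rw [l2sq, integral_eq_zero_iff_of_nonneg (fun x => by positivity) (integrable_norm_sq hu)] at h
  filter_upwards [h] with x hx
  simpa using hx

lemma aestronglyMeasurable_logTerm {u : Ω → ℂ} (hu : AEStronglyMeasurable u μ) :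
    AEStronglyMeasurable (logTerm μ u) μ := by
  have h : Measurable fun z : ℂ => z * ((Real.log (‖z‖ ^ 2 / l2sq μ u) : ℝ) : ℂ) :=
    measurable_id.mul (Complex.measurable_ofReal.comp
      (Real.measurable_log.comp ((measurable_norm.pow_const 2).div_const _)))
  exact (h.comp_aemeasurable hu.aemeasurable).aestronglyMeasurable

variable [IsProbabilityMeasure μ]

/-- The logarithmic term is controlled in L¹ only, which is why it is always paired with bounded
functions. The bound comes from b|log b²| ≤ 2(1 + b²) at b = |u|/‖u‖; normalising by ‖u‖ makes it
linear in the norm. -/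
lemma integrable_logTerm {u : Ω → ℂ} (hu : MemLp u 2 μ) :
    Integrable (logTerm μ u) μ ∧ ∫ x, ‖logTerm μ u x‖ ∂μ ≤ 4 * √(l2sq μ u) := by
  have hmeas := aestronglyMeasurable_logTerm hu.1
  rcases (l2sq_nonneg (μ := μ) u).eq_or_lt with h0 | h0
  · have h1 : logTerm μ u =ᵐ[μ] 0 := by
      filter_upwards [ae_eq_zero_of_l2sq_eq_zero hu h0.symm] with x hx
      simp [logTerm, hx]
    refine ⟨(integrable_zero _ _ _).congr h1.symm, ?_⟩
    rw [integral_congr_ae (g := fun _ => (0 : ℝ)) (by filter_upwards [h1] with x hx; simp [hx])]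
    simp
  · have hb : ∀ x, ‖logTerm μ u x‖ ≤ 2 * √(l2sq μ u) * (1 + ‖u x‖ ^ 2 / l2sq μ u) := fun x => by
      rw [logTerm, norm_mul, Complex.norm_real, Real.norm_eq_abs]
      exact mul_abs_log_sq_div_le (norm_nonneg _) h0
    have hi : Integrable (fun x => 2 * √(l2sq μ u) * (1 + ‖u x‖ ^ 2 / l2sq μ u)) μ :=
      ((integrable_const 1).add ((integrable_norm_sq hu).div_const _)).const_mul _
    have hint : Integrable (logTerm μ u) μ :=
      hi.mono' hmeas (Eventually.of_forall hb)
    refine ⟨hint, (integral_mono hint.norm hi hb).trans (le_of_eq ?_)⟩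
    rw [integral_const_mul, integral_add (integrable_const 1)
      ((integrable_norm_sq hu).div_const _), integral_div]
    change 2 * √(l2sq μ u) * (∫ _, 1 ∂μ + l2sq μ u / l2sq μ u) = _
    rw [div_self h0.ne']
    simp; ring

lemma integrable_star_mul_logTerm {g u : Ω → ℂ} {M : ℝ} (hg : AEStronglyMeasurable g μ)
    (hM : ∀ᵐ x ∂μ, ‖g x‖ ≤ M) (hu : MemLp u 2 μ) :
    Integrable (fun x => star (g x) * logTerm μ u x) μ :=
  (integrable_logTerm hu).1.bdd_mul hg.star (c := M) (by simpa using hM)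

lemma norm_pair_logTerm_le {g u : Ω → ℂ} {M : ℝ} (hM0 : 0 ≤ M)
    (hM : ∀ᵐ x ∂μ, ‖g x‖ ≤ M) (hu : MemLp u 2 μ) :
    ‖pair μ g (logTerm μ u)‖ ≤ M * (4 * √(l2sq μ u)) := by
  have hi := (integrable_logTerm hu)
  calc ‖pair μ g (logTerm μ u)‖ ≤ ∫ x, M * ‖logTerm μ u x‖ ∂μ := by
        refine norm_integral_le_of_norm_le (hi.1.norm.const_mul M) ?_
        filter_upwards [hM] with x hx
        rw [norm_mul, norm_star]
        gcongr
    _ = M * ∫ x, ‖logTerm μ u x‖ ∂μ := integral_const_mul _ _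
    _ ≤ _ := by gcongr; exact hi.2

variable {ι : Type*} [Fintype ι] {W : (Ω → ℂ) → (ι → Ω → ℂ) → Prop} {lam : ℝ}
  {φ : ℝ → Lp ℂ 2 μ} {Dφ : ℝ → ι → Ω → ℂ}

namespace IsWeakSol

/-- The time derivative of the solution, tested with `g`. -/
noncomputable def rate (μ : Measure Ω) (lam : ℝ) (φ : ℝ → Lp ℂ 2 μ) (Dφ : ℝ → ι → Ω → ℂ)
    (g : Ω → ℂ) (G : ι → Ω → ℂ) (t : ℝ) : ℂ :=
  -Complex.I * (∑ j, pair μ (G j) (Dφ t j) + lam * pair μ g (logTerm μ (φ t)))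

lemma exists_norm_le (h : IsWeakSol μ W lam φ Dφ) (T : ℝ) :
    ∃ A : ℝ, 0 ≤ A ∧ ∀ t ∈ Icc 0 T, ‖φ t‖ ≤ A ∧ ∑ j, l2sq μ (Dφ t j) ≤ A := by
  obtain ⟨C, hC⟩ := h.bdd T
  obtain ⟨B, hB⟩ := isCompact_Icc.exists_bound_of_continuousOn
    (h.cont.mono (Icc_subset_Ici_self : Icc 0 T ⊆ Ici 0))
  exact ⟨max (max C B) 0, le_max_right _ _, fun t ht =>
    ⟨(hB t ht).trans ((le_max_right _ _).trans (le_max_left _ _)),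
      (hC t ht).trans ((le_max_left _ _).trans (le_max_left _ _))⟩⟩

lemma norm_rate_le (hW : IsGradRel μ W) (h : IsWeakSol μ W lam φ Dφ) {g : Ω → ℂ}
    {G : ι → Ω → ℂ} {M A B t : ℝ} (hM0 : 0 ≤ M) (hg : W g G) (hM : ∀ᵐ x ∂μ, ‖g x‖ ≤ M)
    (hB : ∑ j, l2sq μ (G j) ≤ B) (ht : 0 ≤ t)
    (hA : ‖φ t‖ ≤ A ∧ ∑ j, l2sq μ (Dφ t j) ≤ A) :
    ‖rate μ lam φ Dφ g G t‖ ≤ A + B + |lam| * (M * (4 * A)) := by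
  rw [rate, norm_mul, norm_neg, Complex.norm_I, one_mul]
  refine (norm_add_le _ _).trans (add_le_add ?_ ?_)
  · refine (norm_sum_le _ _).trans ?_
    calc ∑ j, ‖pair μ (G j) (Dφ t j)‖ ≤ ∑ j, (l2sq μ (Dφ t j) + l2sq μ (G j)) := by
          refine Finset.sum_le_sum fun j _ => (norm_pair_le (hW.memLp_grad hg j)
            (hW.memLp_grad (h.grad t ht) j)).trans ?_
          have h1 := Real.sq_sqrt (l2sq_nonneg (μ := μ) (G j))
          have h2 := Real.sq_sqrt (l2sq_nonneg (μ := μ) (Dφ t j))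
          nlinarith [sq_nonneg (√(l2sq μ (G j)) - √(l2sq μ (Dφ t j))),
            sq_nonneg (√(l2sq μ (G j)) + √(l2sq μ (Dφ t j)))]
      _ ≤ A + B := by rw [Finset.sum_add_distrib]; linarith [hA.2]
  · rw [norm_mul, Complex.norm_real, Real.norm_eq_abs]
    gcongr
    refine (norm_pair_logTerm_le hM0 hM (Lp.memLp _)).trans ?_
    rw [l2sq_coe, Real.sqrt_sq (norm_nonneg _)]
    gcongr
    exact hA.1

lemma norm_pair_sub_le (hW : IsGradRel μ W) (h : IsWeakSol μ W lam φ Dφ) {g : Ω → ℂ}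
    {G : ι → Ω → ℂ} {M A B T : ℝ} (hM0 : 0 ≤ M) (hg : W g G) (hM : ∀ᵐ x ∂μ, ‖g x‖ ≤ M)
    (hB : ∑ j, l2sq μ (G j) ≤ B)
    (hA : ∀ t ∈ Icc 0 T, ‖φ t‖ ≤ A ∧ ∑ j, l2sq μ (Dφ t j) ≤ A) {s t : ℝ}
    (hs : s ∈ Icc 0 T) (ht : t ∈ Icc 0 T) :
    ‖pair μ g (φ s) - pair μ g (φ t)‖ ≤ (A + B + |lam| * (M * (4 * A))) * |s - t| := by
  have := (convex_Icc 0 T).norm_image_sub_le_of_norm_hasDerivWithin_le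
    (f := fun s => pair μ g (φ s)) (f' := rate μ lam φ Dφ g G)
    (C := A + B + |lam| * (M * (4 * A))) (fun r hr =>
      (h.eqn hg hM r hr.1).mono Icc_subset_Ici_self)
    (fun r hr => norm_rate_le hW h hM0 hg hM hB hr.1 (hA r hr)) ht hs
  simpa using this

lemma hasDerivAt_pair (h : IsWeakSol μ W lam φ Dφ) {g : Ω → ℂ}
    {G : ι → Ω → ℂ} {M t : ℝ} (hg : W g G) (hM : ∀ᵐ x ∂μ, ‖g x‖ ≤ M) (ht : 0 < t) :
    HasDerivAt (fun s => pair μ g (φ s)) (rate μ lam φ Dφ g G t) t :=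
  (h.eqn hg hM t ht.le).hasDerivAt (Ici_mem_nhds ht)

/-- A functional of the solution that has bounded subgradients in the domain of the gradient is
the integral of its formal derivative. -/
lemma integral_functional (hW : IsGradRel μ W) (h : IsWeakSol μ W lam φ Dφ) {F : ℝ → ℝ}
    {g : ℝ → Ω → ℂ} {G : ℝ → ι → Ω → ℂ} {M B T : ℝ} (hT : 0 ≤ T) (hM0 : 0 ≤ M)
    (hg : ∀ t ∈ Icc 0 T, W (g t) (G t)) (hM : ∀ t ∈ Icc 0 T, ∀ᵐ x ∂μ, ‖g t x‖ ≤ M)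
    (hB : ∀ t ∈ Icc 0 T, ∑ j, l2sq μ (G t j) ≤ B)
    (hF : ∀ t ∈ Icc 0 T, ∀ s ∈ Icc 0 T,
      2 * (pair μ (g t) (φ s) - pair μ (g t) (φ t)).re ≤ F s - F t) :
    F T - F 0 = ∫ t in (0 : ℝ)..T, 2 * (rate μ lam φ Dφ (g t) (G t) t).re ∧
      AEStronglyMeasurable (fun t => 2 * (rate μ lam φ Dφ (g t) (G t) t).re)
        (volume.restrict (Ioc 0 T)) ∧ ContinuousOn F (Icc 0 T) := by
  obtain ⟨A, hA0, hA⟩ := h.exists_norm_le T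
  have hB0 : 0 ≤ B := (Finset.sum_nonneg fun j _ => l2sq_nonneg _).trans
    (hB 0 ⟨le_rfl, hT⟩)
  set C : ℝ := 2 * (A + B + |lam| * (M * (4 * A))) with hC
  have hC0 : 0 ≤ C := by positivity
  have hp : ∀ t ∈ Icc 0 T, ∀ r ∈ Icc 0 T,
      |2 * (pair μ (g t) (φ r) - pair μ (g t) (φ t)).re| ≤ C.toNNReal * |r - t| := by
    intro t ht r hr
    rw [Real.coe_toNNReal _ hC0, abs_mul, abs_two, hC, mul_assoc]
    gcongr
    exact (Complex.abs_re_le_norm _).trans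
      (norm_pair_sub_le hW h hM0 (hg t ht) (hM t ht) (hB t ht) hA hr ht)
  have h1 := integral_of_subgradient (q := fun t => 2 * (rate μ lam φ Dφ (g t) (G t) t).re)
    hT hF hp fun t ht => ?_
  · exact ⟨h1.1, h1.2, (lipschitzOnWith_of_subgradient hF hp).continuousOn⟩
  · have hmem := Ioo_subset_Icc_self ht
    have := (h.hasDerivAt_pair (hg t hmem) (hM t hmem) ht.1).sub_const (pair μ (g t) (φ t))
    have h2 := (Complex.reCLM.hasFDerivAt.comp_hasDerivAt t this).const_mul 2
    simpa using h2

end IsWeakSol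

end

/-! ### Radial maps of the complex plane -/

/-- The derivative of `z ↦ ‖z‖²`. -/
noncomputable def normSqDeriv (z : ℂ) : ℂ →L[ℝ] ℝ := 2 • Complex.reCLM.comp
  ((ContinuousLinearMap.mul ℝ ℂ) (star z))

lemma normSqDeriv_apply (z p : ℂ) : normSqDeriv z p = 2 * (star z * p).re := by
  simp [normSqDeriv]
  ring

lemma hasFDerivAt_norm_sq (z : ℂ) : HasFDerivAt (fun z : ℂ => ‖z‖ ^ 2) (normSqDeriv z) z := by
  have h := (hasStrictFDerivAt_norm_sq z).hasFDerivAt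
  refine h.congr_fderiv ?_
  ext p
  simp [normSqDeriv]
  ring

lemma hasFDerivAt_radial {c : ℝ → ℂ} {z : ℂ} (hc : DifferentiableAt ℝ c (‖z‖ ^ 2)) :
    HasFDerivAt (fun z : ℂ => c (‖z‖ ^ 2) * z)
      (c (‖z‖ ^ 2) • ContinuousLinearMap.id ℝ ℂ +
        z • ((ContinuousLinearMap.toSpanSingleton ℝ (deriv c (‖z‖ ^ 2))).comp (normSqDeriv z)))
      z := by
  have h1 := hc.hasDerivAt.hasFDerivAt.comp z (hasFDerivAt_norm_sq z)
  exact h1.mul (hasFDerivAt_id z)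

lemma fderiv_radial_apply {c : ℝ → ℂ} {z : ℂ} (hc : DifferentiableAt ℝ c (‖z‖ ^ 2)) (p : ℂ) :
    fderiv ℝ (fun z : ℂ => c (‖z‖ ^ 2) * z) z p =
      c (‖z‖ ^ 2) * p + deriv c (‖z‖ ^ 2) * ((2 * (star z * p).re : ℝ) : ℂ) * z := by
  rw [(hasFDerivAt_radial hc).fderiv]
  simp only [add_apply, smul_apply,
    ContinuousLinearMap.id_apply, ContinuousLinearMap.comp_apply,
    ContinuousLinearMap.toSpanSingleton_apply, normSqDeriv_apply, smul_eq_mul, Complex.real_smul]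
  ring

lemma contDiff_radial {c : ℝ → ℂ} {n : WithTop ℕ∞} (hc : ∀ r, 0 ≤ r → ContDiffAt ℝ n c r) :
    ContDiff ℝ n (fun z : ℂ => c (‖z‖ ^ 2) * z) := by
  rw [contDiff_iff_contDiffAt]
  intro z
  exact ((hc _ (by positivity)).comp z (contDiff_norm_sq ℝ).contDiffAt).mul contDiffAt_id

lemma norm_radial_deriv_le (a b z p : ℂ) :
    ‖a * p + b * ((2 * (star z * p).re : ℝ) : ℂ) * z‖ ≤ (‖a‖ + 2 * ‖z‖ ^ 2 * ‖b‖) * ‖p‖ := by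
  have h : |(star z * p).re| ≤ ‖z‖ * ‖p‖ := by
    simpa using Complex.abs_re_le_norm (star z * p)
  calc _ ≤ ‖a * p‖ + ‖b * ((2 * (star z * p).re : ℝ) : ℂ) * z‖ := norm_add_le _ _
    _ = ‖a‖ * ‖p‖ + ‖b‖ * (2 * |(star z * p).re|) * ‖z‖ := by
        rw [norm_mul, norm_mul, norm_mul, Complex.norm_real, Real.norm_eq_abs, abs_mul, abs_two]
    _ ≤ ‖a‖ * ‖p‖ + ‖b‖ * (2 * (‖z‖ * ‖p‖)) * ‖z‖ := by gcongr
    _ = _ := by ring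

section

variable {Ω : Type*} [MeasurableSpace Ω] {μ : Measure Ω} {ι : Type*}
  {W : (Ω → ℂ) → (ι → Ω → ℂ) → Prop}

/-- The chain rule for z ↦ c(|z|²)z. The quantity bounded in `hC` dominates the operator norm of the
derivative of this map at |z|² = r. -/
lemma IsGradRel.radial (hW : IsGradRel μ W) {u : Ω → ℂ} {D : ι → Ω → ℂ} (hu : W u D)
    {c : ℝ → ℂ} {C : ℝ} (hc : ∀ r, 0 ≤ r → ContDiffAt ℝ 1 c r)
    (hC : ∀ r, 0 ≤ r → ‖c r‖ + 2 * r * ‖deriv c r‖ ≤ C) :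
    W (fun x => c (‖u x‖ ^ 2) * u x) fun j x =>
      c (‖u x‖ ^ 2) * D j x +
        deriv c (‖u x‖ ^ 2) * ((2 * (star (u x) * D j x).re : ℝ) : ℂ) * u x := by
  have hd : ∀ z : ℂ, DifferentiableAt ℝ c (‖z‖ ^ 2) := fun z =>
    (hc _ (by positivity)).differentiableAt (by norm_num)
  have hC0 : 0 ≤ C := (by positivity : 0 ≤ ‖c 0‖ + 2 * 0 * ‖deriv c 0‖).trans (hC 0 le_rfl)
  have h := hW.chain (F := fun z => c (‖z‖ ^ 2) * z) (C := C) hu (contDiff_radial hc) fun z => by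
    refine ContinuousLinearMap.opNorm_le_bound _ hC0 fun p => ?_
    rw [fderiv_radial_apply (hd z)]
    exact (norm_radial_deriv_le _ _ _ _).trans
      (mul_le_mul_of_nonneg_right (hC _ (by positivity)) (norm_nonneg _))
  refine hW.congr h EventuallyEq.rfl fun j => ?_
  filter_upwards with x
  rw [fderiv_radial_apply (hd (u x))]

end

/-! ### A smooth truncation -/

/-- The radial factor of the truncation `z ↦ z / (1 + ‖z‖² / N²)`, with `N = n + 1`. -/
noncomputable def truncCoeff (n : ℕ) (r : ℝ) : ℂ := (((1 + r / (n + 1) ^ 2)⁻¹ : ℝ) : ℂ)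

lemma truncCoeff_pos {n : ℕ} {r : ℝ} (hr : 0 ≤ r) : 0 < 1 + r / ((n : ℝ) + 1) ^ 2 := by positivity

lemma contDiffAt_truncCoeff (n : ℕ) {r : ℝ} (hr : 0 ≤ r) {m : WithTop ℕ∞} :
    ContDiffAt ℝ m (truncCoeff n) r := by
  unfold truncCoeff
  refine Complex.ofRealCLM.contDiff.contDiffAt.comp r ?_
  refine ContDiffAt.inv (by fun_prop) (truncCoeff_pos hr).ne'

lemma hasDerivAt_truncCoeff (n : ℕ) {r : ℝ} (hr : 0 ≤ r) :
    HasDerivAt (truncCoeff n)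
      ((-(((n : ℝ) + 1) ^ 2)⁻¹ / (1 + r / (n + 1) ^ 2) ^ 2 : ℝ) : ℂ) r := by
  have h : HasDerivAt (fun r : ℝ => 1 + r / ((n : ℝ) + 1) ^ 2) ((((n : ℝ) + 1) ^ 2)⁻¹) r := by
    simpa using ((hasDerivAt_id r).div_const (((n : ℝ) + 1) ^ 2)).const_add 1
  exact (h.inv (truncCoeff_pos hr).ne').ofReal_comp

lemma norm_truncCoeff_le (n : ℕ) {r : ℝ} (hr : 0 ≤ r) : ‖truncCoeff n r‖ ≤ 1 := by
  rw [truncCoeff, Complex.norm_real, Real.norm_eq_abs, abs_of_pos (inv_pos.2 (truncCoeff_pos hr))]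
  apply inv_le_one_of_one_le₀
  have : 0 ≤ r / ((n : ℝ) + 1) ^ 2 := by positivity
  linarith

lemma norm_deriv_truncCoeff_le (n : ℕ) {r : ℝ} (hr : 0 ≤ r) :
    2 * r * ‖deriv (truncCoeff n) r‖ ≤ 1 := by
  rw [(hasDerivAt_truncCoeff n hr).deriv, Complex.norm_real, Real.norm_eq_abs, abs_div, abs_neg,
    abs_of_pos (by positivity), abs_of_pos (by positivity : 0 < (1 + r / ((n : ℝ) + 1) ^ 2) ^ 2)]
  rw [← mul_div_assoc, div_le_one (by positivity)]
  have : 2 * r * (((n : ℝ) + 1) ^ 2)⁻¹ = 2 * (r / ((n : ℝ) + 1) ^ 2) := by ring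
  rw [this]
  nlinarith [sq_nonneg (r / ((n : ℝ) + 1) ^ 2)]

lemma norm_trunc_le (n : ℕ) (z : ℂ) : ‖truncCoeff n (‖z‖ ^ 2) * z‖ ≤ n + 1 := by
  have h := truncCoeff_pos (n := n) (sq_nonneg ‖z‖)
  rw [norm_mul, truncCoeff, Complex.norm_real, Real.norm_eq_abs, abs_of_pos (inv_pos.2 h),
    inv_mul_le_iff₀ h]
  have hn : (0 : ℝ) < n + 1 := by positivity
  have : (1 + ‖z‖ ^ 2 / ((n : ℝ) + 1) ^ 2) * (n + 1) = (n + 1) + ‖z‖ ^ 2 / (n + 1) := by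
    field_simp
  rw [this]
  have h2 : ‖z‖ ^ 2 / ((n : ℝ) + 1) = (‖z‖ / (n + 1)) * ‖z‖ := by ring
  have h3 : (‖z‖ / ((n : ℝ) + 1)) * (n + 1) = ‖z‖ := by field_simp
  rw [h2]
  have h4 : 0 ≤ ‖z‖ / ((n : ℝ) + 1) := by positivity
  set y := ‖z‖ / ((n : ℝ) + 1)
  rw [← h3]
  nlinarith [sq_nonneg (y - 1), mul_nonneg hn.le (sq_nonneg (y - 1)), mul_nonneg hn.le h4]

lemma norm_trunc_le_norm (n : ℕ) (z : ℂ) : ‖truncCoeff n (‖z‖ ^ 2) * z‖ ≤ ‖z‖ := by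
  rw [norm_mul]
  exact mul_le_of_le_one_left (norm_nonneg _) (norm_truncCoeff_le n (by positivity))

lemma tendsto_div_natCast_add_one_sq (r : ℝ) :
    Tendsto (fun n : ℕ => r / ((n : ℝ) + 1) ^ 2) atTop (𝓝 0) := by
  refine Tendsto.div_atTop tendsto_const_nhds ?_
  exact (tendsto_pow_atTop two_ne_zero).comp
    (tendsto_atTop_add_const_right _ _ tendsto_natCast_atTop_atTop)

lemma tendsto_truncCoeff (r : ℝ) : Tendsto (fun n => truncCoeff n r) atTop (𝓝 1) := by
  have h : Tendsto (fun n : ℕ => (1 + r / ((n : ℝ) + 1) ^ 2)⁻¹) atTop (𝓝 1) := by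
    have := ((tendsto_div_natCast_add_one_sq r).const_add 1).inv₀ (by norm_num)
    simpa using this
  have h2 := (Complex.continuous_ofReal.tendsto _).comp h
  rw [Complex.ofReal_one] at h2
  exact h2

lemma tendsto_deriv_truncCoeff {r : ℝ} (hr : 0 ≤ r) :
    Tendsto (fun n => deriv (truncCoeff n) r) atTop (𝓝 0) := by
  have h : Tendsto (fun n : ℕ => -(((n : ℝ) + 1) ^ 2)⁻¹ / (1 + r / ((n : ℝ) + 1) ^ 2) ^ 2)
      atTop (𝓝 0) := by
    have h1 := ((tendsto_div_natCast_add_one_sq r).const_add 1).pow 2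
    have h2 := (tendsto_div_natCast_add_one_sq 1).neg.div h1 (by norm_num)
    rw [neg_zero, zero_div] at h2
    exact h2.congr fun n => by simp
  have h3 := (Complex.continuous_ofReal.tendsto _).comp h
  simp only [Complex.ofReal_zero] at h3
  exact h3.congr fun n => by rw [(hasDerivAt_truncCoeff n hr).deriv]; rfl

section

variable {Ω : Type*} [MeasurableSpace Ω] {μ : Measure Ω} {ι : Type*}
  {W : (Ω → ℂ) → (ι → Ω → ℂ) → Prop}

/-- The truncation `T_n u`. -/
noncomputable def trunc (n : ℕ) (u : Ω → ℂ) (x : Ω) : ℂ := truncCoeff n (‖u x‖ ^ 2) * u x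

/-- The gradient of the truncation `T_n u`, if `u` has gradient `D`. -/
noncomputable def truncGrad (n : ℕ) (u D : Ω → ℂ) (x : Ω) : ℂ :=
  truncCoeff n (‖u x‖ ^ 2) * D x +
    deriv (truncCoeff n) (‖u x‖ ^ 2) * ((2 * (star (u x) * D x).re : ℝ) : ℂ) * u x

lemma IsGradRel.trunc (hW : IsGradRel μ W) {u : Ω → ℂ} {D : ι → Ω → ℂ} (hu : W u D) (n : ℕ) :
    W (LSE.trunc n u) fun j => truncGrad n u (D j) :=
  hW.radial (C := 2) hu (fun _ hr => contDiffAt_truncCoeff n hr) fun r hr => by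
    linarith [norm_truncCoeff_le n hr, norm_deriv_truncCoeff_le n hr]

lemma tendsto_l2sq_of_dominated {f : ℕ → Ω → ℂ} {b : Ω → ℂ}
    (hf : ∀ n, AEStronglyMeasurable (f n) μ) (hb : MemLp b 2 μ)
    (hfb : ∀ n, ∀ᵐ x ∂μ, ‖f n x‖ ≤ ‖b x‖)
    (h : ∀ᵐ x ∂μ, Tendsto (fun n => f n x) atTop (𝓝 0)) :
    Tendsto (fun n => l2sq μ (f n)) atTop (𝓝 0) := by
  have : Tendsto (fun n => l2sq μ (f n)) atTop (𝓝 (∫ _, (0 : ℝ) ∂μ)) := by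
    refine tendsto_integral_of_dominated_convergence (fun x => ‖b x‖ ^ 2)
      (fun n => (hf n).norm.pow 2) (integrable_norm_sq hb) (fun n => ?_) ?_
    · filter_upwards [hfb n] with x hx
      rw [Real.norm_eq_abs, abs_of_nonneg (by positivity)]
      gcongr
    · filter_upwards [h] with x hx
      simpa using hx.norm.pow 2
  simpa using this

lemma tendsto_trunc {u : Ω → ℂ} (hu : MemLp u 2 μ) (hT : ∀ n, AEStronglyMeasurable (trunc n u) μ) :
    Tendsto (fun n => l2sq μ (fun x => trunc n u x - u x)) atTop (𝓝 0) := by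
  refine tendsto_l2sq_of_dominated (b := fun x => 2 * u x) (fun n => (hT n).sub hu.1)
    (hu.const_mul 2) (fun n => Eventually.of_forall fun x => ?_)
    (Eventually.of_forall fun x => ?_)
  · have := norm_trunc_le_norm n (u x)
    calc _ ≤ ‖trunc n u x‖ + ‖u x‖ := norm_sub_le _ _
      _ ≤ ‖2 * u x‖ := by 
          rw [show ‖2 * u x‖ = ‖u x‖ + ‖u x‖ by rw [norm_mul]; norm_num; ring]
          gcongr
          exact this
  · have := ((tendsto_truncCoeff (‖u x‖ ^ 2)).mul_const (u x)).sub_const (u x)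
    simpa [trunc] using this

lemma tendsto_truncGrad {u D : Ω → ℂ} (hD : MemLp D 2 μ)
    (hT : ∀ n, AEStronglyMeasurable (truncGrad n u D) μ) :
    Tendsto (fun n => l2sq μ (fun x => truncGrad n u D x - D x)) atTop (𝓝 0) := by
  refine tendsto_l2sq_of_dominated (b := fun x => 3 * D x) (fun n => (hT n).sub hD.1)
    (hD.const_mul 3) (fun n => Eventually.of_forall fun x => ?_)
    (Eventually.of_forall fun x => ?_)
  · have h1 := norm_radial_deriv_le (truncCoeff n (‖u x‖ ^ 2)) (deriv (truncCoeff n) (‖u x‖ ^ 2))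
      (u x) (D x)
    have h2 := norm_truncCoeff_le n (sq_nonneg ‖u x‖)
    have h3 := norm_deriv_truncCoeff_le n (sq_nonneg ‖u x‖)
    calc _ ≤ ‖truncGrad n u D x‖ + ‖D x‖ := norm_sub_le _ _
      _ ≤ 2 * ‖D x‖ + ‖D x‖ := by
          gcongr
          refine h1.trans (mul_le_mul_of_nonneg_right (by linarith) (norm_nonneg _))
      _ = ‖3 * D x‖ := by rw [norm_mul]; norm_num; ring
  · have h1 := (tendsto_truncCoeff (‖u x‖ ^ 2)).mul_const (D x)
    have h2 := ((tendsto_deriv_truncCoeff (sq_nonneg ‖u x‖)).mul_const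
      ((2 * (star (u x) * D x).re : ℝ) : ℂ)).mul_const (u x)
    have h3 := (h1.add h2).sub_const (D x)
    simpa [truncGrad] using h3

end

/-! ### Minimisation of the penalised distance by Hilbert space projection. -/

variable {Ω : Type*} [MeasurableSpace Ω] {μ : Measure Ω} {ι : Type*} [Fintype ι]
  {W : (Ω → ℂ) → (ι → Ω → ℂ) → Prop}

/-- The penalised distance of `u` to `w`, where `D` is the gradient of `w`. -/
noncomputable def cost (μ : Measure Ω) (ε : ℝ) (u w : Ω → ℂ) (D : ι → Ω → ℂ) : ℝ :=
  l2sq μ (fun x => u x - w x) + ε * ∑ j, l2sq μ (D j)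

lemma cost_congr {ε : ℝ} {u u' w w' : Ω → ℂ} {D D' : ι → Ω → ℂ} (hu : u =ᵐ[μ] u')
    (hw : w =ᵐ[μ] w') (hD : ∀ j, D j =ᵐ[μ] D' j) : cost μ ε u w D = cost μ ε u' w' D' := by
  rw [cost, cost, l2sq_congr (f := fun x => u x - w x) (g := fun x => u' x - w' x)
    (by filter_upwards [hu, hw] with x h1 h2; rw [h1, h2]),
    Finset.sum_congr rfl fun j _ => l2sq_congr (hD j)]

lemma l2sq_sub_coe (u v : Lp ℂ 2 μ) : l2sq μ (fun x => u x - v x) = ‖u - v‖ ^ 2 := by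
  rw [← l2sq_coe]
  exact l2sq_congr (by filter_upwards [Lp.coeFn_sub u v] with x hx; rw [hx]; rfl)

lemma l2sq_const_mul (c : ℂ) (f : Ω → ℂ) : l2sq μ (fun x => c * f x) = ‖c‖ ^ 2 * l2sq μ f := by
  simp only [l2sq, norm_mul, mul_pow, integral_const_mul]

/-- The Hilbert space of pairs (function, vector field). -/
abbrev PairSpace (ι : Type*) [Fintype ι] (μ : Measure Ω) : Type _ :=
  PiLp 2 fun _ : Option ι => Lp ℂ 2 μ

namespace IsGradRel

/-- The graph of the gradient, with vector fields rescaled by `c`. -/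
noncomputable def graph (hW : IsGradRel μ W) (c : ℝ) : Submodule ℂ (PairSpace ι μ) where
  carrier := {x | W (x none) fun j ω => (c : ℂ)⁻¹ * x (some j) ω}
  add_mem' {x y} hx hy := by
    refine hW.congr (hW.add hx hy) ?_ fun j => ?_
    · filter_upwards [Lp.coeFn_add (x none) (y none)] with ω hω
      exact hω.symm
    · filter_upwards [Lp.coeFn_add (x (some j)) (y (some j))] with ω hω
      rw [← mul_add]
      exact congrArg _ hω.symm
  zero_mem' := by
    refine hW.congr hW.zero ?_ fun j => ?_
    · filter_upwards [Lp.coeFn_zero ℂ 2 μ] with ω hω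
      exact hω.symm
    · filter_upwards [Lp.coeFn_zero ℂ 2 μ] with ω hω
      exact (mul_eq_zero_of_right _ hω).symm
  smul_mem' a x hx := by
    refine hW.congr (hW.smul a hx) ?_ fun j => ?_
    · filter_upwards [Lp.coeFn_smul a (x none)] with ω hω
      exact hω.symm
    · filter_upwards [Lp.coeFn_smul a (x (some j))] with ω hω
      rw [mul_left_comm]
      exact congrArg _ hω.symm

lemma tendsto_l2sq_of_tendsto {x : ℕ → PairSpace ι μ} {y : PairSpace ι μ}
    (h : Tendsto x atTop (𝓝 y)) (o : Option ι) :
    Tendsto (fun n => l2sq μ (fun ω => x n o ω - y o ω)) atTop (𝓝 0) := by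
  simp_rw [l2sq_sub_coe]
  have h1 : Tendsto (fun n => x n o) atTop (𝓝 (y o)) :=
    ((PiLp.continuous_apply 2 _ o).tendsto y).comp h
  have h2 := (h1.sub_const (y o)).norm.pow 2
  simpa using h2

lemma isClosed_graph (hW : IsGradRel μ W) (c : ℝ) :
    IsClosed (hW.graph c : Set (PairSpace ι μ)) := by
  refine IsSeqClosed.isClosed fun x y hx hxy => ?_
  refine hW.closed hx (Lp.memLp _) (fun j => (Lp.memLp (y (some j))).const_mul _)
    (tendsto_l2sq_of_tendsto hxy none) fun j => ?_
  have h := (tendsto_l2sq_of_tendsto hxy (some j)).const_mul (‖(c : ℂ)⁻¹‖ ^ 2)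
  rw [mul_zero] at h
  refine h.congr fun n => ?_
  rw [← l2sq_const_mul]
  simp only [mul_sub]

/-- The part of the graph over the functions bounded by `M`. -/
def bddGraph (hW : IsGradRel μ W) (c M : ℝ) : Set (PairSpace ι μ) :=
  {x | x ∈ hW.graph c ∧ ∀ᵐ ω ∂μ, ‖x none ω‖ ≤ M}

/-- The gradient is closed, and the bound by `M` survives L² limits along an almost everywhere
convergent subsequence. -/
lemma isClosed_bddGraph (hW : IsGradRel μ W) (c M : ℝ) : IsClosed (hW.bddGraph c M) := by
  refine IsSeqClosed.isClosed fun x y hx hxy => ?_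
  refine ⟨(hW.isClosed_graph c).isSeqClosed (fun n => (hx n).1) hxy, ?_⟩
  obtain ⟨ns, -, hns⟩ := exists_subseq_tendsto_ae (fun n => Lp.memLp (x n none))
    (Lp.memLp (y none)) (tendsto_l2sq_of_tendsto hxy none)
  filter_upwards [hns, ae_all_iff.2 fun n => (hx n).2] with ω h1 h2
  exact le_of_tendsto h1.norm (Eventually.of_forall fun n => h2 _)

lemma ofReal_smul_pairSpace (a : ℝ) (x : PairSpace ι μ) : a • x = (a : ℂ) • x := by
  ext o : 1
  apply Lp.ext
  filter_upwards [Lp.coeFn_smul a (x o), Lp.coeFn_smul (a : ℂ) (x o)] with ω h1 h2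
  exact h1.trans ((Complex.coe_smul a (x o ω)).symm.trans h2.symm)

lemma convex_bddGraph (hW : IsGradRel μ W) (c M : ℝ) : Convex ℝ (hW.bddGraph c M) := by
  intro x hx y hy a b ha hb hab
  refine ⟨?_, ?_⟩
  · have h1 := (hW.graph c).add_mem ((hW.graph c).smul_mem (a : ℂ) hx.1)
      ((hW.graph c).smul_mem (b : ℂ) hy.1)
    rwa [← ofReal_smul_pairSpace, ← ofReal_smul_pairSpace] at h1
  · filter_upwards [hx.2, hy.2, Lp.coeFn_add (a • x none) (b • y none),
      Lp.coeFn_smul a (x none), Lp.coeFn_smul b (y none)] with ω h1 h2 h3 h4 h5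
    have : (a • x + b • y) none = a • x none + b • y none := rfl
    rw [this, h3, Pi.add_apply, h4, h5, Pi.smul_apply, Pi.smul_apply]
    calc ‖a • x none ω + b • y none ω‖ ≤ ‖a • x none ω‖ + ‖b • y none ω‖ := norm_add_le _ _
      _ = a * ‖x none ω‖ + b * ‖y none ω‖ := by
          rw [norm_smul, norm_smul, Real.norm_of_nonneg ha, Real.norm_of_nonneg hb]
      _ ≤ a * M + b * M := by gcongr
      _ = M := by rw [← add_mul, hab, one_mul]

/-- The embedding of functions as pairs with vanishing second component. -/
noncomputable def embed (u : Lp ℂ 2 μ) : PairSpace ι μ :=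
  WithLp.toLp 2 fun o => o.elim u fun _ => 0

lemma norm_sq_pairSpace (x : PairSpace ι μ) : ‖x‖ ^ 2 = ‖x none‖ ^ 2 + ∑ j, ‖x (some j)‖ ^ 2 := by
  rw [PiLp.norm_sq_eq_of_L2, Fintype.sum_option]

lemma isometry_embed : Isometry (embed : Lp ℂ 2 μ → PairSpace ι μ) := by
  refine Isometry.of_dist_eq fun u v => ?_
  rw [dist_eq_norm, dist_eq_norm, ← sq_eq_sq₀ (norm_nonneg _) (norm_nonneg _), norm_sq_pairSpace]
  simp [embed]

/-- This is the purpose of scaling the graph by √ε: the cost becomes the squared distance from (u,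
0) to a point of the graph, so minimisers are metric projections onto a closed subspace or onto a
closed convex set. -/
lemma norm_embed_sub_sq {ε : ℝ} (hε : 0 < ε) (u : Lp ℂ 2 μ) (x : PairSpace ι μ) :
    ‖embed u - x‖ ^ 2 =
      cost μ ε u (x none) fun j ω => ((√ε : ℝ) : ℂ)⁻¹ * x (some j) ω := by
  rw [norm_sq_pairSpace, cost, l2sq_sub_coe, Finset.mul_sum]
  congr 1
  refine Finset.sum_congr rfl fun j _ => ?_
  have h1 : (embed u - x : PairSpace ι μ) (some j) = -x (some j) := by simp [embed]
  rw [h1, norm_neg, l2sq_const_mul, l2sq_coe, ← mul_assoc, norm_inv, Complex.norm_real,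
    Real.norm_of_nonneg (Real.sqrt_nonneg _), inv_pow, Real.sq_sqrt hε.le,
    mul_inv_cancel₀ hε.ne', one_mul]

/-- A function and its gradient as a point of the graph. -/
lemma exists_mem_graph (hW : IsGradRel μ W) {ε : ℝ} (hε : 0 < ε) {w : Ω → ℂ} {D : ι → Ω → ℂ}
    (hw : W w D) : ∃ x ∈ hW.graph √ε, x none =ᵐ[μ] w ∧
      ∀ j, (fun ω => ((√ε : ℝ) : ℂ)⁻¹ * x (some j) ω) =ᵐ[μ] D j := by
  have hc : ((√ε : ℝ) : ℂ) ≠ 0 := by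
    rw [Ne, Complex.ofReal_eq_zero]
    exact (Real.sqrt_pos.2 hε).ne'
  let x : PairSpace ι μ := WithLp.toLp 2 fun o => o.elim ((hW.memLp hw).toLp w)
    fun j => ((hW.memLp_grad hw j).const_mul ((√ε : ℝ) : ℂ)).toLp _
  have h1 : x none =ᵐ[μ] w := (hW.memLp hw).coeFn_toLp
  have h2 : ∀ j, (fun ω => ((√ε : ℝ) : ℂ)⁻¹ * x (some j) ω) =ᵐ[μ] D j := fun j => by
    have : x (some j) =ᵐ[μ] _ := ((hW.memLp_grad hw j).const_mul ((√ε : ℝ) : ℂ)).coeFn_toLp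
    filter_upwards [this] with ω hω
    rw [hω, inv_mul_cancel_left₀ hc]
  exact ⟨x, hW.congr hw h1.symm fun j => (h2 j).symm, h1, h2⟩

lemma exists_infDist_eq {K : Set (PairSpace ι μ)} (hne : K.Nonempty) (hc : IsClosed K)
    (hconv : Convex ℝ K) (p : PairSpace ι μ) : ∃ x ∈ K, ‖p - x‖ = Metric.infDist p K := by
  let _ : InnerProductSpace ℝ (PairSpace ι μ) := InnerProductSpace.rclikeToReal ℂ (PairSpace ι μ)
  obtain ⟨x, hx, h⟩ := exists_norm_eq_iInf_of_complete_convex hne hc.isComplete hconv p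
  refine ⟨x, hx, h.trans ?_⟩
  rw [Metric.infDist_eq_iInf]
  simp [dist_eq_norm]

/-- Existence of the minimiser of the cost among bounded functions, and continuity of the
minimum. -/
lemma exists_bdd_minimiser (hW : IsGradRel μ W) {ε M : ℝ} (hε : 0 < ε) (hM : 0 ≤ M) :
    ∃ δ : Lp ℂ 2 μ → ℝ, Continuous δ ∧
      (∀ u : Lp ℂ 2 μ, ∀ w D, W w D → (∀ᵐ x ∂μ, ‖w x‖ ≤ M) → δ u ≤ cost μ ε u w D) ∧
      ∀ u : Lp ℂ 2 μ, ∃ w D, W w D ∧ (∀ᵐ x ∂μ, ‖w x‖ ≤ M) ∧ cost μ ε u w D = δ u := by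
  have hne : (hW.bddGraph √ε M).Nonempty := by
    refine ⟨0, (hW.graph √ε).zero_mem, ?_⟩
    filter_upwards [Lp.coeFn_zero ℂ 2 μ] with ω hω
    change ‖(0 : Lp ℂ 2 μ) ω‖ ≤ M
    rw [hω]
    simpa using hM
  -- The minimum is the squared distance to a fixed set, hence continuous in u without any
  -- information on the minimisers.
  refine ⟨fun u => Metric.infDist (embed u) (hW.bddGraph √ε M) ^ 2,
    ((Metric.continuous_infDist_pt _).comp isometry_embed.continuous).pow 2, ?_, fun u => ?_⟩
  · intro u w D hw hb
    obtain ⟨x, hx, h1, h2⟩ := hW.exists_mem_graph hε hw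
    rw [← cost_congr EventuallyEq.rfl h1 h2, ← norm_embed_sub_sq hε, ← dist_eq_norm]
    have : x ∈ hW.bddGraph √ε M := ⟨hx, by filter_upwards [h1, hb] with ω h3 h4; rwa [h3]⟩
    exact pow_le_pow_left₀ Metric.infDist_nonneg (Metric.infDist_le_dist_of_mem this) 2
  · obtain ⟨x, hx, h⟩ := exists_infDist_eq hne (hW.isClosed_bddGraph _ _) (hW.convex_bddGraph _ _)
      (embed u)
    exact ⟨_, _, hx.1, hx.2, by simp only [← h, norm_embed_sub_sq hε]⟩

/-- Existence of the minimiser of the cost, and its defining properties. -/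
lemma exists_minimiser (hW : IsGradRel μ W) {ε : ℝ} (hε : 0 < ε) :
    ∃ δ : Lp ℂ 2 μ → ℝ, Continuous δ ∧ ∀ u : Lp ℂ 2 μ, ∃ v E, W v E ∧ cost μ ε u v E = δ u ∧
      (∀ w D, W w D → cost μ ε u w D = δ u + l2sq μ (fun x => w x - v x) +
        ε * ∑ j, l2sq μ (fun x => D j x - E j x)) ∧
      ∀ w D, W w D → pair μ w (fun x => u x - v x) = ε * ∑ j, pair μ (D j) (E j) := by
  set K := hW.graph √ε with hK
  have : CompleteSpace K := (hW.isClosed_graph √ε).completeSpace_coe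
  -- Pythagoras for the orthogonal projection of (u, 0) onto the graph.
  have hpy : ∀ (u : Lp ℂ 2 μ) (x : PairSpace ι μ), x ∈ K →
      ‖embed u - x‖ ^ 2 = ‖embed u - K.starProjection (embed u)‖ ^ 2 +
        ‖x - K.starProjection (embed u)‖ ^ 2 := by
    intro u x hx
    have h1 : inner ℂ (embed u - K.starProjection (embed u)) (K.starProjection (embed u) - x) = 0 :=
      K.starProjection_inner_eq_zero _ _ (K.sub_mem (K.starProjection_apply_mem _) hx)
    have h2 := norm_add_sq_eq_norm_sq_add_norm_sq_of_inner_eq_zero _ _ h1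
    rw [sub_add_sub_cancel] at h2
    rw [sq, sq, sq, h2, norm_sub_rev x]
  refine ⟨fun u => ‖embed u - K.starProjection (embed u)‖ ^ 2, ?_, fun u => ?_⟩
  · have := (isometry_embed (ι := ι) (μ := μ)).continuous
    fun_prop
  · have hmem := K.starProjection_apply_mem (embed u)
    refine ⟨_, _, hmem, (norm_embed_sub_sq hε _ _).symm, ?_, ?_⟩
    · intro w D hw
      obtain ⟨x, hx, h1, h2⟩ := hW.exists_mem_graph hε hw
      rw [← cost_congr EventuallyEq.rfl h1 h2, ← norm_embed_sub_sq hε, hpy u x hx, add_assoc]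
      congr 1
      rw [norm_sq_pairSpace, ← l2sq_congr (f := fun ω => x none ω -
        (K.starProjection (embed u)) none ω) (by filter_upwards [h1] with ω hω; rw [hω]),
        l2sq_sub_coe, Finset.mul_sum]
      congr 1
      refine Finset.sum_congr rfl fun j _ => ?_
      rw [← l2sq_congr (f := fun ω => ((√ε : ℝ) : ℂ)⁻¹ * (x (some j) ω -
        (K.starProjection (embed u)) (some j) ω))
        (by filter_upwards [h2 j] with ω hω; rw [← hω, mul_sub]), l2sq_const_mul, l2sq_sub_coe,
        ← mul_assoc, norm_inv, Complex.norm_real,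
        Real.norm_of_nonneg (Real.sqrt_nonneg _), inv_pow, Real.sq_sqrt hε.le,
        mul_inv_cancel₀ hε.ne', one_mul]
      rfl
    · intro w D hw
      obtain ⟨x, hx, h1, h2⟩ := hW.exists_mem_graph hε hw
      -- The residual (u - v, -√ε ∇v) is orthogonal to the graph; this is the weak form of u - v =
      -- -εΔv.
      have h0 : inner ℂ x (embed u - K.starProjection (embed u)) = 0 := by
        rw [← inner_conj_symm, K.starProjection_inner_eq_zero _ _ hx, map_zero]
      rw [PiLp.inner_apply, Fintype.sum_option] at h0
      have h3 : ∀ j, inner ℂ (x (some j)) ((embed u - K.starProjection (embed u) : PairSpace ι μ) (some j)) =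
          -(ε * pair μ (D j) (fun ω => ((√ε : ℝ) : ℂ)⁻¹ *
            (K.starProjection (embed u)) (some j) ω)) := fun j => by
        have h4 : (embed u - K.starProjection (embed u) : PairSpace ι μ) (some j)
          = -(K.starProjection (embed u)) (some j) := by simp [embed]
        rw [h4, inner_neg_right, ← pair_coe, ← pair_congr (h2 j) EventuallyEq.rfl, neg_inj]
        simp only [pair]
        rw [integral_congr_ae (f := fun ω => star (((√ε : ℝ) : ℂ)⁻¹ * _) * _) (g := fun ω => ((√ε : ℝ) : ℂ)⁻¹ * (((√ε : ℝ) : ℂ)⁻¹ *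
          (star (x (some j) ω) * (K.starProjection (embed u)) (some j) ω)))]
        · rw [integral_const_mul, integral_const_mul]
          have : (ε : ℂ) * ((√ε : ℝ) : ℂ)⁻¹ * ((√ε : ℝ) : ℂ)⁻¹ = 1 := by
            rw [mul_assoc, ← mul_inv, ← Complex.ofReal_mul, Real.mul_self_sqrt hε.le,
              mul_inv_cancel₀ (by exact_mod_cast hε.ne')]
          rw [← mul_assoc, ← mul_assoc, this, one_mul]
        · filter_upwards with ω
          rw [star_mul', show star ((√ε : ℝ) : ℂ)⁻¹ = ((√ε : ℝ) : ℂ)⁻¹ by simp]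
          ring
      have h5 : inner ℂ (x none) ((embed u - K.starProjection (embed u) : PairSpace ι μ) none) =
          pair μ w (fun ω => u ω - (K.starProjection (embed u)) none ω) := by
        rw [← pair_coe]
        refine pair_congr h1 ?_
        have h6 : (embed u - K.starProjection (embed u) : PairSpace ι μ) none
          = u - (K.starProjection (embed u)) none := rfl
        rw [h6]
        filter_upwards [Lp.coeFn_sub u ((K.starProjection (embed u)) none)] with ω hω
        rw [hω]; rfl
      rw [h5, Finset.sum_congr rfl fun j _ => h3 j, Finset.sum_neg_distrib, ← Finset.mul_sum] at h0
      exact add_neg_eq_zero.1 h0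

end IsGradRel

/-- The regularisation of `twist` with denominator `κ + |z|²`. -/
noncomputable def twistReg (κ : ℝ) (z p : ℂ) : ℝ :=
  2 * (star z * p).re * (star z * p).im / (κ + ‖z‖ ^ 2)

lemma measurable_re_im : Measurable (fun x : ℂ × ℂ => (star x.1 * x.2).re) ∧
    Measurable (fun x : ℂ × ℂ => (star x.1 * x.2).im) := by
  have h1 : Measurable fun x : ℂ × ℂ => star x.1 * x.2 := by fun_prop
  exact ⟨Complex.measurable_re.comp h1, Complex.measurable_im.comp h1⟩

lemma measurable_twistReg (κ : ℝ) : Measurable fun x : ℂ × ℂ => twistReg κ x.1 x.2 :=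
  ((measurable_re_im.1.const_mul 2).mul measurable_re_im.2).div
    ((measurable_norm.comp measurable_fst).pow_const 2 |>.const_add κ)

lemma twistReg_eq {κ : ℝ} (z p : ℂ) :
    twistReg κ z p = ‖z‖ ^ 2 / (κ + ‖z‖ ^ 2) * twist z p := by
  rw [twistReg, ← norm_sq_mul_twist]; ring

lemma abs_twistReg_le {κ : ℝ} (hκ : 0 < κ) (z p : ℂ) : |twistReg κ z p| ≤ ‖p‖ ^ 2 := by
  rw [twistReg_eq, abs_mul, abs_of_nonneg (by positivity)]
  have h1 : ‖z‖ ^ 2 / (κ + ‖z‖ ^ 2) ≤ 1 := by rw [div_le_one (by positivity)]; linarith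
  exact (mul_le_of_le_one_left (abs_nonneg _) h1).trans (abs_twist_le z p)

lemma tendsto_twistReg {κ : ℕ → ℝ} (hκ : Tendsto κ atTop (𝓝 0)) (z p : ℂ) :
    Tendsto (fun n => twistReg (κ n) z p) atTop (𝓝 (twist z p)) := by
  rcases eq_or_ne z 0 with rfl | hz
  · simp [twistReg, twist]
  · have h := tendsto_const_nhds (x := 2 * (star z * p).re * (star z * p).im) (f := atTop) |>.div
      (hκ.add_const (‖z‖ ^ 2)) (by simpa using hz)
    rw [zero_add] at h
    exact h

/-- The first-order condition at a minimum when only small variations are allowed and only a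
quadratic upper bound for the varied functional is known. -/
lemma eq_zero_of_quadratic_nonneg {X C s₀ : ℝ} (hs₀ : 0 < s₀)
    (h : ∀ s, |s| ≤ s₀ → 0 ≤ 2 * s * X + s ^ 2 * C) : X = 0 := by
  by_contra hX
  have hX' : 0 < |X| := abs_pos.2 hX
  -- The variation s = -ηX is admissible because η|X| ≤ s₀, and ηC ≤ 1 makes the quadratic
  -- expression at most -ηX² < 0.
  set η := min (s₀ / |X|) (1 / (|C| + 1)) with hη
  have hη0 : 0 < η := lt_min (by positivity) (by positivity)
  have h1 : |(-η * X)| ≤ s₀ := by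
    rw [abs_mul, abs_neg, abs_of_pos hη0]
    calc η * |X| ≤ s₀ / |X| * |X| := by gcongr; exact min_le_left _ _
      _ = s₀ := by field_simp
  have h2 := h _ h1
  have h3 : η * (|C| + 1) ≤ 1 := by
    calc η * (|C| + 1) ≤ 1 / (|C| + 1) * (|C| + 1) := by gcongr; exact min_le_right _ _
      _ = 1 := by field_simp
  have h4 : η * C ≤ 1 := by
    have := le_abs_self C
    nlinarith
  have h5 : 0 < η * X ^ 2 := by positivity
  nlinarith

/-! ### Rotations of the phase and the Euler–Lagrange identity. -/

section

variable {Ω : Type*} [MeasurableSpace Ω] {μ : Measure Ω} {ι : Type*} [Fintype ι]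
  {W : (Ω → ℂ) → (ι → Ω → ℂ) → Prop}

/-- The phase `exp (i s (a + log (κ + r)))`. -/
noncomputable def phase (a κ s r : ℝ) : ℂ :=
  Complex.exp (((s * (a + Real.log (κ + r)) : ℝ) : ℂ) * Complex.I)

lemma norm_phase (a κ s r : ℝ) : ‖phase a κ s r‖ = 1 := Complex.norm_exp_ofReal_mul_I _

lemma contDiffAt_phase {a κ s r : ℝ} (hκ : 0 < κ) (hr : 0 ≤ r) :
    ContDiffAt ℝ 1 (phase a κ s) r := by
  unfold phase
  have h1 : ContDiffAt ℝ 1 (fun r => s * (a + Real.log (κ + r))) r := by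
    refine contDiffAt_const.mul (contDiffAt_const.add (ContDiffAt.log (by fun_prop) ?_))
    positivity
  exact ((Complex.ofRealCLM.contDiff.contDiffAt.comp r h1).mul contDiffAt_const).cexp

lemma deriv_phase {a κ s r : ℝ} (hκ : 0 < κ) (hr : 0 ≤ r) :
    deriv (phase a κ s) r = phase a κ s r * (((s / (κ + r) : ℝ) : ℂ) * Complex.I) := by
  have hne : κ + r ≠ 0 := by positivity
  have h1 : HasDerivAt (fun r => s * (a + Real.log (κ + r))) (s / (κ + r)) r := by
    have := (((hasDerivAt_id r).const_add κ).log hne).const_add a |>.const_mul s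
    convert! this using 1
    simp [div_eq_mul_inv]
  exact (h1.ofReal_comp.mul_const Complex.I).cexp.deriv

lemma norm_add_rotated_sq (p z : ℂ) (t : ℝ) :
    ‖p + (t : ℂ) * Complex.I * z‖ ^ 2 = ‖p‖ ^ 2 + 2 * t * (star z * p).im + t ^ 2 * ‖z‖ ^ 2 := by
  simp only [Complex.sq_norm, Complex.normSq_apply]
  simp
  ring

/-- Rotation preserves |w|, so only Re(ū e^{it} w) changes; its expansion follows from |e^{it} - 1 -
it| ≤ t² for |t| ≤ 1. -/
lemma norm_sub_rotated_sq_le {u w : ℂ} {t : ℝ} (ht : |t| ≤ 1) :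
    ‖u - Complex.exp (t * Complex.I) * w‖ ^ 2 ≤
      ‖u - w‖ ^ 2 - 2 * t * (star w * u).im + 2 * t ^ 2 * (‖u‖ * ‖w‖) := by
  set e := Complex.exp (t * Complex.I) with he
  have hnorm : ‖e * w‖ = ‖w‖ := by rw [norm_mul, he, Complex.norm_exp_ofReal_mul_I, one_mul]
  have h1 : ∀ v : ℂ, ‖u - v‖ ^ 2 = ‖u‖ ^ 2 + ‖v‖ ^ 2 - 2 * (star u * v).re := fun v => by
    simp only [Complex.sq_norm, Complex.normSq_apply]; simp; ring
  rw [h1, h1, hnorm]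
  have h2 : (star u * (e * w)).re = (star u * w).re + t * (star w * u).im +
      (star u * w * (e - 1 - t * Complex.I)).re := by
    simp; ring
  have h3 : ‖e - 1 - t * Complex.I‖ ≤ t ^ 2 := by
    have := Complex.norm_exp_sub_one_sub_id_le (x := t * Complex.I) (by simpa using ht)
    simpa using this
  have h4 : |(star u * w * (e - 1 - t * Complex.I)).re| ≤ ‖u‖ * ‖w‖ * t ^ 2 := by
    refine (Complex.abs_re_le_norm _).trans ?_
    rw [norm_mul, norm_mul, norm_star]
    gcongr
  have h5 := (abs_le.1 h4).1
  rw [h2]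
  linarith

/-- Multiplying w by exp(isα) with α = a + log(κ + |w|²) preserves |w| and therefore the constraint.
To first order in s it changes ‖u - w‖² by at most -2s∫ α Im(w̄u), and the energy by 2s times the
integral of the regularised twist; minimality forces the two to balance. The constant κ > 0 keeps α
bounded and the rotation continuously differentiable. -/
lemma eulerLagrange_reg (hW : IsGradRel μ W) {ε M a κ : ℝ} (hκ : 0 < κ)
    {u w : Ω → ℂ} {D : ι → Ω → ℂ} (hu : MemLp u 2 μ) (hw : W w D)
    (hM : ∀ᵐ x ∂μ, ‖w x‖ ≤ M)
    (hmin : ∀ w' D', W w' D' → (∀ᵐ x ∂μ, ‖w' x‖ ≤ M) → cost μ ε u w D ≤ cost μ ε u w' D') :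
    ∫ x, (a + Real.log (κ + ‖w x‖ ^ 2)) * (star (w x) * u x).im ∂μ =
      ε * ∑ j, ∫ x, twistReg κ (w x) (D j x) ∂μ := by
  have hw2 := hW.memLp hw
  have hD := hW.memLp_grad hw
  set α : Ω → ℝ := fun x => a + Real.log (κ + ‖w x‖ ^ 2) with hα
  set A : ℝ := |a| + max |Real.log κ| |Real.log (κ + M ^ 2)| with hA
  have hA0 : 0 ≤ A := by positivity
  have hαA : ∀ᵐ x ∂μ, |α x| ≤ A := by
    filter_upwards [hM] with x hx
    refine (abs_add_le _ _).trans (add_le_add le_rfl (abs_le_max_abs_abs ?_ ?_))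
    · exact Real.log_le_log hκ (by linarith [sq_nonneg ‖w x‖])
    · exact Real.log_le_log (by positivity) (by gcongr)
  have hαm : AEStronglyMeasurable α μ := by
    have : Measurable fun z : ℂ => a + Real.log (κ + ‖z‖ ^ 2) := by fun_prop
    exact (this.comp_aemeasurable hw2.1.aemeasurable).aestronglyMeasurable
  have hi1 : Integrable (fun x => α x * (star (w x) * u x).im) μ :=
    (integrable_star_mul hw2 hu).im.bdd_mul hαm hαA
  have hi2 : Integrable (fun x => α x ^ 2 * (‖u x‖ * ‖w x‖)) μ := by
    refine (integrable_norm_mul_norm hu hw2).bdd_mul (c := A ^ 2) (hαm.pow 2) ?_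
    filter_upwards [hαA] with x hx
    rw [Real.norm_eq_abs, abs_pow]
    gcongr
  have hpm : ∀ j, AEMeasurable (fun x => (w x, D j x)) μ := fun j =>
    hw2.1.aemeasurable.prodMk (hD j).1.aemeasurable
  have hi3 : ∀ j, Integrable (fun x => twistReg κ (w x) (D j x)) μ := fun j => by
    refine (integrable_norm_sq (hD j)).mono'
      ((measurable_twistReg κ).comp_aemeasurable (hpm j)).aestronglyMeasurable
      (Eventually.of_forall fun x => abs_twistReg_le hκ _ _)
  -- This is the derivative of α in direction j.
  set ρ : ι → Ω → ℝ := fun j x => 2 * (star (w x) * D j x).re / (κ + ‖w x‖ ^ 2) with hρ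
  have hi4 : ∀ j, Integrable (fun x => ρ j x ^ 2 * ‖w x‖ ^ 2) μ := fun j => by
    have hm : Measurable fun x : ℂ × ℂ =>
        (2 * (star x.1 * x.2).re / (κ + ‖x.1‖ ^ 2)) ^ 2 * ‖x.1‖ ^ 2 :=
      (((measurable_re_im.1.const_mul 2).div (by fun_prop)).pow_const 2).mul (by fun_prop)
    refine ((integrable_norm_sq (hD j)).const_mul 4).mono'
      (hm.comp_aemeasurable (hpm j)).aestronglyMeasurable (Eventually.of_forall fun x => ?_)
    simp only [hρ]
    rw [Real.norm_eq_abs, abs_of_nonneg (by positivity)]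
    have h1 : |(star (w x) * D j x).re| ≤ ‖w x‖ * ‖D j x‖ := by
      simpa using Complex.abs_re_le_norm (star (w x) * D j x)
    have h2 : (star (w x) * D j x).re ^ 2 ≤ ‖w x‖ ^ 2 * ‖D j x‖ ^ 2 := by
      rw [← sq_abs, ← mul_pow]; gcongr
    have h3 : 0 < κ + ‖w x‖ ^ 2 := by positivity
    rw [div_pow, div_mul_eq_mul_div, div_le_iff₀ (by positivity)]
    calc (2 * (star (w x) * D j x).re) ^ 2 * ‖w x‖ ^ 2
        = 4 * (star (w x) * D j x).re ^ 2 * ‖w x‖ ^ 2 := by ring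
      _ ≤ 4 * (‖w x‖ ^ 2 * ‖D j x‖ ^ 2) * ‖w x‖ ^ 2 := by gcongr
      _ = 4 * ‖D j x‖ ^ 2 * (‖w x‖ ^ 2) ^ 2 := by ring
      _ ≤ 4 * ‖D j x‖ ^ 2 * (κ + ‖w x‖ ^ 2) ^ 2 := by gcongr; linarith
  have hX : -(∫ x, α x * (star (w x) * u x).im ∂μ) +
      ε * ∑ j, ∫ x, twistReg κ (w x) (D j x) ∂μ = 0 := by
    -- This range of s guarantees |sα| ≤ 1, as the expansion of the rotation requires.
    refine eq_zero_of_quadratic_nonneg (s₀ := 1 / (A + 1)) (by positivity)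
      (C := 2 * ∫ x, α x ^ 2 * (‖u x‖ * ‖w x‖) ∂μ +
        ε * ∑ j, ∫ x, ρ j x ^ 2 * ‖w x‖ ^ 2 ∂μ) fun s hs => ?_
    have hrot := hW.radial (c := phase a κ s) (C := 1 + 2 * |s|) hw
      (fun r hr => contDiffAt_phase hκ hr) fun r hr => by
        rw [deriv_phase hκ hr, norm_phase, norm_mul, norm_phase, norm_mul, Complex.norm_I,
          Complex.norm_real, Real.norm_eq_abs, abs_div, abs_of_pos (by positivity : 0 < κ + r),
          mul_one, one_mul]
        have : r * (|s| / (κ + r)) ≤ |s| := by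
          rw [← mul_div_assoc, div_le_iff₀ (by positivity)]
          nlinarith [abs_nonneg s]
        linarith
    have hrotM : ∀ᵐ x ∂μ, ‖phase a κ s (‖w x‖ ^ 2) * w x‖ ≤ M := by
      filter_upwards [hM] with x hx
      rwa [norm_mul, norm_phase, one_mul]
    have hle := hmin _ _ hrot hrotM
    have hw2' := hW.memLp hrot
    have hD' := hW.memLp_grad hrot
    have h1 : l2sq μ (fun x => u x - phase a κ s (‖w x‖ ^ 2) * w x) ≤
        l2sq μ (fun x => u x - w x) - 2 * s * ∫ x, α x * (star (w x) * u x).im ∂μ +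
          2 * s ^ 2 * ∫ x, α x ^ 2 * (‖u x‖ * ‖w x‖) ∂μ := by
      have i1 : Integrable (fun x => ‖u x - w x‖ ^ 2) μ := integrable_norm_sq (hu.sub hw2)
      have i2 : Integrable (fun x => ‖u x - phase a κ s (‖w x‖ ^ 2) * w x‖ ^ 2) μ :=
        integrable_norm_sq (hu.sub hw2')
      have i4 : Integrable
          (fun x => ‖u x - w x‖ ^ 2 - 2 * s * (α x * (star (w x) * u x).im)) μ :=
        i1.sub (hi1.const_mul _)
      rw [l2sq, l2sq, ← integral_const_mul, ← integral_const_mul,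
        ← integral_sub i1 (hi1.const_mul _), ← integral_add i4 (hi2.const_mul _)]
      refine integral_mono_ae i2 (i4.add (hi2.const_mul _)) ?_
      filter_upwards [hαA] with x hx
      have ht : |s * α x| ≤ 1 := by
        rw [abs_mul]
        calc |s| * |α x| ≤ 1 / (A + 1) * A := by gcongr
          _ ≤ 1 := by rw [one_div, inv_mul_le_iff₀ (by positivity)]; linarith
      have := norm_sub_rotated_sq_le (u := u x) (w := w x) ht
      simp only [phase]
      refine this.trans (le_of_eq ?_)
      ring
    have h2 : ∀ j, l2sq μ (fun x => phase a κ s (‖w x‖ ^ 2) * D j x +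
        deriv (phase a κ s) (‖w x‖ ^ 2) * ((2 * (star (w x) * D j x).re : ℝ) : ℂ) * w x) =
        l2sq μ (D j) + 2 * s * ∫ x, twistReg κ (w x) (D j x) ∂μ +
          s ^ 2 * ∫ x, ρ j x ^ 2 * ‖w x‖ ^ 2 ∂μ := fun j => by
      have i5 : Integrable (fun x => ‖D j x‖ ^ 2 + 2 * s * twistReg κ (w x) (D j x)) μ :=
        (integrable_norm_sq (hD j)).add ((hi3 j).const_mul _)
      rw [l2sq, l2sq, ← integral_const_mul, ← integral_const_mul,
        ← integral_add (integrable_norm_sq (hD j)) ((hi3 j).const_mul _),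
        ← integral_add i5 ((hi4 j).const_mul _)]
      refine integral_congr_ae (Eventually.of_forall fun x => ?_)
      simp only
      rw [deriv_phase hκ (by positivity)]
      -- The phase factors out of the gradient of the rotated function, leaving D + isρw; its
      -- squared norm is an exact quadratic in s.
      have : phase a κ s (‖w x‖ ^ 2) * D j x + phase a κ s (‖w x‖ ^ 2) *
          (((s / (κ + ‖w x‖ ^ 2) : ℝ) : ℂ) * Complex.I) *
            ((2 * (star (w x) * D j x).re : ℝ) : ℂ) * w x =
          phase a κ s (‖w x‖ ^ 2) * (D j x + ((s * ρ j x : ℝ) : ℂ) * Complex.I * w x) := by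
        simp only [hρ]
        push_cast
        ring
      rw [this, norm_mul, norm_phase, one_mul, norm_add_rotated_sq]
      simp only [hρ, twistReg]
      ring
    rw [cost, cost, Finset.sum_congr rfl fun j _ => h2 j, Finset.sum_add_distrib,
      Finset.sum_add_distrib, ← Finset.mul_sum, ← Finset.mul_sum] at hle
    linarith
  linarith

lemma abs_log_add_le {κ b : ℝ} (hκ : 0 ≤ κ) (hκ1 : κ ≤ 1) (hb : 0 < b) :
    |Real.log (κ + b)| ≤ |Real.log b| + b := by
  have h1 : Real.log b ≤ Real.log (κ + b) := Real.log_le_log hb (by linarith)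
  have h2 : Real.log (κ + b) ≤ κ + b - 1 := Real.log_le_sub_one_of_pos (by positivity)
  rw [abs_le]
  constructor
  · linarith [neg_abs_le (Real.log b)]
  · linarith [abs_nonneg (Real.log b)]

/-- The factor |w| absorbs the singularity of the logarithm at zero uniformly in κ, including κ = 0;
this provides the dominating function for removing κ. -/
lemma norm_mul_abs_log_add_le {κ M : ℝ} (hκ : 0 ≤ κ) (hκ1 : κ ≤ 1) {w : ℂ} (hM : ‖w‖ ≤ M) :
    ‖w‖ * |Real.log (κ + ‖w‖ ^ 2)| ≤ 2 * (1 + M ^ 2) + M ^ 3 := by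
  have hM0 : 0 ≤ M := (norm_nonneg _).trans hM
  rcases (norm_nonneg w).eq_or_lt with h0 | h0
  · rw [← h0]; simp; positivity
  calc ‖w‖ * |Real.log (κ + ‖w‖ ^ 2)| ≤ ‖w‖ * (|Real.log (‖w‖ ^ 2)| + ‖w‖ ^ 2) := by
        gcongr; exact abs_log_add_le hκ hκ1 (by positivity)
    _ = ‖w‖ * |Real.log (‖w‖ ^ 2)| + ‖w‖ ^ 3 := by ring
    _ ≤ 2 * (1 + ‖w‖ ^ 2) + ‖w‖ ^ 3 := add_le_add (mul_abs_log_sq_le h0.le) le_rfl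
    _ ≤ _ := by gcongr

lemma integrable_twist {w D : Ω → ℂ} (hw : AEStronglyMeasurable w μ) (hD : MemLp D 2 μ) :
    Integrable (fun x => twist (w x) (D x)) μ :=
  (integrable_norm_sq hD).mono' (measurable_twist.comp_aemeasurable
    (hw.aemeasurable.prodMk hD.1.aemeasurable)).aestronglyMeasurable
      (Eventually.of_forall fun _ => abs_twist_le _ _)

/-- The Euler–Lagrange identity for rotations `w ↦ exp (i s (a + log |w|²)) w` of a bounded
minimiser. -/
lemma eulerLagrange [IsProbabilityMeasure μ] (hW : IsGradRel μ W) {ε M a : ℝ}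
    {u w : Ω → ℂ} {D : ι → Ω → ℂ} (hu : MemLp u 2 μ) (hw : W w D)
    (hM : ∀ᵐ x ∂μ, ‖w x‖ ≤ M)
    (hmin : ∀ w' D', W w' D' → (∀ᵐ x ∂μ, ‖w' x‖ ≤ M) → cost μ ε u w D ≤ cost μ ε u w' D') :
    Integrable (fun x => (a + Real.log (‖w x‖ ^ 2)) * (star (w x) * u x).im) μ ∧
    ∫ x, (a + Real.log (‖w x‖ ^ 2)) * (star (w x) * u x).im ∂μ =
      ε * ∑ j, ∫ x, twist (w x) (D j x) ∂μ := by
  have hw2 := hW.memLp hw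
  have hD := hW.memLp_grad hw
  have hκ : ∀ n : ℕ, 0 < 1 / ((n : ℝ) + 1) := fun n => by positivity
  have hκ1 : ∀ n : ℕ, 1 / ((n : ℝ) + 1) ≤ 1 := fun n => by
    rw [div_le_one (by positivity)]
    linarith [(n.cast_nonneg : (0 : ℝ) ≤ n)]
  set B : ℝ := |a| * M + (2 * (1 + M ^ 2) + M ^ 3) with hB
  have hbound : ∀ κ : ℝ, 0 ≤ κ → κ ≤ 1 → ∀ᵐ x ∂μ,
      ‖(a + Real.log (κ + ‖w x‖ ^ 2)) * (star (w x) * u x).im‖ ≤ B * ‖u x‖ := by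
    intro κ h0 h1
    filter_upwards [hM] with x hx
    have h2 : |(star (w x) * u x).im| ≤ ‖w x‖ * ‖u x‖ := by
      simpa using Complex.abs_im_le_norm (star (w x) * u x)
    rw [norm_mul, Real.norm_eq_abs, Real.norm_eq_abs]
    calc |a + Real.log (κ + ‖w x‖ ^ 2)| * |(star (w x) * u x).im|
        ≤ (|a| + |Real.log (κ + ‖w x‖ ^ 2)|) * (‖w x‖ * ‖u x‖) := by
          gcongr; exact abs_add_le _ _
      _ = (|a| * ‖w x‖ + ‖w x‖ * |Real.log (κ + ‖w x‖ ^ 2)|) * ‖u x‖ := by ring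
      _ ≤ B * ‖u x‖ := by
          rw [hB]; gcongr; exact norm_mul_abs_log_add_le h0 h1 hx
  have hmeas : ∀ κ : ℝ, AEStronglyMeasurable
      (fun x => (a + Real.log (κ + ‖w x‖ ^ 2)) * (star (w x) * u x).im) μ := fun κ => by
    have h1 : Measurable fun z : ℂ => a + Real.log (κ + ‖z‖ ^ 2) := by fun_prop
    exact (h1.comp_aemeasurable hw2.1.aemeasurable).aestronglyMeasurable.mul
      (integrable_star_mul hw2 hu).im.aestronglyMeasurable
  have hu1 : Integrable (fun x => B * ‖u x‖) μ := (hu.integrable (by norm_num)).norm.const_mul B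
  have hint : Integrable (fun x => (a + Real.log (‖w x‖ ^ 2)) * (star (w x) * u x).im) μ := by
    have := hu1.mono' (hmeas 0) (hbound 0 le_rfl zero_le_one)
    simpa using this
  -- Both sides of the regularised identity are followed to their limits along κ = 1/(n+1).
  refine ⟨hint, tendsto_nhds_unique (f := fun n : ℕ => ∫ x,
    (a + Real.log (1 / ((n : ℝ) + 1) + ‖w x‖ ^ 2)) * (star (w x) * u x).im ∂μ) (l := atTop) ?_ ?_⟩
  · refine tendsto_integral_of_dominated_convergence _ (fun n => hmeas _) hu1
      (fun n => hbound _ (hκ n).le (hκ1 n)) (Eventually.of_forall fun x => ?_)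
    rcases eq_or_ne (w x) 0 with h0 | h0
    · simp [h0]
    · have h1 : Tendsto (fun n : ℕ => 1 / ((n : ℝ) + 1) + ‖w x‖ ^ 2) atTop (𝓝 (‖w x‖ ^ 2)) := by
        simpa using tendsto_one_div_add_atTop_nhds_zero_nat.add_const (‖w x‖ ^ 2)
      exact (((Real.continuousAt_log (by simpa using h0)).tendsto.comp h1).const_add a).mul_const _
  · simp_rw [fun n : ℕ => eulerLagrange_reg (a := a) hW (hκ n) hu hw hM hmin]
    refine (tendsto_finsetSum _ fun j _ => ?_).const_mul ε
    refine tendsto_integral_of_dominated_convergence (fun x => ‖D j x‖ ^ 2) (fun n => ?_)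
      (integrable_norm_sq (hD j))
      (fun n => Eventually.of_forall fun x => abs_twistReg_le (hκ n) _ _)
      (Eventually.of_forall fun x => tendsto_twistReg tendsto_one_div_add_atTop_nhds_zero_nat _ _)
    exact ((measurable_twistReg _).comp_aemeasurable
      (hw2.1.aemeasurable.prodMk (hD j).1.aemeasurable)).aestronglyMeasurable

end

/-! ### Convergence of the minimisers, and removal of the bound. -/

section

variable {Ω : Type*} [MeasurableSpace Ω] {μ : Measure Ω} {ι : Type*} [Fintype ι]
  {W : (Ω → ℂ) → (ι → Ω → ℂ) → Prop}

lemma l2sq_sub_comm (f g : Ω → ℂ) :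
    l2sq μ (fun x => f x - g x) = l2sq μ (fun x => g x - f x) := by
  simp only [l2sq, norm_sub_rev]

lemma tendsto_l2sq {u : ℕ → Ω → ℂ} {v : Ω → ℂ} (hu : ∀ n, MemLp (u n) 2 μ) (hv : MemLp v 2 μ)
    (h : Tendsto (fun n => l2sq μ (fun x => u n x - v x)) atTop (𝓝 0)) :
    Tendsto (fun n => l2sq μ (u n)) atTop (𝓝 (l2sq μ v)) := by
  have h1 : Tendsto (fun n => (hu n).toLp (u n)) atTop (𝓝 (hv.toLp v)) := by
    rw [tendsto_iff_norm_sub_tendsto_zero]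
    have h2 : ∀ n, ‖(hu n).toLp (u n) - hv.toLp v‖ = √(l2sq μ (fun x => u n x - v x)) := by
      intro n
      rw [← MemLp.toLp_sub, show (fun x => u n x - v x) = u n - v from rfl,
        l2sq_eq_norm_toLp ((hu n).sub hv), Real.sqrt_sq (norm_nonneg _)]
    simp_rw [h2]
    simpa using h.sqrt
  have h3 := h1.norm.pow 2
  simpa only [← l2sq_eq_norm_toLp] using h3

/-- As `ε → 0` the minimisers converge to `u` together with their gradients. -/
lemma IsGradRel.minimiser_tendsto (hW : IsGradRel μ W) {ε : ℕ → ℝ} (hε : ∀ n, 0 < ε n)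
    (hanti : Antitone ε) (hε0 : Tendsto ε atTop (𝓝 0)) {u : Ω → ℂ} {Du : ι → Ω → ℂ}
    (hu : W u Du) {v : ℕ → Ω → ℂ} {E : ℕ → ι → Ω → ℂ} {δ : ℕ → ℝ} (hv : ∀ n, W (v n) (E n))
    (hδ : ∀ n, cost μ (ε n) u (v n) (E n) = δ n)
    (hpy : ∀ n w D, W w D → cost μ (ε n) u w D = δ n + l2sq μ (fun x => w x - v n x) +
        ε n * ∑ j, l2sq μ (fun x => D j x - E n j x)) :
    Tendsto (fun n => δ n / ε n) atTop (𝓝 (∑ j, l2sq μ (Du j))) ∧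
      ∀ n, l2sq μ (fun x => u x - v n x) / ε n + ∑ j, l2sq μ (fun x => Du j x - E n j x) =
        ∑ j, l2sq μ (Du j) - δ n / ε n := by
  set S := ∑ j, l2sq μ (Du j) with hS
  set a : ℕ → ℝ := fun n => δ n / ε n with ha
  have hself : ∀ n, l2sq μ (fun x => u x - v n x) / ε n +
      ∑ j, l2sq μ (fun x => Du j x - E n j x) = S - a n := by
    intro n
    have h1 := hpy n u Du hu
    rw [cost] at h1
    have h2 : l2sq μ (fun x => u x - u x) = 0 := by simp [l2sq]
    rw [h2, zero_add] at h1
    have h3 := (hε n).ne'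
    simp only [ha]
    field_simp
    linarith
  have haS : ∀ n, a n ≤ S := fun n => by
    have h1 := hself n
    have h2 : 0 ≤ l2sq μ (fun x => u x - v n x) / ε n := div_nonneg (l2sq_nonneg _) (hε n).le
    have h3 : 0 ≤ ∑ j, l2sq μ (fun x => Du j x - E n j x) :=
      Finset.sum_nonneg fun j _ => l2sq_nonneg _
    linarith
  have ha' : ∀ n, a n = l2sq μ (fun x => u x - v n x) / ε n + ∑ j, l2sq μ (E n j) := fun n => by
    simp only [ha]
    rw [← hδ, cost, add_div, mul_div_cancel_left₀ _ (hε n).ne']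
  -- The minimiser at the finer scale m competes in the problem at scale n. Since ε decreases,
  -- dividing its cost by ε n gives at most a m, and Pythagoras turns the excess over a n into the
  -- distance of the gradients. Hence a is increasing and the gradients form a Cauchy sequence.
  have hcau : ∀ n m, n ≤ m → ∑ j, l2sq μ (fun x => E m j x - E n j x) ≤ a m - a n := by
    intro n m hnm
    have h1 := hpy n _ _ (hv m)
    rw [cost] at h1
    have h2 : l2sq μ (fun x => u x - v m x) / ε n ≤ l2sq μ (fun x => u x - v m x) / ε m :=
      div_le_div_of_nonneg_left (l2sq_nonneg _) (hε m) (hanti hnm)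
    have h3 : l2sq μ (fun x => u x - v m x) / ε n + ∑ j, l2sq μ (E m j) = a n +
        l2sq μ (fun x => v m x - v n x) / ε n + ∑ j, l2sq μ (fun x => E m j x - E n j x) := by
      have h3 := (hε n).ne'
      simp only [ha]
      field_simp
      linarith
    have h4 : 0 ≤ l2sq μ (fun x => v m x - v n x) / ε n := div_nonneg (l2sq_nonneg _) (hε n).le
    linarith [ha' m]
  have hmono : Monotone a := fun n m hnm => by
    have := hcau n m hnm
    have h3 : 0 ≤ ∑ j, l2sq μ (fun x => E m j x - E n j x) :=
      Finset.sum_nonneg fun j _ => l2sq_nonneg _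
    linarith
  obtain ⟨L, hL⟩ : ∃ L, Tendsto a atTop (𝓝 L) :=
    ⟨_, tendsto_atTop_ciSup hmono ⟨S, by rintro _ ⟨n, rfl⟩; exact haS n⟩⟩
  have haL : ∀ n, a n ≤ L := fun n => hmono.ge_of_tendsto hL n
  have hE : ∀ n j, MemLp (E n j) 2 μ := fun n j => hW.memLp_grad (hv n) j
  have hlim : ∀ j, ∃ e : Lp ℂ 2 μ,
      Tendsto (fun n => l2sq μ (fun x => E n j x - e x)) atTop (𝓝 0) := by
    intro j
    have hc : CauchySeq fun n => (hE n j).toLp (E n j) := by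
      refine cauchySeq_of_le_tendsto_0' (fun n => √(L - a n)) (fun n m hnm => ?_) ?_
      · rw [dist_comm, dist_eq_norm, ← MemLp.toLp_sub]
        refine Real.le_sqrt_of_sq_le ?_
        rw [← l2sq_eq_norm_toLp ((hE m j).sub (hE n j))]
        have h1 := Finset.single_le_sum (f := fun j => l2sq μ (fun x => E m j x - E n j x))
          (fun j _ => l2sq_nonneg _) (Finset.mem_univ j)
        have h2 := hcau n m hnm
        have h3 : l2sq μ (E m j - E n j) ≤ a m - a n := h1.trans h2
        linarith [haL m]
      · simpa using (hL.const_sub L).sqrt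
    obtain ⟨e, he⟩ := cauchySeq_tendsto_of_complete hc
    refine ⟨e, ?_⟩
    have h1 := (he.sub_const e).norm.pow 2
    simp only [sub_self, norm_zero, ne_eq, OfNat.ofNat_ne_zero, not_false_eq_true, zero_pow] at h1
    refine h1.congr fun n => ?_
    rw [← l2sq_sub_coe]
    exact l2sq_congr (by filter_upwards [(hE n j).coeFn_toLp] with x hx; rw [hx])
  choose e he using hlim
  have hve : Tendsto (fun n => l2sq μ (fun x => v n x - u x)) atTop (𝓝 0) := by
    have h1 : Tendsto (fun n => ε n * (S - a 0)) atTop (𝓝 0) := by simpa using hε0.mul_const _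
    refine squeeze_zero (fun n => l2sq_nonneg _) (fun n => ?_) h1
    have h2 := hself n
    have h3 : 0 ≤ ∑ j, l2sq μ (fun x => Du j x - E n j x) :=
      Finset.sum_nonneg fun j _ => l2sq_nonneg _
    have h4 : l2sq μ (fun x => u x - v n x) / ε n ≤ S - a 0 := by
      linarith [hmono (Nat.zero_le n)]
    rw [div_le_iff₀ (hε n)] at h4
    rw [l2sq_sub_comm]
    linarith
  -- As v n tends to u, closedness and uniqueness identify the limit of the gradients with ∇u.
  have hWe := hW.closed hv (hW.memLp hu) (fun j => Lp.memLp (e j)) hve he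
  have hae := hW.unique hWe hu
  have hS' : Tendsto (fun n => ∑ j, l2sq μ (E n j)) atTop (𝓝 S) := by
    refine tendsto_finsetSum _ fun j _ => ?_
    have := tendsto_l2sq (fun n => hE n j) (Lp.memLp (e j)) (he j)
    rwa [l2sq_congr (hae j)] at this
  -- The sequence a is squeezed between the energies of the minimisers, which tend to S, and S
  -- itself.
  refine ⟨tendsto_of_tendsto_of_tendsto_of_le_of_le hS' tendsto_const_nhds (fun n => ?_) haS,
    hself⟩
  rw [ha' n]
  have : 0 ≤ l2sq μ (fun x => u x - v n x) / ε n := div_nonneg (l2sq_nonneg _) (hε n).le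
  linarith

lemma IsGradRel.exists_bounded_approx (hW : IsGradRel μ W) {v : Ω → ℂ} {E : ι → Ω → ℂ}
    (hv : W v E) :
    Tendsto (fun n => l2sq μ (fun x => LSE.trunc n v x - v x)) atTop (𝓝 0) ∧
    ∀ j, Tendsto (fun n => l2sq μ (fun x => truncGrad n v (E j) x - E j x)) atTop (𝓝 0) :=
  ⟨tendsto_trunc (hW.memLp hv) fun n => (hW.memLp (hW.trunc hv n)).1,
    fun j => tendsto_truncGrad (hW.memLp_grad hv j) fun n => (hW.memLp_grad (hW.trunc hv n) j).1⟩

/-- The bounded minimisation problems approximate the unbounded one, uniformly on compact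
intervals of time. -/
lemma IsGradRel.exists_uniform_bound (hW : IsGradRel μ W) {ε η T : ℝ} (hε : 0 < ε) (hη : 0 < η)
    {φ : ℝ → Lp ℂ 2 μ} (hφ : ContinuousOn φ (Icc 0 T))
    {δ : Lp ℂ 2 μ → ℝ} (hδ : Continuous δ)
    (hmin : ∀ u : Lp ℂ 2 μ, ∃ v E, W v E ∧ cost μ ε u v E = δ u ∧
      (∀ w D, W w D → cost μ ε u w D = δ u + l2sq μ (fun x => w x - v x) +
        ε * ∑ j, l2sq μ (fun x => D j x - E j x))) :
    ∃ (M : ℝ) (d : Lp ℂ 2 μ → ℝ), 0 ≤ M ∧ Continuous d ∧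
      (∀ u : Lp ℂ 2 μ, ∀ w D, W w D → (∀ᵐ x ∂μ, ‖w x‖ ≤ M) → d u ≤ cost μ ε u w D) ∧
      (∀ u : Lp ℂ 2 μ, ∃ w D, W w D ∧ (∀ᵐ x ∂μ, ‖w x‖ ≤ M) ∧ cost μ ε u w D = d u) ∧
      ∀ t ∈ Icc 0 T, d (φ t) ≤ δ (φ t) + η := by
  choose d hd1 hd2 hd3 using fun k : ℕ =>
    hW.exists_bdd_minimiser (μ := μ) hε (M := (k : ℝ) + 1) (by positivity)
  have hanti : ∀ u, Antitone fun k => d k u := by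
    intro u k l hkl
    obtain ⟨w, D, hw, hb, hc⟩ := hd3 k u
    change d l u ≤ d k u
    rw [← hc]
    refine hd2 l u w D hw ?_
    filter_upwards [hb] with x hx
    refine hx.trans ?_
    have : (k : ℝ) ≤ l := by exact_mod_cast hkl
    linarith
  -- The constrained minimum decreases with the bound and stays above the unconstrained one;
  -- truncating the unconstrained minimiser shows that it converges to it.
  have hlow : ∀ k u, δ u ≤ d k u := by
    intro k u
    obtain ⟨w, D, hw, hb, hc⟩ := hd3 k u
    obtain ⟨v, E, hv, -, hpy⟩ := hmin u
    rw [← hc, hpy w D hw]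
    have h1 := l2sq_nonneg (μ := μ) (fun x => w x - v x)
    have h2 : 0 ≤ ∑ j, l2sq μ (fun x => D j x - E j x) :=
      Finset.sum_nonneg fun j _ => l2sq_nonneg _
    have := mul_nonneg hε.le h2
    linarith
  have htend : ∀ u, Tendsto (fun k => d k u) atTop (𝓝 (δ u)) := by
    intro u
    obtain ⟨v, E, hv, -, hpy⟩ := hmin u
    obtain ⟨h1, h2⟩ := hW.exists_bounded_approx hv
    have h3 : Tendsto (fun n => δ u + l2sq μ (fun x => LSE.trunc n v x - v x) +
        ε * ∑ j, l2sq μ (fun x => truncGrad n v (E j) x - E j x)) atTop (𝓝 (δ u)) := by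
      have := (h1.const_add (δ u)).add ((tendsto_finsetSum Finset.univ fun j _ => h2 j).const_mul ε)
      simpa using this
    refine tendsto_of_tendsto_of_tendsto_of_le_of_le tendsto_const_nhds h3 (fun k => hlow k u)
      fun k => ?_
    simp only
    rw [← hpy _ _ (hW.trunc hv k)]
    exact hd2 k u _ _ (hW.trunc hv k) (Eventually.of_forall fun x => norm_trunc_le k (v x))
  -- Dini's theorem on [0, T]: monotone pointwise convergence of continuous functions to a
  -- continuous limit is uniform. It makes one bound M serve for all times.
  have hunif := Antitone.tendstoUniformlyOn_of_forall_tendsto isCompact_Icc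
    (F := fun k t => d k (φ t)) (f := fun t => δ (φ t))
    (fun k => (hd1 k).comp_continuousOn hφ) (fun t _ => hanti (φ t))
    (hδ.comp_continuousOn hφ) (fun t _ => htend (φ t))
  obtain ⟨k, hk⟩ := (Metric.tendstoUniformlyOn_iff.1 hunif η hη).exists
  refine ⟨k + 1, d k, by positivity, hd1 k, hd2 k, hd3 k, fun t ht => ?_⟩
  have := hk t ht
  rw [Real.dist_eq, abs_lt] at this
  linarith [this.1]

end

/-! ### The nonlinear term tested with a minimiser. -/

namespace IsWeakSol

variable {Ω : Type*} [MeasurableSpace Ω] {μ : Measure Ω} [IsProbabilityMeasure μ]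
  {ι : Type*} [Fintype ι] {W : (Ω → ℂ) → (ι → Ω → ℂ) → Prop} {lam : ℝ}
  {φ : ℝ → Lp ℂ 2 μ} {Dφ : ℝ → ι → Ω → ℂ}

lemma re_rate (g : Ω → ℂ) (G : ι → Ω → ℂ) (t : ℝ) : (rate μ lam φ Dφ g G t).re =
    (∑ j, pair μ (G j) (Dφ t j)).im + lam * (pair μ g (logTerm μ (φ t))).im := by
  simp [rate]

/-- By the Euler–Lagrange identity the subtracted twist term is an integral of log|w|² - log‖u‖²
against Im(w̄u). What remains is Im(w̄u)(log|u|² - log|w|²), which the sharp pointwise inequality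
bounds by |u - w|². -/
lemma rate_minimiser (hW : IsGradRel μ W) {u w : Ω → ℂ} {D : ι → Ω → ℂ} {ε M : ℝ}
    (hu : MemLp u 2 μ) (hw : W w D) (hM : ∀ᵐ x ∂μ, ‖w x‖ ≤ M)
    (hmin : ∀ w' D', W w' D' → (∀ᵐ x ∂μ, ‖w' x‖ ≤ M) → cost μ ε u w D ≤ cost μ ε u w' D') :
    |(pair μ w (logTerm μ u)).im - ε * ∑ j, ∫ x, twist (w x) (D j x) ∂μ| ≤
      l2sq μ (fun x => u x - w x) := by
  -- The free constant a accounts for the normalisation by the mass inside the logarithm.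
  obtain ⟨hi, hEL⟩ := eulerLagrange (a := -Real.log (l2sq μ u)) hW hu hw hM hmin
  have hw2 := hW.memLp hw
  have hint := integrable_star_mul_logTerm hw2.1 hM hu
  have h1 : (pair μ w (logTerm μ u)).im = ∫ x, (star (w x) * logTerm μ u x).im ∂μ :=
    (integral_im (𝕜 := ℂ) hint).symm
  have hi2 : Integrable (fun x => (star (w x) * logTerm μ u x).im) μ := hint.im
  rw [h1, ← hEL, ← integral_sub hi2 hi]
  have hae : (fun x => (star (w x) * logTerm μ u x).im -
      (-Real.log (l2sq μ u) + Real.log (‖w x‖ ^ 2)) * (star (w x) * u x).im) =ᵐ[μ]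
      fun x => (star (w x) * u x).im * (Real.log (‖u x‖ ^ 2) - Real.log (‖w x‖ ^ 2)) := by
    have hz : ∀ᵐ x ∂μ, l2sq μ u = 0 → u x = 0 := by
      by_cases h0 : l2sq μ u = 0
      · filter_upwards [ae_eq_zero_of_l2sq_eq_zero hu h0] with x hx _ using hx
      · exact Eventually.of_forall fun x h => absurd h h0
    filter_upwards [hz] with x hx
    by_cases hux : u x = 0
    · simp [hux, logTerm]
    · have hm : l2sq μ u ≠ 0 := fun h => hux (hx h)
      rw [logTerm, ← mul_assoc, Complex.im_mul_ofReal, Real.log_div (by simpa using hux) hm]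
      ring
  rw [integral_congr_ae hae, l2sq, ← Real.norm_eq_abs]
  exact norm_integral_le_of_norm_le (integrable_norm_sq (hu.sub hw2))
    (Eventually.of_forall fun x => abs_im_conj_mul_log_sub_log_le _ _)

end IsWeakSol

/-! ### Approximate minimisers along the solution. -/

section

variable {Ω : Type*} [MeasurableSpace Ω] {μ : Measure Ω}
  {ι : Type*} [Fintype ι] {W : (Ω → ℂ) → (ι → Ω → ℂ) → Prop} {lam : ℝ}
  {φ : ℝ → Lp ℂ 2 μ} {Dφ : ℝ → ι → Ω → ℂ}

lemma pair_conj (f g : Ω → ℂ) : pair μ g f = star (pair μ f g) := by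
  rw [pair, pair, ← integral_conj_star f g]
where
  integral_conj_star (f g : Ω → ℂ) :
    (∫ x, star (g x) * f x ∂μ) = star (∫ x, star (f x) * g x ∂μ) := by
    have := integral_conj (μ := μ) (f := fun x => star (f x) * g x)
    rw [starRingEnd_apply] at this
    rw [← this]
    congr 1
    ext x
    simp [mul_comm]

lemma pair_self_im (f : Ω → ℂ) : (pair μ f f).im = 0 := by
  have h := congrArg Complex.im (pair_conj (μ := μ) f f)
  simp only [Complex.star_def, Complex.conj_im] at h
  linarith

/-- The approximations, at scale `ε`, of the solution on `[0, T]` by bounded functions `w` in the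
domain of the gradient: `w t` minimises `‖φ t - w‖² + ε ‖∇w‖²` under the constraint `|w| ≤ M`, and
`v t` is the minimiser without constraint. -/
structure Approx (μ : Measure Ω) (W : (Ω → ℂ) → (ι → Ω → ℂ) → Prop) (φ : ℝ → Lp ℂ 2 μ)
    (Dφ : ℝ → ι → Ω → ℂ) (T ε : ℝ) where
  w : ℝ → Ω → ℂ
  D : ℝ → ι → Ω → ℂ
  v : ℝ → Ω → ℂ
  E : ℝ → ι → Ω → ℂ
  d : ℝ → ℝ
  δ : ℝ → ℝ
  M : ℝ
  M_nonneg : 0 ≤ M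
  continuousOn : ContinuousOn d (Icc 0 T)
  mem : ∀ t, W (w t) (D t)
  bdd : ∀ t, ∀ᵐ x ∂μ, ‖w t x‖ ≤ M
  cost_eq : ∀ t, cost μ ε (φ t) (w t) (D t) = d t
  le_cost : ∀ t w' D', W w' D' → (∀ᵐ x ∂μ, ‖w' x‖ ≤ M) → d t ≤ cost μ ε (φ t) w' D'
  mem' : ∀ t, W (v t) (E t)
  cost_eq' : ∀ t, cost μ ε (φ t) (v t) (E t) = δ t
  pyth : ∀ t w' D', W w' D' → cost μ ε (φ t) w' D' = δ t + l2sq μ (fun x => w' x - v t x) +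
        ε * ∑ j, l2sq μ (fun x => D' j x - E t j x)
  orth : ∀ t w' D', W w' D' → pair μ w' (fun x => φ t x - v t x) = ε * ∑ j, pair μ (D' j) (E t j)
  close : ∀ t ∈ Icc 0 T, d t ≤ δ t + ε ^ 5

lemma IsWeakSol.exists_approx (hW : IsGradRel μ W) (h : IsWeakSol μ W lam φ Dφ) (T : ℝ) {ε : ℝ}
    (hε : 0 < ε) : Nonempty (Approx μ W φ Dφ T ε) := by
  obtain ⟨δ, hδ, hmin⟩ := hW.exists_minimiser (μ := μ) hε
  -- The tolerance ε⁵ makes the gradients of w and v agree up to ε⁴ in squared norm, so that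
  -- replacing one by the other in the time derivative costs O(ε²) and disappears after division by
  -- ε.
  obtain ⟨M, d, hM, hd, hle, hex, hcl⟩ := hW.exists_uniform_bound hε (pow_pos hε 5)
    (h.cont.mono (Icc_subset_Ici_self : Icc 0 T ⊆ Ici 0)) hδ
    (fun u => by obtain ⟨v, E, h1, h2, h3, -⟩ := hmin u; exact ⟨v, E, h1, h2, h3⟩)
  choose v E h1 h2 h3 h4 using hmin
  choose w D h5 h6 h7 using hex
  exact ⟨{ w := fun t => w (φ t), D := fun t => D (φ t), v := fun t => v (φ t)
           E := fun t => E (φ t), d := fun t => d (φ t), δ := fun t => δ (φ t), M := M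
           M_nonneg := hM
           continuousOn := hd.comp_continuousOn (h.cont.mono Icc_subset_Ici_self)
           mem := fun t => h5 _
           bdd := fun t => h6 _
           cost_eq := fun t => h7 _
           le_cost := fun t => hle _
           mem' := fun t => h1 _
           cost_eq' := fun t => h2 _
           pyth := fun t => h3 _
           orth := fun t => h4 _
           close := hcl }⟩

namespace Approx

variable {T ε : ℝ} (P : Approx μ W φ Dφ T ε)

include P

/-- By Pythagoras d - δ equals ‖w - v‖² + ε‖∇(w - v)‖², and it is at most ε⁵. -/
lemma close' (hε : 0 < ε) {t : ℝ} (ht : t ∈ Icc 0 T) :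
    l2sq μ (fun x => P.w t x - P.v t x) ≤ ε ^ 5 ∧
      ∑ j, l2sq μ (fun x => P.D t j x - P.E t j x) ≤ ε ^ 4 := by
  have h1 := P.pyth t _ _ (P.mem t)
  rw [P.cost_eq] at h1
  have h2 := P.close t ht
  have h3 := l2sq_nonneg (μ := μ) (fun x => P.w t x - P.v t x)
  have h4 : 0 ≤ ∑ j, l2sq μ (fun x => P.D t j x - P.E t j x) :=
      Finset.sum_nonneg fun j _ => l2sq_nonneg _
  refine ⟨by nlinarith, le_of_mul_le_mul_left ?_ hε⟩
  nlinarith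

lemma d_nonneg (hε : 0 < ε) (t : ℝ) : ε * ∑ j, l2sq μ (P.D t j) + 
    l2sq μ (fun x => φ t x - P.w t x) = P.d t ∧ 0 ≤ ∑ j, l2sq μ (P.D t j) ∧ 0 ≤ P.d t := by
  have h4 : 0 ≤ ∑ j, l2sq μ (P.D t j) := Finset.sum_nonneg fun j _ => l2sq_nonneg _
  have := P.cost_eq t
  rw [cost] at this
  refine ⟨by linarith, h4, ?_⟩
  have := mul_nonneg hε.le h4
  have := l2sq_nonneg (μ := μ) (fun x => φ t x - P.w t x)
  linarith

lemma d_le (hε : 0 < ε) (h : IsWeakSol μ W lam φ Dφ) {t : ℝ} (ht : t ∈ Icc 0 T) :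
    P.δ t ≤ P.d t ∧ P.d t ≤ ε * (∑ j, l2sq μ (Dφ t j) + ε ^ 4) := by
  constructor
  · have h1 := P.pyth t _ _ (P.mem t)
    rw [P.cost_eq] at h1
    have h3 := l2sq_nonneg (μ := μ) (fun x => P.w t x - P.v t x)
    have h4 : 0 ≤ ∑ j, l2sq μ (fun x => P.D t j x - P.E t j x) :=
      Finset.sum_nonneg fun j _ => l2sq_nonneg _
    have := mul_nonneg hε.le h4
    linarith
  · have h1 := P.pyth t _ _ (h.grad t ht.1)
    have h3 := l2sq_nonneg (μ := μ) (fun x => φ t x - P.v t x)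
    have h4 : 0 ≤ ∑ j, l2sq μ (fun x => Dφ t j x - P.E t j x) :=
      Finset.sum_nonneg fun j _ => l2sq_nonneg _
    have := mul_nonneg hε.le h4
    have h5 : cost μ ε (φ t) (φ t) (Dφ t) = ε * ∑ j, l2sq μ (Dφ t j) := by
      simp [cost, l2sq]
    have := P.close t ht
    have h6 : ε * (∑ j, l2sq μ (Dφ t j) + ε ^ 4) = ε * ∑ j, l2sq μ (Dφ t j) + ε ^ 5 := by ring
    rw [h6]
    linarith

/-- For the unconstrained minimiser the imaginary part is exactly zero: by orthogonality ε⟨∇φ, ∇v⟩ =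
⟨φ, φ - v⟩ = ‖φ - v‖² + ⟨v, φ - v⟩ = ‖φ - v‖² + ε‖∇v‖² is real. Passing from v to w costs ‖∇(w -
v)‖‖∇φ‖, which is split with weights ε⁻² and ε². -/
lemma abs_im_le (hε : 0 < ε) (hW : IsGradRel μ W) (h : IsWeakSol μ W lam φ Dφ) {t : ℝ}
    (ht : t ∈ Icc 0 T) :
    |(∑ j, pair μ (P.D t j) (Dφ t j)).im| ≤ ε ^ 2 * (1 + ∑ j, l2sq μ (Dφ t j)) := by
  have hg := h.grad t ht.1
  have h0 : (∑ j, pair μ (P.E t j) (Dφ t j)).im = 0 := by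
    have h1 := P.orth t _ _ hg
    have h2 := P.orth t _ _ (P.mem' t)
    have hφ := hW.memLp hg
    have hv := hW.memLp (P.mem' t)
    have h3 := pair_sub_left (μ := μ) (f := φ t) (f' := P.v t) (g := fun x => φ t x - P.v t x)
      hφ hv (hφ.sub hv)
    have h4 := congrArg Complex.im h3
    rw [pair_self_im, Complex.sub_im, h1, h2, Complex.im_ofReal_mul, Complex.im_ofReal_mul] at h4
    have h5 : (∑ j, pair μ (P.E t j) (P.E t j)).im = 0 := by
      simp [pair_self_im]
    rw [h5, mul_zero, sub_zero] at h4
    have h6 : (∑ j, pair μ (Dφ t j) (P.E t j)).im = 0 := by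
      rcases mul_eq_zero.1 h4.symm with h | h
      · exact absurd h hε.ne'
      · exact h
    have h7 : ∑ j, pair μ (P.E t j) (Dφ t j) = star (∑ j, pair μ (Dφ t j) (P.E t j)) := by
      rw [star_sum]
      exact Finset.sum_congr rfl fun j _ => pair_conj _ _
    rw [h7, Complex.star_def, Complex.conj_im, h6, neg_zero]
  have hD := fun j => hW.memLp_grad (P.mem t) j
  have hE := fun j => hW.memLp_grad (P.mem' t) j
  have hφ := fun j => hW.memLp_grad hg j
  have h1 : (∑ j, pair μ (P.D t j) (Dφ t j)).im =
      (∑ j, pair μ (fun x => P.D t j x - P.E t j x) (Dφ t j)).im := by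
    have : ∀ j, pair μ (fun x => P.D t j x - P.E t j x) (Dφ t j) =
        pair μ (P.D t j) (Dφ t j) - pair μ (P.E t j) (Dφ t j) := fun j =>
      pair_sub_left (hD j) (hE j) (hφ j)
    simp_rw [this]
    rw [Finset.sum_sub_distrib, Complex.sub_im, h0, sub_zero]
  rw [h1]
  refine (Complex.abs_im_le_norm _).trans ((norm_sum_le _ _).trans ?_)
  have h2 : ∀ j, ‖pair μ (fun x => P.D t j x - P.E t j x) (Dφ t j)‖ ≤
      (ε ^ 2)⁻¹ * l2sq μ (fun x => P.D t j x - P.E t j x) + ε ^ 2 * l2sq μ (Dφ t j) := by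
    intro j
    refine (norm_pair_le ((hD j).sub (hE j)) (hφ j)).trans ?_
    have h1 := Real.sq_sqrt (l2sq_nonneg (μ := μ) (fun x => P.D t j x - P.E t j x))
    have h2 := Real.sq_sqrt (l2sq_nonneg (μ := μ) (Dφ t j))
    set a := √(l2sq μ (fun x => P.D t j x - P.E t j x))
    set b := √(l2sq μ (Dφ t j))
    rw [← h1, ← h2]
    have h3 : a * b = (ε⁻¹ * a) * (ε * b) := by field_simp
    have h4 : (ε ^ 2)⁻¹ * a ^ 2 + ε ^ 2 * b ^ 2 = (ε⁻¹ * a) ^ 2 + (ε * b) ^ 2 := by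
      field_simp
    rw [h4]
    change a * b ≤ _
    rw [h3]
    nlinarith [sq_nonneg (ε⁻¹ * a - ε * b), sq_nonneg (ε⁻¹ * a), sq_nonneg (ε * b)]
  refine (Finset.sum_le_sum fun j _ => h2 j).trans ?_
  rw [Finset.sum_add_distrib, ← Finset.mul_sum, ← Finset.mul_sum, mul_add, mul_one]
  gcongr
  have := (P.close' hε ht).2
  calc (ε ^ 2)⁻¹ * ∑ j, l2sq μ (fun x => P.D t j x - P.E t j x) ≤ (ε ^ 2)⁻¹ * ε ^ 4 := by gcongr
    _ = ε ^ 2 := by field_simp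

lemma abs_sum_twist_le (hW : IsGradRel μ W) (t : ℝ) :
    |∑ j, ∫ x, twist (P.w t x) (P.D t j x) ∂μ| ≤ ∑ j, l2sq μ (P.D t j) := by
  refine (Finset.abs_sum_le_sum_abs _ _).trans (Finset.sum_le_sum fun j _ => ?_)
  rw [← Real.norm_eq_abs]
  exact norm_integral_le_of_norm_le (integrable_norm_sq (hW.memLp_grad (P.mem t) j))
    (Eventually.of_forall fun x => abs_twist_le _ _)

variable [IsProbabilityMeasure μ]

/-- The derivative of ‖φ‖² - d equals 2λε times the twist of the minimiser, up to a generator part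
of order ε² and a nonlinear part controlled by ‖φ - w‖². -/
lemma abs_rate_sub_le (hε : 0 < ε) (hW : IsGradRel μ W) (h : IsWeakSol μ W lam φ Dφ) {t : ℝ}
    (ht : t ∈ Icc 0 T) :
    |2 * (IsWeakSol.rate μ lam φ Dφ (P.w t) (P.D t) t).re -
        2 * lam * (ε * ∑ j, ∫ x, twist (P.w t x) (P.D t j x) ∂μ)| ≤
      2 * (ε ^ 2 * (1 + ∑ j, l2sq μ (Dφ t j))) +
        2 * |lam| * l2sq μ (fun x => φ t x - P.w t x) := by
  rw [IsWeakSol.re_rate]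
  have h1 := P.abs_im_le hε hW h ht
  have h2 := IsWeakSol.rate_minimiser hW (hW.memLp (h.grad t ht.1)) (P.mem t) (P.bdd t)
    (fun w' D' hw hM => by rw [P.cost_eq]; exact P.le_cost t w' D' hw hM)
  set a := (∑ j, pair μ (P.D t j) (Dφ t j)).im
  set b := (pair μ (P.w t) (logTerm μ (φ t))).im
  set c := ε * ∑ j, ∫ x, twist (P.w t x) (P.D t j x) ∂μ
  calc |2 * (a + lam * b) - 2 * lam * c| = |2 * a + 2 * lam * (b - c)| := by ring_nf
    _ ≤ |2 * a| + |2 * lam * (b - c)| := abs_add_le _ _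
    _ = 2 * |a| + 2 * |lam| * |b - c| := by simp [abs_mul]
    _ ≤ _ := by gcongr

/-- A crude bound linear in ε and uniform in time. It gives conservation of mass in the limit and
serves as the dominating function after division by ε. -/
lemma abs_rate_le (hε : 0 < ε) (hε1 : ε ≤ 1) (hW : IsGradRel μ W) (h : IsWeakSol μ W lam φ Dφ)
    {t A : ℝ} (ht : t ∈ Icc 0 T) (hA : ∑ j, l2sq μ (Dφ t j) ≤ A) :
    |2 * (IsWeakSol.rate μ lam φ Dφ (P.w t) (P.D t) t).re| ≤ ε * ((2 + 2 * |lam|) * (1 + A)) := by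
  have h1 := P.abs_rate_sub_le hε hW h ht
  obtain ⟨h2, h3, h4⟩ := P.d_nonneg hε t
  have h5 := (P.d_le hε h ht).2
  have h6 := P.abs_sum_twist_le hW t
  have h7 := l2sq_nonneg (μ := μ) (fun x => φ t x - P.w t x)
  set a := 2 * (IsWeakSol.rate μ lam φ Dφ (P.w t) (P.D t) t).re
  set b := ∑ j, ∫ x, twist (P.w t x) (P.D t j x) ∂μ
  have h8 : |a| ≤ |a - 2 * lam * (ε * b)| + 2 * |lam| * (ε * |b|) := by
    have := abs_add_le (a - 2 * lam * (ε * b)) (2 * lam * (ε * b))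
    rw [sub_add_cancel, abs_mul (2 * lam) (ε * b), abs_mul ε b, abs_of_pos hε, abs_mul 2 lam,
      abs_two] at this
    exact this
  have h9 : ε ^ 4 ≤ 1 := pow_le_one₀ hε.le hε1
  have hd : P.d t ≤ ε * (1 + A) := h5.trans (mul_le_mul_of_nonneg_left (by linarith) hε.le)
  have h10 : ε * |b| + l2sq μ (fun x => φ t x - P.w t x) ≤ ε * (1 + A) := by
    have := mul_le_mul_of_nonneg_left h6 hε.le
    linarith
  have hA0 : 0 ≤ 1 + A := by
    have : 0 ≤ ε * (1 + A) := h4.trans hd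
    exact nonneg_of_mul_nonneg_right this hε
  have h11 : ε ^ 2 * (1 + ∑ j, l2sq μ (Dφ t j)) ≤ ε * (1 + A) := by
    have : ε ^ 2 ≤ ε := by nlinarith
    have h0 : 0 ≤ ∑ j, l2sq μ (Dφ t j) := Finset.sum_nonneg fun j _ => l2sq_nonneg _
    gcongr
  have h12 := mul_le_mul_of_nonneg_left h10 (by positivity : 0 ≤ 2 * |lam|)
  calc |a| ≤ 2 * (ε * (1 + A)) + 2 * |lam| * (ε * (1 + A)) := by linarith
    _ = _ := by ring

/-- The derivative of `‖φ‖² - d`. -/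
lemma integral_eq (hε : 0 < ε) (hW : IsGradRel μ W) (h : IsWeakSol μ W lam φ Dφ) {t : ℝ}
    (ht : t ∈ Icc 0 T) :
    (‖φ t‖ ^ 2 - P.d t) - (‖φ 0‖ ^ 2 - P.d 0) =
      ∫ s in (0 : ℝ)..t, 2 * (IsWeakSol.rate μ lam φ Dφ (P.w s) (P.D s) s).re ∧
      AEStronglyMeasurable (fun s => 2 * (IsWeakSol.rate μ lam φ Dφ (P.w s) (P.D s) s).re)
        (volume.restrict (Ioc 0 t)) := by
  have hsub : Icc 0 t ⊆ Icc 0 T := Icc_subset_Icc_right ht.2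
  obtain ⟨B, hB⟩ := isCompact_Icc.exists_bound_of_continuousOn P.continuousOn
  -- The functional ‖φ‖² - d is the supremum over admissible w of 2 Re⟨w, φ⟩ - ‖w‖² - ε‖∇w‖², so a
  -- maximiser is a subgradient.
  have := h.integral_functional (F := fun s => ‖φ s‖ ^ 2 - P.d s) hW (g := P.w) (G := P.D)
    (B := B / ε) ht.1 P.M_nonneg (fun s _ => P.mem s)
    (fun s _ => P.bdd s) (fun s hs => ?_) (fun s hs r hr => ?_)
  · exact ⟨this.1, this.2.1⟩
  · rw [le_div_iff₀ hε]
    have h1 := P.d_nonneg hε s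
    have h2 := (Real.norm_eq_abs _ ▸ (le_abs_self (P.d s))).trans (hB s (hsub hs))
    have h3 := l2sq_nonneg (μ := μ) (fun x => φ s x - P.w s x)
    linarith [h1.1]
  · have h1 := P.le_cost r _ _ (P.mem s) (P.bdd s)
    have h2 := P.cost_eq s
    have hw := hW.memLp (P.mem s)
    rw [cost, l2sq_sub (Lp.memLp _) hw, l2sq_coe] at h1 h2
    have h3 : ∀ r, (pair μ (P.w s) (φ r)).re = (pair μ (φ r) (P.w s)).re := fun r => by
      rw [pair_conj]; simp
    rw [Complex.sub_re, h3, h3]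
    linarith

end Approx

end

/-! ### The gradient on the zero set, and convergence of the twist. -/

section

variable {Ω : Type*} [MeasurableSpace Ω] {μ : Measure Ω}
  {ι : Type*} [Fintype ι] {W : (Ω → ℂ) → (ι → Ω → ℂ) → Prop} {lam : ℝ}
  {φ : ℝ → Lp ℂ 2 μ} {Dφ : ℝ → ι → Ω → ℂ}

/-- Radial cutoffs that concentrate on the zero set of a function. -/
noncomputable def zeroCoeff (n : ℕ) (r : ℝ) : ℂ := (((1 + (n + 1) * r)⁻¹ : ℝ) : ℂ)

lemma zeroCoeff_pos {n : ℕ} {r : ℝ} (hr : 0 ≤ r) : 0 < 1 + ((n : ℝ) + 1) * r := by positivity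

lemma hasDerivAt_zeroCoeff (n : ℕ) {r : ℝ} (hr : 0 ≤ r) :
    HasDerivAt (zeroCoeff n) ((-((n : ℝ) + 1) / (1 + (n + 1) * r) ^ 2 : ℝ) : ℂ) r := by
  have h : HasDerivAt (fun r : ℝ => 1 + ((n : ℝ) + 1) * r) ((n : ℝ) + 1) r := by
    simpa using ((hasDerivAt_id r).const_mul ((n : ℝ) + 1)).const_add 1
  exact (h.inv (zeroCoeff_pos hr).ne').ofReal_comp

lemma norm_zeroCoeff (n : ℕ) {r : ℝ} (hr : 0 ≤ r) :
    ‖zeroCoeff n r‖ = (1 + (n + 1) * r)⁻¹ ∧ ‖zeroCoeff n r‖ ≤ 1 := by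
  have h1 : ‖zeroCoeff n r‖ = (1 + (n + 1) * r)⁻¹ := by
    rw [zeroCoeff, Complex.norm_real, Real.norm_eq_abs, abs_of_pos (inv_pos.2 (zeroCoeff_pos hr))]
  refine ⟨h1, h1.trans_le (inv_le_one_of_one_le₀ ?_)⟩
  have : 0 ≤ ((n : ℝ) + 1) * r := by positivity
  linarith

lemma norm_deriv_zeroCoeff_le (n : ℕ) {r : ℝ} (hr : 0 ≤ r) :
    2 * r * ‖deriv (zeroCoeff n) r‖ ≤ 2 * (1 + (n + 1) * r)⁻¹ ∧
      2 * r * ‖deriv (zeroCoeff n) r‖ ≤ 2 := by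
  have hp := zeroCoeff_pos (n := n) hr
  have h1 : 2 * r * ‖deriv (zeroCoeff n) r‖ =
      2 * (1 + (n + 1) * r)⁻¹ * (((n : ℝ) + 1) * r / (1 + (n + 1) * r)) := by
    rw [(hasDerivAt_zeroCoeff n hr).deriv, Complex.norm_real, Real.norm_eq_abs, abs_div, abs_neg,
      abs_of_pos (by positivity : (0 : ℝ) < n + 1), abs_of_pos (by positivity)]
    field_simp
  have h2 : ((n : ℝ) + 1) * r / (1 + (n + 1) * r) ≤ 1 := by rw [div_le_one hp]; linarith
  have h3 : 0 ≤ ((n : ℝ) + 1) * r / (1 + (n + 1) * r) := by positivity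
  have h4 : (1 + ((n : ℝ) + 1) * r)⁻¹ ≤ 1 :=
    ((norm_zeroCoeff n hr).1.symm.trans_le (norm_zeroCoeff n hr).2)
  have h5 : 0 ≤ (1 + ((n : ℝ) + 1) * r)⁻¹ := by positivity
  rw [h1]
  constructor <;> nlinarith

/-- The weak gradient of `u` vanishes almost everywhere on the zero set of `u`. -/
lemma IsGradRel.ae_grad_eq_zero (hW : IsGradRel μ W) {u : Ω → ℂ} {D : ι → Ω → ℂ} (hu : W u D)
    (j : ι) : ∀ᵐ x ∂μ, u x = 0 → D j x = 0 := by
  classical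
  have hu2 := hW.memLp hu
  have hD := fun j => hW.memLp_grad hu j
  -- The functions u/(1 + (n+1)|u|²) tend to 0 in L², while their gradients tend to the restriction
  -- of ∇u to the zero set of u. By closedness and uniqueness that restriction is the gradient of 0.
  have hrad := fun n => hW.radial hu (c := zeroCoeff n) (C := 1 + 2) (fun r hr => by
      unfold zeroCoeff
      refine Complex.ofRealCLM.contDiff.contDiffAt.comp r ?_
      exact ContDiffAt.inv (by fun_prop) (zeroCoeff_pos hr).ne')
    (fun r hr => add_le_add (norm_zeroCoeff n hr).2 (norm_deriv_zeroCoeff_le n hr).2)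
  have hlim : ∀ r : ℝ, 0 < r → Tendsto (fun n : ℕ => (1 + ((n : ℝ) + 1) * r)⁻¹) atTop (𝓝 0) := by
    intro r hr
    refine tendsto_inv_atTop_zero.comp (tendsto_atTop_add_const_left _ _ ?_)
    exact (tendsto_atTop_add_const_right _ _ tendsto_natCast_atTop_atTop).atTop_mul_const hr
  -- A measurable representative makes the zero set measurable.
  let u' : Ω → ℂ := hu2.1.mk u
  have hu' : MeasurableSet {x | u' x = 0} :=
    hu2.1.stronglyMeasurable_mk.measurable (measurableSet_singleton 0)
  have huu' : u =ᵐ[μ] u' := hu2.1.ae_eq_mk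
  have hE : ∀ j, MemLp ({x | u' x = 0}.indicator (D j)) 2 μ := fun j => (hD j).indicator hu'
  have hz := hW.closed (v := fun _ => 0) (E := fun j => {x | u' x = 0}.indicator (D j)) hrad
    (by simp) hE ?_ fun j => ?_
  · filter_upwards [hW.unique hz hW.zero j, huu'] with x h1 h2 h3
    rw [indicator_of_mem (by rw [mem_ofPred_eq, ← h2, h3])] at h1
    exact h1
  · refine tendsto_l2sq_of_dominated (b := u)
      (fun n => ((hW.memLp (hrad n)).1.sub aestronglyMeasurable_const)) hu2
      (fun n => Eventually.of_forall fun x => ?_) (Eventually.of_forall fun x => ?_)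
    · rw [sub_zero, norm_mul]
      exact mul_le_of_le_one_left (norm_nonneg _) (norm_zeroCoeff n (by positivity)).2
    · simp only [sub_zero]
      rcases eq_or_ne (u x) 0 with h0 | h0
      · simp [h0]
      · rw [tendsto_zero_iff_norm_tendsto_zero]
        have h1 := (hlim (‖u x‖ ^ 2) (by positivity)).mul_const ‖u x‖
        rw [zero_mul] at h1
        refine h1.congr fun n => ?_
        rw [norm_mul, (norm_zeroCoeff n (by positivity)).1]
  · refine tendsto_l2sq_of_dominated (b := fun x => 4 * D j x)
      (fun n => ((hW.memLp_grad (hrad n) j).1.sub (hE j).1)) ((hD j).const_mul 4)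
      (fun n => Eventually.of_forall fun x => ?_) ?_
    · have h1 := norm_radial_deriv_le (zeroCoeff n (‖u x‖ ^ 2)) (deriv (zeroCoeff n) (‖u x‖ ^ 2))
        (u x) (D j x)
      have h2 := (norm_zeroCoeff n (sq_nonneg ‖u x‖)).2
      have h3 := (norm_deriv_zeroCoeff_le n (sq_nonneg ‖u x‖)).2
      have h4 := norm_indicator_le_norm_self (s := {x | u' x = 0}) (D j) x
      refine (norm_sub_le _ _).trans ((add_le_add h1 h4).trans ?_)
      rw [norm_mul]
      norm_num
      nlinarith [norm_nonneg (D j x)]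
    · filter_upwards [huu'] with x hx
      rcases eq_or_ne (u x) 0 with h0 | h0
      · rw [indicator_of_mem (by rw [mem_ofPred_eq, ← hx, h0])]
        simp [h0, zeroCoeff]
      · rw [indicator_of_notMem (by rw [mem_ofPred_eq, ← hx]; exact h0)]
        simp only [sub_zero]
        have h1 := ((hlim (‖u x‖ ^ 2) (by positivity)).const_mul 3).mul_const ‖D j x‖
        rw [mul_zero, zero_mul] at h1
        refine squeeze_zero_norm (fun n => (norm_radial_deriv_le _ _ _ _).trans ?_) h1
        have h2 := (norm_zeroCoeff n (sq_nonneg ‖u x‖)).1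
        have h3 := (norm_deriv_zeroCoeff_le n (sq_nonneg ‖u x‖)).1
        gcongr
        linarith

/-- The twist is continuous only where its first argument is nonzero. On the zero set of u,
hypothesis `h0` makes the limiting gradient vanish, and there |twist| ≤ |D|² suffices. Elsewhere an
almost everywhere convergent subsequence is used. -/
lemma tendsto_integral_twist {w D : ℕ → Ω → ℂ} {u Du : Ω → ℂ} (hw : ∀ n, MemLp (w n) 2 μ)
    (hD : ∀ n, MemLp (D n) 2 μ) (hu : MemLp u 2 μ) (hDu : MemLp Du 2 μ)
    (h0 : ∀ᵐ x ∂μ, u x = 0 → Du x = 0)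
    (hwu : Tendsto (fun n => l2sq μ (fun x => w n x - u x)) atTop (𝓝 0))
    (hDDu : Tendsto (fun n => l2sq μ (fun x => D n x - Du x)) atTop (𝓝 0)) :
    Tendsto (fun n => ∫ x, twist (w n x) (D n x) ∂μ) atTop (𝓝 (∫ x, twist (u x) (Du x) ∂μ)) := by
  have key : Tendsto (fun n => ∫ x, (twist (w n x) (D n x) - twist (u x) (Du x)) ∂μ) atTop
      (𝓝 0) := by
    refine tendsto_integral_of_subseq fun ns hns => ?_
    obtain ⟨ms, hms, h1⟩ := exists_subseq_tendsto_ae (fun k => hw (ns k)) hu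
      (hwu.comp hns.tendsto_atTop)
    obtain ⟨ls, hls, h2⟩ := exists_subseq_tendsto_ae (fun k => hD (ns (ms k))) hDu
      (hDDu.comp (hns.tendsto_atTop.comp hms.tendsto_atTop))
    refine ⟨ms ∘ ls, hms.comp hls, ?_⟩
    -- the integrand is bounded by `2 |D - Du|² + 3 |Du|²`; subtract the first part
    have hi : ∀ n, Integrable (fun x => twist (w n x) (D n x)) μ := fun n =>
      integrable_twist (hw n).1 (hD n)
    have hiu := integrable_twist hu.1 hDu
    set N : ℕ → ℕ := fun k => ns (ms (ls k)) with hN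
    let f : ℕ → Ω → ℝ := fun k x => twist (w (N k) x) (D (N k) x) - twist (u x) (Du x)
    -- Clipping f at ±3|Du|² gives a dominated sequence, which is identically zero wherever Du = 0;
    -- the part cut off is at most 2|D - Du|² and tends to zero in L¹.
    let g : ℕ → Ω → ℝ := fun k x => max (-(3 * ‖Du x‖ ^ 2)) (min (f k x) (3 * ‖Du x‖ ^ 2))
    have hf : ∀ k, Integrable (f k) μ := fun k => (hi _).sub hiu
    have hb : Integrable (fun x => 3 * ‖Du x‖ ^ 2) μ := (integrable_norm_sq hDu).const_mul 3
    have hfg : ∀ k x, |f k x - g k x| ≤ 2 * ‖D (N k) x - Du x‖ ^ 2 := by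
      intro k x
      have h1 := abs_twist_le (w (N k) x) (D (N k) x)
      have h2 := abs_twist_le (u x) (Du x)
      have h3 : ‖D (N k) x‖ ^ 2 ≤ 2 * ‖D (N k) x - Du x‖ ^ 2 + 2 * ‖Du x‖ ^ 2 := by
        have : ‖D (N k) x‖ ≤ ‖D (N k) x - Du x‖ + ‖Du x‖ := by
          simpa using norm_add_le (D (N k) x - Du x) (Du x)
        nlinarith [sq_nonneg (‖D (N k) x - Du x‖ - ‖Du x‖), norm_nonneg (D (N k) x)]
      have h4 : |f k x| ≤ 2 * ‖D (N k) x - Du x‖ ^ 2 + 3 * ‖Du x‖ ^ 2 := by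
        refine (abs_sub _ _).trans ?_
        linarith
      have h5 : 0 ≤ 3 * ‖Du x‖ ^ 2 := by positivity
      have h6 : 0 ≤ 2 * ‖D (N k) x - Du x‖ ^ 2 := by positivity
      simp only [g]
      rw [abs_le] at h4 ⊢
      rcases le_total (f k x) (3 * ‖Du x‖ ^ 2) with h | h
      · rw [min_eq_left h]
        rcases le_total (-(3 * ‖Du x‖ ^ 2)) (f k x) with h' | h'
        · rw [max_eq_right h']; constructor <;> linarith
        · rw [max_eq_left h']; constructor <;> linarith
      · rw [min_eq_right h, max_eq_right (by linarith)]; constructor <;> linarith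
    have hgm : ∀ k, AEStronglyMeasurable (g k) μ := fun k =>
      hb.1.neg.sup ((hf k).1.inf hb.1)
    have hgb : ∀ k x, |g k x| ≤ 3 * ‖Du x‖ ^ 2 := fun k x => by
      have h5 : 0 ≤ 3 * ‖Du x‖ ^ 2 := by positivity
      rw [abs_le]
      exact ⟨le_max_left _ _, max_le (by linarith) (min_le_right _ _)⟩
    have hgi : ∀ k, Integrable (g k) μ := fun k =>
      hb.mono' (hgm k) (Eventually.of_forall fun x => hgb k x)
    have hg0 : Tendsto (fun k => ∫ x, g k x ∂μ) atTop (𝓝 (∫ _, (0 : ℝ) ∂μ)) := by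
      refine tendsto_integral_of_dominated_convergence _ hgm hb
        (fun k => Eventually.of_forall fun x => hgb k x) ?_
      filter_upwards [h0, h1, h2] with x hx0 hx1 hx2
      have hx1' : Tendsto (fun k => w (N k) x) atTop (𝓝 (u x)) := hx1.comp hls.tendsto_atTop
      rcases eq_or_ne (u x) 0 with h | h
      · have hDu0 : Du x = 0 := hx0 h
        have : ∀ k, g k x = 0 := fun k => by simp [g, hDu0]
        simp [this]
      · have hf0 : Tendsto (fun k => f k x) atTop (𝓝 0) := by
          have := ((continuousAt_twist (p := Du x) h).tendsto.comp
            (hx1'.prodMk_nhds hx2)).sub_const (twist (u x) (Du x))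
          simpa [f] using this
        have h5 : 0 ≤ 3 * ‖Du x‖ ^ 2 := by positivity
        have := (tendsto_const_nhds (x := -(3 * ‖Du x‖ ^ 2))).max (hf0.min
          (tendsto_const_nhds (x := 3 * ‖Du x‖ ^ 2)))
        rwa [min_eq_left h5, max_eq_right (by linarith)] at this
    rw [integral_zero] at hg0
    have hdiff : Tendsto (fun k => ∫ x, (f k x - g k x) ∂μ) atTop (𝓝 0) := by
      have hlim : Tendsto (fun k => 2 * l2sq μ (fun x => D (N k) x - Du x)) atTop (𝓝 0) := by
        have := (hDDu.comp (hns.tendsto_atTop.comp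
          (hms.tendsto_atTop.comp hls.tendsto_atTop))).const_mul 2
        simpa using this
      refine squeeze_zero_norm (fun k => ?_) hlim
      rw [l2sq, ← integral_const_mul]
      exact norm_integral_le_of_norm_le ((integrable_norm_sq ((hD _).sub hDu)).const_mul 2)
        (Eventually.of_forall fun x => hfg k x)
    have := hdiff.add hg0
    rw [add_zero] at this
    refine this.congr fun k => ?_
    rw [integral_sub (hf k) (hgi k), sub_add_cancel]
    rfl
  have hi : ∀ n, Integrable (fun x => twist (w n x) (D n x)) μ := fun n =>
    integrable_twist (hw n).1 (hD n)
  have := key.add_const (∫ x, twist (u x) (Du x) ∂μ)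
  rw [zero_add] at this
  refine this.congr fun n => ?_
  rw [integral_sub (hi n) (integrable_twist hu.1 hDu), sub_add_cancel]

end

/-! ### Conservation of mass and balance of energy. -/

section

variable {Ω : Type*} [MeasurableSpace Ω] {μ : Measure Ω}
  {ι : Type*} [Fintype ι] {W : (Ω → ℂ) → (ι → Ω → ℂ) → Prop} {lam : ℝ}
  {φ : ℝ → Lp ℂ 2 μ} {Dφ : ℝ → ι → Ω → ℂ}

/-- The Dirichlet energy `∑_j ∫ |D_j|²`. -/
noncomputable def energy (μ : Measure Ω) (D : ι → Ω → ℂ) : ℝ := ∑ j, l2sq μ (D j)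

lemma energy_nonneg (D : ι → Ω → ℂ) : 0 ≤ energy μ D := Finset.sum_nonneg fun _ _ => l2sq_nonneg _

/-- The total twist `∑_j ∫ 2 Re (ū D_j) Im (ū D_j) / |u|²`, the dissipation rate of the energy. -/
noncomputable def totalTwist (μ : Measure Ω) (u : Ω → ℂ) (D : ι → Ω → ℂ) : ℝ :=
  ∑ j, ∫ x, twist (u x) (D j x) ∂μ

lemma abs_totalTwist_le {u : Ω → ℂ} {D : ι → Ω → ℂ} (hD : ∀ j, MemLp (D j) 2 μ) :
    |totalTwist μ u D| ≤ energy μ D := by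
  refine (Finset.abs_sum_le_sum_abs _ _).trans (Finset.sum_le_sum fun j _ => ?_)
  rw [← Real.norm_eq_abs]
  exact norm_integral_le_of_norm_le (integrable_norm_sq (hD j))
    (Eventually.of_forall fun x => abs_twist_le _ _)

/-- The scales at which the solution is approximated. -/
noncomputable def scale (n : ℕ) : ℝ := 1 / (n + 1)

lemma scale_pos (n : ℕ) : 0 < scale n := by unfold scale; positivity

lemma scale_le_one (n : ℕ) : scale n ≤ 1 := by
  unfold scale
  rw [div_le_one (by positivity)]
  linarith [Nat.cast_nonneg (α := ℝ) n]

lemma tendsto_scale : Tendsto scale atTop (𝓝 0) := tendsto_one_div_add_atTop_nhds_zero_nat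

lemma antitone_scale : Antitone scale := fun n m hnm => by
  unfold scale
  have : (n : ℝ) ≤ m := by exact_mod_cast hnm
  gcongr

lemma tendsto_scale_pow {k : ℕ} (hk : k ≠ 0) : Tendsto (fun n => scale n ^ k) atTop (𝓝 0) := by
  simpa [hk] using tendsto_scale.pow k

variable {T : ℝ} (P : ∀ n, Approx μ W φ Dφ T (scale n))

include P

/-- The corresponding statements for the unconstrained minimisers carry over because δ ≤ d ≤ δ + ε⁵.
The second limit, ‖φ - w‖² = o(ε), is what makes the error in the logarithmic term negligible after
division by ε. -/
lemma Approx.tendsto_d (hW : IsGradRel μ W) (h : IsWeakSol μ W lam φ Dφ) {t : ℝ}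
    (ht : t ∈ Icc 0 T) :
    Tendsto (fun n => (P n).d t / scale n) atTop (𝓝 (energy μ (Dφ t))) ∧
    Tendsto (fun n => l2sq μ (fun x => φ t x - (P n).w t x) / scale n) atTop (𝓝 0) ∧
    ∀ j, Tendsto (fun n => l2sq μ (fun x => (P n).D t j x - Dφ t j x)) atTop (𝓝 0) := by
  have hg := h.grad t ht.1
  obtain ⟨h1, h2⟩ := hW.minimiser_tendsto scale_pos antitone_scale tendsto_scale hg
    (fun n => (P n).mem' t) (fun n => (P n).cost_eq' t) (fun n => (P n).pyth t)
  have hφ := hW.memLp hg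
  have hw := fun n => hW.memLp ((P n).mem t)
  have hv := fun n => hW.memLp ((P n).mem' t)
  have hgap : Tendsto (fun n => energy μ (Dφ t) - (P n).δ t / scale n) atTop (𝓝 0) := by
    have := h1.const_sub (energy μ (Dφ t))
    simpa [energy] using this
  refine ⟨?_, ?_, fun j => ?_⟩
  · have h3 := h1.add (tendsto_scale_pow (k := 4) (by norm_num))
    rw [add_zero] at h3
    refine tendsto_of_tendsto_of_tendsto_of_le_of_le h1 h3 (fun n => ?_) (fun n => ?_)
    · have := ((P n).d_le (scale_pos n) h ht).1
      exact div_le_div_of_nonneg_right this (scale_pos n).le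
    · have h4 := (P n).close t ht
      have h5 := (scale_pos n).ne'
      simp only
      rw [div_le_iff₀ (scale_pos n), add_mul, div_mul_cancel₀ _ h5]
      linarith [show scale n ^ 4 * scale n = scale n ^ 5 by ring]
  · have h3 := (hgap.const_mul 2).add ((tendsto_scale_pow (k := 4) (by norm_num)).const_mul 2)
    simp only [mul_zero, add_zero] at h3
    refine squeeze_zero (fun n => div_nonneg (l2sq_nonneg _) (scale_pos n).le) (fun n => ?_) h3
    have h4 := l2sq_sub_le hφ (hv n) (hw n)
    have h5 := ((P n).close' (scale_pos n) ht).1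
    rw [l2sq_sub_comm] at h5
    have h6 := h2 n
    have h7 : 0 ≤ ∑ j, l2sq μ (fun x => Dφ t j x - (P n).E t j x) :=
      Finset.sum_nonneg fun j _ => l2sq_nonneg _
    have h8 : l2sq μ (fun x => φ t x - (P n).v t x) ≤
        (energy μ (Dφ t) - (P n).δ t / scale n) * scale n := by
      rw [← div_le_iff₀ (scale_pos n), energy]
      linarith
    rw [div_le_iff₀ (scale_pos n)]
    nlinarith [show scale n ^ 4 * scale n = scale n ^ 5 by ring]
  · have h3 := (hgap.const_mul 2).add ((tendsto_scale_pow (k := 4) (by norm_num)).const_mul 2)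
    simp only [mul_zero, add_zero] at h3
    refine squeeze_zero (fun n => l2sq_nonneg _) (fun n => ?_) h3
    have h4 := l2sq_sub_le (hW.memLp_grad hg j) (hW.memLp_grad ((P n).mem' t) j)
      (hW.memLp_grad ((P n).mem t) j)
    rw [l2sq_sub_comm (Dφ t j) ((P n).D t j)] at h4
    have h5 := ((P n).close' (scale_pos n) ht).2
    have h6 := h2 n
    have h7 := Finset.single_le_sum (f := fun j => l2sq μ (fun x => (P n).D t j x - (P n).E t j x))
      (fun j _ => l2sq_nonneg _) (Finset.mem_univ j)
    have h8 := Finset.single_le_sum (f := fun j => l2sq μ (fun x => Dφ t j x - (P n).E t j x))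
      (fun j _ => l2sq_nonneg _) (Finset.mem_univ j)
    have h9 : 0 ≤ l2sq μ (fun x => φ t x - (P n).v t x) / scale n :=
      div_nonneg (l2sq_nonneg _) (scale_pos n).le
    have h10 := l2sq_sub_comm (μ := μ) ((P n).E t j) ((P n).D t j)
    simp only [energy] at *
    linarith

variable [IsProbabilityMeasure μ]

/-- The error in the formula for the rate is o(ε), and the twist of the minimiser converges since w
and ∇w converge in L². -/
lemma Approx.tendsto_rate (hW : IsGradRel μ W) (h : IsWeakSol μ W lam φ Dφ) {t : ℝ}
    (ht : t ∈ Icc 0 T) :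
    Tendsto (fun n => 2 * (IsWeakSol.rate μ lam φ Dφ ((P n).w t) ((P n).D t) t).re / scale n)
      atTop (𝓝 (2 * lam * totalTwist μ (φ t) (Dφ t))) := by
  obtain ⟨-, h2, h3⟩ := Approx.tendsto_d P hW h ht
  have hg := h.grad t ht.1
  have hwφ : Tendsto (fun n => l2sq μ (fun x => (P n).w t x - φ t x)) atTop (𝓝 0) := by
    have := h2.mul tendsto_scale
    rw [zero_mul] at this
    refine this.congr fun n => ?_
    rw [div_mul_cancel₀ _ (scale_pos n).ne', l2sq_sub_comm]
  have hY : Tendsto (fun n => totalTwist μ ((P n).w t) ((P n).D t)) atTop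
      (𝓝 (totalTwist μ (φ t) (Dφ t))) :=
    tendsto_finsetSum _ fun j _ => tendsto_integral_twist (fun n => hW.memLp ((P n).mem t))
      (fun n => hW.memLp_grad ((P n).mem t) j) (hW.memLp hg) (hW.memLp_grad hg j)
      (hW.ae_grad_eq_zero hg j) hwφ (h3 j)
  have hdiff : Tendsto (fun n => 2 * (IsWeakSol.rate μ lam φ Dφ ((P n).w t) ((P n).D t) t).re /
      scale n - 2 * lam * totalTwist μ ((P n).w t) ((P n).D t)) atTop (𝓝 0) := by
    have h4 := (tendsto_scale.const_mul (2 * (1 + energy μ (Dφ t)))).add (h2.const_mul (2 * |lam|))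
    simp only [mul_zero, add_zero] at h4
    refine squeeze_zero_norm (fun n => ?_) h4
    have h5 := (P n).abs_rate_sub_le (scale_pos n) hW h ht
    have h6 := scale_pos n
    have h7 : 2 * (IsWeakSol.rate μ lam φ Dφ ((P n).w t) ((P n).D t) t).re / scale n -
        2 * lam * totalTwist μ ((P n).w t) ((P n).D t) =
        (2 * (IsWeakSol.rate μ lam φ Dφ ((P n).w t) ((P n).D t) t).re - 2 * lam * (scale n *
          ∑ j, ∫ x, twist ((P n).w t x) ((P n).D t j x) ∂μ)) / scale n := by
      rw [totalTwist, sub_div]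
      congr 1
      field_simp
    rw [Real.norm_eq_abs, h7, abs_div, abs_of_pos h6, div_le_iff₀ h6]
    refine h5.trans (le_of_eq ?_)
    rw [add_mul, ← mul_div_assoc, div_mul_cancel₀ _ h6.ne', energy]
    ring
  have := hdiff.add (hY.const_mul (2 * lam))
  simpa using this

omit P

/-- Conservation of mass and the balance of energy. -/
theorem IsWeakSol.conservation (hW : IsGradRel μ W) (h : IsWeakSol μ W lam φ Dφ) {T : ℝ}
    (hT : 0 ≤ T) :
    ‖φ T‖ ^ 2 = ‖φ 0‖ ^ 2 ∧
    IntervalIntegrable (fun t => lam * totalTwist μ (φ t) (Dφ t)) volume 0 T ∧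
    energy μ (Dφ T) = energy μ (Dφ 0) -
      2 * ∫ t in (0 : ℝ)..T, lam * totalTwist μ (φ t) (Dφ t) := by
  have P : ∀ n, Approx μ W φ Dφ T (scale n) := fun n =>
    (h.exists_approx hW T (scale_pos n)).some
  obtain ⟨A, hA0, hA⟩ := h.exists_norm_le T
  have h0 : (0 : ℝ) ∈ Icc 0 T := ⟨le_rfl, hT⟩
  have hTT : T ∈ Icc 0 T := ⟨hT, le_rfl⟩
  set K := (2 + 2 * |lam|) * (1 + A) with hK
  have hrate : ∀ n, ∀ t ∈ Icc 0 T,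
      |2 * (rate μ lam φ Dφ ((P n).w t) ((P n).D t) t).re| ≤ scale n * K := fun n t ht =>
    (P n).abs_rate_le (scale_pos n) (scale_le_one n) hW h ht (hA t ht).2
  have hint := fun n => (P n).integral_eq (scale_pos n) hW h hTT
  have hd : ∀ t ∈ Icc 0 T, Tendsto (fun n => (P n).d t) atTop (𝓝 0) := fun t ht => by
    have := (Approx.tendsto_d P hW h ht).1.mul tendsto_scale
    rw [mul_zero] at this
    exact this.congr fun n => div_mul_cancel₀ _ (scale_pos n).ne'
  -- The increment of ‖φ‖² - d is O(ε), and d itself tends to zero.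
  have hmass : ‖φ T‖ ^ 2 = ‖φ 0‖ ^ 2 := by
    have h1 : Tendsto (fun n => (‖φ T‖ ^ 2 - (P n).d T) - (‖φ 0‖ ^ 2 - (P n).d 0)) atTop
        (𝓝 ((‖φ T‖ ^ 2 - 0) - (‖φ 0‖ ^ 2 - 0))) :=
      ((hd T hTT).const_sub _).sub ((hd 0 h0).const_sub _)
    have h2 : Tendsto (fun n => (‖φ T‖ ^ 2 - (P n).d T) - (‖φ 0‖ ^ 2 - (P n).d 0)) atTop
        (𝓝 0) := by
      have h3 : Tendsto (fun n => scale n * K * T) atTop (𝓝 0) := by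
        simpa using (tendsto_scale.mul_const K).mul_const T
      refine squeeze_zero_norm (fun n => ?_) h3
      rw [(hint n).1]
      refine (intervalIntegral.norm_integral_le_of_norm_le_const (C := scale n * K)
        fun t ht => ?_).trans (le_of_eq ?_)
      · rw [uIoc_of_le hT] at ht
        exact hrate n t (Ioc_subset_Icc_self ht)
      · rw [sub_zero, abs_of_nonneg hT]
    have := tendsto_nhds_unique h1 h2
    linarith
  have hlim : ∀ t ∈ Icc 0 T, Tendsto (fun n => 2 * (rate μ lam φ Dφ ((P n).w t) ((P n).D t) t).re /
      scale n) atTop (𝓝 (2 * lam * totalTwist μ (φ t) (Dφ t))) :=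
    fun t ht => Approx.tendsto_rate P hW h ht
  have hmeasn : ∀ n, AEStronglyMeasurable (fun t => 2 * (rate μ lam φ Dφ ((P n).w t)
      ((P n).D t) t).re / scale n) (volume.restrict (uIoc 0 T)) := fun n => by
    rw [uIoc_of_le hT]
    exact ((hint n).2.aemeasurable.div_const _).aestronglyMeasurable
  have hae : ∀ {p : ℝ → Prop}, (∀ t ∈ Icc 0 T, p t) → ∀ᵐ t, t ∈ uIoc 0 T → p t := by
    intro p hp
    refine Eventually.of_forall fun t ht => ?_
    rw [uIoc_of_le hT] at ht
    exact hp t (Ioc_subset_Icc_self ht)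
  have hb : ∀ n, ∀ t ∈ Icc 0 T,
      ‖2 * (rate μ lam φ Dφ ((P n).w t) ((P n).D t) t).re / scale n‖ ≤ K := fun n t ht => by
    rw [Real.norm_eq_abs, abs_div, abs_of_pos (scale_pos n), div_le_iff₀ (scale_pos n), mul_comm K]
    exact hrate n t ht
  have hdct := intervalIntegral.tendsto_integral_filter_of_dominated_convergence (fun _ => K)
    (Eventually.of_forall hmeasn) (Eventually.of_forall fun n => hae (hb n))
    (intervalIntegrable_const) (hae hlim)
  have hmeas : AEStronglyMeasurable (fun t => 2 * lam * totalTwist μ (φ t) (Dφ t))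
      (volume.restrict (uIoc 0 T)) :=
    aestronglyMeasurable_of_tendsto_ae atTop hmeasn
      ((ae_restrict_iff' measurableSet_uIoc).2 (hae hlim))
  have hii : IntervalIntegrable (fun t => 2 * lam * totalTwist μ (φ t) (Dφ t)) volume 0 T := by
    rw [intervalIntegrable_iff]
    refine IntegrableOn.of_bound (by simp) hmeas K
      ((ae_restrict_iff' measurableSet_uIoc).2 (hae fun t ht => ?_))
    exact le_of_tendsto (hlim t ht).norm (Eventually.of_forall fun n => hb n t ht)
  refine ⟨hmass, ?_, ?_⟩
  · have := hii.const_mul 2⁻¹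
    refine this.congr fun t _ => ?_
    ring
  · have h1 := (Approx.tendsto_d P hW h hTT).1.sub (Approx.tendsto_d P hW h h0).1
    -- Conservation of mass cancels ‖φ‖² before the division by ε, leaving only the increment of d,
    -- with a change of sign.
    have h2 : Tendsto (fun n => (P n).d T / scale n - (P n).d 0 / scale n) atTop
        (𝓝 (-∫ t in (0 : ℝ)..T, 2 * lam * totalTwist μ (φ t) (Dφ t))) := by
      refine hdct.neg.congr fun n => ?_
      rw [intervalIntegral.integral_div, ← (hint n).1, hmass]
      ring
    have h3 := tendsto_nhds_unique h1 h2
    have h4 : ∫ t in (0 : ℝ)..T, 2 * lam * totalTwist μ (φ t) (Dφ t) =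
        2 * ∫ t in (0 : ℝ)..T, lam * totalTwist μ (φ t) (Dφ t) := by
      rw [← intervalIntegral.integral_const_mul]
      congr 1
      ext t
      ring
    rw [h4] at h3
    linarith

/-- Grönwall's inequality in integral form. -/
lemma exp_bound_of_integral_le {e : ℝ → ℝ} {K T : ℝ} (hK : 0 ≤ K) (hT : 0 ≤ T)
    (he : ContinuousOn e (Icc 0 T))
    (h : ∀ t ∈ Icc 0 T, e t ≤ e 0 + K * ∫ s in (0 : ℝ)..t, e s) :
    e 0 + K * ∫ s in (0 : ℝ)..T, e s ≤ Real.exp (K * T) * e 0 := by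
  -- A continuous extension to the whole line makes the primitive differentiable everywhere,
  -- endpoints included.
  let e' : ℝ → ℝ := fun s => e (projIcc 0 T hT s)
  have he' : Continuous e' := by
    have := he.domRestrict
    exact this.comp continuous_projIcc
  have hee : ∀ s ∈ Icc 0 T, e' s = e s := fun s hs => by simp [e', projIcc_of_mem hT hs]
  have hint : ∀ t ∈ Icc 0 T, ∫ s in (0 : ℝ)..t, e' s = ∫ s in (0 : ℝ)..t, e s := fun t ht => by
    refine intervalIntegral.integral_congr fun s hs => hee s ?_
    rw [uIcc_of_le ht.1] at hs
    exact ⟨hs.1, hs.2.trans ht.2⟩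
  let G : ℝ → ℝ := fun t => e 0 + K * ∫ s in (0 : ℝ)..t, e' s
  have hG : ∀ t, HasDerivAt G (K * e' t) t := fun t =>
    ((intervalIntegral.integral_hasDerivAt_right (he'.intervalIntegrable _ _)
      (he'.stronglyMeasurableAtFilter _ _) he'.continuousAt).const_mul K).const_add _
  -- The primitive G satisfies G' = Ke' ≤ KG.
  have hmono : AntitoneOn (fun t => Real.exp (-(K * t)) * G t) (Icc 0 T) := by
    have hd : ∀ t, HasDerivAt (fun t => Real.exp (-(K * t)) * G t)
        (Real.exp (-(K * t)) * (-(K * 1)) * G t + Real.exp (-(K * t)) * (K * e' t)) t := fun t =>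
      (((hasDerivAt_id t).const_mul K).neg.exp).mul (hG t)
    refine antitoneOn_of_deriv_nonpos (convex_Icc 0 T)
      (fun t _ => (hd t).continuousAt.continuousWithinAt)
      (fun t _ => (hd t).differentiableAt.differentiableWithinAt) fun t ht => ?_
    rw [interior_Icc] at ht
    have ht' := Ioo_subset_Icc_self ht
    have h1 := h t ht'
    rw [← hint t ht', ← hee t ht'] at h1
    rw [(hd t).deriv]
    have h2 : 0 ≤ Real.exp (-(K * t)) * K := by positivity
    have h3 : e' t ≤ G t := h1
    nlinarith
  have h1 := hmono ⟨le_rfl, hT⟩ ⟨hT, le_rfl⟩ hT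
  simp only [G, hint T ⟨hT, le_rfl⟩, mul_zero, neg_zero, Real.exp_zero, one_mul,
    intervalIntegral.integral_same, add_zero] at h1
  rw [Real.exp_neg, inv_mul_le_iff₀ (Real.exp_pos _)] at h1
  exact h1

/-- As |Y| is at most the energy, Grönwall's inequality bounds not just the final energy but the
initial energy plus 2|λ| times the integral of the energy. The latter controls the integral of λY,
and it yields the factor (e^{2|λ|t} - 1)/|λ| in the entropy bound. -/
theorem IsWeakSol.energy_bound (hW : IsGradRel μ W) (h : IsWeakSol μ W lam φ Dφ) {T : ℝ}
    (hT : 0 ≤ T) :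
    energy μ (Dφ T) ≤ Real.exp (2 * |lam| * T) * energy μ (Dφ 0) ∧
    energy μ (Dφ 0) + 2 * |∫ t in (0 : ℝ)..T, lam * totalTwist μ (φ t) (Dφ t)| ≤
      Real.exp (2 * |lam| * T) * energy μ (Dφ 0) := by
  have hc := fun t ht => h.conservation hW (T := t) ht
  -- Continuity of the energy is itself a consequence of the balance, which exhibits it as a
  -- primitive.
  have hcont : ContinuousOn (fun t => energy μ (Dφ t)) (Icc 0 T) := by
    have h1 : ContinuousOn (fun t => energy μ (Dφ 0) -
        2 * ∫ s in (0 : ℝ)..t, lam * totalTwist μ (φ s) (Dφ s)) (Icc 0 T) := by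
      have := intervalIntegral.continuousOn_primitive_interval (μ := volume)
        ((intervalIntegrable_iff' enorm_ne_top).1 (hc T hT).2.1)
      rw [uIcc_of_le hT] at this
      exact continuousOn_const.sub (continuousOn_const.mul this)
    exact h1.congr fun t ht => (hc t ht.1).2.2
  have hb : ∀ t ∈ Icc 0 T, |∫ s in (0 : ℝ)..t, lam * totalTwist μ (φ s) (Dφ s)| ≤
      |lam| * ∫ s in (0 : ℝ)..t, energy μ (Dφ s) := by
    intro t ht
    rw [← intervalIntegral.integral_const_mul, ← Real.norm_eq_abs]
    refine intervalIntegral.norm_integral_le_of_norm_le ht.1 ?_ ?_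
    · refine Eventually.of_forall fun s hs => ?_
      rw [Real.norm_eq_abs, abs_mul]
      gcongr
      exact abs_totalTwist_le fun j => hW.memLp_grad (h.grad s hs.1.le) j
    · refine ContinuousOn.intervalIntegrable ?_
      rw [uIcc_of_le ht.1]
      exact continuousOn_const.mul (hcont.mono (Icc_subset_Icc_right ht.2))
  have hg := exp_bound_of_integral_le (e := fun t => energy μ (Dφ t)) (K := 2 * |lam|)
    (by positivity) hT hcont fun t ht => by
      have h1 := (hc t ht.1).2.2
      have h2 := hb t ht
      have h3 := neg_abs_le (∫ s in (0 : ℝ)..t, lam * totalTwist μ (φ s) (Dφ s))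
      rw [h1]
      linarith
  have h2 := hb T ⟨hT, le_rfl⟩
  refine ⟨?_, by linarith⟩
  have h1 := (hc T hT).2.2
  have h3 := neg_abs_le (∫ s in (0 : ℝ)..T, lam * totalTwist μ (φ s) (Dφ s))
  linarith

end

/-! ### Regularised logarithms -/

/-- A bounded regularisation of `log r`. -/
noncomputable def logReg (κ r : ℝ) : ℝ := Real.log ((r + κ) / (1 + κ * r))

section

variable {κ r : ℝ}

lemma logReg_bounds (hκ : 0 < κ) (hκ1 : κ ≤ 1) (hr : 0 ≤ r) :
    Real.log κ ≤ logReg κ r ∧ logReg κ r ≤ -Real.log κ := by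
  have h1 : 0 < 1 + κ * r := by positivity
  constructor
  · refine Real.log_le_log hκ ?_
    rw [le_div_iff₀ h1]
    nlinarith [mul_nonneg hκ.le hr]
  · rw [← Real.log_inv]
    refine Real.log_le_log (by positivity) ?_
    rw [div_le_iff₀ h1, inv_mul_eq_div, le_div_iff₀ hκ]
    nlinarith

lemma hasDerivAt_logReg (hκ : 0 < κ) (hr : 0 ≤ r) :
    HasDerivAt (logReg κ) ((1 - κ ^ 2) / ((r + κ) * (1 + κ * r))) r := by
  have h1 : 0 < 1 + κ * r := by positivity
  have h2 : 0 < r + κ := by positivity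
  have h3 : HasDerivAt (fun r => r + κ) 1 r := (hasDerivAt_id r).add_const κ
  have h4 : HasDerivAt (fun r => 1 + κ * r) κ r := by
    simpa using ((hasDerivAt_id r).const_mul κ).const_add 1
  refine ((h3.div h4 h1.ne').log (div_pos h2 h1).ne').congr_deriv ?_
  simp only [Pi.div_apply]
  field_simp
  ring

/-- The weight in front of the twist in the entropy balance is twice this quantity; being bounded
uniformly in κ, it permits dominated convergence. -/
lemma mul_deriv_logReg (hκ : 0 < κ) (hκ1 : κ ≤ 1) (hr : 0 ≤ r) :
    0 ≤ r * deriv (logReg κ) r ∧ r * deriv (logReg κ) r ≤ 1 := by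
  have h0 : 0 ≤ 1 - κ ^ 2 := by nlinarith
  rw [(hasDerivAt_logReg hκ hr).deriv, ← mul_div_assoc]
  refine ⟨by positivity, ?_⟩
  rw [div_le_one (by positivity)]
  nlinarith [mul_nonneg hκ.le hr, mul_nonneg (mul_nonneg hκ.le hr) hr, sq_nonneg κ,
    mul_nonneg (sq_nonneg κ) hr]

lemma contDiffAt_logReg (hκ : 0 < κ) (hr : 0 ≤ r) : ContDiffAt ℝ 1 (logReg κ) r := by
  unfold logReg
  have h1 : 1 + κ * r ≠ 0 := by positivity
  have h2 : (r + κ) / (1 + κ * r) ≠ 0 := by positivity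
  exact ((by fun_prop : ContDiffAt ℝ 1 (fun r => r + κ) r).div
    (by fun_prop : ContDiffAt ℝ 1 (fun r => 1 + κ * r) r) h1).log h2

lemma logReg_mono (hκ : 0 < κ) (hκ1 : κ ≤ 1) {r' : ℝ} (hr : 0 ≤ r) (hrr : r ≤ r') :
    logReg κ r ≤ logReg κ r' := by
  refine Real.log_le_log (by positivity) ?_
  have hr' := hr.trans hrr
  rw [div_le_div_iff₀ (by positivity) (by positivity)]
  nlinarith [mul_le_mul_of_nonneg_left hrr hκ.le, mul_nonneg (sub_nonneg.2 hrr)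
    (by nlinarith : 0 ≤ 1 - κ ^ 2)]

lemma logReg_of_le_one (hκ : 0 < κ) (hκ1 : κ ≤ 1) (hr : 0 < r) (hr1 : r ≤ 1) :
    Real.log r ≤ logReg κ r ∧ logReg κ r ≤ 0 := by
  have h1 : 0 < 1 + κ * r := by positivity
  constructor
  · refine Real.log_le_log hr ?_
    rw [le_div_iff₀ h1]
    nlinarith [mul_nonneg hκ.le hr.le]
  · refine Real.log_nonpos (by positivity) ?_
    rw [div_le_one h1]
    nlinarith

lemma logReg_of_one_le (hκ : 0 < κ) (hκ1 : κ ≤ 1) (hr1 : 1 ≤ r) :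
    0 ≤ logReg κ r ∧ logReg κ r ≤ Real.log r := by
  have h1 : 0 < 1 + κ * r := by positivity
  constructor
  · refine Real.log_nonneg ?_
    rw [le_div_iff₀ h1]
    nlinarith
  · refine Real.log_le_log (by positivity) ?_
    rw [div_le_iff₀ h1]
    nlinarith [mul_nonneg hκ.le (by linarith : 0 ≤ r)]

/-- The regularisation preserves the sign change at r = 1 and moves the logarithm towards zero on
both sides of it. -/
lemma abs_logReg_le (hκ : 0 < κ) (hκ1 : κ ≤ 1) (hr : 0 < r) : |logReg κ r| ≤ |Real.log r| := by
  rcases le_total r 1 with h | h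
  · have := logReg_of_le_one hκ hκ1 hr h
    rw [abs_of_nonpos this.2, abs_of_nonpos (this.1.trans this.2)]
    linarith
  · have := logReg_of_one_le hκ hκ1 h
    rw [abs_of_nonneg this.1, abs_of_nonneg (this.1.trans this.2)]
    exact this.2

lemma tendsto_logReg {κ : ℕ → ℝ} (hκ : Tendsto κ atTop (𝓝 0)) (hr : 0 < r) :
    Tendsto (fun n => logReg (κ n) r) atTop (𝓝 (Real.log r)) := by
  have h1 : Tendsto (fun n => (r + κ n) / (1 + κ n * r)) atTop (𝓝 ((r + 0) / (1 + 0 * r))) :=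
    (hκ.const_add r).div ((hκ.mul_const r).const_add 1) (by simp)
  simp only [add_zero, zero_mul, div_one] at h1
  exact h1.log hr.ne'

lemma tendsto_mul_deriv_logReg {κ : ℕ → ℝ} (hκ0 : ∀ n, 0 < κ n) (hκ : Tendsto κ atTop (𝓝 0))
    (hr : 0 < r) : Tendsto (fun n => r * deriv (logReg (κ n)) r) atTop (𝓝 1) := by
  have h1 : Tendsto (fun n => r * ((1 - κ n ^ 2) / ((r + κ n) * (1 + κ n * r)))) atTop
      (𝓝 (r * ((1 - 0 ^ 2) / ((r + 0) * (1 + 0 * r))))) :=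
    ((((hκ.pow 2).const_sub 1).div ((hκ.const_add r).mul ((hκ.mul_const r).const_add 1))
      (by simpa using hr.ne')).const_mul r)
  have h2 : r * ((1 - 0 ^ 2) / ((r + 0) * (1 + 0 * r))) = 1 := by field_simp; ring
  rw [h2] at h1
  exact h1.congr fun n => by rw [(hasDerivAt_logReg (hκ0 n) hr.le).deriv]

/-- A factor that truncates at large values, such that `√r * damp n r` is bounded and
increasing. -/
noncomputable def damp (n : ℕ) (r : ℝ) : ℝ := (√(1 + r / (n + 1)))⁻¹

lemma damp_arg_pos (n : ℕ) (hr : 0 ≤ r) : 0 < 1 + r / ((n : ℝ) + 1) := by positivity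

lemma damp_pos (n : ℕ) (hr : 0 ≤ r) : 0 < damp n r :=
  inv_pos.2 (Real.sqrt_pos.2 (damp_arg_pos n hr))

lemma damp_le_one (n : ℕ) (hr : 0 ≤ r) : damp n r ≤ 1 := by
  refine inv_le_one_of_one_le₀ (Real.one_le_sqrt.2 ?_)
  have : 0 ≤ r / ((n : ℝ) + 1) := by positivity
  linarith

lemma contDiffAt_damp (n : ℕ) (hr : 0 ≤ r) : ContDiffAt ℝ 1 (damp n) r := by
  unfold damp
  exact ((by fun_prop : ContDiffAt ℝ 1 (fun r => 1 + r / ((n : ℝ) + 1)) r).sqrt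
    (damp_arg_pos n hr).ne').inv (Real.sqrt_pos.2 (damp_arg_pos n hr)).ne'

lemma abs_mul_deriv_damp_le (n : ℕ) (hr : 0 ≤ r) :
    |r * deriv (damp n) r| ≤ min 1 (r / (n + 1)) := by
  have hp := damp_arg_pos n hr
  have hs := Real.sqrt_pos.2 hp
  have h1 : HasDerivAt (fun r => 1 + r / ((n : ℝ) + 1)) (1 / ((n : ℝ) + 1)) r :=
    ((hasDerivAt_id r).div_const _).const_add 1
  have h2 := (h1.sqrt hp.ne').inv hs.ne'
  have h3 : deriv (damp n) r = _ := h2.deriv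
  set y := r / ((n : ℝ) + 1) with hy
  have hy0 : 0 ≤ y := by positivity
  have h4 : r * deriv (damp n) r = -(y * ((1 + y)⁻¹ * (2 * √(1 + y))⁻¹)) := by
    rw [h3, Real.sq_sqrt hp.le, hy]
    field_simp
  have h5 : 1 ≤ √(1 + y) := Real.one_le_sqrt.2 (by linarith)
  have h6 : (2 * √(1 + y))⁻¹ ≤ 1 := inv_le_one_of_one_le₀ (by linarith)
  have h7 : 0 ≤ (2 * √(1 + y))⁻¹ := by positivity
  have h8 : (1 + y)⁻¹ ≤ 1 := inv_le_one_of_one_le₀ (by linarith)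
  have h8' : 0 ≤ (1 + y)⁻¹ := by positivity
  have h9 : y * (1 + y)⁻¹ ≤ 1 := by
    rw [← div_eq_mul_inv, div_le_one hp]; linarith
  rw [h4, abs_neg, abs_of_nonneg (by positivity), ← mul_assoc]
  refine le_min ?_ ?_
  · exact mul_le_one₀ h9 h7 h6
  · calc y * (1 + y)⁻¹ * (2 * √(1 + y))⁻¹ ≤ y * 1 * 1 := by gcongr
      _ = y := by ring

lemma tendsto_damp (r : ℝ) : Tendsto (fun n => damp n r) atTop (𝓝 1) := by
  have h : Tendsto (fun n : ℕ => r / ((n : ℝ) + 1)) atTop (𝓝 0) :=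
    tendsto_const_nhds.div_atTop (tendsto_atTop_add_const_right _ _ tendsto_natCast_atTop_atTop)
  have h2 := (h.const_add 1).sqrt.inv₀ (by simp)
  simpa [damp] using h2

lemma tendsto_mul_deriv_damp (hr : 0 ≤ r) :
    Tendsto (fun n => r * deriv (damp n) r) atTop (𝓝 0) := by
  have h : Tendsto (fun n : ℕ => r / ((n : ℝ) + 1)) atTop (𝓝 0) :=
    tendsto_const_nhds.div_atTop (tendsto_atTop_add_const_right _ _ tendsto_natCast_atTop_atTop)
  exact squeeze_zero_norm (fun n => (abs_mul_deriv_damp_le n hr).trans (min_le_right _ _)) h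

lemma mul_damp_sq_mono (n : ℕ) {a b : ℝ} (ha : 0 ≤ a) (hab : a ≤ b) :
    a * damp n (a ^ 2) ≤ b * damp n (b ^ 2) := by
  have hb := ha.trans hab
  have h1 := damp_arg_pos n (sq_nonneg a)
  have h2 := damp_arg_pos n (sq_nonneg b)
  rw [damp, damp, ← div_eq_mul_inv, ← div_eq_mul_inv,
    div_le_div_iff₀ (Real.sqrt_pos.2 h1) (Real.sqrt_pos.2 h2)]
  refine abs_le_of_sq_le_sq' ?_ (by positivity) |>.2
  rw [mul_pow, mul_pow, Real.sq_sqrt h1.le, Real.sq_sqrt h2.le]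
  have : a ^ 2 ≤ b ^ 2 := by gcongr
  have h3 : (0 : ℝ) < n + 1 := by positivity
  field_simp
  nlinarith

lemma mul_damp_sq_le (n : ℕ) (a : ℝ) : a * damp n (a ^ 2) ≤ n + 1 := by
  have h1 := damp_arg_pos n (sq_nonneg a)
  rw [damp, ← div_eq_mul_inv, div_le_iff₀ (Real.sqrt_pos.2 h1)]
  refine abs_le_of_sq_le_sq' ?_ (by positivity) |>.2
  rw [mul_pow, Real.sq_sqrt h1.le]
  have h3 : (1 : ℝ) ≤ n + 1 := by linarith [Nat.cast_nonneg (α := ℝ) n]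
  have h4 : ((n : ℝ) + 1) ^ 2 * (1 + a ^ 2 / (n + 1)) = (n + 1) ^ 2 + (n + 1) * a ^ 2 := by
    field_simp
  rw [h4]
  nlinarith [sq_nonneg a]

/-- The derivative of the regularised, truncated and convexified entropy. -/
noncomputable def entCoeff (κ : ℝ) (n : ℕ) (r : ℝ) : ℝ := (logReg κ r + (1 - Real.log κ)) * damp n r

/-- A bound for the regularised logarithm. -/
noncomputable def entBound (κ : ℝ) : ℝ := 1 - 2 * Real.log κ

lemma one_le_entBound (hκ : 0 < κ) (hκ1 : κ ≤ 1) : 1 ≤ entBound κ := by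
  have := Real.log_nonpos hκ.le hκ1
  unfold entBound
  linarith

lemma logReg_add_bounds (hκ : 0 < κ) (hκ1 : κ ≤ 1) (hr : 0 ≤ r) :
    1 ≤ logReg κ r + (1 - Real.log κ) ∧ logReg κ r + (1 - Real.log κ) ≤ entBound κ := by
  have := logReg_bounds hκ hκ1 hr
  unfold entBound
  constructor <;> linarith

lemma entCoeff_bounds (hκ : 0 < κ) (hκ1 : κ ≤ 1) (n : ℕ) (hr : 0 ≤ r) :
    0 ≤ entCoeff κ n r ∧ entCoeff κ n r ≤ entBound κ := by
  have h1 := logReg_add_bounds hκ hκ1 hr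
  have h2 := damp_pos n hr
  have h3 := damp_le_one n hr
  unfold entCoeff
  constructor
  · nlinarith
  · nlinarith

lemma contDiffAt_entCoeff (hκ : 0 < κ) (n : ℕ) (hr : 0 ≤ r) : ContDiffAt ℝ 1 (entCoeff κ n) r :=
  ((contDiffAt_logReg hκ hr).add contDiffAt_const).mul (contDiffAt_damp n hr)

lemma mul_deriv_entCoeff (hκ : 0 < κ) (n : ℕ) (hr : 0 ≤ r) :
    r * deriv (entCoeff κ n) r = r * deriv (logReg κ) r * damp n r +
      (logReg κ r + (1 - Real.log κ)) * (r * deriv (damp n) r) := by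
  have h1 := ((contDiffAt_logReg hκ hr).differentiableAt (by norm_num)).hasDerivAt
  have h2 := ((contDiffAt_damp n hr).differentiableAt (by norm_num)).hasDerivAt
  have h3 := ((h1.add_const (1 - Real.log κ)).mul h2).deriv
  rw [show deriv (entCoeff κ n) r = _ from h3]
  ring

lemma abs_mul_deriv_entCoeff_le (hκ : 0 < κ) (hκ1 : κ ≤ 1) (n : ℕ) (hr : 0 ≤ r) :
    |r * deriv (entCoeff κ n) r| ≤ 1 + entBound κ := by
  rw [mul_deriv_entCoeff hκ n hr]
  have h1 := logReg_add_bounds hκ hκ1 hr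
  have h2 := mul_deriv_logReg hκ hκ1 hr
  have h3 := (abs_mul_deriv_damp_le n hr).trans (min_le_left _ _)
  refine (abs_add_le _ _).trans (add_le_add ?_ ?_)
  · rw [abs_mul, abs_of_nonneg h2.1, abs_of_pos (damp_pos n hr)]
    exact mul_le_one₀ h2.2 (damp_pos n hr).le (damp_le_one n hr)
  · rw [abs_mul, abs_of_nonneg (by linarith [h1.1])]
    have : 0 ≤ entBound κ := by linarith [h1.1, h1.2]
    calc _ ≤ entBound κ * 1 := by gcongr; exact h1.2
      _ = _ := mul_one _

lemma tendsto_mul_deriv_entCoeff (hκ : 0 < κ) (hr : 0 ≤ r) :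
    Tendsto (fun n => r * deriv (entCoeff κ n) r) atTop (𝓝 (r * deriv (logReg κ) r)) := by
  have h := ((tendsto_damp r).const_mul (r * deriv (logReg κ) r)).add
    ((tendsto_mul_deriv_damp hr).const_mul (logReg κ r + (1 - Real.log κ)))
  simp only [mul_one, mul_zero, add_zero] at h
  exact h.congr fun n => (mul_deriv_entCoeff hκ n hr).symm

lemma tendsto_entCoeff (r : ℝ) :
    Tendsto (fun n => entCoeff κ n r) atTop (𝓝 (logReg κ r + (1 - Real.log κ))) := by
  have h := (tendsto_damp r).const_mul (logReg κ r + (1 - Real.log κ))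
  rw [mul_one] at h
  exact h

lemma continuous_mul_comp_sq {c : ℝ → ℝ} (hc : ∀ r, 0 ≤ r → ContinuousAt c r) :
    Continuous fun σ : ℝ => 2 * σ * c (σ ^ 2) := by
  have : Continuous fun σ : ℝ => c (σ ^ 2) := continuous_iff_continuousAt.2 fun σ =>
    (hc _ (sq_nonneg σ)).comp (f := fun σ : ℝ => σ ^ 2) (by fun_prop)
  exact (continuous_const.mul continuous_id).mul this

/-- Convexity of the radial profile. Both `logReg` shifted by 1 - log κ and σ times the damping are
nonnegative and increasing; the shift is there to make the first factor nonnegative. -/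
lemma mul_entCoeff_mono (hκ : 0 < κ) (hκ1 : κ ≤ 1) (n : ℕ) :
    MonotoneOn (fun σ : ℝ => 2 * σ * entCoeff κ n (σ ^ 2)) (Ici 0) := by
  intro a ha b hb hab
  have ha' : 0 ≤ a := ha
  have hb' : 0 ≤ b := hb
  have hsq : a ^ 2 ≤ b ^ 2 := by gcongr
  have h1 := logReg_add_bounds hκ hκ1 (sq_nonneg a)
  have h2 := logReg_mono hκ hκ1 (sq_nonneg a) hsq
  have h3 := mul_damp_sq_mono n ha hab
  have h4 := damp_pos n (sq_nonneg a)
  have h5 := damp_pos n (sq_nonneg b)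
  have h6 := mul_nonneg ha' h4.le
  have h7 := mul_le_mul (add_le_add_left h2 (1 - Real.log κ)) h3 h6 (by linarith [h1.1])
  simp only [entCoeff]
  linarith

/-- The profile of a radial function from its derivative. -/
noncomputable def radialPrimitive (c : ℝ → ℝ) (s : ℝ) : ℝ := ∫ σ in (0 : ℝ)..s, 2 * σ * c (σ ^ 2)

/-- A radial function with convex, increasing profile is convex: the tangent inequality for the
profile at |z| is combined with Re(z̄z') ≤ |z||z'|. -/
lemma radialPrimitive_subgradient {c : ℝ → ℝ} (hc : ∀ r, 0 ≤ r → ContinuousAt c r)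
    (hc0 : ∀ r, 0 ≤ r → 0 ≤ c r)
    (hmono : MonotoneOn (fun σ : ℝ => 2 * σ * c (σ ^ 2)) (Ici 0)) (z z' : ℂ) :
    2 * (star ((c (‖z‖ ^ 2) : ℂ) * z) * (z' - z)).re ≤
      radialPrimitive c ‖z'‖ - radialPrimitive c ‖z‖ := by
  have hcont := continuous_mul_comp_sq hc
  set p : ℝ → ℝ := fun σ => 2 * σ * c (σ ^ 2) with hp
  have key : ∀ s s' : ℝ, 0 ≤ s → 0 ≤ s' → p s * (s' - s) ≤ ∫ σ in s..s', p σ := by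
    intro s s' hs hs'
    rcases le_total s s' with h | h
    · have := intervalIntegral.integral_mono_on (μ := volume) h (f := fun _ => p s) (g := p)
        intervalIntegrable_const (hcont.intervalIntegrable _ _)
        fun x hx => hmono hs (hs.trans hx.1) hx.1
      rw [intervalIntegral.integral_const, smul_eq_mul] at this
      linarith
    · have := intervalIntegral.integral_mono_on (μ := volume) h (f := p) (g := fun _ => p s)
        (hcont.intervalIntegrable _ _) intervalIntegrable_const
        fun x hx => hmono (hs'.trans hx.1) hs hx.2
      rw [intervalIntegral.integral_const, smul_eq_mul] at this
      rw [intervalIntegral.integral_symm]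
      linarith
  have h1 := key ‖z‖ ‖z'‖ (norm_nonneg _) (norm_nonneg _)
  rw [radialPrimitive, radialPrimitive, intervalIntegral.integral_interval_sub_left
    (hcont.intervalIntegrable _ _) (hcont.intervalIntegrable _ _)]
  refine le_trans ?_ h1
  have h2 : (star z * z').re ≤ ‖z‖ * ‖z'‖ := by
    simpa using (le_abs_self _).trans (Complex.abs_re_le_norm (star z * z'))
  have h3 : (star ((c (‖z‖ ^ 2) : ℂ) * z) * (z' - z)).re =
      c (‖z‖ ^ 2) * ((star z * z').re - ‖z‖ ^ 2) := by
    rw [Complex.sq_norm, Complex.normSq_apply]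
    simp
    ring
  rw [h3, hp]
  have := hc0 _ (sq_nonneg ‖z‖)
  nlinarith [mul_le_mul_of_nonneg_left h2 this]

lemma abs_radialPrimitive_le {c : ℝ → ℝ} {K s : ℝ} (hs : 0 ≤ s)
    (hK : ∀ r, 0 ≤ r → |c r| ≤ K) : |radialPrimitive c s| ≤ K * s ^ 2 := by
  have h1 : ∫ σ in (0 : ℝ)..s, K * (2 * σ) = K * s ^ 2 := by
    rw [intervalIntegral.integral_const_mul, intervalIntegral.integral_const_mul, integral_id]
    ring
  rw [radialPrimitive, ← Real.norm_eq_abs, ← h1]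
  refine intervalIntegral.norm_integral_le_of_norm_le hs (Eventually.of_forall fun σ hσ => ?_)
    (Continuous.intervalIntegrable (by fun_prop) _ _)
  rw [Real.norm_eq_abs, abs_mul, abs_of_nonneg (by linarith [hσ.1]), mul_comm]
  have := hσ.1.le
  gcongr
  exact hK _ (sq_nonneg σ)

lemma measurable_radialPrimitive {c : ℝ → ℝ} (hc : ∀ r, 0 ≤ r → ContinuousAt c r) :
    Measurable (radialPrimitive c) := by
  have hcont := continuous_mul_comp_sq hc
  exact (intervalIntegral.continuous_primitive (fun a b => hcont.intervalIntegrable a b)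
    0).measurable

lemma tendsto_radialPrimitive {c : ℕ → ℝ → ℝ} {c' : ℝ → ℝ} {b : ℝ → ℝ} {s : ℝ} (hs : 0 ≤ s)
    (hc : ∀ n r, 0 ≤ r → ContinuousAt (c n) r)
    (hb : ∀ n, ∀ r, 0 < r → |c n r| ≤ b r)
    (hbi : IntervalIntegrable (fun σ => 2 * σ * b (σ ^ 2)) volume 0 s)
    (h : ∀ r, 0 < r → Tendsto (fun n => c n r) atTop (𝓝 (c' r))) :
    Tendsto (fun n => radialPrimitive (c n) s) atTop (𝓝 (radialPrimitive c' s)) := by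
  refine intervalIntegral.tendsto_integral_filter_of_dominated_convergence
    (fun σ => 2 * σ * b (σ ^ 2))
    (Eventually.of_forall fun n => (continuous_mul_comp_sq (hc n)).aestronglyMeasurable)
    (Eventually.of_forall fun n => Eventually.of_forall fun σ hσ => ?_) hbi
    (Eventually.of_forall fun σ hσ => ?_)
  · rw [uIoc_of_le hs] at hσ
    have := hσ.1
    rw [Real.norm_eq_abs, abs_mul, abs_of_pos (by positivity)]
    gcongr
    exact hb n _ (by positivity)
  · rw [uIoc_of_le hs] at hσ
    have := hσ.1
    exact (h _ (by positivity)).const_mul _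

lemma continuous_mul_log_sq : Continuous fun σ : ℝ => 2 * σ * Real.log (σ ^ 2) := by
  have : (fun σ : ℝ => 2 * σ * Real.log (σ ^ 2)) = fun σ => 4 * (σ * Real.log σ) := by
    ext σ
    rw [Real.log_pow]
    push_cast
    ring
  rw [this]
  exact Real.continuous_mul_log.const_mul 4

lemma hasDerivAt_sq_mul_log_sq {σ : ℝ} (hσ : σ ≠ 0) :
    HasDerivAt (fun σ : ℝ => σ ^ 2 * Real.log (σ ^ 2) - σ ^ 2) (2 * σ * Real.log (σ ^ 2)) σ := by
  have h1 : HasDerivAt (fun σ : ℝ => σ ^ 2) (2 * σ) σ := by simpa using hasDerivAt_pow 2 σ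
  refine ((h1.mul (h1.log (by positivity))).sub h1).congr_deriv ?_
  field_simp
  ring

lemma integral_mul_log_sq {a b : ℝ} (ha : 0 ≤ a) (hab : a ≤ b) :
    ∫ σ in a..b, 2 * σ * Real.log (σ ^ 2) =
      (b ^ 2 * Real.log (b ^ 2) - b ^ 2) - (a ^ 2 * Real.log (a ^ 2) - a ^ 2) := by
  refine intervalIntegral.integral_eq_sub_of_hasDerivAt_of_le hab ?_
    (fun σ hσ => hasDerivAt_sq_mul_log_sq (ha.trans_lt hσ.1).ne')
    (continuous_mul_log_sq.intervalIntegrable _ _)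
  exact ((Real.continuous_mul_log.comp (continuous_pow 2)).sub (continuous_pow 2)).continuousOn

lemma radialPrimitive_log {s : ℝ} (hs : 0 ≤ s) :
    radialPrimitive Real.log s = s ^ 2 * Real.log (s ^ 2) - s ^ 2 := by
  rw [radialPrimitive, integral_mul_log_sq le_rfl hs]
  simp

/-- Both bounds are uniform in κ. Below 1 the integrand lies between that of the logarithm and 0,
above 1 between 0 and that of the logarithm. The lower bound enables Fatou's lemma at the final
time, and both enter dominated convergence at time 0. -/
lemma radialPrimitive_logReg_bounds (hκ : 0 < κ) (hκ1 : κ ≤ 1) {s : ℝ} (hs : 0 ≤ s) :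
    -1 ≤ radialPrimitive (logReg κ) s ∧
      radialPrimitive (logReg κ) s ≤ s ^ 2 * Real.log (s ^ 2) - s ^ 2 + 1 := by
  have hcont := continuous_mul_comp_sq (c := logReg κ) fun r hr =>
    (contDiffAt_logReg hκ hr).continuousAt
  have hge : ∀ x : ℝ, 0 ≤ x → 0 ≤ x ^ 2 * Real.log (x ^ 2) - x ^ 2 + 1 := by
    intro x hx
    rcases hx.eq_or_lt with rfl | hx
    · simp
    have h1 : 0 < x ^ 2 := by positivity
    have h2 := Real.log_le_sub_one_of_pos (inv_pos.2 h1)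
    rw [Real.log_inv] at h2
    have h3 : x ^ 2 * (x ^ 2)⁻¹ = 1 := mul_inv_cancel₀ h1.ne'
    nlinarith
  have h1 : ∀ x, 0 ≤ x → x ≤ 1 → -1 ≤ radialPrimitive (logReg κ) x ∧
      radialPrimitive (logReg κ) x ≤ 0 := by
    intro x hx hx1
    constructor
    · have h2 := intervalIntegral.integral_mono_on (μ := volume) hx
        (f := fun σ => 2 * σ * Real.log (σ ^ 2)) (continuous_mul_log_sq.intervalIntegrable _ _)
        (hcont.intervalIntegrable _ _) (fun σ hσ => ?_)
      · rw [integral_mul_log_sq le_rfl hx] at h2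
        have := hge x hx
        simp only [radialPrimitive]
        simp at h2 this
        linarith
      · rcases hσ.1.eq_or_lt with h0 | h0
        · simp [← h0]
        have h3 : 0 < σ ^ 2 := by positivity
        have h4 : σ ^ 2 ≤ 1 := pow_le_one₀ h0.le (hσ.2.trans hx1)
        have := (logReg_of_le_one hκ hκ1 h3 h4).1
        gcongr
    · have h2 := intervalIntegral.integral_mono_on (μ := volume) hx (g := fun _ => (0 : ℝ))
        (hcont.intervalIntegrable _ _) intervalIntegrable_const (fun σ hσ => ?_)
      · simpa [radialPrimitive] using h2
      · rcases hσ.1.eq_or_lt with h0 | h0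
        · simp [← h0]
        have h3 : 0 < σ ^ 2 := by positivity
        have h4 : σ ^ 2 ≤ 1 := pow_le_one₀ h0.le (hσ.2.trans hx1)
        have := (logReg_of_le_one hκ hκ1 h3 h4).2
        nlinarith
  rcases le_total s 1 with hs1 | hs1
  · have := h1 s hs hs1
    exact ⟨this.1, this.2.trans (hge s hs)⟩
  · have h2 := h1 1 zero_le_one le_rfl
    have hsplit : radialPrimitive (logReg κ) s = radialPrimitive (logReg κ) 1 +
        ∫ σ in (1 : ℝ)..s, 2 * σ * logReg κ (σ ^ 2) :=
      (intervalIntegral.integral_add_adjacent_intervals (hcont.intervalIntegrable _ _)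
        (hcont.intervalIntegrable _ _)).symm
    have hb : ∀ σ ∈ Icc 1 s, 0 ≤ logReg κ (σ ^ 2) ∧ logReg κ (σ ^ 2) ≤ Real.log (σ ^ 2) :=
      fun σ hσ => logReg_of_one_le hκ hκ1 (one_le_pow₀ hσ.1)
    have h3 : 0 ≤ ∫ σ in (1 : ℝ)..s, 2 * σ * logReg κ (σ ^ 2) :=
      intervalIntegral.integral_nonneg hs1 fun σ hσ => by
        have := (hb σ hσ).1
        have := hσ.1
        positivity
    have h4 := intervalIntegral.integral_mono_on (μ := volume) hs1
      (g := fun σ => 2 * σ * Real.log (σ ^ 2)) (hcont.intervalIntegrable _ _)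
      (continuous_mul_log_sq.intervalIntegrable _ _) (fun σ hσ => by
        have := (hb σ hσ).2
        have : 0 ≤ σ := zero_le_one.trans hσ.1
        gcongr)
    rw [integral_mul_log_sq zero_le_one hs1] at h4
    rw [hsplit]
    simp only [one_pow, Real.log_one, mul_zero] at h4
    constructor <;> linarith

end

/-! ### Balance of convex radial functionals and growth of the entropy. -/

section

variable {Ω : Type*} [MeasurableSpace Ω] {μ : Measure Ω} [IsProbabilityMeasure μ]
  {ι : Type*} [Fintype ι] {W : (Ω → ℂ) → (ι → Ω → ℂ) → Prop} {lam : ℝ}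
  {φ : ℝ → Lp ℂ 2 μ} {Dφ : ℝ → ι → Ω → ℂ}

lemma integrable_radialPrimitive {c : ℝ → ℝ} {K : ℝ} (hc : ∀ r, 0 ≤ r → ContinuousAt c r)
    (hK : ∀ r, 0 ≤ r → |c r| ≤ K) {u : Ω → ℂ} (hu : MemLp u 2 μ) :
    Integrable (fun x => radialPrimitive c ‖u x‖) μ :=
  ((integrable_norm_sq hu).const_mul K).mono'
    ((measurable_radialPrimitive hc).comp_aemeasurable hu.1.norm.aemeasurable).aestronglyMeasurable
    (Eventually.of_forall fun _ => abs_radialPrimitive_le (norm_nonneg _) hK)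

/-- The integral of the twist against a radial weight. -/
noncomputable def weightedTwist (μ : Measure Ω) (ρ : ℝ → ℝ) (u : Ω → ℂ) (D : ι → Ω → ℂ) : ℝ :=
  ∑ j, ∫ x, ρ (‖u x‖ ^ 2) * twist (u x) (D j x) ∂μ

lemma norm_weight_mul_twist_le {ρ : ℝ → ℝ} {K : ℝ} (hρ : ∀ r, 0 ≤ r → |ρ r| ≤ K) (z p : ℂ) :
    ‖ρ (‖z‖ ^ 2) * twist z p‖ ≤ K * ‖p‖ ^ 2 := by
  rw [norm_mul]
  exact mul_le_mul (hρ _ (sq_nonneg _)) (abs_twist_le z p) (norm_nonneg _)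
    ((abs_nonneg _).trans (hρ _ (sq_nonneg ‖z‖)))

lemma abs_weightedTwist_le {ρ : ℝ → ℝ} {K : ℝ} (hρ : ∀ r, 0 ≤ r → |ρ r| ≤ K) {u : Ω → ℂ}
    {D : ι → Ω → ℂ} (hD : ∀ j, MemLp (D j) 2 μ) : |weightedTwist μ ρ u D| ≤ K * energy μ D := by
  rw [energy, Finset.mul_sum]
  refine (Finset.abs_sum_le_sum_abs _ _).trans (Finset.sum_le_sum fun j _ => ?_)
  rw [← Real.norm_eq_abs, l2sq, ← integral_const_mul]
  exact norm_integral_le_of_norm_le ((integrable_norm_sq (hD j)).const_mul K)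
    (Eventually.of_forall fun x => norm_weight_mul_twist_le hρ _ _)

lemma tendsto_weightedTwist {ρ : ℕ → ℝ → ℝ} {ρ' : ℝ → ℝ} {K : ℝ}
    (hm : ∀ n, Measurable (ρ n)) (hρ : ∀ n r, 0 ≤ r → |ρ n r| ≤ K)
    (h : ∀ r, 0 < r → Tendsto (fun n => ρ n r) atTop (𝓝 (ρ' r)))
    {u : Ω → ℂ} {D : ι → Ω → ℂ} (hu : MemLp u 2 μ) (hD : ∀ j, MemLp (D j) 2 μ) :
    Tendsto (fun n => weightedTwist μ (ρ n) u D) atTop (𝓝 (weightedTwist μ ρ' u D)) := by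
  refine tendsto_finsetSum _ fun j _ => ?_
  refine tendsto_integral_of_dominated_convergence (fun x => K * ‖D j x‖ ^ 2) (fun n => ?_)
    ((integrable_norm_sq (hD j)).const_mul K)
    (fun n => Eventually.of_forall fun x => norm_weight_mul_twist_le (hρ n) _ _)
    (Eventually.of_forall fun x => ?_)
  · exact ((hm n).comp_aemeasurable (hu.1.norm.aemeasurable.pow_const 2)).aestronglyMeasurable.mul
      (integrable_twist hu.1 (hD j)).1
  · rcases eq_or_ne (u x) 0 with h0 | h0
    · simp [h0, twist]
    · exact (h _ (by positivity)).mul_const _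

lemma im_star_radial_mul (a b : ℝ) (z p : ℂ) :
    (star ((a : ℂ) * p + (b : ℂ) * ((2 * (star z * p).re : ℝ) : ℂ) * z) * p).im =
      b * (‖z‖ ^ 2 * twist z p) := by
  rw [norm_sq_mul_twist]
  simp
  ring

/-- Balance of a functional with convex radial density. -/
lemma IsWeakSol.radial_balance (hW : IsGradRel μ W) (h : IsWeakSol μ W lam φ Dφ)
    {c : ℝ → ℝ} {K M T : ℝ} (hT : 0 ≤ T)
    (hcd : ∀ r, 0 ≤ r → ContDiffAt ℝ 1 c r) (hc0 : ∀ r, 0 ≤ r → 0 ≤ c r)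
    (hcK : ∀ r, 0 ≤ r → c r ≤ K) (hcK' : ∀ r, 0 ≤ r → |r * deriv c r| ≤ K)
    (hcM : ∀ s, 0 ≤ s → s * c (s ^ 2) ≤ M)
    (hmono : MonotoneOn (fun σ : ℝ => 2 * σ * c (σ ^ 2)) (Ici 0)) :
    (∫ x, radialPrimitive c ‖φ T x‖ ∂μ) - ∫ x, radialPrimitive c ‖φ 0 x‖ ∂μ =
      ∫ t in (0 : ℝ)..T, weightedTwist μ (fun r => 2 * (r * deriv c r)) (φ t) (Dφ t) ∧
    AEStronglyMeasurable (fun t => weightedTwist μ (fun r => 2 * (r * deriv c r)) (φ t) (Dφ t))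
      (volume.restrict (Ioc 0 T)) := by
  have hcc : ∀ r, 0 ≤ r → ContinuousAt c r := fun r hr => (hcd r hr).continuousAt
  have habs : ∀ r, 0 ≤ r → |c r| ≤ K := fun r hr => by
    rw [abs_of_nonneg (hc0 r hr)]; exact hcK r hr
  have hK0 : 0 ≤ K := (abs_nonneg _).trans (habs 0 le_rfl)
  have hM0 : 0 ≤ M := by simpa using hcM 0 le_rfl
  have hderiv : ∀ r, 0 ≤ r → deriv (fun r => ((c r : ℝ) : ℂ)) r = ((deriv c r : ℝ) : ℂ) :=
    fun r hr => ((hcd r hr).differentiableAt (by norm_num)).hasDerivAt.ofReal_comp.deriv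
  have hC : ∀ r, 0 ≤ r → ‖((c r : ℝ) : ℂ)‖ + 2 * r * ‖deriv (fun r => ((c r : ℝ) : ℂ)) r‖ ≤
      3 * K := fun r hr => by
    rw [hderiv r hr, Complex.norm_real, Complex.norm_real, Real.norm_eq_abs, Real.norm_eq_abs]
    have h1 := hcK' r hr
    rw [abs_mul, abs_of_nonneg hr] at h1
    linarith [habs r hr]
  obtain ⟨A, hA0, hA⟩ := h.exists_norm_le T
  have hrad := fun t (ht : t ∈ Icc 0 T) => hW.radial (h.grad t ht.1)
    (c := fun r => ((c r : ℝ) : ℂ)) (C := 3 * K)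
    (fun r hr => Complex.ofRealCLM.contDiff.contDiffAt.comp r (hcd r hr)) hC
  have hint : ∀ t, Integrable (fun x => radialPrimitive c ‖φ t x‖) μ := fun t =>
    integrable_radialPrimitive hcc habs (Lp.memLp _)
  have key := h.integral_functional hW (F := fun t => ∫ x, radialPrimitive c ‖φ t x‖ ∂μ) (M := M)
    (B := (3 * K) ^ 2 * A) hT hM0 hrad (fun t ht => Eventually.of_forall fun x => ?_)
    (fun t ht => ?_) (fun t ht s hs => ?_)
  -- In the gradient pairing the part c|∇φ|² is real, so only the derivative of c contributes.
  · have hrate : ∀ t ∈ Icc 0 T, 2 * (rate μ lam φ Dφ (fun x => ((c (‖φ t x‖ ^ 2) : ℝ) : ℂ) * φ t x)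
        (fun j x => ((c (‖φ t x‖ ^ 2) : ℝ) : ℂ) * Dφ t j x +
        deriv (fun r => ((c r : ℝ) : ℂ)) (‖φ t x‖ ^ 2) *
          ((2 * (star (φ t x) * Dφ t j x).re : ℝ) : ℂ) * φ t x) t).re =
        weightedTwist μ (fun r => 2 * (r * deriv c r)) (φ t) (Dφ t) := by
      intro t ht
      rw [re_rate]
      -- The nonlinearity tested with c(|φ|²)φ is real and drops out.
      have h0 : (pair μ (fun x => ((c (‖φ t x‖ ^ 2) : ℝ) : ℂ) * φ t x) (logTerm μ (φ t))).im =
          0 := by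
        have hp : ∀ x, star (((c (‖φ t x‖ ^ 2) : ℝ) : ℂ) * φ t x) * logTerm μ (φ t) x =
            ((c (‖φ t x‖ ^ 2) * ‖φ t x‖ ^ 2 *
              Real.log (‖φ t x‖ ^ 2 / l2sq μ (φ t)) : ℝ) : ℂ) := fun x => by
          rw [logTerm, star_mul, Complex.star_def, Complex.conj_ofReal]
          push_cast
          rw [← Complex.conj_mul']
          ring
        rw [pair]
        simp_rw [hp]
        rw [integral_complex_ofReal, Complex.ofReal_im]
      rw [h0, mul_zero, add_zero, Complex.im_sum, Finset.mul_sum]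
      refine Finset.sum_congr rfl fun j _ => ?_
      rw [im_pair (hW.memLp_grad (hrad t ht) j) (hW.memLp_grad (h.grad t ht.1) j),
        ← integral_const_mul]
      refine integral_congr_ae (Eventually.of_forall fun x => ?_)
      simp only
      rw [hderiv _ (sq_nonneg _), im_star_radial_mul]
      ring
    refine ⟨key.1.trans ?_, key.2.1.congr ?_⟩
    · refine intervalIntegral.integral_congr fun t ht => hrate t ?_
      rwa [uIcc_of_le hT] at ht
    · refine (ae_restrict_iff' measurableSet_Ioc).2 (Eventually.of_forall fun t ht => hrate t ?_)
      exact Ioc_subset_Icc_self ht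
  · rw [norm_mul, Complex.norm_real, Real.norm_eq_abs, abs_of_nonneg (hc0 _ (sq_nonneg _)),
      mul_comm]
    exact hcM _ (norm_nonneg _)
  · refine le_trans ?_ (mul_le_mul_of_nonneg_left (hA t ht).2 (by positivity))
    rw [Finset.mul_sum]
    refine Finset.sum_le_sum fun j _ => ?_
    rw [l2sq, l2sq, ← integral_const_mul]
    refine integral_mono (integrable_norm_sq (hW.memLp_grad (hrad t ht) j))
      ((integrable_norm_sq (hW.memLp_grad (h.grad t ht.1) j)).const_mul _) fun x => ?_
    simp only
    rw [← mul_pow]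
    refine pow_le_pow_left₀ (norm_nonneg _) ?_ 2
    exact (norm_radial_deriv_le _ _ _ _).trans
      (mul_le_mul_of_nonneg_right (hC _ (sq_nonneg _)) (norm_nonneg _))
  · have hg2 := hW.memLp (hrad t ht)
    have hs2 : MemLp (φ s) 2 μ := Lp.memLp _
    have ht2 : MemLp (φ t) 2 μ := Lp.memLp _
    have hd2 : MemLp (fun x => φ s x - φ t x) 2 μ := hs2.sub ht2
    rw [← pair_sub_right hg2 hs2 ht2, re_pair hg2 hd2, ← integral_const_mul]
    rw [← integral_sub (hint s) (hint t)]
    refine integral_mono ((integrable_star_mul hg2 (hs2.sub ht2)).re.const_mul 2)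
      ((hint s).sub (hint t)) fun x => ?_
    exact radialPrimitive_subgradient hcc hc0 hmono _ _

lemma abs_log_entropy_density_le {s : ℝ} (hs : 0 ≤ s) :
    0 ≤ s ^ 2 * Real.log (s ^ 2) - s ^ 2 + 1 := by
  -- At κ = 1 the regularised logarithm vanishes identically, so the upper bound says just that x
  -- log x - x + 1 ≥ 0 at x = s².
  have h := radialPrimitive_logReg_bounds one_pos le_rfl hs
  have h1 : radialPrimitive (logReg 1) s = 0 := by
    have : ∀ σ : ℝ, logReg 1 (σ ^ 2) = 0 := fun σ => by
      rw [logReg, one_mul, add_comm, div_self (by positivity), Real.log_one]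
    simp [radialPrimitive, this]
  linarith [h.2]

/-- Balance of the regularised entropy. -/
lemma IsWeakSol.logReg_balance (hW : IsGradRel μ W) (h : IsWeakSol μ W lam φ Dφ)
    {κ T : ℝ} (hκ : 0 < κ) (hκ1 : κ ≤ 1) (hT : 0 ≤ T) :
    (∫ x, radialPrimitive (logReg κ) ‖φ T x‖ ∂μ) - ∫ x, radialPrimitive (logReg κ) ‖φ 0 x‖ ∂μ =
      ∫ t in (0 : ℝ)..T, weightedTwist μ (fun r => 2 * (r * deriv (logReg κ) r)) (φ t) (Dφ t) ∧
    AEStronglyMeasurable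
      (fun t => weightedTwist μ (fun r => 2 * (r * deriv (logReg κ) r)) (φ t) (Dφ t))
      (volume.restrict (Ioc 0 T)) := by
  have hE := one_le_entBound hκ hκ1
  -- The damping makes c(|φ|²)φ bounded, hence admissible; it is removed first, with κ fixed.
  have hb := fun n => h.radial_balance hW (c := entCoeff κ n) (K := 1 + entBound κ)
    (M := entBound κ * (n + 1)) hT
    (fun r hr => contDiffAt_entCoeff hκ n hr) (fun r hr => (entCoeff_bounds hκ hκ1 n hr).1)
    (fun r hr => (entCoeff_bounds hκ hκ1 n hr).2.trans (by linarith))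
    (fun r hr => abs_mul_deriv_entCoeff_le hκ hκ1 n hr) (fun s hs => by
      have h1 := mul_damp_sq_le n s
      have h2 := (logReg_add_bounds hκ hκ1 (sq_nonneg s))
      have h3 := mul_nonneg hs (damp_pos n (sq_nonneg s)).le
      rw [entCoeff, mul_left_comm]
      exact mul_le_mul h2.2 h1 h3 (by linarith)) (mul_entCoeff_mono hκ hκ1 n)
  obtain ⟨A, hA0, hA⟩ := h.exists_norm_le T
  have hρ : ∀ n r, 0 ≤ r → |2 * (r * deriv (entCoeff κ n) r)| ≤ 2 * (1 + entBound κ) :=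
    fun n r hr => by
      rw [abs_mul, abs_two]
      gcongr
      exact abs_mul_deriv_entCoeff_le hκ hκ1 n hr
  have hlim : ∀ t ∈ Ioc 0 T, Tendsto (fun n => weightedTwist μ
      (fun r => 2 * (r * deriv (entCoeff κ n) r)) (φ t) (Dφ t)) atTop
      (𝓝 (weightedTwist μ (fun r => 2 * (r * deriv (logReg κ) r)) (φ t) (Dφ t))) := fun t ht =>
    tendsto_weightedTwist (K := 2 * (1 + entBound κ))
      (fun n => (measurable_id.mul (measurable_deriv _)).const_mul 2) hρ
      (fun r hr => (tendsto_mul_deriv_entCoeff hκ hr.le).const_mul 2) (Lp.memLp _)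
      fun j => hW.memLp_grad (h.grad t ht.1.le) j
  have hRHS : Tendsto (fun n => ∫ t in (0 : ℝ)..T, weightedTwist μ
      (fun r => 2 * (r * deriv (entCoeff κ n) r)) (φ t) (Dφ t)) atTop
      (𝓝 (∫ t in (0 : ℝ)..T, weightedTwist μ (fun r => 2 * (r * deriv (logReg κ) r))
        (φ t) (Dφ t))) := by
    refine intervalIntegral.tendsto_integral_filter_of_dominated_convergence
      (fun _ => 2 * (1 + entBound κ) * A) (Eventually.of_forall fun n => ?_)
      (Eventually.of_forall fun n => Eventually.of_forall fun t ht => ?_)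
      intervalIntegrable_const (Eventually.of_forall fun t ht => ?_)
    · rw [uIoc_of_le hT]
      exact (hb n).2
    · rw [uIoc_of_le hT] at ht
      refine (abs_weightedTwist_le (hρ n) fun j => hW.memLp_grad (h.grad t ht.1.le) j).trans ?_
      exact mul_le_mul_of_nonneg_left (hA t (Ioc_subset_Icc_self ht)).2 (by positivity)
    · rw [uIoc_of_le hT] at ht
      exact hlim t ht
  have hcont : ∀ r, 0 ≤ r → ContinuousAt (logReg κ) r := fun r hr =>
    (contDiffAt_logReg hκ hr).continuousAt
  have hlogb : ∀ r, 0 ≤ r → |logReg κ r| ≤ -Real.log κ := fun r hr => by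
    have := logReg_bounds hκ hκ1 hr
    rw [abs_le]
    constructor <;> linarith
  -- The shift introduced for convexity adds a multiple of |φ|², whose integral is conserved and
  -- cancels at the end.
  have hprim : ∀ s, 0 ≤ s → radialPrimitive (fun r => logReg κ r + (1 - Real.log κ)) s =
      radialPrimitive (logReg κ) s + (1 - Real.log κ) * s ^ 2 := fun s hs => by
    have h1 : ∫ σ in (0 : ℝ)..s, 2 * σ * (1 - Real.log κ) = (1 - Real.log κ) * s ^ 2 := by
      rw [intervalIntegral.integral_mul_const, intervalIntegral.integral_const_mul, integral_id]
      ring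
    rw [radialPrimitive, radialPrimitive, ← h1, ← intervalIntegral.integral_add
      ((continuous_mul_comp_sq hcont).intervalIntegrable _ _)
      (Continuous.intervalIntegrable (by fun_prop) _ _)]
    congr 1
    ext σ
    ring
  have hLHS : ∀ t, Tendsto (fun n => ∫ x, radialPrimitive (entCoeff κ n) ‖φ t x‖ ∂μ) atTop
      (𝓝 (∫ x, radialPrimitive (logReg κ) ‖φ t x‖ ∂μ + (1 - Real.log κ) * ‖φ t‖ ^ 2)) := by
    intro t
    have hφ : MemLp (φ t) 2 μ := Lp.memLp _
    have h1 : ∫ x, radialPrimitive (logReg κ) ‖φ t x‖ ∂μ + (1 - Real.log κ) * ‖φ t‖ ^ 2 =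
        ∫ x, radialPrimitive (fun r => logReg κ r + (1 - Real.log κ)) ‖φ t x‖ ∂μ := by
      rw [← l2sq_coe, l2sq, ← integral_const_mul, ← integral_add
        (integrable_radialPrimitive hcont hlogb hφ) ((integrable_norm_sq hφ).const_mul _)]
      exact integral_congr_ae (Eventually.of_forall fun x => (hprim _ (norm_nonneg _)).symm)
    have habs : ∀ n r, 0 ≤ r → |entCoeff κ n r| ≤ entBound κ := fun n r hr => by
      rw [abs_of_nonneg (entCoeff_bounds hκ hκ1 n hr).1]
      exact (entCoeff_bounds hκ hκ1 n hr).2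
    have hcn : ∀ n r, 0 ≤ r → ContinuousAt (entCoeff κ n) r := fun n r hr =>
      (contDiffAt_entCoeff hκ n hr).continuousAt
    rw [h1]
    refine tendsto_integral_of_dominated_convergence (fun x => entBound κ * ‖φ t x‖ ^ 2)
      (fun n => (integrable_radialPrimitive (hcn n) (habs n) hφ).1)
      ((integrable_norm_sq hφ).const_mul _)
      (fun n => Eventually.of_forall fun x => abs_radialPrimitive_le (norm_nonneg _) (habs n))
      (Eventually.of_forall fun x => ?_)
    exact tendsto_radialPrimitive (norm_nonneg _) hcn (b := fun _ => entBound κ)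
      (fun n r hr => habs n r hr.le) (Continuous.intervalIntegrable (by fun_prop) _ _)
      fun r _ => tendsto_entCoeff r
  have hlim2 := ((hLHS T).sub (hLHS 0)).congr fun n => (hb n).1
  refine ⟨?_, ?_⟩
  · have := tendsto_nhds_unique hlim2 hRHS
    rw [(h.conservation hW hT).1] at this
    linarith
  · exact aestronglyMeasurable_of_tendsto_ae atTop (fun n => (hb n).2)
      ((ae_restrict_iff' measurableSet_Ioc).2 (Eventually.of_forall hlim))

/-- Growth of the entropy: its derivative is at most twice the total twist. -/
theorem IsWeakSol.entropy_balance (hW : IsGradRel μ W) (h : IsWeakSol μ W lam φ Dφ)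
    {T : ℝ} (hT : 0 ≤ T)
    (h0 : Integrable (fun x => ‖φ 0 x‖ ^ 2 * Real.log (‖φ 0 x‖ ^ 2)) μ) :
    Integrable (fun x => ‖φ T x‖ ^ 2 * Real.log (‖φ T x‖ ^ 2)) μ ∧
    ∫ x, ‖φ T x‖ ^ 2 * Real.log (‖φ T x‖ ^ 2) ∂μ ≤
      ∫ x, ‖φ 0 x‖ ^ 2 * Real.log (‖φ 0 x‖ ^ 2) ∂μ +
        2 * ∫ t in (0 : ℝ)..T, totalTwist μ (φ t) (Dφ t) := by
  have hb := fun n => h.logReg_balance hW (scale_pos n) (scale_le_one n) hT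
  obtain ⟨A, hA0, hA⟩ := h.exists_norm_le T
  have hρ : ∀ n r, 0 ≤ r → |2 * (r * deriv (logReg (scale n)) r)| ≤ 2 := fun n r hr => by
    have := mul_deriv_logReg (scale_pos n) (scale_le_one n) hr
    rw [abs_mul, abs_two, abs_of_nonneg this.1]
    linarith
  have hRHS : Tendsto (fun n => ∫ t in (0 : ℝ)..T, weightedTwist μ
      (fun r => 2 * (r * deriv (logReg (scale n)) r)) (φ t) (Dφ t)) atTop
      (𝓝 (2 * ∫ t in (0 : ℝ)..T, totalTwist μ (φ t) (Dφ t))) := by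
    rw [← intervalIntegral.integral_const_mul]
    refine intervalIntegral.tendsto_integral_filter_of_dominated_convergence
      (fun _ => 2 * A) (Eventually.of_forall fun n => ?_)
      (Eventually.of_forall fun n => Eventually.of_forall fun t ht => ?_)
      intervalIntegrable_const (Eventually.of_forall fun t ht => ?_)
    · rw [uIoc_of_le hT]
      exact (hb n).2
    · rw [uIoc_of_le hT] at ht
      refine (abs_weightedTwist_le (hρ n) fun j => hW.memLp_grad (h.grad t ht.1.le) j).trans ?_
      exact mul_le_mul_of_nonneg_left (hA t (Ioc_subset_Icc_self ht)).2 (by positivity)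
    · rw [uIoc_of_le hT] at ht
      have h1 := tendsto_weightedTwist (μ := μ) (K := 2) (ρ' := fun _ => 2)
        (fun n => (measurable_id.mul (measurable_deriv (logReg (scale n)))).const_mul 2) hρ
        (fun r hr => by
          simpa using (tendsto_mul_deriv_logReg scale_pos tendsto_scale hr).const_mul 2)
        (Lp.memLp (φ t)) fun j => hW.memLp_grad (h.grad t ht.1.le) j
      have h2 : weightedTwist μ (fun _ => 2) (φ t) (Dφ t) = 2 * totalTwist μ (φ t) (Dφ t) := by
        simp only [weightedTwist, totalTwist, integral_const_mul, Finset.mul_sum]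
      rw [← h2]
      exact h1
  have hmeas : ∀ n t, AEStronglyMeasurable (fun x => radialPrimitive (logReg (scale n)) ‖φ t x‖) μ :=
    fun n t => ((measurable_radialPrimitive fun r hr =>
      (contDiffAt_logReg (scale_pos n) hr).continuousAt).comp_aemeasurable
        (Lp.memLp (φ t)).1.norm.aemeasurable).aestronglyMeasurable
  have hint : ∀ n t, Integrable (fun x => radialPrimitive (logReg (scale n)) ‖φ t x‖) μ := fun n t =>
    integrable_radialPrimitive (K := -Real.log (scale n)) (fun r hr =>
      (contDiffAt_logReg (scale_pos n) hr).continuousAt) (fun r hr => by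
        have := logReg_bounds (scale_pos n) (scale_le_one n) hr
        rw [abs_le]
        constructor <;> linarith) (Lp.memLp _)
  have hpt : ∀ t x, Tendsto (fun n => radialPrimitive (logReg (scale n)) ‖φ t x‖) atTop
      (𝓝 (‖φ t x‖ ^ 2 * Real.log (‖φ t x‖ ^ 2) - ‖φ t x‖ ^ 2)) := fun t x => by
    rw [← radialPrimitive_log (norm_nonneg _)]
    refine tendsto_radialPrimitive (norm_nonneg _) (b := fun r => |Real.log r|)
      (fun n r hr => (contDiffAt_logReg (scale_pos n) hr).continuousAt)
      (fun n r hr => abs_logReg_le (scale_pos n) (scale_le_one n) hr) ?_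
      fun r hr => tendsto_logReg tendsto_scale hr
    refine (continuous_mul_log_sq.abs.intervalIntegrable 0 ‖φ t x‖).congr fun σ hσ => ?_
    rw [uIoc_of_le (norm_nonneg _)] at hσ
    simp only [abs_mul, abs_two, abs_of_pos hσ.1]
  have hbd := fun n t x => radialPrimitive_logReg_bounds (scale_pos n) (scale_le_one n)
    (norm_nonneg (φ t x))
  have hsq : ∀ t, Integrable (fun x => ‖φ t x‖ ^ 2) μ := fun t => integrable_norm_sq (Lp.memLp _)
  have hi0 : Integrable (fun x => ‖φ 0 x‖ ^ 2 * Real.log (‖φ 0 x‖ ^ 2) - ‖φ 0 x‖ ^ 2) μ :=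
    h0.sub (hsq 0)
  -- At time 0 the entropy density is integrable by hypothesis and dominates; at time T
  -- integrability is part of the claim, and only Fatou's lemma is available.
  have hlim0 : Tendsto (fun n => ∫ x, radialPrimitive (logReg (scale n)) ‖φ 0 x‖ ∂μ) atTop
      (𝓝 (∫ x, (‖φ 0 x‖ ^ 2 * Real.log (‖φ 0 x‖ ^ 2) - ‖φ 0 x‖ ^ 2) ∂μ)) := by
    refine tendsto_integral_of_dominated_convergence
      (fun x => ‖φ 0 x‖ ^ 2 * Real.log (‖φ 0 x‖ ^ 2) - ‖φ 0 x‖ ^ 2 + 2) (fun n => hmeas n 0)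
      (hi0.add (integrable_const 2)) (fun n => Eventually.of_forall fun x => ?_)
      (Eventually.of_forall fun x => hpt 0 x)
    have h1 := hbd n 0 x
    rw [Real.norm_eq_abs, abs_le]
    have h2 := abs_log_entropy_density_le (norm_nonneg (φ 0 x))
    constructor <;> linarith [h1.1, h1.2]
  have hlimT := hlim0.add hRHS
  have hT1 : ∀ n, ∫ x, (radialPrimitive (logReg (scale n)) ‖φ T x‖ + 1) ∂μ =
      ∫ x, radialPrimitive (logReg (scale n)) ‖φ 0 x‖ ∂μ + (∫ t in (0 : ℝ)..T, weightedTwist μ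
      (fun r => 2 * (r * deriv (logReg (scale n)) r)) (φ t) (Dφ t)) + 1 := fun n => by
    rw [integral_add (hint n T) (integrable_const 1), ← (hb n).1]
    simp
  -- Adding 1 makes both the entropy density and its approximants nonnegative.
  set g : Ω → ℝ := fun x => ‖φ T x‖ ^ 2 * Real.log (‖φ T x‖ ^ 2) - ‖φ T x‖ ^ 2 + 1 with hg
  have hg0 : ∀ x, 0 ≤ g x := fun x => abs_log_entropy_density_le (norm_nonneg _)
  set L := ∫ x, (‖φ 0 x‖ ^ 2 * Real.log (‖φ 0 x‖ ^ 2) - ‖φ 0 x‖ ^ 2) ∂μ +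
    2 * (∫ t in (0 : ℝ)..T, totalTwist μ (φ t) (Dφ t)) + 1 with hL
  have hgm : AEStronglyMeasurable g μ := by
    refine aestronglyMeasurable_of_tendsto_ae atTop (fun n => (hmeas n T).add_const 1)
      (Eventually.of_forall fun x => (hpt T x).add_const 1)
  have hfatou : ∫⁻ x, ENNReal.ofReal (g x) ∂μ ≤ ENNReal.ofReal L := by
    calc ∫⁻ x, ENNReal.ofReal (g x) ∂μ
        = ∫⁻ x, liminf (fun n => ENNReal.ofReal
            (radialPrimitive (logReg (scale n)) ‖φ T x‖ + 1)) atTop ∂μ := by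
          refine lintegral_congr fun x => ?_
          exact (((ENNReal.continuous_ofReal.tendsto _).comp
            ((hpt T x).add_const 1)).liminf_eq).symm
      _ ≤ liminf (fun n => ∫⁻ x, ENNReal.ofReal
            (radialPrimitive (logReg (scale n)) ‖φ T x‖ + 1) ∂μ) atTop :=
          lintegral_liminf_le' fun n => ((hmeas n T).add_const 1).aemeasurable.ennreal_ofReal
      _ = liminf (fun n => ENNReal.ofReal
            (∫ x, (radialPrimitive (logReg (scale n)) ‖φ T x‖ + 1) ∂μ)) atTop := by
          congr 1
          ext n
          have hi : Integrable (fun x => radialPrimitive (logReg (scale n)) ‖φ T x‖ + 1) μ :=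
            (hint n T).add (integrable_const 1)
          rw [ofReal_integral_eq_lintegral_ofReal hi]
          exact Eventually.of_forall fun x => by
            have := (hbd n T x).1
            simp only [Pi.zero_apply]
            linarith
      _ = ENNReal.ofReal L := by
          refine ((ENNReal.continuous_ofReal.tendsto _).comp ?_).liminf_eq
          refine (hlimT.add_const 1).congr fun n => (hT1 n).symm
  have hgi : Integrable g μ := by
    refine ⟨hgm, ?_⟩
    rw [hasFiniteIntegral_iff_ofReal (Eventually.of_forall hg0)]
    exact hfatou.trans_lt ENNReal.ofReal_lt_top
  have hL0 : 0 ≤ L := by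
    refine ge_of_tendsto ((hlimT.add_const 1).congr fun n => (hT1 n).symm)
      (Eventually.of_forall fun n => integral_nonneg fun x => ?_)
    have := (hbd n T x).1
    simp only [Pi.zero_apply]
    linarith
  have hgL : ∫ x, g x ∂μ ≤ L := by
    rw [integral_eq_lintegral_of_nonneg_ae (Eventually.of_forall hg0) hgm]
    exact ENNReal.toReal_le_of_le_ofReal hL0 hfatou
  have hgeq : ∀ x, ‖φ T x‖ ^ 2 * Real.log (‖φ T x‖ ^ 2) = (g x + ‖φ T x‖ ^ 2) - 1 := fun x => by
    simp only [hg]; ring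
  have hfin : Integrable (fun x => ‖φ T x‖ ^ 2 * Real.log (‖φ T x‖ ^ 2)) μ := by
    simp_rw [hgeq]
    exact (hgi.add (hsq T)).sub (integrable_const 1)
  refine ⟨hfin, ?_⟩
  have h1 : ∫ x, g x ∂μ = ∫ x, ‖φ T x‖ ^ 2 * Real.log (‖φ T x‖ ^ 2) ∂μ - ‖φ T‖ ^ 2 + 1 := by
    have hi : Integrable (fun x => ‖φ T x‖ ^ 2 * Real.log (‖φ T x‖ ^ 2) - ‖φ T x‖ ^ 2) μ :=
      hfin.sub (hsq T)
    rw [hg, integral_add hi (integrable_const 1), integral_sub hfin (hsq T), ← l2sq_coe, l2sq]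
    simp
  have h2 : ∫ x, (‖φ 0 x‖ ^ 2 * Real.log (‖φ 0 x‖ ^ 2) - ‖φ 0 x‖ ^ 2) ∂μ =
      ∫ x, ‖φ 0 x‖ ^ 2 * Real.log (‖φ 0 x‖ ^ 2) ∂μ - ‖φ 0‖ ^ 2 := by
    rw [integral_sub h0 (hsq 0), ← l2sq_coe, l2sq]
  rw [h1, hL, h2, (h.conservation hW hT).1] at hgL
  linarith

end

/-! ### Cylinder functions -/

section

variable {d : ℕ} {Γ Γ' Λ : Finset (Lattice d)} {n m : WithTop ℕ∞}

/-- Functions of class `C^n` of the coordinates in `Γ`. -/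
def IsCyl {E : Type*} [NormedAddCommGroup E] [NormedSpace ℝ E] (n : WithTop ℕ∞)
    (Γ : Finset (Lattice d)) (f : Config d → E) : Prop :=
  ∃ h : (Γ → ℝ) → E, ContDiff ℝ n h ∧ f = fun x => h (Γ.restrict x)

/-- Compactly supported functions of class `C^n` of the coordinates in `Γ`. -/
def IsCTest (n : WithTop ℕ∞) (Γ : Finset (Lattice d)) (g : Config d → ℂ) : Prop :=
  ∃ h : (Γ → ℝ) → ℂ, ContDiff ℝ n h ∧ HasCompactSupport h ∧ g = fun x => h (Γ.restrict x)

lemma measurable_finset_restrict : Measurable (fun x : Config d => Γ.restrict x) :=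
  measurable_pi_lambda _ fun _ => measurable_pi_apply _

section

variable {E F : Type*} [NormedAddCommGroup E] [NormedSpace ℝ E]
  [NormedAddCommGroup F] [NormedSpace ℝ F]

lemma IsCTest.isCyl {g : Config d → ℂ} (hg : IsCTest n Γ g) : IsCyl n Γ g := by
  obtain ⟨h, h1, -, h2⟩ := hg
  exact ⟨h, h1, h2⟩

lemma IsCTest.of_le {g : Config d → ℂ} (hg : IsCTest n Γ g) (hmn : m ≤ n) : IsCTest m Γ g := by
  obtain ⟨h, h1, h2, h3⟩ := hg
  exact ⟨h, h1.of_le hmn, h2, h3⟩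

lemma IsCyl.mono {f : Config d → E} (hf : IsCyl n Γ f) (h : Γ ⊆ Γ') : IsCyl n Γ' f := by
  obtain ⟨k, h1, rfl⟩ := hf
  refine ⟨fun z => k fun i => z ⟨i, h i.2⟩, h1.comp ?_, rfl⟩
  exact contDiff_pi.2 fun i => contDiff_apply _ _ _

lemma IsCyl.comp {f : Config d → E} (hf : IsCyl n Γ f) {k : E → F} (hk : ContDiff ℝ n k) :
    IsCyl n Γ fun x => k (f x) := by
  obtain ⟨h, h1, rfl⟩ := hf
  exact ⟨fun z => k (h z), hk.comp h1, rfl⟩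

lemma isCyl_const (c : E) : IsCyl n Γ fun _ : Config d => c := ⟨fun _ => c, contDiff_const, rfl⟩

lemma IsCyl.add {f g : Config d → E} (hf : IsCyl n Γ f) (hg : IsCyl n Γ g) :
    IsCyl n Γ fun x => f x + g x := by
  obtain ⟨h, h1, rfl⟩ := hf
  obtain ⟨k, h2, rfl⟩ := hg
  exact ⟨_, h1.add h2, rfl⟩

lemma IsCyl.ofReal {f : Config d → ℝ} (hf : IsCyl n Γ f) :
    IsCyl n Γ fun x => ((f x : ℝ) : ℂ) := hf.comp Complex.ofRealCLM.contDiff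

lemma IsCyl.stronglyMeasurable [SecondCountableTopologyEither (Γ → ℝ) E]
    {f : Config d → E} (hf : IsCyl n Γ f) : StronglyMeasurable f := by
  obtain ⟨h, h1, rfl⟩ := hf
  exact h1.continuous.stronglyMeasurable.comp_measurable measurable_finset_restrict

lemma hasDerivAt_restrict_line (x v : Config d) (t : ℝ) :
    HasDerivAt (fun t : ℝ => Γ.restrict (x + t • v)) (Γ.restrict v) t :=
  (((hasDerivAt_id t).smul_const (Γ.restrict v)).const_add (Γ.restrict x)).congr_deriv
    (one_smul _ _)

lemma IsCyl.hasDerivAt_line {f : Config d → E} (hf : IsCyl n Γ f) (hn : n ≠ 0) (x v : Config d)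
    (t : ℝ) : HasDerivAt (fun t : ℝ => f (x + t • v)) (lineDeriv ℝ f (x + t • v) v) t := by
  obtain ⟨h, h1, rfl⟩ := hf
  have key : ∀ y : Config d, ∀ t : ℝ, HasDerivAt (fun t : ℝ => h (Γ.restrict (y + t • v)))
      (fderiv ℝ h (Γ.restrict (y + t • v)) (Γ.restrict v)) t := by
    intro y t
    have h2 := ((h1.differentiable hn) (Γ.restrict (y + t • v))).hasFDerivAt
    exact h2.comp_hasDerivAt t (hasDerivAt_restrict_line y v t)
  have h4 : lineDeriv ℝ (fun x => h (Γ.restrict x)) (x + t • v) v =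
      fderiv ℝ h (Γ.restrict (x + t • v)) (Γ.restrict v) := by
    have := (key (x + t • v) 0).deriv
    rwa [zero_smul, add_zero] at this
  rw [h4]
  exact key x t

lemma IsCyl.hasDerivAt {f : Config d → E} (hf : IsCyl n Γ f) (hn : n ≠ 0) (j : Lattice d)
    (x : Config d) (t : ℝ) :
    HasDerivAt (fun t : ℝ => f (x + t • Pi.single j 1)) (pderiv j f (x + t • Pi.single j 1)) t :=
  hf.hasDerivAt_line hn x _ t

lemma IsCyl.hasDerivAt_zero {f : Config d → E} (hf : IsCyl n Γ f) (hn : n ≠ 0) (j : Lattice d)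
    (x : Config d) : HasDerivAt (fun t : ℝ => f (x + t • Pi.single j 1)) (pderiv j f x) 0 := by
  simpa using hf.hasDerivAt hn j x 0

lemma pderiv_eq {f : Config d → E} {j : Lattice d} {x : Config d} {f' : E}
    (h : HasDerivAt (fun t : ℝ => f (x + t • Pi.single j 1)) f' 0) : pderiv j f x = f' := h.deriv

lemma pderiv_comp_restrict {h : (Γ → ℝ) → E} (hh : Differentiable ℝ h) (j : Lattice d)
    (x : Config d) : pderiv j (fun x => h (Γ.restrict x)) x =
      fderiv ℝ h (Γ.restrict x) (Γ.restrict (Pi.single j 1 : Config d)) := by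
  refine pderiv_eq ?_
  have h2 := (hh (Γ.restrict x)).hasFDerivAt
  have h4 : Γ.restrict (x + (0 : ℝ) • (Pi.single j 1 : Config d)) = Γ.restrict x := by
    rw [zero_smul, add_zero]
  have h5 : HasFDerivAt h (fderiv ℝ h (Γ.restrict x))
      (Γ.restrict (x + (0 : ℝ) • (Pi.single j 1 : Config d))) := by rwa [h4]
  exact h5.comp_hasDerivAt 0 (hasDerivAt_restrict_line x _ 0)

lemma IsCyl.pderiv {f : Config d → E} (hf : IsCyl n Γ f) (hmn : m + 1 ≤ n) (j : Lattice d) :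
    IsCyl m Γ (pderiv j f) := by
  obtain ⟨h, h1, rfl⟩ := hf
  refine ⟨fun z => fderiv ℝ h z (Γ.restrict (Pi.single j 1 : Config d)),
    (h1.fderiv_right hmn).clm_apply contDiff_const, ?_⟩
  ext x
  refine pderiv_comp_restrict (h1.differentiable fun h0 => ?_) j x
  subst h0
  simp at hmn

end

lemma IsCTest.pderiv {f : Config d → ℂ} (hf : IsCTest n Γ f) (hmn : m + 1 ≤ n) (j : Lattice d) :
    IsCTest m Γ (pderiv j f) := by
  obtain ⟨h, h1, h2, rfl⟩ := hf
  refine ⟨fun z => fderiv ℝ h z (Γ.restrict (Pi.single j 1 : Config d)),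
    (h1.fderiv_right hmn).clm_apply contDiff_const, ?_, ?_⟩
  · exact (h2.fderiv ℝ).comp_left (g := fun L : (Γ → ℝ) →L[ℝ] ℂ => L (Γ.restrict (Pi.single j 1 : Config d)))
      rfl
  · ext x
    refine pderiv_comp_restrict (h1.differentiable fun h0 => ?_) j x
    subst h0
    simp at hmn

lemma IsTest.pderiv {f : Config d → ℂ} (hf : IsTest Γ f) (j : Lattice d) :
    IsTest Γ (pderiv j f) := IsCTest.pderiv hf (by exact_mod_cast le_rfl) j

lemma IsTest.isCTest {f : Config d → ℂ} (hf : IsTest Γ f) (k : ℕ) : IsCTest k Γ f :=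
  IsCTest.of_le hf (by exact_mod_cast le_top)

lemma IsCTest.mul_cyl {f g : Config d → ℂ} (hg : IsCTest n Γ g) (hf : IsCyl n Γ f) :
    IsCTest n Γ fun x => g x * f x := by
  obtain ⟨h, h1, h2, rfl⟩ := hg
  obtain ⟨k, h3, rfl⟩ := hf
  exact ⟨fun z => h z * k z, h1.mul h3, h2.mul_right, rfl⟩

lemma IsCTest.mul {f g : Config d → ℂ} (hf : IsCTest n Γ f) (hg : IsCTest n Γ' g) :
    IsCTest n (Γ ∪ Γ') fun x => f x * g x := by
  obtain ⟨h, h1, h2, rfl⟩ := hf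
  obtain ⟨k, h3, h4, rfl⟩ := hg
  have hl : Continuous fun (z : ↥(Γ ∪ Γ') → ℝ) (i : Γ) => z ⟨i, Finset.mem_union_left _ i.2⟩ :=
    continuous_pi fun i => continuous_apply _
  refine ⟨fun z => h (fun i => z ⟨i, Finset.mem_union_left _ i.2⟩) *
    k (fun i => z ⟨i, Finset.mem_union_right _ i.2⟩), ?_, ?_, rfl⟩
  · refine (h1.comp ?_).mul (h3.comp ?_)
    · exact contDiff_pi.2 fun i => contDiff_apply _ _ _
    · exact contDiff_pi.2 fun i => contDiff_apply _ _ _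
  · obtain ⟨R, hR⟩ := h2.isCompact.isBounded.subset_closedBall 0
    obtain ⟨R', hR'⟩ := h4.isCompact.isBounded.subset_closedBall 0
    refine HasCompactSupport.of_support_subset_isCompact
      (isCompact_closedBall (0 : ↥(Γ ∪ Γ') → ℝ) (max R R')) fun z hz => ?_
    have hz1 := hR (subset_tsupport _ (left_ne_zero_of_mul hz))
    have hz2 := hR' (subset_tsupport _ (right_ne_zero_of_mul hz))
    rw [mem_closedBall_zero_iff] at hz1 hz2 ⊢
    have h0 : 0 ≤ max R R' := ((norm_nonneg _).trans hz1).trans (le_max_left _ _)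
    refine (pi_norm_le_iff_of_nonneg h0).2 fun i => ?_
    rcases Finset.mem_union.1 i.2 with hi | hi
    · exact ((norm_le_pi_norm (fun i : Γ => z ⟨i, Finset.mem_union_left _ i.2⟩) ⟨i, hi⟩).trans
        hz1).trans (le_max_left _ _)
    · exact ((norm_le_pi_norm (fun i : Γ' => z ⟨i, Finset.mem_union_right _ i.2⟩) ⟨i, hi⟩).trans
        hz2).trans (le_max_right _ _)

lemma IsCTest.comp {g : Config d → ℂ} (hg : IsCTest n Γ g) {F : ℂ → ℂ} (hF : ContDiff ℝ n F)
    (h0 : F 0 = 0) : IsCTest n Γ fun x => F (g x) := by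
  obtain ⟨h, h1, h2, rfl⟩ := hg
  exact ⟨fun z => F (h z), hF.comp h1, h2.comp_left h0, rfl⟩

lemma IsCTest.star {g : Config d → ℂ} (hg : IsCTest n Γ g) : IsCTest n Γ fun x => star (g x) :=
  hg.comp Complex.conjCLE.contDiff (star_zero _)

lemma IsCTest.add {f g : Config d → ℂ} (hf : IsCTest n Γ f) (hg : IsCTest n Γ g) :
    IsCTest n Γ fun x => f x + g x := by
  obtain ⟨h, h1, h2, rfl⟩ := hf
  obtain ⟨k, h3, h4, rfl⟩ := hg
  exact ⟨_, h1.add h3, h2.add h4, rfl⟩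

lemma IsCTest.exists_bound {g : Config d → ℂ} (hg : IsCTest n Γ g) : ∃ C, 0 ≤ C ∧ ∀ x, ‖g x‖ ≤ C := by
  obtain ⟨h, h1, h2, rfl⟩ := hg
  obtain ⟨C, hC⟩ := h2.exists_bound_of_continuous h1.continuous
  exact ⟨C, (norm_nonneg _).trans (hC 0), fun x => hC _⟩

lemma pderiv_mul {f g : Config d → ℂ} (hf : IsCyl 1 Γ f) (hg : IsCyl 1 Γ' g) (j : Lattice d)
    (x : Config d) : pderiv j (fun x => f x * g x) x = pderiv j f x * g x + f x * pderiv j g x := by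
  have h := (hf.hasDerivAt_zero one_ne_zero j x).mul (hg.hasDerivAt_zero one_ne_zero j x)
  simp only [zero_smul, add_zero] at h
  exact pderiv_eq h

lemma pderiv_comp {f : Config d → ℂ} (hf : IsCyl 1 Γ f) {F : ℂ → ℂ} (hF : ContDiff ℝ 1 F)
    (j : Lattice d) (x : Config d) :
    pderiv j (fun x => F (f x)) x = fderiv ℝ F (f x) (pderiv j f x) := by
  have h1 := hf.hasDerivAt_zero one_ne_zero j x
  have h2 := ((hF.differentiable one_ne_zero) (f (x + (0 : ℝ) • Pi.single j 1))).hasFDerivAt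
  have h := h2.comp_hasDerivAt 0 h1
  rw [zero_smul, add_zero] at h
  exact pderiv_eq h

/-- Smooth cutoffs that increase to one, with gradients that tend to zero. -/
lemma exists_cutoff (Γ : Finset (Lattice d)) : ∃ θ : ℕ → Config d → ℂ, (∀ n, IsTest Γ (θ n)) ∧
    (∀ n x, ‖θ n x‖ ≤ 1) ∧ (∀ x, Tendsto (fun n => θ n x) atTop (𝓝 1)) ∧
    ∀ j, ∃ C, ∀ n x, ‖pderiv j (θ n) x‖ ≤ C / (n + 1) := by
  -- A single bump is dilated by n + 1, which divides its gradient by n + 1.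
  let b : ContDiffBump (0 : Γ → ℝ) := ⟨1, 2, one_pos, one_lt_two⟩
  have hb : ContDiff ℝ 1 fun z : Γ → ℝ => ((b z : ℝ) : ℂ) :=
    Complex.ofRealCLM.contDiff.comp b.contDiff
  have hb' : HasCompactSupport fun z : Γ → ℝ => ((b z : ℝ) : ℂ) :=
    b.hasCompactSupport.comp_left Complex.ofReal_zero
  refine ⟨fun n x => ((b (((n : ℝ) + 1)⁻¹ • Γ.restrict x) : ℝ) : ℂ), fun n => ?_, fun n x => ?_,
    fun x => ?_, fun j => ?_⟩
  · refine ⟨fun z => ((b (((n : ℝ) + 1)⁻¹ • z) : ℝ) : ℂ), ?_, ?_, rfl⟩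
    · exact Complex.ofRealCLM.contDiff.comp (b.contDiff.comp (contDiff_const_smul _))
    · exact hb'.comp_smul (by positivity)
  · rw [Complex.norm_real, Real.norm_eq_abs, abs_of_nonneg b.nonneg]
    exact b.le_one
  · refine tendsto_const_nhds.congr' ?_
    obtain ⟨N, hN⟩ := exists_nat_ge ‖Γ.restrict x‖
    filter_upwards [eventually_ge_atTop N] with n hn
    rw [b.one_of_mem_closedBall, Complex.ofReal_one]
    rw [mem_closedBall_zero_iff, norm_smul, norm_inv, Real.norm_of_nonneg (by positivity),
      inv_mul_le_iff₀ (by positivity)]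
    have : (N : ℝ) ≤ n := by exact_mod_cast hn
    change _ ≤ _ * (1 : ℝ)
    linarith
  · obtain ⟨C, hC⟩ := (hb'.fderiv ℝ).exists_bound_of_continuous
      (hb.continuous_fderiv one_ne_zero)
    refine ⟨C * ‖Γ.restrict (Pi.single j 1 : Config d)‖, fun n x => ?_⟩
    have h1 : HasFDerivAt (fun z : Γ → ℝ => ((n : ℝ) + 1)⁻¹ • z)
        (((n : ℝ) + 1)⁻¹ • ContinuousLinearMap.id ℝ (Γ → ℝ)) (Γ.restrict x) :=
      (((n : ℝ) + 1)⁻¹ • ContinuousLinearMap.id ℝ (Γ → ℝ)).hasFDerivAt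
    have h2 := ((hb.differentiable one_ne_zero)
      (((n : ℝ) + 1)⁻¹ • Γ.restrict x)).hasFDerivAt.comp _ h1
    have h3 := pderiv_comp_restrict (Γ := Γ)
      (h := fun z => ((b (((n : ℝ) + 1)⁻¹ • z) : ℝ) : ℂ))
      ((hb.comp (contDiff_const_smul _)).differentiable one_ne_zero) j x
    have h4 : fderiv ℝ (fun z => ((b (((n : ℝ) + 1)⁻¹ • z) : ℝ) : ℂ)) (Γ.restrict x) = _ :=
      h2.fderiv
    rw [h3, h4]
    simp only [ContinuousLinearMap.comp_apply, smul_apply,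
      ContinuousLinearMap.id_apply, map_smul]
    rw [norm_smul, norm_inv, Real.norm_of_nonneg (by positivity : (0 : ℝ) ≤ (n : ℝ) + 1),
      div_eq_inv_mul]
    gcongr
    exact (ContinuousLinearMap.le_opNorm _ _).trans (by gcongr; exact hC _)

end

/-! ### The energy and the DLR equations -/

section

variable {d : ℕ} {Φ : Interaction d} {Γ Γ' Λ Λ' : Finset (Lattice d)} {μ : Measure (Config d)}

lemma Interaction.Covers.mono (h : Φ.Covers Λ Γ) (hΓ : Γ ⊆ Γ') : Φ.Covers Λ Γ' :=
  fun i hi k hk => hΓ (h i hi k hk)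

lemma Interaction.Covers.anti (h : Φ.Covers Λ Γ) (hΛ : Λ' ⊆ Λ) : Φ.Covers Λ' Γ :=
  fun i hi k hk => h i (hΛ hi) k hk

lemma Interaction.exists_covers (Φ : Interaction d) (Λ : Finset (Lattice d)) :
    ∃ Γ, Φ.Covers Λ Γ := by
  refine ⟨Λ.biUnion fun i => Finset.Icc (fun a => i a - Φ.R) (fun a => i a + Φ.R),
    fun i hi k hk => Finset.mem_biUnion.2 ⟨i, hi, ?_⟩⟩
  have h : ∀ a, |i a - k a| ≤ (Φ.R : ℤ) := by
    intro a
    have := (dist_le_pi_dist i k a).trans hk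
    rw [Int.dist_eq] at this
    exact_mod_cast this
  rw [Finset.mem_Icc]
  constructor <;> intro a <;> have := abs_le.1 (h a) <;> simp only <;> linarith

/-- A set X meeting Λ with J_X ≠ 0 has diameter at most R, so all its sites lie within R of Λ. This
turns the energy into a finite sum of functions of x_Γ. -/
lemma Interaction.subset_of_ne_zero (hΓ : Φ.Covers Λ Γ) {X : Finset (Lattice d)}
    (hX : ¬ Disjoint X Λ) (hJ : Φ.J X ≠ 0) : X ⊆ Γ := by
  obtain ⟨i, hiX, hi⟩ := Finset.not_disjoint_iff.1 hX
  intro k hk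
  refine hΓ i hi k ?_
  have h1 : Metric.diam (X : Set (Lattice d)) ≤ Φ.R := by
    by_contra h
    exact hJ (Φ.finite_range X (not_le.1 h))
  exact (Metric.dist_le_diam_of_mem X.finite_toSet.isBounded hiX hk).trans h1

lemma Interaction.U_eq_sum (hΓ : Φ.Covers Λ Γ) (x : Config d) :
    Φ.U Λ x = ∑ X ∈ Γ.powerset.filter (fun X => ¬ Disjoint X Λ), Φ.J X (X.restrict x) := by
  refine finsum_mem_eq_sum_of_inter_support_eq (s := {X | ¬ Disjoint X Λ}) _ ?_
  ext X
  simp only [mem_inter_iff, mem_ofPred_eq, Function.mem_support, Finset.coe_filter,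
    Finset.mem_powerset]
  constructor
  · rintro ⟨h1, h2⟩
    exact ⟨⟨Interaction.subset_of_ne_zero hΓ h1 fun h => h2 (by rw [h]; rfl), h1⟩, h2⟩
  · rintro ⟨⟨-, h1⟩, h2⟩
    exact ⟨h1, h2⟩

lemma Interaction.contDiff_J (Φ : Interaction d) (X : Finset (Lattice d)) :
    ContDiff ℝ 1 (Φ.J X) :=
  contDiff_one_iff_fderiv.2 ⟨Φ.differentiable X, (Φ.differentiable_fderiv X).continuous⟩

lemma Interaction.isCyl_U (hΓ : Φ.Covers Λ Γ) : IsCyl 1 Γ (Φ.U Λ) := by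
  have h : ∀ S : Finset (Finset (Lattice d)), (∀ X ∈ S, X ⊆ Γ) →
      IsCyl 1 Γ fun x : Config d => ∑ X ∈ S, Φ.J X (X.restrict x) := by
    classical
    intro S
    induction S using Finset.induction_on with
    | empty => intro _; simpa using isCyl_const (0 : ℝ)
    | insert X S hX ih =>
      intro hS
      simp only [Finset.sum_insert hX]
      refine IsCyl.add ?_ (ih fun Y hY => hS Y (Finset.mem_insert_of_mem hY))
      exact IsCyl.mono ⟨Φ.J X, Φ.contDiff_J X, rfl⟩ (hS X (Finset.mem_insert_self _ _))
  have h2 := h (Γ.powerset.filter fun X => ¬ Disjoint X Λ)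
    fun X hX => Finset.mem_powerset.1 (Finset.mem_filter.1 hX).1
  convert h2 using 2 with x
  exact Interaction.U_eq_sum hΓ x

lemma Interaction.measurable_U (Φ : Interaction d) (Λ : Finset (Lattice d)) :
    Measurable (Φ.U Λ) := by
  obtain ⟨Γ, hΓ⟩ := Φ.exists_covers Λ
  exact (Interaction.isCyl_U hΓ).stronglyMeasurable.measurable

/-- The terms of U_Λ that are missing from U_{j} belong to sets X not containing j, and do not
depend on x_j. -/
lemma Interaction.pderiv_U {j : Lattice d} (hj : j ∈ Λ) : pderiv j (Φ.U Λ) = pderiv j (Φ.U {j}) := by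
  obtain ⟨Γ, hΓ⟩ := Φ.exists_covers Λ
  have hΓj : Φ.Covers {j} Γ := hΓ.anti (by simpa using hj)
  ext x
  have h1 := (Interaction.isCyl_U hΓj).hasDerivAt_zero one_ne_zero j x
  have h2 : ∀ t : ℝ, Φ.U Λ (x + t • Pi.single j 1) =
      Φ.U {j} (x + t • Pi.single j 1) + (Φ.U Λ x - Φ.U {j} x) := by
    intro t
    have key : ∀ y, Φ.U Λ y - Φ.U {j} y =
        ∑ X ∈ (Γ.powerset.filter fun X => ¬ Disjoint X Λ).filter (fun X => j ∉ X),
          Φ.J X (X.restrict y) := by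
      intro y
      rw [Interaction.U_eq_sum hΓ, Interaction.U_eq_sum hΓj, sub_eq_iff_eq_add,
        ← Finset.sum_filter_add_sum_filter_not _ (fun X => j ∉ X)]
      congr 1
      refine Finset.sum_congr ?_ fun _ _ => rfl
      ext X
      simp only [Finset.mem_filter, not_not, Finset.disjoint_singleton_right]
      constructor
      · rintro ⟨⟨h1, -⟩, h3⟩
        exact ⟨h1, h3⟩
      · rintro ⟨h1, h3⟩
        exact ⟨⟨h1, Finset.not_disjoint_iff.2 ⟨j, h3, hj⟩⟩, h3⟩
    have h3 : Φ.U Λ (x + t • Pi.single j 1) - Φ.U {j} (x + t • Pi.single j 1) =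
        Φ.U Λ x - Φ.U {j} x := by
      rw [key, key]
      refine Finset.sum_congr rfl fun X hX => ?_
      congr 1
      ext i
      have hne : (i : Lattice d) ≠ j := fun h => (Finset.mem_filter.1 hX).2 (h ▸ i.2)
      simp [Finset.restrict, Pi.single_eq_of_ne hne]
    linarith
  refine pderiv_eq ?_
  simp only [h2]
  exact h1.add_const _

/-- The configuration that agrees with `z` on `Λ` and vanishes elsewhere. -/
noncomputable def extendZero (z : Λ → ℝ) : Config d :=
  Function.updateFinset (0 : Config d) Λ z

lemma updateFinset_add (ω : Config d) (y z : Λ → ℝ) :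
    Function.updateFinset ω Λ y + extendZero z =
      Function.updateFinset ω Λ (y + z) := by
  ext i
  by_cases hi : i ∈ Λ <;> simp [extendZero, Function.updateFinset, hi]

lemma measurable_updateFinset_prod (Λ : Finset (Lattice d)) :
    Measurable fun p : Config d × (Λ → ℝ) => Function.updateFinset p.1 Λ p.2 := by
  refine measurable_pi_lambda _ fun i => ?_
  by_cases hi : i ∈ Λ
  · simp only [Function.updateFinset, hi, dite_true]
    exact (measurable_pi_apply _).comp measurable_snd
  · simp only [Function.updateFinset, hi, dite_false]
    exact (measurable_pi_apply _).comp measurable_fst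

lemma measurable_updateFinset_right (ω : Config d) :
    Measurable fun y : Λ → ℝ => Function.updateFinset ω Λ y :=
  (measurable_updateFinset_prod Λ).comp measurable_prodMk_left

lemma Interaction.measurable_Z (Φ : Interaction d) (Λ : Finset (Lattice d)) :
    Measurable (Φ.Z Λ) := by
  refine Measurable.lintegral_prod_right' (f := fun p : Config d × (Λ → ℝ) =>
    ENNReal.ofReal (Real.exp (-Φ.U Λ (Function.updateFinset p.1 Λ p.2)))) ?_
  exact (((Φ.measurable_U Λ).comp (measurable_updateFinset_prod Λ)).neg.exp).ennreal_ofReal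

lemma Interaction.lintegral_localGibbs (Φ : Interaction d) (Λ : Finset (Lattice d)) (ω : Config d)
    {F : Config d → ℝ≥0∞} (hF : Measurable F) :
    ∫⁻ x, F x ∂Φ.localGibbs Λ ω = (Φ.Z Λ ω)⁻¹ * ∫⁻ y : Λ → ℝ,
      ENNReal.ofReal (Real.exp (-Φ.U Λ (Function.updateFinset ω Λ y))) *
        F (Function.updateFinset ω Λ y) := by
  have h1 : Measurable fun y : Λ → ℝ =>
      ENNReal.ofReal (Real.exp (-Φ.U Λ (Function.updateFinset ω Λ y))) :=
    (((Φ.measurable_U Λ).comp (measurable_updateFinset_right ω)).neg.exp).ennreal_ofReal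
  have h2 : Measurable fun y : Λ → ℝ => F (Function.updateFinset ω Λ y) :=
    hF.comp (measurable_updateFinset_right ω)
  rw [Interaction.localGibbs, lintegral_smul_measure,
    lintegral_map hF (measurable_updateFinset_right ω),
    lintegral_withDensity_eq_lintegral_mul _ h1 h2]
  rfl

lemma Interaction.measurable_localGibbs (Φ : Interaction d) (Λ : Finset (Lattice d)) :
    Measurable (Φ.localGibbs Λ) := by
  refine Measure.measurable_of_measurable_coe _ fun A hA => ?_
  have h : (fun ω => Φ.localGibbs Λ ω A) = fun ω => (Φ.Z Λ ω)⁻¹ * ∫⁻ y : Λ → ℝ,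
      ENNReal.ofReal (Real.exp (-Φ.U Λ (Function.updateFinset ω Λ y))) *
        A.indicator 1 (Function.updateFinset ω Λ y) := by
    ext ω
    rw [← Φ.lintegral_localGibbs Λ ω (measurable_one.indicator hA), lintegral_indicator_one hA]
  rw [h]
  refine (Φ.measurable_Z Λ).inv.mul ?_
  refine Measurable.lintegral_prod_right' (f := fun p : Config d × (Λ → ℝ) =>
    ENNReal.ofReal (Real.exp (-Φ.U Λ (Function.updateFinset p.1 Λ p.2))) *
      A.indicator 1 (Function.updateFinset p.1 Λ p.2)) ?_
  exact (((Φ.measurable_U Λ).comp (measurable_updateFinset_prod Λ)).neg.exp).ennreal_ofReal.mul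
    ((measurable_one.indicator hA).comp (measurable_updateFinset_prod Λ))

lemma Interaction.IsGibbs.lintegral_eq (hμ : Φ.IsGibbs μ) (Λ : Finset (Lattice d))
    {F : Config d → ℝ≥0∞} (hF : Measurable F) :
    ∫⁻ x, F x ∂μ = ∫⁻ ω, ((Φ.Z Λ ω)⁻¹ * ∫⁻ y : Λ → ℝ,
      ENNReal.ofReal (Real.exp (-Φ.U Λ (Function.updateFinset ω Λ y))) *
        F (Function.updateFinset ω Λ y)) ∂μ := by
  have h : μ.bind (Φ.localGibbs Λ) = μ := by
    ext A hA
    rw [Measure.bind_apply hA (Φ.measurable_localGibbs Λ).aemeasurable, hμ Λ A hA]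
  conv_lhs => rw [← h]
  rw [Measure.lintegral_bind (Φ.measurable_localGibbs Λ).aemeasurable hF.aemeasurable]
  simp only [Φ.lintegral_localGibbs Λ _ hF]

/-- The measure `e^{U_Λ} μ`, which for a Gibbs measure `μ` is invariant under translations of the
coordinates in `Λ`. -/
noncomputable def Interaction.flat (Φ : Interaction d) (μ : Measure (Config d))
    (Λ : Finset (Lattice d)) : Measure (Config d) :=
  μ.withDensity fun x => ENNReal.ofReal (Real.exp (Φ.U Λ x))

lemma Interaction.measurable_exp_U (Φ : Interaction d) (Λ : Finset (Lattice d)) :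
    Measurable fun x => ENNReal.ofReal (Real.exp (Φ.U Λ x)) :=
  (Φ.measurable_U Λ).exp.ennreal_ofReal

/-- In the DLR equation the weight e^{U_Λ} cancels the Gibbs factor, leaving Lebesgue measure in x_Λ
with a normalisation depending on the boundary condition alone. -/
lemma Interaction.IsGibbs.lintegral_flat (hμ : Φ.IsGibbs μ) (Λ : Finset (Lattice d))
    {F : Config d → ℝ≥0∞} (hF : Measurable F) :
    ∫⁻ x, F x ∂Φ.flat μ Λ = ∫⁻ ω, ((Φ.Z Λ ω)⁻¹ * ∫⁻ y : Λ → ℝ,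
      F (Function.updateFinset ω Λ y)) ∂μ := by
  rw [Interaction.flat, lintegral_withDensity_eq_lintegral_mul _ (Φ.measurable_exp_U Λ) hF,
    hμ.lintegral_eq Λ ((Φ.measurable_exp_U Λ).mul hF)]
  refine lintegral_congr fun ω => ?_
  congr 1
  refine lintegral_congr fun y => ?_
  rw [Pi.mul_apply, ← mul_assoc, ← ENNReal.ofReal_mul (Real.exp_nonneg _), ← Real.exp_add,
    neg_add_cancel, Real.exp_zero, ENNReal.ofReal_one, one_mul]

lemma Interaction.IsGibbs.measurePreserving_add (hμ : Φ.IsGibbs μ) (Λ : Finset (Lattice d))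
    (z : Λ → ℝ) : MeasurePreserving (fun x => x + extendZero z)
      (Φ.flat μ Λ) (Φ.flat μ Λ) := by
  have hm : Measurable fun x : Config d => x + extendZero z :=
    measurable_id.add_const _
  refine ⟨hm, Measure.ext_of_lintegral _ fun F hF => ?_⟩
  rw [lintegral_map hF hm, hμ.lintegral_flat Λ (F := fun x => F (x + extendZero z)) (hF.comp hm), hμ.lintegral_flat Λ hF]
  refine lintegral_congr fun ω => ?_
  congr 1
  simp only [updateFinset_add]
  exact lintegral_add_right_eq_self (fun y : Λ → ℝ => F (Function.updateFinset ω Λ y)) z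

/-- The flat measure may be infinite, but U_Λ is continuous in x_Γ and hence bounded where x_Γ stays
in a compact set. -/
lemma Interaction.flat_lt_top [IsFiniteMeasure μ] (hΓ : Φ.Covers Λ Γ) {K : Set (Γ → ℝ)}
    (hK : IsCompact K) : Φ.flat μ Λ ((fun x => Γ.restrict x) ⁻¹' K) < ∞ := by
  obtain ⟨h, h1, h2⟩ := Interaction.isCyl_U hΓ
  obtain ⟨C, hC⟩ := hK.exists_bound_of_continuousOn h1.continuous.continuousOn
  have hms : MeasurableSet ((fun x : Config d => Γ.restrict x) ⁻¹' K) :=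
    measurable_finset_restrict hK.measurableSet
  rw [Interaction.flat, withDensity_apply _ hms]
  calc ∫⁻ x in (fun x => Γ.restrict x) ⁻¹' K, ENNReal.ofReal (Real.exp (Φ.U Λ x)) ∂μ
      ≤ ∫⁻ _ in (fun x : Config d => Γ.restrict x) ⁻¹' K, ENNReal.ofReal (Real.exp C) ∂μ := by
        refine setLIntegral_mono' hms fun x hx => ENNReal.ofReal_le_ofReal (Real.exp_le_exp.2 ?_)
        rw [h2]
        exact (le_abs_self _).trans (hC _ hx)
    _ < ∞ := by
        rw [setLIntegral_const]
        exact ENNReal.mul_lt_top ENNReal.ofReal_lt_top (measure_lt_top _ _)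

end

/-! ### Integration by parts -/

section

variable {d : ℕ} {Φ : Interaction d} {Γ Γ' Λ : Finset (Lattice d)} {μ : Measure (Config d)}
  {j : Lattice d}

lemma IsCyl.exists_bound_on {E : Type*} [NormedAddCommGroup E] [NormedSpace ℝ E]
    {n : WithTop ℕ∞} {f : Config d → E} (hf : IsCyl n Γ f) (R : ℝ) :
    ∃ C, 0 ≤ C ∧ ∀ x, ‖Γ.restrict x‖ ≤ R → ‖f x‖ ≤ C := by
  obtain ⟨h, h1, rfl⟩ := hf
  obtain ⟨C, hC⟩ := (isCompact_closedBall (0 : Γ → ℝ) R).exists_bound_of_continuousOn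
    h1.continuous.continuousOn
  exact ⟨max C 0, le_max_right _ _, fun x hx =>
    (hC _ (mem_closedBall_zero_iff.2 hx)).trans (le_max_left _ _)⟩

lemma IsCTest.exists_radius {n : WithTop ℕ∞} {g : Config d → ℂ} (hg : IsCTest n Γ g) :
    ∃ R, ∀ x, g x ≠ 0 → ‖Γ.restrict x‖ ≤ R := by
  obtain ⟨h, h1, h2, rfl⟩ := hg
  obtain ⟨R, hR⟩ := h2.isCompact.isBounded.subset_closedBall 0
  exact ⟨R, fun x hx => mem_closedBall_zero_iff.1 (hR (subset_tsupport _ hx))⟩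

lemma IsCyl.exists_norm_mul_le {E : Type*} [NormedAddCommGroup E] [NormedSpace ℝ E]
    {n m : WithTop ℕ∞} {g : Config d → ℂ} {f : Config d → E} (hf : IsCyl n Γ f)
    (hg : IsCTest m Γ g) : ∃ C, 0 ≤ C ∧ ∀ x, ‖g x‖ * ‖f x‖ ≤ C := by
  obtain ⟨R, hR⟩ := hg.exists_radius
  obtain ⟨C, hC0, hC⟩ := hf.exists_bound_on R
  obtain ⟨M, hM0, hM⟩ := hg.exists_bound
  refine ⟨M * C, by positivity, fun x => ?_⟩
  by_cases h : g x = 0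
  · rw [h, norm_zero, zero_mul]
    positivity
  · exact mul_le_mul (hM x) (hC x (hR x h)) (norm_nonneg _) hM0

lemma IsCTest.stronglyMeasurable {n : WithTop ℕ∞} {g : Config d → ℂ} (hg : IsCTest n Γ g) :
    StronglyMeasurable g := hg.isCyl.stronglyMeasurable

lemma IsCTest.memLp [IsFiniteMeasure μ] {n : WithTop ℕ∞} {g : Config d → ℂ} (hg : IsCTest n Γ g)
    (p : ℝ≥0∞) : MemLp g p μ := by
  obtain ⟨C, -, hC⟩ := hg.exists_bound
  exact MemLp.of_bound hg.stronglyMeasurable.aestronglyMeasurable C (Eventually.of_forall hC)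

lemma isCyl_pderiv_U (hΓ : Φ.Covers {j} Γ) :
    IsCyl 0 Γ fun x => ((pderiv j (Φ.U {j}) x : ℝ) : ℂ) :=
  ((Interaction.isCyl_U hΓ).pderiv (by simp) j).ofReal

lemma norm_restrict_single_le (j : Lattice d) :
    ‖Γ.restrict (Pi.single j 1 : Config d)‖ ≤ 1 := by
  refine (pi_norm_le_iff_of_nonneg zero_le_one).2 fun i => ?_
  change ‖(Pi.single j 1 : Config d) i‖ ≤ 1
  rw [Pi.single_apply]
  split_ifs <;> simp

lemma extendZero_single (hj : j ∈ Λ) (t : ℝ) :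
    extendZero (t • Pi.single (⟨j, hj⟩ : Λ) 1 : Λ → ℝ) = t • (Pi.single j 1 : Config d) := by
  ext i
  by_cases hi : i ∈ Λ
  · by_cases hij : i = j
    · subst hij
      simp [extendZero, Function.updateFinset, hi]
    · have : (⟨i, hi⟩ : Λ) ≠ ⟨j, hj⟩ := fun h => hij (congrArg Subtype.val h)
      simp [extendZero, Function.updateFinset, hi, Pi.single_eq_of_ne this,
        Pi.single_eq_of_ne hij]
  · have hij : i ≠ j := fun h => hi (h ▸ hj)
    simp [extendZero, Function.updateFinset, hi, Pi.single_eq_of_ne hij]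

lemma measurableSet_restrict_closedBall (R : ℝ) :
    MeasurableSet ((fun x : Config d => Γ.restrict x) ⁻¹' Metric.closedBall 0 R) :=
  measurable_finset_restrict measurableSet_closedBall

lemma integrable_flat_indicator [IsFiniteMeasure μ] (hΓ : Φ.Covers Λ Γ) (R M : ℝ) :
    Integrable (indicator ((fun x : Config d => Γ.restrict x) ⁻¹' Metric.closedBall 0 R)
      fun _ => M) (Φ.flat μ Λ) :=
  (integrable_indicator_iff (measurableSet_restrict_closedBall R)).2
    (integrableOn_const (Φ.flat_lt_top hΓ (isCompact_closedBall 0 R)).ne)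

lemma IsCTest.integrable_flat [IsFiniteMeasure μ] (hΓ : Φ.Covers Λ Γ) {n : WithTop ℕ∞}
    {G : Config d → ℂ} (hG : IsCTest n Γ G) : Integrable G (Φ.flat μ Λ) := by
  obtain ⟨R, hR⟩ := hG.exists_radius
  obtain ⟨M, hM0, hM⟩ := hG.exists_bound
  refine Integrable.mono' (integrable_flat_indicator hΓ R M)
    hG.stronglyMeasurable.aestronglyMeasurable (Eventually.of_forall fun x => ?_)
  by_cases h : G x = 0
  · rw [h, norm_zero]
    exact indicator_nonneg (fun _ _ => hM0) _
  · rw [indicator_of_mem]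
    · exact hM x
    · exact mem_closedBall_zero_iff.2 (hR x h)

lemma integral_flat (Φ : Interaction d) (Λ : Finset (Lattice d)) (F : Config d → ℂ) :
    ∫ x, F x ∂Φ.flat μ Λ = ∫ x, ((Real.exp (Φ.U Λ x) : ℝ) : ℂ) * F x ∂μ := by
  rw [Interaction.flat, integral_withDensity_eq_integral_toReal_smul (Φ.measurable_exp_U Λ)
    (Eventually.of_forall fun _ => ENNReal.ofReal_lt_top)]
  refine integral_congr_ae (Eventually.of_forall fun x => ?_)
  simp only
  rw [ENNReal.toReal_ofReal (Real.exp_nonneg _), Complex.real_smul]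

/-- By translation invariance the integral of G(x + s e_j) does not depend on s; its derivative at s
= 0 is taken under the integral. -/
lemma integral_pderiv_flat [IsFiniteMeasure μ] (hμ : Φ.IsGibbs μ) (hΓ : Φ.Covers Λ Γ)
    (hj : j ∈ Λ) {G : Config d → ℂ} (hG : IsCTest 1 Γ G) :
    ∫ x, pderiv j G x ∂Φ.flat μ Λ = 0 := by
  have hG' : IsCTest 0 Γ (pderiv j G) := hG.pderiv (by simp) j
  obtain ⟨R, hR⟩ := hG'.exists_radius
  obtain ⟨M, hM0, hM⟩ := hG'.exists_bound
  have hmeas : ∀ s : ℝ, Measurable fun x : Config d => x + s • (Pi.single j 1 : Config d) :=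
    fun s => measurable_id.add_const _
  have key := hasDerivAt_integral_of_dominated_loc_of_deriv_le (μ := Φ.flat μ Λ)
    (F := fun (s : ℝ) x => G (x + s • (Pi.single j 1 : Config d)))
    (F' := fun (s : ℝ) x => pderiv j G (x + s • (Pi.single j 1 : Config d)))
    (x₀ := (0 : ℝ)) (s := Metric.ball 0 1)
    -- The radius grows by one since |s| < 1 and the unit vector has norm at most one.
    (bound := indicator ((fun x : Config d => Γ.restrict x) ⁻¹' Metric.closedBall 0 (R + 1))
      fun _ => M) (Metric.ball_mem_nhds _ one_pos)
    (Eventually.of_forall fun s =>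
      (hG.stronglyMeasurable.comp_measurable (hmeas s)).aestronglyMeasurable)
    (by simpa using hG.integrable_flat hΓ)
    (hG'.stronglyMeasurable.comp_measurable (hmeas 0)).aestronglyMeasurable
    (Eventually.of_forall fun x s hs => ?_) ?_
    (Eventually.of_forall fun x s _ => hG.isCyl.hasDerivAt one_ne_zero j x s)
  · have h1 : ∀ s : ℝ, ∫ x, G (x + s • (Pi.single j 1 : Config d)) ∂Φ.flat μ Λ =
        ∫ x, G x ∂Φ.flat μ Λ := by
      intro s
      have hp := hμ.measurePreserving_add Λ (s • Pi.single (⟨j, hj⟩ : Λ) 1)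
      rw [extendZero_single hj] at hp
      conv_rhs => rw [← hp.map_eq]
      rw [integral_map hp.measurable.aemeasurable hG.stronglyMeasurable.aestronglyMeasurable]
    have h2 := key.2
    simp only [h1] at h2
    have h3 := h2.unique (hasDerivAt_const _ _)
    simpa using h3
  · by_cases h : pderiv j G (x + s • (Pi.single j 1 : Config d)) = 0
    · rw [h, norm_zero]
      exact indicator_nonneg (fun _ _ => hM0) _
    · rw [indicator_of_mem]
      · exact hM _
      · refine mem_closedBall_zero_iff.2 ?_
        have h1 := hR _ h
        have h2 : Γ.restrict x = Γ.restrict (x + s • (Pi.single j 1 : Config d)) -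
            s • Γ.restrict (Pi.single j 1 : Config d) := by
          ext i
          simp [Finset.restrict]
        simp only
        rw [h2]
        refine (norm_sub_le _ _).trans (add_le_add h1 ?_)
        rw [norm_smul]
        have hs' : ‖s‖ ≤ 1 := (mem_ball_zero_iff.1 hs).le
        nlinarith [norm_restrict_single_le (Γ := Γ) j, norm_nonneg s]
  · exact integrable_flat_indicator hΓ _ _

lemma pderiv_ofReal_exp {f : Config d → ℝ} (hf : IsCyl 1 Γ f) (j : Lattice d) (x : Config d) :
    pderiv j (fun x => ((Real.exp (f x) : ℝ) : ℂ)) x =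
      ((Real.exp (f x) : ℝ) : ℂ) * ((pderiv j f x : ℝ) : ℂ) := by
  have h := ((hf.hasDerivAt_zero one_ne_zero j x).exp).ofReal_comp
  rw [zero_smul, add_zero] at h
  rw [← Complex.ofReal_mul]
  exact pderiv_eq h

lemma pderiv_neg_apply {f : Config d → ℝ} (hf : IsCyl 1 Γ f) (j : Lattice d) (x : Config d) :
    pderiv j (fun x => -f x) x = -pderiv j f x :=
  pderiv_eq (hf.hasDerivAt_zero one_ne_zero j x).neg

lemma IsCyl.exp {f : Config d → ℝ} {n : WithTop ℕ∞} (hf : IsCyl n Γ f) :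
    IsCyl n Γ fun x => ((Real.exp (f x) : ℝ) : ℂ) :=
  (hf.comp (k := Real.exp) Real.contDiff_exp).ofReal

lemma IsCyl.neg {f : Config d → ℝ} {n : WithTop ℕ∞} (hf : IsCyl n Γ f) :
    IsCyl n Γ fun x => -f x :=
  hf.comp (k := fun t : ℝ => -t) contDiff_neg

/-- Integration by parts for the Gibbs measure. -/
lemma integral_pderiv_sub [IsFiniteMeasure μ] (hμ : Φ.IsGibbs μ) (hΓ : Φ.Covers {j} Γ)
    {G : Config d → ℂ} (hG : IsCTest 1 Γ G) :
    ∫ x, (pderiv j G x - G x * ((pderiv j (Φ.U {j}) x : ℝ) : ℂ)) ∂μ = 0 := by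
  have hU := Interaction.isCyl_U hΓ
  -- Applied to G e^{-U}, whose flat integral is the μ-integral of G; the weight yields the term
  -- with ∇_jU.
  have h := integral_pderiv_flat hμ hΓ (Finset.mem_singleton_self j) (hG.mul_cyl hU.neg.exp)
  rw [integral_flat] at h
  rw [← h]
  refine integral_congr_ae (Eventually.of_forall fun x => ?_)
  simp only
  rw [pderiv_mul hG.isCyl hU.neg.exp, pderiv_ofReal_exp hU.neg, pderiv_neg_apply hU]
  have : ((Real.exp (Φ.U {j} x) : ℝ) : ℂ) * ((Real.exp (-Φ.U {j} x) : ℝ) : ℂ) = 1 := by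
    rw [← Complex.ofReal_mul, ← Real.exp_add, add_neg_cancel, Real.exp_zero, Complex.ofReal_one]
  push_cast at this ⊢
  linear_combination (-(pderiv j G x) + G x * ((pderiv j (Φ.U {j}) x : ℝ) : ℂ)) * this

lemma isWeakDeriv_pderiv [IsFiniteMeasure μ] (hμ : Φ.IsGibbs μ) {u : Config d → ℂ}
    (hu : IsCTest 1 Γ' u) (j : Lattice d) : Φ.IsWeakDeriv μ j u (pderiv j u) := by
  have hu' : IsCTest 0 Γ' (pderiv j u) := hu.pderiv (by simp) j
  refine ⟨hu.memLp 2, hu'.memLp 2, fun Γ hΓ g hg => ?_⟩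
  have hg1 : IsCTest 1 Γ g := hg.isCTest 1
  have hg' : IsCTest 0 Γ (pderiv j g) := hg1.pderiv (by simp) j
  have h := integral_pderiv_sub hμ (hΓ.mono (Finset.subset_union_left (s₂ := Γ'))) (hg1.mul hu)
  obtain ⟨C, -, hC⟩ := (isCyl_pderiv_U hΓ).exists_norm_mul_le hg1
  have i1 : Integrable (fun x => g x * pderiv j u x) μ :=
    (hg1.memLp 2).integrable_mul (hu'.memLp 2)
  have i2 : Integrable (fun x =>
      (g x * ((pderiv j (Φ.U {j}) x : ℝ) : ℂ) - pderiv j g x) * u x) μ := by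
    refine MemLp.integrable_mul (p := 2) (q := 2) ?_ (hu.memLp 2)
    refine MemLp.sub ?_ (hg'.memLp 2)
    refine MemLp.of_bound ((hg1.stronglyMeasurable.mul
      (isCyl_pderiv_U hΓ).stronglyMeasurable).aestronglyMeasurable) C
      (Eventually.of_forall fun x => ?_)
    exact (norm_mul _ _).trans_le (hC x)
  rw [← sub_eq_zero, ← integral_sub i1 i2, ← h]
  refine integral_congr_ae (Eventually.of_forall fun x => ?_)
  simp only
  rw [pderiv_mul hg1.isCyl hu.isCyl]
  ring

end

/-! ### Regularisation of test functions -/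

section

variable {d : ℕ} {Φ : Interaction d} {Γ Γ' Λ : Finset (Lattice d)} {μ : Measure (Config d)}
  {j : Lattice d}

lemma IsTest.stronglyMeasurable {g : Config d → ℂ} (hg : IsTest Γ g) : StronglyMeasurable g :=
  IsCTest.stronglyMeasurable hg

/-- A compactly supported `C^1` function is approximated in `C^1` by smooth ones, with a common
compact support. -/
lemma exists_contDiff_approx {ι : Type*} [Fintype ι] {h : (ι → ℝ) → ℂ} (h1 : ContDiff ℝ 1 h)
    (h2 : HasCompactSupport h) :
    ∃ R : ℝ, ∀ ε > 0, ∃ k : (ι → ℝ) → ℂ, ContDiff ℝ ((⊤ : ℕ∞) : WithTop ℕ∞) k ∧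
      HasCompactSupport k ∧ (∀ z, k z ≠ 0 → ‖z‖ ≤ R) ∧ (∀ z, ‖k z - h z‖ ≤ ε) ∧
      ∀ z v, ‖fderiv ℝ k z v - fderiv ℝ h z v‖ ≤ ε * ‖v‖ := by
  obtain ⟨R, hR⟩ := h2.isCompact.isBounded.subset_closedBall 0
  refine ⟨R + 1, fun ε hε => ?_⟩
  have u1 := h2.uniformContinuous_of_continuous h1.continuous
  have h1' := h1.continuous_fderiv one_ne_zero
  have u2 := (h2.fderiv ℝ).uniformContinuous_of_continuous h1'
  obtain ⟨δ₁, hδ₁, H1⟩ := Metric.uniformContinuous_iff.1 u1 ε hε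
  obtain ⟨δ₂, hδ₂, H2⟩ := Metric.uniformContinuous_iff.1 u2 ε hε
  have hδ : 0 < min (min δ₁ δ₂) 1 := by positivity
  let b : ContDiffBump (0 : ι → ℝ) := ⟨min (min δ₁ δ₂) 1 / 2, min (min δ₁ δ₂) 1, by positivity, by linarith⟩
  have hb : HasCompactSupport (b.normed volume) := b.hasCompactSupport_normed
  have hbl : LocallyIntegrable (b.normed volume) volume :=
    b.continuous_normed.locallyIntegrable
  let k : (ι → ℝ) → ℂ :=
    convolution (b.normed volume) h (ContinuousLinearMap.lsmul ℝ ℝ) volume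
  refine ⟨k, ?_, ?_, ?_, ?_, ?_⟩
  · exact hb.contDiff_convolution_left _ b.contDiff_normed h1.continuous.locallyIntegrable
  · exact hb.convolution _ h2
  · intro z hz
    obtain ⟨x, hx, y, hy, rfl⟩ := support_convolution_subset _ hz
    rw [b.support_normed_eq] at hx
    have hx' : ‖x‖ ≤ 1 := (mem_ball_zero_iff.1 hx).le.trans (min_le_right _ _)
    have hy' : ‖y‖ ≤ R := mem_closedBall_zero_iff.1 (hR (subset_tsupport _ hy))
    exact (norm_add_le _ _).trans (by linarith)
  · intro z
    rw [← dist_eq_norm]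
    refine b.dist_normed_convolution_le h1.continuous.aestronglyMeasurable fun x hx => ?_
    exact (H1 (lt_of_lt_of_le hx ((min_le_left _ _).trans (min_le_left _ _)))).le
  · intro z v
    have h3 := (h2.hasFDerivAt_convolution_right (ContinuousLinearMap.lsmul ℝ ℝ) hbl h1 z).fderiv
    have h4 := DFunLike.congr_fun h3 v
    rw [convolution_precompR_apply _ hbl (h2.fderiv ℝ) h1'] at h4
    change ‖fderiv ℝ (convolution (b.normed volume) h (ContinuousLinearMap.lsmul ℝ ℝ) volume) z v
      - _‖ ≤ _
    rw [h4, ← dist_eq_norm]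
    refine b.dist_normed_convolution_le (g := fun a => fderiv ℝ h a v)
      (h1'.clm_apply continuous_const).aestronglyMeasurable fun x hx => ?_
    rw [dist_eq_norm, ← sub_apply]
    refine (ContinuousLinearMap.le_opNorm _ _).trans ?_
    gcongr
    rw [← dist_eq_norm]
    exact (H2 (lt_of_lt_of_le hx ((min_le_left _ _).trans (min_le_right _ _)))).le

lemma IsCTest.exists_test_approx {g : Config d → ℂ} (hg : IsCTest 1 Γ g) :
    ∃ R : ℝ, ∀ ε > 0, ∃ k : Config d → ℂ, IsTest Γ k ∧ (∀ x, k x ≠ 0 → ‖Γ.restrict x‖ ≤ R) ∧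
      (∀ x, ‖k x - g x‖ ≤ ε) ∧ ∀ j x, ‖LSE.pderiv j k x - LSE.pderiv j g x‖ ≤ ε := by
  obtain ⟨h, h1, h2, rfl⟩ := hg
  obtain ⟨R, hR⟩ := exists_contDiff_approx h1 h2
  refine ⟨R, fun ε hε => ?_⟩
  obtain ⟨k, k1, k2, k3, k4, k5⟩ := hR ε hε
  refine ⟨fun x => k (Γ.restrict x), ⟨k, k1, k2, rfl⟩, fun x hx => k3 _ hx, fun x => k4 _,
    fun j x => ?_⟩
  rw [pderiv_comp_restrict (k1.differentiable (by simp)), pderiv_comp_restrict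
    (h1.differentiable one_ne_zero)]
  refine (k5 _ _).trans ?_
  nlinarith [norm_restrict_single_le (Γ := Γ) j]

/-- The identity that characterises the weak derivative extends to `C^1` test functions. -/
lemma Interaction.IsWeakDeriv.integral_mul [IsFiniteMeasure μ] {u D : Config d → ℂ}
    (h : Φ.IsWeakDeriv μ j u D) (hΓ : Φ.Covers {j} Γ) {g : Config d → ℂ} (hg : IsCTest 1 Γ g) :
    ∫ x, g x * D x ∂μ =
      ∫ x, (g x * ((pderiv j (Φ.U {j}) x : ℝ) : ℂ) - pderiv j g x) * u x ∂μ := by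
  obtain ⟨hu, hD, hw⟩ := h
  obtain ⟨R, hR⟩ := hg.exists_test_approx
  choose k k1 k2 k3 k4 using fun n : ℕ => hR (1 / ((n : ℝ) + 1)) (by positivity)
  have hε : ∀ n : ℕ, 1 / ((n : ℝ) + 1) ≤ 1 := fun n => by
    rw [div_le_one (by positivity)]
    linarith [n.cast_nonneg (α := ℝ)]
  have hε0 : Tendsto (fun n : ℕ => 1 / ((n : ℝ) + 1)) atTop (𝓝 0) :=
    tendsto_one_div_add_atTop_nhds_zero_nat
  obtain ⟨M, hM0, hM⟩ := hg.exists_bound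
  obtain ⟨M', hM'0, hM'⟩ := (hg.pderiv (m := 0) (by simp) j).exists_bound
  obtain ⟨C, hC0, hC⟩ := (isCyl_pderiv_U hΓ).exists_bound_on R
  have hkM : ∀ n x, ‖k n x‖ ≤ M + 1 := fun n x => by
    have := norm_add_le (k n x - g x) (g x)
    rw [sub_add_cancel] at this
    linarith [k3 n x, hε n, hM x]
  have hkM' : ∀ n x, ‖pderiv j (k n) x‖ ≤ M' + 1 := fun n x => by
    have := norm_add_le (pderiv j (k n) x - pderiv j g x) (pderiv j g x)
    rw [sub_add_cancel] at this
    linarith [k4 n j x, hε n, hM' x]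
  have hUm := (isCyl_pderiv_U hΓ).stronglyMeasurable
  have hlim : ∀ x, Tendsto (fun n => k n x) atTop (𝓝 (g x)) := fun x =>
    tendsto_iff_norm_sub_tendsto_zero.2
      (squeeze_zero (fun _ => norm_nonneg _) (fun n => k3 n x) hε0)
  have hlim' : ∀ x, Tendsto (fun n => pderiv j (k n) x) atTop (𝓝 (pderiv j g x)) := fun x =>
    tendsto_iff_norm_sub_tendsto_zero.2
      (squeeze_zero (fun _ => norm_nonneg _) (fun n => k4 n j x) hε0)
  have L1 : Tendsto (fun n => ∫ x, k n x * D x ∂μ) atTop (𝓝 (∫ x, g x * D x ∂μ)) := by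
    refine tendsto_integral_of_dominated_convergence (fun x => (M + 1) * ‖D x‖) (fun n => ?_)
      ((hD.integrable one_le_two).norm.const_mul _) (fun n => Eventually.of_forall fun x => ?_)
      (Eventually.of_forall fun x => (hlim x).mul_const _)
    · exact (k1 n).stronglyMeasurable.aestronglyMeasurable.mul hD.1
    · rw [norm_mul]
      exact mul_le_mul_of_nonneg_right (hkM n x) (norm_nonneg _)
  have L2 : Tendsto (fun n => ∫ x, (k n x * ((pderiv j (Φ.U {j}) x : ℝ) : ℂ) -
      pderiv j (k n) x) * u x ∂μ) atTop
      (𝓝 (∫ x, (g x * ((pderiv j (Φ.U {j}) x : ℝ) : ℂ) - pderiv j g x) * u x ∂μ)) := by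
    refine tendsto_integral_of_dominated_convergence
      (fun x => ((M + 1) * C + (M' + 1)) * ‖u x‖) (fun n => ?_)
      ((hu.integrable one_le_two).norm.const_mul _) (fun n => Eventually.of_forall fun x => ?_)
      (Eventually.of_forall fun x => (((hlim x).mul_const _).sub (hlim' x)).mul_const _)
    · exact ((((k1 n).stronglyMeasurable.mul hUm).sub
        ((k1 n).pderiv j).stronglyMeasurable).aestronglyMeasurable).mul hu.1
    · rw [norm_mul]
      refine mul_le_mul_of_nonneg_right ?_ (norm_nonneg _)
      refine (norm_sub_le _ _).trans (add_le_add ?_ (hkM' n x))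
      rw [norm_mul]
      by_cases h0 : k n x = 0
      · rw [h0, norm_zero, zero_mul]
        positivity
      · exact mul_le_mul (hkM n x) (hC x (k2 n x h0)) (norm_nonneg _) (by positivity)
  refine tendsto_nhds_unique L1 (L2.congr fun n => ?_)
  exact (hw Γ hΓ (k n) (k1 n)).symm

/-- In terms of the flat measure, the weak derivative is characterised without weights. -/
lemma Interaction.IsWeakDeriv.integral_flat_mul [IsFiniteMeasure μ] {u D : Config d → ℂ}
    (h : Φ.IsWeakDeriv μ j u D) (hΓ : Φ.Covers Λ Γ) (hj : j ∈ Λ) {g : Config d → ℂ}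
    (hg : IsCTest 1 Γ g) :
    ∫ x, g x * D x ∂Φ.flat μ Λ = -∫ x, pderiv j g x * u x ∂Φ.flat μ Λ := by
  have hU := Interaction.isCyl_U hΓ
  have hΓj : Φ.Covers {j} Γ := hΓ.anti (by simpa using hj)
  -- The function g e^{U_Λ} is only known to be C¹, which is why the defining identity was first
  -- extended to C¹ test functions.
  have h1 := h.integral_mul hΓj (hg.mul_cyl hU.exp)
  rw [integral_flat, integral_flat, ← integral_neg]
  calc ∫ x, ((Real.exp (Φ.U Λ x) : ℝ) : ℂ) * (g x * D x) ∂μ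
      = ∫ x, (g x * ((Real.exp (Φ.U Λ x) : ℝ) : ℂ)) * D x ∂μ :=
        integral_congr_ae (Eventually.of_forall fun x => by simp only; ring)
    _ = _ := h1
    _ = _ := by
        refine integral_congr_ae (Eventually.of_forall fun x => ?_)
        simp only
        rw [pderiv_mul hg.isCyl hU.exp, pderiv_ofReal_exp hU, Interaction.pderiv_U hj]
        ring

/-- The product rule for a weak derivative and a test function. -/
lemma Interaction.IsWeakDeriv.test_mul [IsFiniteMeasure μ] {u D θ : Config d → ℂ}
    (h : Φ.IsWeakDeriv μ j u D) (hθ : IsTest Γ' θ) :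
    Φ.IsWeakDeriv μ j (fun x => θ x * u x) fun x => θ x * D x + pderiv j θ x * u x := by
  have hθ1 : IsCTest 1 Γ' θ := hθ.isCTest 1
  have hb : ∀ {θ v : Config d → ℂ}, IsTest Γ' θ → MemLp v 2 μ →
      MemLp (fun x => θ x * v x) 2 μ := by
    intro θ v hθ hv
    obtain ⟨C, hC0, hC⟩ := IsCTest.exists_bound hθ
    refine MemLp.of_le_mul (c := C) hv (hθ.stronglyMeasurable.aestronglyMeasurable.mul hv.1)
      (Eventually.of_forall fun x => ?_)
    rw [norm_mul]
    exact mul_le_mul_of_nonneg_right (hC x) (norm_nonneg _)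
  obtain ⟨hu, hD, hw⟩ := id h
  have m1 := hb hθ hu
  have m2 := hb hθ hD
  have m3 := hb (hθ.pderiv j) hu
  refine ⟨m1, m2.add m3, fun Γ hΓ g hg => ?_⟩
  have hg1 : IsCTest 1 Γ g := hg.isCTest 1
  have h1 := h.integral_mul (hΓ.mono Finset.subset_union_left) (hg1.mul hθ1)
  have hgm : MemLp g 2 μ := IsCTest.memLp hg 2
  have hgm' : MemLp (pderiv j g) 2 μ := IsCTest.memLp (hg.pderiv j) 2
  obtain ⟨C, -, hC⟩ := (isCyl_pderiv_U hΓ).exists_norm_mul_le hg1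
  have hgU : MemLp (fun x => g x * ((pderiv j (Φ.U {j}) x : ℝ) : ℂ)) 2 μ :=
    MemLp.of_bound ((hg1.stronglyMeasurable.mul
      (isCyl_pderiv_U hΓ).stronglyMeasurable).aestronglyMeasurable) C
      (Eventually.of_forall fun x => (norm_mul _ _).trans_le (hC x))
  have i1 : Integrable (fun x => g x * θ x * D x) μ := by
    simpa [Pi.mul_def, mul_assoc] using hgm.integrable_mul m2
  have i2 : Integrable (fun x => g x * (pderiv j θ x * u x)) μ := hgm.integrable_mul m3
  have i3 : Integrable (fun x =>
      (g x * ((pderiv j (Φ.U {j}) x : ℝ) : ℂ) - pderiv j g x) * (θ x * u x)) μ :=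
    (hgU.sub hgm').integrable_mul m1
  calc ∫ x, g x * (θ x * D x + pderiv j θ x * u x) ∂μ
      = ∫ x, g x * θ x * D x ∂μ + ∫ x, g x * (pderiv j θ x * u x) ∂μ := by
        rw [← integral_add i1 i2]
        exact integral_congr_ae (Eventually.of_forall fun x => by simp only; ring)
    _ = ∫ x, ((g x * ((pderiv j (Φ.U {j}) x : ℝ) : ℂ) - pderiv j g x) * (θ x * u x) -
          g x * (pderiv j θ x * u x)) ∂μ + ∫ x, g x * (pderiv j θ x * u x) ∂μ := by
        rw [h1]
        congr 1
        refine integral_congr_ae (Eventually.of_forall fun x => ?_)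
        simp only
        rw [pderiv_mul hg1.isCyl hθ1.isCyl]
        ring
    _ = _ := by
        rw [integral_sub i3 i2, sub_add_cancel]

end

/-! ### Density of the test functions in `L²` -/

section

variable {d : ℕ} {Φ : Interaction d} {Γ Γ' Λ : Finset (Lattice d)} {μ : Measure (Config d)}
  {j : Lattice d}

/-- Indicators suffice, and a measurable set is approximated in measure by cylinder sets, since
these form a ring generating the product σ-algebra. -/
lemma exists_bounded_localised_approx [IsFiniteMeasure μ] 
    {u : Config d → ℂ} (hu : MemLp u 2 μ) {ε : ℝ≥0∞} (hε : ε ≠ 0) :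
    ∃ g : Config d → ℂ, eLpNorm (u - g) 2 μ ≤ ε ∧ ∃ Γ : Finset (Lattice d), ∃ h : (Γ → ℝ) → ℂ,
      StronglyMeasurable h ∧ (∃ C, ∀ z, ‖h z‖ ≤ C) ∧ g = fun x => h (Γ.restrict x) := by
  classical
  refine MemLp.induction_dense ENNReal.ofNat_ne_top _ ?_ ?_ ?_ hu hε
  · intro c s hs _ ε hε
    obtain ⟨η, hη, H⟩ := exists_eLpNorm_indicator_le (μ := μ) (p := 2) ENNReal.ofNat_ne_top c hε
    obtain ⟨t, ht, hts⟩ := exists_measure_symmDiff_lt_of_generateFrom_isSetRing (μ := μ)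
      (isSetRing_measurableCylinders (α := fun _ : Lattice d => ℝ))
      ⟨{univ}, countable_singleton _, by
        simpa using univ_mem_measurableCylinders (fun _ : Lattice d => ℝ), by simp⟩
      generateFrom_measurableCylinders.symm hs (ε := η) (by exact_mod_cast hη)
    obtain ⟨Γ₁, S, hS, rfl⟩ := (mem_measurableCylinders _).1 ht
    refine ⟨(cylinder Γ₁ S).indicator fun _ => c, ?_, Γ₁, S.indicator fun _ => c,
      ?_, ⟨‖c‖, fun z => norm_indicator_le_norm_self _ _⟩, ?_⟩
    · rw [eLpNorm_indicator_sub_indicator]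
      exact H _ hts.le
    · exact stronglyMeasurable_const.indicator hS
    · rfl
  · rintro f g ⟨Γ₁, h₁, hm₁, ⟨C₁, hC₁⟩, rfl⟩ ⟨Γ₂, h₂, hm₂, ⟨C₂, hC₂⟩, rfl⟩
    refine ⟨Γ₁ ∪ Γ₂,
      fun z => h₁ (fun i : Γ₁ => z ⟨i, Finset.mem_union_left _ i.2⟩) +
        h₂ (fun i : Γ₂ => z ⟨i, Finset.mem_union_right _ i.2⟩), ?_,
      ⟨C₁ + C₂, fun z => (norm_add_le _ _).trans (add_le_add (hC₁ _) (hC₂ _))⟩, rfl⟩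
    exact (hm₁.comp_measurable (measurable_pi_lambda _ fun i => measurable_pi_apply _)).add
      (hm₂.comp_measurable (measurable_pi_lambda _ fun i => measurable_pi_apply _))
  · rintro f ⟨Γ₁, h₁, hm₁, -, rfl⟩
    exact (hm₁.comp_measurable measurable_finset_restrict).aestronglyMeasurable

lemma exists_test_eLpNorm_le_of_localised [IsFiniteMeasure μ] {h : (Γ → ℝ) → ℂ}
    (hm : StronglyMeasurable h) {C : ℝ} (hC : ∀ z, ‖h z‖ ≤ C) {ε : ℝ≥0∞} (hε : 0 < ε) :
    ∃ g, IsTest Γ g ∧ eLpNorm ((fun x => h (Γ.restrict x)) - g) 2 μ ≤ ε := by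
  have hmeas : Measurable fun x : Config d => Γ.restrict x := measurable_finset_restrict
  have hL : MemLp h 2 (μ.map fun x => Γ.restrict x) :=
    MemLp.of_bound hm.aestronglyMeasurable C (Eventually.of_forall hC)
  have hη' : 0 < (min ε 1).toReal :=
    ENNReal.toReal_pos (lt_min hε one_pos).ne' (min_lt_of_right_lt ENNReal.one_lt_top).ne
  obtain ⟨k, k1, k2, k3⟩ := hL.exist_eLpNorm_sub_le ENNReal.ofNat_ne_top one_le_two hη'
  rw [ENNReal.ofReal_toReal (min_lt_of_right_lt ENNReal.one_lt_top).ne] at k3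
  have hkm : AEStronglyMeasurable (h - k) (μ.map fun x => Γ.restrict x) :=
    (hm.sub k2.continuous.stronglyMeasurable).aestronglyMeasurable
  rw [eLpNorm_map_measure hkm hmeas.aemeasurable] at k3
  exact ⟨fun x => k (Γ.restrict x), ⟨k, k2, k1, rfl⟩, k3.trans (min_le_left _ _)⟩

/-- The approximant exists for every Γ containing Γ₀, so that several functions can be approximated
over one common set of coordinates. -/
lemma exists_test_eLpNorm_le [IsFiniteMeasure μ]
    {u : Config d → ℂ} (hu : MemLp u 2 μ) {ε : ℝ≥0∞} (hε : ε ≠ 0) :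
    ∃ Γ₀, ∀ Γ, Γ₀ ⊆ Γ → ∃ g, IsTest Γ g ∧ eLpNorm (u - g) 2 μ ≤ ε := by
  obtain ⟨η, hη, H⟩ := exists_Lp_half ℂ μ 2 hε
  obtain ⟨f, hf, Γ₀, h₀, hm₀, ⟨C, hC₀⟩, rfl⟩ := exists_bounded_localised_approx hu hη.ne'
  refine ⟨Γ₀, fun Γ hΓ => ?_⟩
  set h : (Γ → ℝ) → ℂ := fun z => h₀ fun i : Γ₀ => z ⟨i, hΓ i.2⟩ with hh
  have hm : StronglyMeasurable h :=
    hm₀.comp_measurable (measurable_pi_lambda _ fun i => measurable_pi_apply _)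
  obtain ⟨g, hg, hgf⟩ := exists_test_eLpNorm_le_of_localised (μ := μ) hm (fun z => hC₀ _) hη
  have hfm : AEStronglyMeasurable (fun x => h (Γ.restrict x)) μ :=
    (hm.comp_measurable measurable_finset_restrict).aestronglyMeasurable
  refine ⟨g, hg, ?_⟩
  have h1 := H _ _ (hu.1.sub hfm) (hfm.sub hg.stronglyMeasurable.aestronglyMeasurable) hf hgf
  rw [sub_add_sub_cancel] at h1
  exact h1.le

lemma exists_test_l2sq_le [IsFiniteMeasure μ]
    {u : Config d → ℂ} (hu : MemLp u 2 μ) {ε : ℝ} (hε : 0 < ε) :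
    ∃ Γ₀, ∀ Γ, Γ₀ ⊆ Γ → ∃ g, IsTest Γ g ∧ l2sq μ (fun x => g x - u x) ≤ ε := by
  obtain ⟨Γ₀, hΓ₀⟩ := exists_test_eLpNorm_le hu (ε := ENNReal.ofReal √ε) (by simpa using hε)
  refine ⟨Γ₀, fun Γ hΓ => ?_⟩
  obtain ⟨g, hg, h⟩ := hΓ₀ Γ hΓ
  refine ⟨g, hg, ?_⟩
  have hgm : MemLp g 2 μ := IsCTest.memLp hg 2
  have h0 : l2sq μ (fun x => g x - u x) = (eLpNorm (fun x => g x - u x) 2 μ).toReal ^ 2 :=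
    l2sq_eq_eLpNorm (hgm.sub hu)
  rw [h0]
  have h1 : eLpNorm (fun x => g x - u x) 2 μ = eLpNorm (u - g) 2 μ := eLpNorm_sub_comm _ _ _ _
  have h2 : (eLpNorm (fun x => g x - u x) 2 μ).toReal ≤ √ε := by
    rw [h1]
    exact ENNReal.toReal_le_of_le_ofReal (Real.sqrt_nonneg _) h
  calc _ ≤ √ε ^ 2 := by gcongr
    _ = ε := Real.sq_sqrt hε.le

/-- A square integrable function that integrates to zero against the test functions vanishes. -/
lemma ae_eq_zero_of_integral_test [IsFiniteMeasure μ] (Γ₀ : Finset (Lattice d))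
    {u : Config d → ℂ} (hu : MemLp u 2 μ)
    (h : ∀ Γ, Γ₀ ⊆ Γ → ∀ g, IsTest Γ g → ∫ x, g x * u x ∂μ = 0) : u =ᵐ[μ] 0 := by
  have h1 : ∀ ε : ℝ, 0 < ε → l2sq μ u ≤ ε := by
    intro ε hε
    obtain ⟨Γ₁, hΓ₁⟩ := exists_test_l2sq_le hu hε
    obtain ⟨g, hg, hgu⟩ := hΓ₁ (Γ₀ ∪ Γ₁) Finset.subset_union_right
    have hgm : MemLp g 2 μ := IsCTest.memLp hg 2
    have h2 := h _ Finset.subset_union_left _ (IsCTest.star hg)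
    have h3 : pair μ g u = 0 := h2
    rw [l2sq_sub hgm hu, h3] at hgu
    have := l2sq_nonneg (μ := μ) g
    simp only [Complex.zero_re, mul_zero, sub_zero] at hgu
    linarith
  have h2 : l2sq μ u = 0 := le_antisymm (le_of_forall_pos_le_add fun ε hε => by
    simpa using h1 ε hε) (l2sq_nonneg _)
  rw [l2sq, integral_eq_zero_iff_of_nonneg (fun _ => by positivity) (integrable_norm_sq hu)] at h2
  filter_upwards [h2] with x hx
  simpa using hx

end

/-! ### Mollification in the coordinates of a finite set -/

section

variable {d : ℕ} {Φ : Interaction d} {Γ Γ' Λ : Finset (Lattice d)} {μ : Measure (Config d)}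
  {j : Lattice d}

/-- The mollification of `q` in the coordinates in `Λ` with the kernel `k`. -/
noncomputable def mollify (k : (Λ → ℝ) → ℝ) (q : Config d → ℂ) (x : Config d) : ℂ :=
  ∫ y, k y • q (x + extendZero y)

lemma measurable_add_extendZero :
    Measurable fun p : Config d × (Λ → ℝ) => p.1 + extendZero p.2 :=
  measurable_fst.add
    ((measurable_updateFinset_right (0 : Config d)).comp measurable_snd)

lemma contDiff_restrict_extendZero {n : WithTop ℕ∞} :
    ContDiff ℝ n fun y : Λ → ℝ => Γ.restrict (extendZero y) := by
  refine contDiff_pi.2 fun i => ?_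
  by_cases hi : (i : Lattice d) ∈ Λ
  · simp only [Finset.restrict, extendZero, Function.updateFinset, hi, dite_true]
    exact contDiff_apply ..
  · simp only [Finset.restrict, extendZero, Function.updateFinset, hi, dite_false]
    exact contDiff_const

lemma norm_restrict_extendZero_le (y : Λ → ℝ) : ‖Γ.restrict (extendZero y)‖ ≤ ‖y‖ := by
  refine (pi_norm_le_iff_of_nonneg (norm_nonneg _)).2 fun i => ?_
  change ‖extendZero y (i : Lattice d)‖ ≤ _
  by_cases hi : (i : Lattice d) ∈ Λ
  · simp only [extendZero, Function.updateFinset, hi, dite_true]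
    exact norm_le_pi_norm y _
  · simp [extendZero, Function.updateFinset, hi]

lemma extendZero_add (y z : Λ → ℝ) :
    (extendZero (y + z) : Config d) = extendZero y + extendZero z :=
  (updateFinset_add 0 y z).symm

lemma extendZero_neg (y : Λ → ℝ) : (extendZero (-y) : Config d) = -extendZero y := by
  ext i
  by_cases hi : i ∈ Λ <;> simp [extendZero, Function.updateFinset, hi]

/-- The coordinates in Γ \ Λ are parameters. Smoothness comes from writing the mollification as the
convolution, at the origin, of the constant 1 with a smooth kernel depending on a parameter z. -/
lemma isTest_mollify {k : (Λ → ℝ) → ℝ} (hk : ContDiff ℝ ((⊤ : ℕ∞) : WithTop ℕ∞) k)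
    (hk' : HasCompactSupport k) {q : Config d → ℂ} (hq : IsTest Γ q) :
    IsTest Γ (mollify k q) := by
  obtain ⟨h, h1, h2, rfl⟩ := hq
  refine ⟨fun z => ∫ y, k y • h (z + Γ.restrict (extendZero y)), ?_, ?_, rfl⟩
  · have key := contDiffOn_convolution_right_with_param (μ := (volume : Measure (Λ → ℝ)))
      (𝕜 := ℝ) (f := fun _ => (1 : ℝ)) (n := ⊤) (ContinuousLinearMap.lsmul ℝ ℝ)
      (g := fun (z : Γ → ℝ) y => k (-y) • h (z + Γ.restrict (extendZero (-y))))
      (s := univ) (k := -tsupport k) isOpen_univ hk'.isCompact.neg (fun z y _ hy => ?_)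
      (locallyIntegrable_const 1) ?_
    · have h3 : ContDiff ℝ ((⊤ : ℕ∞) : WithTop ℕ∞) fun z : Γ → ℝ => ((z, 0) : (Γ → ℝ) × (Λ → ℝ)) :=
        contDiff_id.prodMk contDiff_const
      rw [univ_prod_univ, contDiffOn_univ] at key
      have h4 := key.comp h3
      convert h4 using 2 with z
      simp [convolution]
    · rw [image_eq_zero_of_notMem_tsupport (f := k) hy, zero_smul]
    · refine ContDiff.contDiffOn ?_
      refine ContDiff.smul (hk.comp contDiff_snd.neg) (h1.comp ?_)
      exact contDiff_fst.add (contDiff_restrict_extendZero.comp contDiff_snd.neg)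
  · obtain ⟨R, hR⟩ := h2.isCompact.isBounded.subset_closedBall 0
    obtain ⟨R', hR'⟩ := hk'.isCompact.isBounded.subset_closedBall 0
    refine HasCompactSupport.of_support_subset_isCompact
      (isCompact_closedBall (0 : Γ → ℝ) (R + R')) fun z hz => ?_
    rw [mem_closedBall_zero_iff]
    by_contra hlt
    refine hz (integral_eq_zero_of_ae (Eventually.of_forall fun y => ?_))
    by_contra h0
    have hz1 := hR' (subset_tsupport _ (left_ne_zero_of_smul h0))
    have hz2 := hR (subset_tsupport _ (right_ne_zero_of_smul h0))
    rw [mem_closedBall_zero_iff] at hz1 hz2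
    have := norm_sub_le (z + Γ.restrict (extendZero y)) (Γ.restrict (extendZero y))
    rw [add_sub_cancel_right] at this
    linarith [norm_restrict_extendZero_le (Γ := Γ) y]

/-- A change of variables moves the shift from q to the kernel, so the derivative falls on k. -/
lemma pderiv_mollify {k : (Λ → ℝ) → ℝ} (hk : ContDiff ℝ 1 k)
    (hk' : HasCompactSupport k) {q : Config d → ℂ} (hq : IsTest Γ q) (hj : j ∈ Λ)
    (x : Config d) : pderiv j (mollify k q) x =
      -mollify (fun y => fderiv ℝ k y (Pi.single (⟨j, hj⟩ : Λ) 1)) q x := by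
  set e : Λ → ℝ := Pi.single (⟨j, hj⟩ : Λ) 1 with he
  have he1 : ‖e‖ ≤ 1 := by
    refine (pi_norm_le_iff_of_nonneg zero_le_one).2 fun i => ?_
    rw [he, Pi.single_apply]
    split_ifs <;> simp
  obtain ⟨M, hM0, hM⟩ := IsCTest.exists_bound hq
  obtain ⟨C, hC⟩ := (hk'.fderiv ℝ).exists_bound_of_continuous (hk.continuous_fderiv one_ne_zero)
  have hC0 : 0 ≤ C := (norm_nonneg _).trans (hC 0)
  obtain ⟨R, hR⟩ := (hk'.fderiv ℝ).isCompact.isBounded.subset_closedBall 0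
  have hqm : StronglyMeasurable fun y : Λ → ℝ => q (x + extendZero y) :=
    hq.stronglyMeasurable.comp_measurable (measurable_add_extendZero.comp measurable_prodMk_left)
  have hshift : ∀ s : ℝ, mollify k q (x + s • Pi.single j 1) =
      ∫ y, k (y - s • e) • q (x + extendZero y) := by
    intro s
    rw [← integral_add_right_eq_self _ (s • e), mollify]
    refine integral_congr_ae (Eventually.of_forall fun y => ?_)
    simp only
    rw [add_sub_cancel_right, extendZero_add, he, extendZero_single hj, ← add_assoc,
      add_right_comm]
  have key := hasDerivAt_integral_of_dominated_loc_of_deriv_le (μ := (volume : Measure (Λ → ℝ)))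
    (F := fun (s : ℝ) y => k (y - s • e) • q (x + extendZero y))
    (F' := fun (s : ℝ) y => (-fderiv ℝ k (y - s • e) e) • q (x + extendZero y))
    (x₀ := (0 : ℝ)) (s := Metric.ball 0 1)
    (bound := indicator (Metric.closedBall 0 (R + 1)) fun _ => C * M)
    (Metric.ball_mem_nhds _ one_pos)
    (Eventually.of_forall fun s => ((hk.continuous.comp (continuous_id.sub
      continuous_const)).stronglyMeasurable.smul hqm).aestronglyMeasurable) ?_
    (((((hk.continuous_fderiv one_ne_zero).clm_apply continuous_const).comp
      (continuous_id.sub continuous_const)).neg.stronglyMeasurable.smul hqm).aestronglyMeasurable)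
    (Eventually.of_forall fun y s hs => ?_)
    ((integrable_indicator_iff measurableSet_closedBall).2
      (integrableOn_const measure_closedBall_lt_top.ne))
    (Eventually.of_forall fun y s _ => ?_)
  · refine pderiv_eq ?_
    simp only [hshift]
    refine key.2.congr_deriv ?_
    rw [mollify, ← integral_neg]
    refine integral_congr_ae (Eventually.of_forall fun y => ?_)
    simp
  · refine Integrable.mono' (g := fun y => M * ‖k (y - (0 : ℝ) • e)‖) ?_
      ((hk.continuous.comp (continuous_id.sub
        continuous_const)).stronglyMeasurable.smul hqm).aestronglyMeasurable
      (Eventually.of_forall fun y => ?_)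
    · simp only [zero_smul, sub_zero]
      exact (hk.continuous.integrable_of_hasCompactSupport hk').norm.const_mul M
    · rw [norm_smul, mul_comm]
      exact mul_le_mul_of_nonneg_right (hM _) (norm_nonneg _)
  · by_cases h : fderiv ℝ k (y - s • e) = 0
    · rw [h]
      simp only [zero_apply, neg_zero, zero_smul, norm_zero]
      exact indicator_nonneg (fun _ _ => by positivity) _
    · rw [indicator_of_mem]
      · rw [norm_smul, norm_neg]
        refine mul_le_mul ?_ (hM _) (norm_nonneg _) hC0
        refine (ContinuousLinearMap.le_opNorm _ _).trans ?_
        calc _ ≤ C * 1 := mul_le_mul (hC _) he1 (norm_nonneg _) hC0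
          _ = C := mul_one C
      · rw [mem_closedBall_zero_iff]
        have h1 := mem_closedBall_zero_iff.1 (hR (subset_tsupport _ h))
        have h2 := norm_add_le (y - s • e) (s • e)
        rw [sub_add_cancel, norm_smul] at h2
        have hs' : ‖s‖ ≤ 1 := (mem_ball_zero_iff.1 hs).le
        nlinarith [norm_nonneg s, norm_nonneg e]
  · refine HasDerivAt.smul_const ?_ _
    have h1 : HasDerivAt (fun s : ℝ => y - s • e) (-e) s := by
      simpa using ((hasDerivAt_id s).smul_const e).const_sub y
    have h2 := ((hk.differentiable one_ne_zero) (y - s • e)).hasFDerivAt.comp_hasDerivAt s h1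
    rwa [map_neg] at h2

end

/-! ### Mollification in L² of the flat measure. -/

section

variable {d : ℕ} {Φ : Interaction d} {Γ Γ' Λ : Finset (Lattice d)} {μ : Measure (Config d)}
  {j : Lattice d}

lemma IsCTest.memLp_flat [IsFiniteMeasure μ] (hΓ : Φ.Covers Λ Γ) {n : WithTop ℕ∞}
    {G : Config d → ℂ} (hG : IsCTest n Γ G) : MemLp G 2 (Φ.flat μ Λ) := by
  obtain ⟨M, hM0, hM⟩ := hG.exists_bound
  rw [memLp_two_iff_integrable_sq_norm hG.stronglyMeasurable.aestronglyMeasurable]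
  refine Integrable.mono' ((hG.integrable_flat (μ := μ) hΓ).norm.const_mul M)
    (hG.stronglyMeasurable.norm.pow 2).aestronglyMeasurable (Eventually.of_forall fun x => ?_)
  rw [norm_pow, norm_norm, sq]
  exact mul_le_mul_of_nonneg_right (hM x) (norm_nonneg _)

instance [IsFiniteMeasure μ] : SFinite (Φ.flat μ Λ) := by
  unfold Interaction.flat
  infer_instance

lemma integrable_mul_mollify [IsFiniteMeasure μ] (hΓ : Φ.Covers Λ Γ) {k : (Λ → ℝ) → ℝ}
    (hk : Continuous k) (hk' : HasCompactSupport k) {g f : Config d → ℂ} {n m : WithTop ℕ∞}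
    (hg : IsCTest n Γ g) (hf : IsCTest m Γ' f) :
    Integrable (fun p : Config d × (Λ → ℝ) => g p.1 * (k p.2 • f (p.1 + extendZero p.2)))
      ((Φ.flat μ Λ).prod volume) := by
  obtain ⟨M, hM0, hM⟩ := hf.exists_bound
  have h1 : Integrable (fun p : Config d × (Λ → ℝ) => ‖g p.1‖ * (M * ‖k p.2‖))
      ((Φ.flat μ Λ).prod volume) :=
    (hg.integrable_flat hΓ).norm.mul_prod
      ((hk.integrable_of_hasCompactSupport hk').norm.const_mul M)
  refine h1.mono' ?_ (Eventually.of_forall fun p => ?_)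
  · exact ((hg.stronglyMeasurable.comp_measurable measurable_fst).mul
      ((hk.stronglyMeasurable.comp_measurable measurable_snd).smul
        (hf.stronglyMeasurable.comp_measurable measurable_add_extendZero))).aestronglyMeasurable
  · rw [norm_mul, norm_smul, mul_comm M]
    gcongr
    exact hM _

lemma integral_mul_mollify [IsFiniteMeasure μ] (hΓ : Φ.Covers Λ Γ) {k : (Λ → ℝ) → ℝ}
    (hk : Continuous k) (hk' : HasCompactSupport k) {g f : Config d → ℂ} {n m : WithTop ℕ∞}
    (hg : IsCTest n Γ g) (hf : IsCTest m Γ' f) :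
    ∫ x, g x * mollify k f x ∂Φ.flat μ Λ =
      ∫ y, k y • ∫ x, g x * f (x + extendZero y) ∂Φ.flat μ Λ := by
  have hi := integrable_mul_mollify (μ := μ) hΓ hk hk' hg hf
  calc ∫ x, g x * mollify k f x ∂Φ.flat μ Λ
      = ∫ x, (∫ y, g x * (k y • f (x + extendZero y))) ∂Φ.flat μ Λ := by
        refine integral_congr_ae (Eventually.of_forall fun x => ?_)
        simp only [mollify]
        rw [integral_const_mul]
    _ = ∫ y, ∫ x, g x * (k y • f (x + extendZero y)) ∂Φ.flat μ Λ := integral_integral_swap hi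
    _ = _ := by
        refine integral_congr_ae (Eventually.of_forall fun y => ?_)
        simp only [mul_smul_comm]
        rw [integral_smul]

lemma integral_flat_add_extendZero (hμ : Φ.IsGibbs μ) (y : Λ → ℝ) {E : Type*}
    [NormedAddCommGroup E] [NormedSpace ℝ E] {F : Config d → E}
    (hF : AEStronglyMeasurable F (Φ.flat μ Λ)) :
    ∫ x, F (x + extendZero y) ∂Φ.flat μ Λ = ∫ x, F x ∂Φ.flat μ Λ := by
  have hp := hμ.measurePreserving_add Λ y
  have h := integral_map hp.measurable.aemeasurable (f := F) (by rwa [hp.map_eq])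
  rw [hp.map_eq] at h
  exact h.symm

lemma l2sq_flat_add_extendZero (hμ : Φ.IsGibbs μ) (y : Λ → ℝ) {F : Config d → ℂ}
    (hF : AEStronglyMeasurable F (Φ.flat μ Λ)) :
    l2sq (Φ.flat μ Λ) (fun x => F (x + extendZero y)) = l2sq (Φ.flat μ Λ) F :=
  integral_flat_add_extendZero hμ y (F := fun x => ‖F x‖ ^ 2) (hF.norm.pow 2)

/-- The mollification with the reflected kernel is the transpose of the mollification. -/
lemma integral_mul_mollify_comm [IsFiniteMeasure μ] (hμ : Φ.IsGibbs μ) (hΓ : Φ.Covers Λ Γ)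
    (hΓ' : Φ.Covers Λ Γ') {k : (Λ → ℝ) → ℝ} (hk : Continuous k) (hk' : HasCompactSupport k)
    {g f : Config d → ℂ} {n m : WithTop ℕ∞} (hg : IsCTest n Γ g) (hf : IsCTest m Γ' f) :
    ∫ x, g x * mollify k f x ∂Φ.flat μ Λ =
      ∫ x, mollify (fun y => k (-y)) g x * f x ∂Φ.flat μ Λ := by
  have hk1 : HasCompactSupport fun y => k (-y) := hk'.comp_homeomorph (Homeomorph.neg _)
  simp only [mul_comm (mollify _ _ _)]
  rw [integral_mul_mollify hΓ hk hk' hg hf,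
    integral_mul_mollify (k := fun y => k (-y)) hΓ' (hk.comp continuous_neg) hk1 hf hg, ← integral_neg_eq_self]
  refine integral_congr_ae (Eventually.of_forall fun y => ?_)
  simp only
  congr 1
  rw [← integral_flat_add_extendZero hμ y]
  · refine integral_congr_ae (Eventually.of_forall fun x => ?_)
    simp only [extendZero_neg]
    rw [add_neg_cancel_right, mul_comm]
  · exact (hg.stronglyMeasurable.mul (hf.stronglyMeasurable.comp_measurable
      (measurable_id.add_const _))).aestronglyMeasurable

lemma norm_integral_mul_mollify_le [IsFiniteMeasure μ] (hμ : Φ.IsGibbs μ) (hΓ : Φ.Covers Λ Γ)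
    (hΓ' : Φ.Covers Λ Γ') {k : (Λ → ℝ) → ℝ} (hk : Continuous k) (hk' : HasCompactSupport k)
    {g f : Config d → ℂ} {n m : WithTop ℕ∞} (hg : IsCTest n Γ g) (hf : IsCTest m Γ' f) :
    ‖∫ x, g x * mollify k f x ∂Φ.flat μ Λ‖ ≤
      (∫ y, |k y|) * (√(l2sq (Φ.flat μ Λ) g) * √(l2sq (Φ.flat μ Λ) f)) := by
  rw [integral_mul_mollify hΓ hk hk' hg hf, ← integral_mul_const]
  refine norm_integral_le_of_norm_le ?_ (Eventually.of_forall fun y => ?_)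
  · exact ((hk.integrable_of_hasCompactSupport hk').norm).mul_const _
  · rw [norm_smul, Real.norm_eq_abs]
    refine mul_le_mul_of_nonneg_left ?_ (abs_nonneg _)
    have hp := hμ.measurePreserving_add Λ y
    have h1 : MemLp (fun x => f (x + extendZero y)) 2 (Φ.flat μ Λ) :=
      (hf.memLp_flat hΓ').comp_measurePreserving hp
    have h2 := l2sq_flat_add_extendZero hμ y (hf.memLp_flat hΓ').1
    have h3 := norm_pair_le (hg.star.memLp_flat (μ := μ) hΓ) h1
    rw [h2] at h3
    have h4 : l2sq (Φ.flat μ Λ) (fun x => star (g x)) = l2sq (Φ.flat μ Λ) g := by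
      simp [l2sq]
    rw [h4] at h3
    simpa [pair] using h3

/-- Young's inequality. -/
lemma l2sq_mollify_le [IsFiniteMeasure μ] (hμ : Φ.IsGibbs μ) (hΓ : Φ.Covers Λ Γ)
    {k : (Λ → ℝ) → ℝ} (hk : ContDiff ℝ ((⊤ : ℕ∞) : WithTop ℕ∞) k) (hk' : HasCompactSupport k)
    {f : Config d → ℂ} (hf : IsTest Γ f) :
    l2sq (Φ.flat μ Λ) (mollify k f) ≤ (∫ y, |k y|) ^ 2 * l2sq (Φ.flat μ Λ) f := by
  have h := isTest_mollify hk hk' hf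
  -- The bilinear bound is tested with the conjugate of the mollification itself.
  have h1 := norm_integral_mul_mollify_le hμ hΓ hΓ hk.continuous hk' (IsCTest.star h) hf
  have h2 : ∫ x, star (mollify k f x) * mollify k f x ∂Φ.flat μ Λ =
      ((l2sq (Φ.flat μ Λ) (mollify k f) : ℝ) : ℂ) := by
    rw [l2sq, ← integral_complex_ofReal]
    refine integral_congr_ae (Eventually.of_forall fun x => ?_)
    simp only
    rw [← Complex.normSq_eq_norm_sq]
    exact Complex.normSq_eq_conj_mul_self.symm
  have h4 : l2sq (Φ.flat μ Λ) (fun x => star (mollify k f x)) =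
      l2sq (Φ.flat μ Λ) (mollify k f) := by
    simp [l2sq]
  rw [h2, h4, Complex.norm_real, Real.norm_of_nonneg (l2sq_nonneg _)] at h1
  set a := l2sq (Φ.flat μ Λ) (mollify k f) with ha
  have ha0 : 0 ≤ a := l2sq_nonneg _
  have hb0 : 0 ≤ l2sq (Φ.flat μ Λ) f := l2sq_nonneg _
  have hI : 0 ≤ ∫ y, |k y| := integral_nonneg fun _ => abs_nonneg _
  have h5 : √a ≤ (∫ y, |k y|) * √(l2sq (Φ.flat μ Λ) f) := by
    rcases ha0.eq_or_lt with h0 | h0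
    · rw [← h0, Real.sqrt_zero]
      positivity
    · have hs : 0 < √a := Real.sqrt_pos.2 h0
      have : √a * √a ≤ ((∫ y, |k y|) * √(l2sq (Φ.flat μ Λ) f)) * √a := by
        rw [Real.mul_self_sqrt ha0]
        linarith
      exact le_of_mul_le_mul_right this hs
  calc a = √a ^ 2 := (Real.sq_sqrt ha0).symm
    _ ≤ ((∫ y, |k y|) * √(l2sq (Φ.flat μ Λ) f)) ^ 2 := by gcongr
    _ = _ := by rw [mul_pow, Real.sq_sqrt hb0]

/-- Uniform continuity makes the difference small everywhere, and for shifts of length at most 1 it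
is supported where |x_Γ| ≤ R + 1, a set of finite flat measure. -/
lemma IsTest.exists_l2sq_translate_sub_le [IsFiniteMeasure μ] (hΓ : Φ.Covers Λ Γ)
    {q : Config d → ℂ} (hq : IsTest Γ q) {ε : ℝ} (hε : 0 < ε) : ∃ δ > 0, ∀ y : Λ → ℝ,
      ‖y‖ < δ → l2sq (Φ.flat μ Λ) (fun x => q (x + extendZero y) - q x) ≤ ε := by
  obtain ⟨R, hR⟩ := IsCTest.exists_radius hq
  obtain ⟨h, h1, h2, rfl⟩ := hq
  set A := (Φ.flat μ Λ ((fun x => Γ.restrict x) ⁻¹' Metric.closedBall 0 (R + 1))).toReal with hA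
  obtain ⟨η, hη, hηA⟩ : ∃ η > 0, η ^ 2 * A ≤ ε := by
    have hA0 : 0 ≤ A := ENNReal.toReal_nonneg
    refine ⟨√(ε / (A + 1)), by positivity, ?_⟩
    rw [Real.sq_sqrt (by positivity), div_mul_eq_mul_div, div_le_iff₀ (by positivity)]
    nlinarith
  obtain ⟨δ, hδ, H⟩ := Metric.uniformContinuous_iff.1
    (h2.uniformContinuous_of_continuous h1.continuous) η hη
  refine ⟨min δ 1, by positivity, fun y hy => ?_⟩
  have hle : ∀ x : Config d, ‖h (Γ.restrict (x + extendZero y)) - h (Γ.restrict x)‖ ≤ η := by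
    intro x
    rw [← dist_eq_norm]
    refine (H ?_).le
    rw [dist_eq_norm]
    change ‖Γ.restrict x + Γ.restrict (extendZero y) - Γ.restrict x‖ < δ
    rw [add_sub_cancel_left]
    exact (norm_restrict_extendZero_le y).trans_lt (hy.trans_le (min_le_left _ _))
  have hzero : ∀ x : Config d, R + 1 < ‖Γ.restrict x‖ →
      h (Γ.restrict (x + extendZero y)) - h (Γ.restrict x) = 0 := by
    intro x hx
    have e1 : h (Γ.restrict x) = 0 := by
      by_contra h0
      linarith [hR x h0]
    have e2 : h (Γ.restrict (x + extendZero y)) = 0 := by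
      by_contra h0
      have h4 := norm_sub_le (Γ.restrict x + Γ.restrict (extendZero y))
        (Γ.restrict (extendZero y))
      rw [add_sub_cancel_right] at h4
      have h5 := (norm_restrict_extendZero_le (Γ := Γ) y).trans
        (hy.le.trans (min_le_right _ _))
      have h6 : ‖Γ.restrict x + Γ.restrict (extendZero y)‖ ≤ R := hR _ h0
      linarith
    rw [e1, e2, sub_zero]
  rw [l2sq]
  refine le_trans ?_ hηA
  have h3 : ∫ x, indicator ((fun x : Config d => Γ.restrict x) ⁻¹' Metric.closedBall 0 (R + 1))
      (fun _ => η ^ 2) x ∂Φ.flat μ Λ = η ^ 2 * A := by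
    rw [integral_indicator (measurableSet_restrict_closedBall _), setIntegral_const, smul_eq_mul,
      mul_comm]
    rfl
  rw [← h3]
  refine integral_mono_of_nonneg (Eventually.of_forall fun _ => by positivity)
    (integrable_flat_indicator hΓ _ _) (Eventually.of_forall fun x => ?_)
  by_cases hx : ‖Γ.restrict x‖ ≤ R + 1
  · rw [indicator_of_mem (by exact mem_closedBall_zero_iff.2 hx)]
    exact pow_le_pow_left₀ (norm_nonneg _) (hle x) 2
  · simp only
    rw [hzero x (not_le.1 hx), norm_zero]
    exact (zero_pow two_ne_zero).trans_le (indicator_nonneg (fun _ _ => by positivity) _)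

/-- Minkowski's inequality by duality: the difference r is tested against itself, Fubini's theorem
writes ‖r‖² as an average over y of ⟨r, q(· + y) - q⟩, and the kernel has mass one. -/
lemma l2sq_mollify_sub_le [IsFiniteMeasure μ] (hΓ : Φ.Covers Λ Γ) (hμ : Φ.IsGibbs μ)
    {q : Config d → ℂ} (hq : IsTest Γ q) {ε : ℝ} (hε : 0 ≤ ε) (b : ContDiffBump (0 : Λ → ℝ))
    (hb : ∀ y : Λ → ℝ, ‖y‖ < b.rOut →
      l2sq (Φ.flat μ Λ) (fun x => q (x + extendZero y) - q x) ≤ ε) :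
    l2sq (Φ.flat μ Λ) (fun x => mollify (b.normed volume) q x - q x) ≤ ε := by
  set m := Φ.flat μ Λ
  have hb1 : Continuous (b.normed volume) := b.continuous_normed
  have hb2 : HasCompactSupport (b.normed volume) := b.hasCompactSupport_normed
  have hS := isTest_mollify (b.contDiff_normed (μ := volume)) hb2 hq
  set r : Config d → ℂ := fun x => mollify (b.normed volume) q x - q x with hr
  have hrt : IsTest Γ r := by
    obtain ⟨h, h1, h2, h3⟩ := hS
    obtain ⟨k, h4, h5, h6⟩ := id hq
    refine ⟨h - k, h1.sub h4, h2.sub h5, ?_⟩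
    rw [hr, h3, h6]
    rfl
  have hrs : IsTest Γ fun x => star (r x) := IsCTest.star hrt
  have hrm : MemLp (fun x => star (r x)) 2 m := IsCTest.memLp_flat hΓ hrs
  have hqm : MemLp q 2 m := IsCTest.memLp_flat hΓ hq
  have hrm' : MemLp r 2 m := IsCTest.memLp_flat hΓ hrt
  have hTm : ∀ y : Λ → ℝ, MemLp (fun x => q (x + extendZero y)) 2 m := fun y =>
    hqm.comp_measurePreserving (hμ.measurePreserving_add Λ y)
  set a := l2sq m r with ha
  have ha0 : 0 ≤ a := l2sq_nonneg _
  have h2 : ∫ x, star (r x) * r x ∂m = ((a : ℝ) : ℂ) := by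
    rw [ha, l2sq, ← integral_complex_ofReal]
    refine integral_congr_ae (Eventually.of_forall fun x => ?_)
    simp only
    rw [← Complex.normSq_eq_norm_sq]
    exact Complex.normSq_eq_conj_mul_self.symm
  have h3 : ∫ x, star (r x) * r x ∂m = ∫ y, b.normed volume y •
      ∫ x, star (r x) * (q (x + extendZero y) - q x) ∂m := by
    have i1 : Integrable (fun y => b.normed volume y •
        ∫ x, star (r x) * q (x + extendZero y) ∂m) := by
      have := (integrable_mul_mollify (μ := μ) hΓ hb1 hb2
        hrs hq).integral_prod_right
      refine this.congr (Eventually.of_forall fun y => ?_)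
      simp only [mul_smul_comm]
      rw [integral_smul]
    have e1 : ∀ y : Λ → ℝ, ∫ x, star (r x) * (q (x + extendZero y) - q x) ∂m =
        ∫ x, star (r x) * q (x + extendZero y) ∂m - ∫ x, star (r x) * q x ∂m :=
      fun y => pair_sub_right hrm' (hTm y) hqm
    have e2 : ∫ x, star (r x) * r x ∂m = ∫ x, star (r x) * mollify (b.normed volume) q x ∂m -
        ∫ x, star (r x) * q x ∂m :=
      pair_sub_right hrm' (IsCTest.memLp_flat hΓ hS) hqm
    rw [e2, integral_mul_mollify hΓ hb1 hb2 hrs hq]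
    simp only [e1, smul_sub]
    rw [integral_sub i1 (b.integrable_normed.smul_const _), integral_smul_const, b.integral_normed,
      one_smul]
  have h4 : ‖∫ x, star (r x) * r x ∂m‖ ≤ √a * √ε := by
    rw [h3]
    have e3 : ∫ y : Λ → ℝ, b.normed volume y * (√a * √ε) = √a * √ε := by
      rw [integral_mul_const, b.integral_normed, one_mul]
    rw [← e3]
    refine norm_integral_le_of_norm_le (b.integrable_normed.mul_const _)
      (Eventually.of_forall fun y => ?_)
    rw [norm_smul, Real.norm_of_nonneg (b.nonneg_normed y)]
    by_cases hy : b.normed volume y = 0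
    · rw [hy, zero_mul, zero_mul]
    · refine mul_le_mul_of_nonneg_left ?_ (b.nonneg_normed y)
      have hy' : y ∈ Function.support (b.normed volume) := hy
      rw [b.support_normed_eq, mem_ball_zero_iff] at hy'
      refine (norm_pair_le hrm' ((hTm y).sub hqm)).trans ?_
      exact mul_le_mul_of_nonneg_left (Real.sqrt_le_sqrt (hb y hy')) (Real.sqrt_nonneg _)
  rw [h2, Complex.norm_real, Real.norm_of_nonneg ha0] at h4
  have h5 : √a * √a ≤ √a * √ε := by rwa [Real.mul_self_sqrt ha0]
  rcases ha0.eq_or_lt with h0 | h0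
  · rw [← h0]
    exact hε
  · exact (Real.sqrt_le_sqrt_iff hε).1 (le_of_mul_le_mul_left h5 (Real.sqrt_pos.2 h0))

end

/-! ### Density of the test functions in the Sobolev space -/

section

variable {d : ℕ} {Φ : Interaction d} {Γ Γ' Λ : Finset (Lattice d)} {μ : Measure (Config d)}
  {j : Lattice d}

lemma l2sq_flat (v : Config d → ℂ) :
    l2sq (Φ.flat μ Λ) v = ∫ x, Real.exp (Φ.U Λ x) * ‖v x‖ ^ 2 ∂μ := by
  rw [l2sq, Interaction.flat, integral_withDensity_eq_integral_toReal_smul (Φ.measurable_exp_U Λ)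
    (Eventually.of_forall fun _ => ENNReal.ofReal_lt_top)]
  refine integral_congr_ae (Eventually.of_forall fun x => ?_)
  simp only
  rw [ENNReal.toReal_ofReal (Real.exp_nonneg _), smul_eq_mul]

lemma integrable_flat_iff {F : Config d → ℝ} : Integrable F (Φ.flat μ Λ) ↔
    Integrable (fun x => Real.exp (Φ.U Λ x) * F x) μ := by
  rw [Interaction.flat, integrable_withDensity_iff_integrable_smul' (Φ.measurable_exp_U Λ)
    (Eventually.of_forall fun _ => ENNReal.ofReal_lt_top)]
  refine integrable_congr (Eventually.of_forall fun x => ?_)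
  simp only
  rw [ENNReal.toReal_ofReal (Real.exp_nonneg _), smul_eq_mul]

lemma aestronglyMeasurable_flat {v : Config d → ℂ} :
    AEStronglyMeasurable v (Φ.flat μ Λ) ↔ AEStronglyMeasurable v μ := by
  refine ⟨fun h => h.mono_ac (withDensity_absolutelyContinuous' (Φ.measurable_exp_U Λ).aemeasurable
    (Eventually.of_forall fun x => ?_)), fun h => h.mono_ac (withDensity_absolutelyContinuous _ _)⟩
  exact (ENNReal.ofReal_pos.2 (Real.exp_pos _)).ne'

/-- On the support of a cutoff e^{U_Λ} is bounded above and below, so multiplication by θ maps L²(μ)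
to L²(e^{U_Λ}μ) and back continuously. -/
lemma exists_exp_mul_sq_le (hΓ : Φ.Covers Λ Γ) {θ : Config d → ℂ} (hθ : IsTest Γ θ) :
    ∃ C, 0 ≤ C ∧ ∀ x, Real.exp (Φ.U Λ x) * ‖θ x‖ ^ 2 ≤ C ∧
      ‖θ x‖ ^ 2 ≤ C * Real.exp (Φ.U Λ x) := by
  obtain ⟨R, hR⟩ := IsCTest.exists_radius hθ
  obtain ⟨M, hM0, hM⟩ := IsCTest.exists_bound hθ
  obtain ⟨C, hC0, hC⟩ := (Interaction.isCyl_U hΓ).exists_bound_on R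
  refine ⟨Real.exp C * M ^ 2, by positivity, fun x => ?_⟩
  by_cases h : θ x = 0
  · rw [h, norm_zero, zero_pow two_ne_zero, mul_zero]
    exact ⟨by positivity, by positivity⟩
  · have h1 := abs_le.1 (hC x (hR x h))
    have h2 : ‖θ x‖ ^ 2 ≤ M ^ 2 := pow_le_pow_left₀ (norm_nonneg _) (hM x) 2
    refine ⟨mul_le_mul (Real.exp_le_exp.2 h1.2) h2 (by positivity) (Real.exp_nonneg _), ?_⟩
    have h3 : 1 ≤ Real.exp C * Real.exp (Φ.U Λ x) := by
      rw [← Real.exp_add]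
      exact Real.one_le_exp (by linarith [h1.1])
    calc ‖θ x‖ ^ 2 ≤ M ^ 2 * 1 := by linarith
      _ ≤ M ^ 2 * (Real.exp C * Real.exp (Φ.U Λ x)) := by gcongr
      _ = _ := by ring

lemma IsTest.memLp_flat_mul [IsFiniteMeasure μ] (hΓ : Φ.Covers Λ Γ) {θ : Config d → ℂ}
    (hθ : IsTest Γ θ) : ∃ C, 0 ≤ C ∧ ∀ v : Config d → ℂ, MemLp v 2 μ →
      MemLp (fun x => θ x * v x) 2 (Φ.flat μ Λ) ∧
        l2sq (Φ.flat μ Λ) (fun x => θ x * v x) ≤ C * l2sq μ v := by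
  obtain ⟨C, hC0, hC⟩ := exists_exp_mul_sq_le hΓ hθ
  refine ⟨C, hC0, fun v hv => ?_⟩
  have hm : AEStronglyMeasurable (fun x => θ x * v x) μ :=
    hθ.stronglyMeasurable.aestronglyMeasurable.mul hv.1
  have hle : ∀ x, Real.exp (Φ.U Λ x) * ‖θ x * v x‖ ^ 2 ≤ C * ‖v x‖ ^ 2 := fun x => by
    rw [norm_mul, mul_pow, ← mul_assoc]
    exact mul_le_mul_of_nonneg_right (hC x).1 (by positivity)
  have hi : Integrable (fun x => Real.exp (Φ.U Λ x) * ‖θ x * v x‖ ^ 2) μ := by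
    refine ((integrable_norm_sq hv).const_mul C).mono'
      ((Φ.measurable_U Λ).exp.aestronglyMeasurable.mul (hm.norm.pow 2))
      (Eventually.of_forall fun x => ?_)
    rw [Real.norm_of_nonneg (by positivity)]
    exact hle x
  refine ⟨(memLp_two_iff_integrable_sq_norm (aestronglyMeasurable_flat.2 hm)).2
    (integrable_flat_iff.2 hi), ?_⟩
  rw [l2sq_flat, l2sq, ← integral_const_mul]
  exact integral_mono hi ((integrable_norm_sq hv).const_mul C) hle

lemma IsTest.l2sq_mul_le [IsFiniteMeasure μ] (hΓ : Φ.Covers Λ Γ) {θ : Config d → ℂ}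
    (hθ : IsTest Γ θ) : ∃ C, 0 ≤ C ∧ ∀ v : Config d → ℂ, MemLp v 2 (Φ.flat μ Λ) →
        MemLp (fun x => θ x * v x) 2 μ ∧
          l2sq μ (fun x => θ x * v x) ≤ C * l2sq (Φ.flat μ Λ) v := by
  obtain ⟨C, hC0, hC⟩ := exists_exp_mul_sq_le hΓ hθ
  refine ⟨C, hC0, fun v hv => ?_⟩
  have hi := (integrable_flat_iff.1 (integrable_norm_sq hv)).const_mul C
  have hm : AEStronglyMeasurable (fun x => θ x * v x) μ :=
    hθ.stronglyMeasurable.aestronglyMeasurable.mul (aestronglyMeasurable_flat.1 hv.1)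
  have hle : ∀ x, ‖θ x * v x‖ ^ 2 ≤ C * (Real.exp (Φ.U Λ x) * ‖v x‖ ^ 2) := fun x => by
    rw [norm_mul, mul_pow, ← mul_assoc]
    exact mul_le_mul_of_nonneg_right (hC x).2 (by positivity)
  have hi2 : Integrable (fun x => ‖θ x * v x‖ ^ 2) μ := by
    refine hi.mono' (hm.norm.pow 2) (Eventually.of_forall fun x => ?_)
    rw [Real.norm_of_nonneg (by positivity)]
    exact hle x
  refine ⟨(memLp_two_iff_integrable_sq_norm hm).2 hi2, ?_⟩
  rw [l2sq_flat, l2sq, ← integral_const_mul]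
  exact integral_mono hi2 hi hle

/-- `v` is a limit of test functions in `L²(m)`, where the set of coordinates of the approximants
may be taken arbitrarily large. -/
def TestApprox (m : Measure (Config d)) (v : Config d → ℂ) : Prop :=
  ∀ ε : ℝ, 0 < ε → ∃ Γ₀, ∀ Γ, Γ₀ ⊆ Γ → ∃ q, IsTest Γ q ∧ l2sq m (fun x => q x - v x) ≤ ε

lemma testApprox_mul_add [IsFiniteMeasure μ] (hΓ : Φ.Covers Λ Γ) {θ η u v : Config d → ℂ}
    (hθ : IsTest Γ θ) (hη : IsTest Γ η) (hu : MemLp u 2 μ) (hv : MemLp v 2 μ) :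
    TestApprox (Φ.flat μ Λ) fun x => θ x * u x + η x * v x := by
  intro ε hε
  obtain ⟨C, hC0, hC⟩ := hθ.memLp_flat_mul (μ := μ) hΓ
  obtain ⟨C', hC'0, hC'⟩ := hη.memLp_flat_mul (μ := μ) hΓ
  have hδ : 0 < ε / (2 * (C + C' + 1)) := by positivity
  obtain ⟨Γ₁, h₁⟩ := exists_test_l2sq_le hu hδ
  obtain ⟨Γ₂, h₂⟩ := exists_test_l2sq_le hv hδ
  refine ⟨Γ ∪ (Γ₁ ∪ Γ₂), fun Γ' hΓ' => ?_⟩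
  have s0 : Γ ⊆ Γ' := Finset.subset_union_left.trans hΓ'
  obtain ⟨p, hp, hpu⟩ := h₁ Γ' ((Finset.subset_union_left.trans Finset.subset_union_right).trans hΓ')
  obtain ⟨q, hq, hqv⟩ := h₂ Γ' ((Finset.subset_union_right.trans Finset.subset_union_right).trans hΓ')
  have hθ' : IsCyl ((⊤ : ℕ∞) : WithTop ℕ∞) Γ' θ := (IsCTest.isCyl hθ).mono s0
  have hη' : IsCyl ((⊤ : ℕ∞) : WithTop ℕ∞) Γ' η := (IsCTest.isCyl hη).mono s0
  have t1 := IsCTest.mul_cyl hp hθ'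
  have t2 := IsCTest.mul_cyl hq hη'
  refine ⟨fun x => p x * θ x + q x * η x, t1.add t2, ?_⟩
  have hpm : MemLp p 2 μ := IsCTest.memLp hp 2
  have hqm : MemLp q 2 μ := IsCTest.memLp hq 2
  obtain ⟨a1, a2⟩ := hC _ (hpm.sub hu)
  obtain ⟨b1, b2⟩ := hC' _ (hv.sub hqm)
  have e1 := l2sq_sub_le a1 (MemLp.zero' (p := 2) (μ := Φ.flat μ Λ) (ε := ℂ)) b1
  have e2 : l2sq μ (v - q) = l2sq μ fun x => q x - v x := by
    simp only [l2sq, Pi.sub_apply, norm_sub_rev]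
  have e3 : l2sq (Φ.flat μ Λ) (fun x => (0 : ℂ) - η x * (v - q) x) =
      l2sq (Φ.flat μ Λ) fun x => η x * (v - q) x := by
    simp only [l2sq, zero_sub, norm_neg]
  simp only [sub_zero] at e1
  rw [e3] at e1
  have e4 : (fun x => p x * θ x + q x * η x - (θ x * u x + η x * v x)) =
      fun x => θ x * (p - u) x - η x * (v - q) x := by
    ext x
    simp only [Pi.sub_apply]
    ring
  rw [e4]
  refine e1.trans ?_
  have f1 : l2sq μ (p - u) ≤ ε / (2 * (C + C' + 1)) := hpu
  rw [e2] at b2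
  have f2 : C * l2sq μ (p - u) ≤ C * (ε / (2 * (C + C' + 1))) := mul_le_mul_of_nonneg_left f1 hC0
  have f3 := mul_le_mul_of_nonneg_left hqv hC'0
  have f4 : 2 * (C * (ε / (2 * (C + C' + 1)))) + 2 * (C' * (ε / (2 * (C + C' + 1)))) ≤ ε := by
    have : 2 * (C * (ε / (2 * (C + C' + 1)))) + 2 * (C' * (ε / (2 * (C + C' + 1)))) =
        ε * ((C + C') / (C + C' + 1)) := by
      field_simp
    rw [this]
    have : (C + C') / (C + C' + 1) ≤ 1 := by
      rw [div_le_one (by positivity)]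
      linarith
    nlinarith
  linarith

lemma TestApprox.exists_translate [IsFiniteMeasure μ] (hμ : Φ.IsGibbs μ) {v : Config d → ℂ}
    (hv : MemLp v 2 (Φ.flat μ Λ)) (h : TestApprox (Φ.flat μ Λ) v) {ε : ℝ} (hε : 0 < ε) :
    ∃ δ > 0, ∀ y : Λ → ℝ, ‖y‖ < δ →
      l2sq (Φ.flat μ Λ) (fun x => v (x + extendZero y) - v x) ≤ ε := by
  obtain ⟨Γ₁, hΓ₁⟩ := Φ.exists_covers Λ
  -- With three errors of size ε/12, applying 2a + 2b twice gives a total of 10ε/12.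
  obtain ⟨Γ₀, h₀⟩ := h (ε / 12) (by positivity)
  obtain ⟨q, hq, hqv⟩ := h₀ (Γ₀ ∪ Γ₁) Finset.subset_union_left
  have hΓ := hΓ₁.mono (Finset.subset_union_right (s₁ := Γ₀))
  obtain ⟨δ, hδ, H⟩ := hq.exists_l2sq_translate_sub_le (μ := μ) hΓ (ε := ε / 12) (by positivity)
  refine ⟨δ, hδ, fun y hy => ?_⟩
  have hqm : MemLp q 2 (Φ.flat μ Λ) := IsCTest.memLp_flat hΓ hq
  have hp := hμ.measurePreserving_add Λ y
  have hvT : MemLp (fun x => v (x + extendZero y)) 2 (Φ.flat μ Λ) :=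
    hv.comp_measurePreserving hp
  have hqT : MemLp (fun x => q (x + extendZero y)) 2 (Φ.flat μ Λ) :=
    hqm.comp_measurePreserving hp
  have e1 := l2sq_sub_le hvT hqT hv
  have e2 := l2sq_sub_le hqT hqm hv
  have e3 : l2sq (Φ.flat μ Λ) (fun x => v (x + extendZero y) - q (x + extendZero y)) =
      l2sq (Φ.flat μ Λ) (fun x => q x - v x) := by
    rw [l2sq_flat_add_extendZero hμ y (F := fun x => v x - q x) (hv.1.sub hqm.1)]
    simp only [l2sq, norm_sub_rev]
  have e4 := H y hy
  linarith

end

/-! ### Simultaneous approximation of a function and its derivatives. -/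

section

variable {d : ℕ} {Φ : Interaction d} {Γ Γ' Λ : Finset (Lattice d)} {μ : Measure (Config d)}
  {j : Lattice d}

lemma norm_integral_mul_le {Ω : Type*} [MeasurableSpace Ω] {m : Measure Ω} {a b : Ω → ℂ}
    (ha : MemLp a 2 m) (hb : MemLp b 2 m) :
    ‖∫ x, a x * b x ∂m‖ ≤ √(l2sq m a) * √(l2sq m b) := by
  have h := norm_pair_le ha.star hb
  have h1 : l2sq m (star a) = l2sq m a := by simp [l2sq]
  rw [h1] at h
  simpa [pair] using h

lemma integral_star_mul_self {Ω : Type*} [MeasurableSpace Ω] {m : Measure Ω} (r : Ω → ℂ) :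
    ∫ x, star (r x) * r x ∂m = ((l2sq m r : ℝ) : ℂ) := by
  rw [l2sq, ← integral_complex_ofReal]
  refine integral_congr_ae (Eventually.of_forall fun x => ?_)
  simp only
  rw [← Complex.normSq_eq_norm_sq]
  exact Complex.normSq_eq_conj_mul_self.symm

lemma mollify_neg (k : (Λ → ℝ) → ℝ) (q : Config d → ℂ) (x : Config d) :
    mollify (fun y => -k y) q x = -mollify k q x := by
  simp only [mollify, neg_smul]
  rw [integral_neg]

lemma IsTest.add {f g : Config d → ℂ} (hf : IsTest Γ f) (hg : IsTest Γ g) :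
    IsTest Γ fun x => f x + g x := IsCTest.add hf hg

lemma IsTest.star {g : Config d → ℂ} (hg : IsTest Γ g) : IsTest Γ fun x => star (g x) :=
  IsCTest.star hg

lemma IsTest.memLp_flat [IsFiniteMeasure μ] (hΓ : Φ.Covers Λ Γ) {g : Config d → ℂ}
    (hg : IsTest Γ g) : MemLp g 2 (Φ.flat μ Λ) := IsCTest.memLp_flat hΓ hg

/-- If `q` approximates `u` and `p` approximates its derivative, then the mollification of `p`
approximates the derivative of the mollification of `q`. -/
lemma l2sq_mollify_add_le [IsFiniteMeasure μ] (hμ : Φ.IsGibbs μ) (hΓ : Φ.Covers Λ Γ) (hj : j ∈ Λ)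
    {u D : Config d → ℂ} (hu : MemLp u 2 (Φ.flat μ Λ)) (hD : MemLp D 2 (Φ.flat μ Λ))
    (huD : ∀ g, IsTest Γ g →
      ∫ x, g x * D x ∂Φ.flat μ Λ = -∫ x, pderiv j g x * u x ∂Φ.flat μ Λ)
    {q p : Config d → ℂ} (hq : IsTest Γ q) (hp : IsTest Γ p) {k : (Λ → ℝ) → ℝ}
    (hk : ContDiff ℝ ((⊤ : ℕ∞) : WithTop ℕ∞) k) (hk' : HasCompactSupport k) {ε : ℝ}
    (hqu : l2sq (Φ.flat μ Λ) (fun x => q x - u x) ≤ ε)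
    (hpD : l2sq (Φ.flat μ Λ) (fun x => p x - D x) ≤ ε) :
    l2sq (Φ.flat μ Λ) (fun x => mollify (fun y => fderiv ℝ k y (Pi.single (⟨j, hj⟩ : Λ) 1)) q x +
      mollify k p x) ≤
        ((∫ y, |fderiv ℝ k y (Pi.single (⟨j, hj⟩ : Λ) 1)|) + ∫ y, |k y|) ^ 2 * ε := by
  set m := Φ.flat μ Λ
  set e : Λ → ℝ := Pi.single (⟨j, hj⟩ : Λ) 1 with he
  set l : (Λ → ℝ) → ℝ := fun y => fderiv ℝ k y e with hl
  have hε : 0 ≤ ε := (l2sq_nonneg _).trans hqu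
  have hls : ContDiff ℝ ((⊤ : ℕ∞) : WithTop ℕ∞) l :=
    (hk.fderiv_right (by exact_mod_cast le_rfl)).clm_apply contDiff_const
  have hl' : HasCompactSupport l :=
    (hk'.fderiv ℝ).comp_left (g := fun L : (Λ → ℝ) →L[ℝ] ℝ => L e) rfl
  have hk1 : HasCompactSupport fun y => k (-y) := hk'.comp_homeomorph (Homeomorph.neg _)
  have hl1 : HasCompactSupport fun y => l (-y) := hl'.comp_homeomorph (Homeomorph.neg _)
  have hks : ContDiff ℝ ((⊤ : ℕ∞) : WithTop ℕ∞) fun y => k (-y) := hk.comp contDiff_neg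
  have hls1 : ContDiff ℝ ((⊤ : ℕ∞) : WithTop ℕ∞) fun y => l (-y) := hls.comp contDiff_neg
  set r : Config d → ℂ := fun x => mollify l q x + mollify k p x with hr
  have t1 := isTest_mollify hls hl' hq
  have t2 := isTest_mollify hk hk' hp
  have hrt : IsTest Γ r := t1.add t2
  have hrs := hrt.star
  have s1 := isTest_mollify hls1 hl1 hrs
  have s2 := isTest_mollify hks hk1 hrs
  have hqm := hq.memLp_flat (μ := μ) hΓ
  have hpm := hp.memLp_flat (μ := μ) hΓ
  have hrm := hrt.memLp_flat (μ := μ) hΓ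
  have s1m := s1.memLp_flat (μ := μ) hΓ
  have s2m := s2.memLp_flat (μ := μ) hΓ
  -- The claim holds with zero error for the pair (u, D): after transposition this is the weak
  -- derivative identity, tested with the mollification of r̄.
  have hzero : ∫ x, mollify (fun y => l (-y)) (fun x => star (r x)) x * u x ∂m +
      ∫ x, mollify (fun y => k (-y)) (fun x => star (r x)) x * D x ∂m = 0 := by
    rw [huD _ s2]
    have : ∀ x, pderiv j (mollify (fun y => k (-y)) fun x => star (r x)) x =
        mollify (fun y => l (-y)) (fun x => star (r x)) x := by
      intro x
      rw [pderiv_mollify (hks.of_le (by simp)) hk1 hrs hj, ← mollify_neg]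
      congr 1
      ext y
      have h1 := ((hk.differentiable (by simp)) (-y)).hasFDerivAt.comp y
        (hasFDerivAt_id y).neg
      have h2 : fderiv ℝ (fun y => k (-y)) y = _ := h1.fderiv
      rw [h2]
      simp [hl, he]
    simp only [this]
    exact add_neg_cancel _
  -- Subtracting the vanishing expression leaves only q - u and p - D, both small; Young's
  -- inequality bounds the factors multiplying them.
  have key : ∫ x, star (r x) * r x ∂m =
      ∫ x, mollify (fun y => l (-y)) (fun x => star (r x)) x * (q x - u x) ∂m +
      ∫ x, mollify (fun y => k (-y)) (fun x => star (r x)) x * (p x - D x) ∂m := by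
    have e1 : ∫ x, star (r x) * r x ∂m =
        ∫ x, star (r x) * mollify l q x ∂m + ∫ x, star (r x) * mollify k p x ∂m := by
      rw [← integral_add]
      · simp only [hr, mul_add]
      · exact (hrs.memLp_flat hΓ).integrable_mul (t1.memLp_flat hΓ)
      · exact (hrs.memLp_flat hΓ).integrable_mul (t2.memLp_flat hΓ)
    rw [integral_mul_mollify_comm hμ hΓ hΓ hls.continuous hl' hrs hq,
      integral_mul_mollify_comm hμ hΓ hΓ hk.continuous hk' hrs hp] at e1
    have e2 : ∫ x, mollify (fun y => l (-y)) (fun x => star (r x)) x * (q x - u x) ∂m =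
        ∫ x, mollify (fun y => l (-y)) (fun x => star (r x)) x * q x ∂m -
        ∫ x, mollify (fun y => l (-y)) (fun x => star (r x)) x * u x ∂m := by
      simp only [mul_sub]
      exact integral_sub (s1m.integrable_mul hqm) (s1m.integrable_mul hu)
    have e3 : ∫ x, mollify (fun y => k (-y)) (fun x => star (r x)) x * (p x - D x) ∂m =
        ∫ x, mollify (fun y => k (-y)) (fun x => star (r x)) x * p x ∂m -
        ∫ x, mollify (fun y => k (-y)) (fun x => star (r x)) x * D x ∂m := by
      simp only [mul_sub]
      exact integral_sub (s2m.integrable_mul hpm) (s2m.integrable_mul hD)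
    rw [e1, e2, e3]
    linear_combination hzero
  set a := l2sq m r with ha
  have ha0 : 0 ≤ a := l2sq_nonneg _
  set I := (∫ y, |l y|) with hI
  set J := (∫ y, |k y|) with hJ
  have hI0 : 0 ≤ I := integral_nonneg fun _ => abs_nonneg _
  have hJ0 : 0 ≤ J := integral_nonneg fun _ => abs_nonneg _
  have hstar : l2sq m (fun x => star (r x)) = a := by simp [l2sq, ha]
  have b1 : √(l2sq m (mollify (fun y => l (-y)) fun x => star (r x))) ≤ I * √a := by
    have h := l2sq_mollify_le hμ hΓ hls1 hl1 hrs
    rw [integral_neg_eq_self (fun y => |l y|), hstar] at h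
    rw [← Real.sqrt_sq hI0, ← Real.sqrt_mul (sq_nonneg _)]
    exact Real.sqrt_le_sqrt h
  have b2 : √(l2sq m (mollify (fun y => k (-y)) fun x => star (r x))) ≤ J * √a := by
    have h := l2sq_mollify_le hμ hΓ hks hk1 hrs
    rw [integral_neg_eq_self (fun y => |k y|), hstar] at h
    rw [← Real.sqrt_sq hJ0, ← Real.sqrt_mul (sq_nonneg _)]
    exact Real.sqrt_le_sqrt h
  have c1 := norm_integral_mul_le s1m (hqm.sub hu)
  have c2 := norm_integral_mul_le s2m (hpm.sub hD)
  have d1 : √(l2sq m (q - u)) ≤ √ε := Real.sqrt_le_sqrt hqu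
  have d2 : √(l2sq m (p - D)) ≤ √ε := Real.sqrt_le_sqrt hpD
  have hfin : a ≤ (I * √a) * √ε + (J * √a) * √ε := by
    have h1 : a = ‖∫ x, star (r x) * r x ∂m‖ := by
      rw [integral_star_mul_self, Complex.norm_real, Real.norm_of_nonneg ha0]
    refine h1.le.trans ?_
    rw [key]
    refine (norm_add_le _ _).trans (add_le_add (c1.trans ?_) (c2.trans ?_))
    · exact mul_le_mul b1 d1 (Real.sqrt_nonneg _) (by positivity)
    · exact mul_le_mul b2 d2 (Real.sqrt_nonneg _) (by positivity)
  have hs : √a ≤ (I + J) * √ε := by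
    rcases ha0.eq_or_lt with h0 | h0
    · rw [← h0, Real.sqrt_zero]
      positivity
    · refine le_of_mul_le_mul_right ?_ (Real.sqrt_pos.2 h0)
      rw [Real.mul_self_sqrt ha0]
      linarith
  calc a = √a ^ 2 := (Real.sq_sqrt ha0).symm
    _ ≤ ((I + J) * √ε) ^ 2 := by gcongr
    _ = _ := by rw [mul_pow, Real.sq_sqrt hε]

lemma l2sq_translate_sub_le [IsFiniteMeasure μ] (hμ : Φ.IsGibbs μ) {v w : Config d → ℂ}
    (hv : MemLp v 2 (Φ.flat μ Λ)) (hw : MemLp w 2 (Φ.flat μ Λ)) (y : Λ → ℝ) :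
    l2sq (Φ.flat μ Λ) (fun x => w (x + extendZero y) - w x) ≤
      6 * l2sq (Φ.flat μ Λ) (fun x => w x - v x) +
        4 * l2sq (Φ.flat μ Λ) (fun x => v (x + extendZero y) - v x) := by
  have hp := hμ.measurePreserving_add Λ y
  have hvT : MemLp (fun x => v (x + extendZero y)) 2 (Φ.flat μ Λ) :=
    hv.comp_measurePreserving hp
  have hwT : MemLp (fun x => w (x + extendZero y)) 2 (Φ.flat μ Λ) :=
    hw.comp_measurePreserving hp
  have e1 := l2sq_sub_le hwT hvT hw
  have e2 := l2sq_sub_le hvT hv hw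
  have e3 : l2sq (Φ.flat μ Λ) (fun x => w (x + extendZero y) - v (x + extendZero y)) =
      l2sq (Φ.flat μ Λ) (fun x => w x - v x) :=
    l2sq_flat_add_extendZero hμ y (F := fun x => w x - v x) (hw.1.sub hv.1)
  have e4 : l2sq (Φ.flat μ Λ) (fun x => v x - w x) = l2sq (Φ.flat μ Λ) (fun x => w x - v x) := by
    simp only [l2sq, norm_sub_rev]
  linarith

/-- Density of the test functions in the Sobolev space over the flat measure. -/
lemma exists_test_approx_flat [IsFiniteMeasure μ] (hμ : Φ.IsGibbs μ)
    {u : Config d → ℂ} {D : Λ → Config d → ℂ} (hu : MemLp u 2 (Φ.flat μ Λ))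
    (hD : ∀ j, MemLp (D j) 2 (Φ.flat μ Λ)) (au : TestApprox (Φ.flat μ Λ) u)
    (aD : ∀ j, TestApprox (Φ.flat μ Λ) (D j))
    (huD : ∀ (j : Λ) (Γ : Finset (Lattice d)), Φ.Covers Λ Γ → ∀ g, IsTest Γ g →
      ∫ x, g x * D j x ∂Φ.flat μ Λ = -∫ x, pderiv j g x * u x ∂Φ.flat μ Λ) {ε : ℝ} (hε : 0 < ε) :
    ∃ Γ, Φ.Covers Λ Γ ∧ ∃ g, IsTest Γ g ∧ l2sq (Φ.flat μ Λ) (fun x => g x - u x) ≤ ε ∧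
      ∀ j : Λ, l2sq (Φ.flat μ Λ) (fun x => pderiv j g x - D j x) ≤ ε := by
  set m := Φ.flat μ Λ
  -- The worst case is the derivative, with error 2·2η + 2·22η = 48η.
  set η := ε / 64 with hη
  have hη0 : 0 < η := by positivity
  obtain ⟨δ, hδ, Hδ⟩ : ∃ δ > 0, ∀ y : Λ → ℝ, ‖y‖ < δ →
      l2sq m (fun x => u (x + extendZero y) - u x) ≤ η ∧
      ∀ j, l2sq m (fun x => D j (x + extendZero y) - D j x) ≤ η := by
    have ev : ∀ {v : Config d → ℂ}, MemLp v 2 m → TestApprox m v →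
        ∀ᶠ y : Λ → ℝ in 𝓝 0, l2sq m (fun x => v (x + extendZero y) - v x) ≤ η := by
      intro v hv av
      obtain ⟨δ, hδ, H⟩ := av.exists_translate hμ hv hη0
      filter_upwards [Metric.ball_mem_nhds (0 : Λ → ℝ) hδ] with y hy
      exact H y (mem_ball_zero_iff.1 hy)
    obtain ⟨δ, hδ, H⟩ := Metric.eventually_nhds_iff.1
      ((ev hu au).and (eventually_all.2 fun j => ev (hD j) (aD j)))
    exact ⟨δ, hδ, fun y hy => H (by simpa using hy)⟩
  let b : ContDiffBump (0 : Λ → ℝ) := ⟨δ / 2, δ, by positivity, by linarith⟩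
  set k : (Λ → ℝ) → ℝ := b.normed volume with hk
  have hks : ContDiff ℝ ((⊤ : ℕ∞) : WithTop ℕ∞) k := b.contDiff_normed
  have hk' : HasCompactSupport k := b.hasCompactSupport_normed
  have hk1 : ∫ y, |k y| = 1 := by
    rw [← b.integral_normed (μ := volume)]
    exact integral_congr_ae (Eventually.of_forall fun y => abs_of_nonneg (b.nonneg_normed y))
  set I : Λ → ℝ := fun j => ∫ y, |fderiv ℝ k y (Pi.single j 1)| with hI
  -- The kernel is fixed before q and p are chosen; demanding accuracy η/A then compensates the
  -- possibly large L¹ norms of its derivatives.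
  set A := 1 + ∑ j, I j ^ 2 with hA
  have hA1 : 1 ≤ A := le_add_of_nonneg_right (Finset.sum_nonneg fun _ _ => sq_nonneg _)
  have hε' : 0 < η / A := by positivity
  have hε'η : η / A ≤ η := div_le_self hη0.le hA1
  obtain ⟨Γ₀, h₀⟩ := au _ hε'
  choose Γ₁ h₁ using fun j => aD j _ hε'
  obtain ⟨Γ₂, hΓ₂⟩ := Φ.exists_covers Λ
  set Γ := Γ₀ ∪ Finset.univ.biUnion Γ₁ ∪ Γ₂ with hΓdef
  have hΓ : Φ.Covers Λ Γ := hΓ₂.mono Finset.subset_union_right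
  obtain ⟨q, hq, hqu⟩ := h₀ Γ (Finset.subset_union_left.trans Finset.subset_union_left)
  choose p hp hpD using fun j => h₁ j Γ ((Finset.subset_biUnion_of_mem Γ₁
    (Finset.mem_univ j)).trans (Finset.subset_union_right.trans Finset.subset_union_left))
  have hqm := hq.memLp_flat (μ := μ) hΓ
  -- Translation errors of w are at most 6η + 4η = 10η, so the total is 2·10η + 2η.
  have close : ∀ {v w : Config d → ℂ}, MemLp v 2 m → IsTest Γ w →
      l2sq m (fun x => w x - v x) ≤ η / A →
      (∀ y : Λ → ℝ, ‖y‖ < δ → l2sq m (fun x => v (x + extendZero y) - v x) ≤ η) →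
      l2sq m (fun x => mollify k w x - v x) ≤ 22 * η := by
    intro v w hv hw hwv hmod
    have hwm := hw.memLp_flat (μ := μ) hΓ
    have h1 := l2sq_mollify_sub_le hΓ hμ hw (ε := 10 * η) (by positivity) b fun y hy => by
      have := l2sq_translate_sub_le hμ hv hwm y
      have := hmod y hy
      linarith
    have h2 := l2sq_sub_le ((isTest_mollify hks hk' hw).memLp_flat (μ := μ) hΓ) hwm hv
    linarith
  refine ⟨Γ, hΓ, mollify k q, isTest_mollify hks hk' hq, ?_, fun j => ?_⟩
  · have := close hu hq hqu fun y hy => (Hδ y hy).1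
    linarith
  · have h1 := close (hD j) (hp j) (hpD j) fun y hy => (Hδ y hy).2 j
    have h2 := l2sq_mollify_add_le hμ hΓ j.2 hu (hD j) (huD j Γ hΓ) hq (hp j) hks hk' hqu (hpD j)
    rw [hk1] at h2
    have h3 : (I j + 1) ^ 2 * (η / A) ≤ 2 * η := by
      have h4 : I j ^ 2 ≤ ∑ j, I j ^ 2 :=
        Finset.single_le_sum (f := fun j => I j ^ 2) (fun _ _ => sq_nonneg _) (Finset.mem_univ j)
      have h5 : (I j + 1) ^ 2 ≤ 2 * A := by nlinarith [sq_nonneg (I j - 1)]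
      calc (I j + 1) ^ 2 * (η / A) ≤ 2 * A * (η / A) := by gcongr
        _ = 2 * η := by field_simp
    have hg := (isTest_mollify hks hk' hq).pderiv j
    have h6 := l2sq_sub_le (hg.memLp_flat (μ := μ) hΓ)
      ((isTest_mollify hks hk' (hp j)).memLp_flat (μ := μ) hΓ) (hD j)
    have h7 : l2sq m (fun x => pderiv j (mollify k q) x - mollify k (p j) x) =
        l2sq m (fun x => mollify (fun y => fderiv ℝ k y (Pi.single j 1)) q x +
          mollify k (p j) x) := by
      simp only [l2sq]
      refine integral_congr_ae (Eventually.of_forall fun x => ?_)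
      simp only
      rw [pderiv_mollify (hks.of_le (by simp)) hk' hq j.2, ← neg_add', norm_neg]
    rw [h7] at h6
    have h8 := h2.trans h3
    linarith

end

/-! ### Density of the test functions for the Gibbs measure. -/

section

variable {d : ℕ} {Φ : Interaction d} {Γ Γ' Λ : Finset (Lattice d)} {μ : Measure (Config d)}
  {j : Lattice d}

lemma l2sq_add_le {Ω : Type*} [MeasurableSpace Ω] {m : Measure Ω} {a b : Ω → ℂ}
    (ha : MemLp a 2 m) (hb : MemLp b 2 m) :
    l2sq m (fun x => a x + b x) ≤ 2 * l2sq m a + 2 * l2sq m b := by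
  have h := l2sq_sub_le ha (MemLp.zero' (p := 2) (μ := m) (ε := ℂ)) hb.neg
  simpa [l2sq] using h

lemma IsTest.memLp [IsFiniteMeasure μ] {g : Config d → ℂ} (hg : IsTest Γ g) (p : ℝ≥0∞) :
    MemLp g p μ := IsCTest.memLp hg p

lemma IsTest.memLp_mul [IsFiniteMeasure μ] {g v : Config d → ℂ} (hg : IsTest Γ g)
    (hv : MemLp v 2 μ) : MemLp (fun x => g x * v x) 2 μ := by
  obtain ⟨C, hC0, hC⟩ := IsCTest.exists_bound hg
  refine MemLp.of_le_mul (c := C) hv (hg.stronglyMeasurable.aestronglyMeasurable.mul hv.1)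
    (Eventually.of_forall fun x => ?_)
  rw [norm_mul]
  exact mul_le_mul_of_nonneg_right (hC x) (norm_nonneg _)

/-- `(u, D)` is a limit of pairs consisting of a test function and its gradient. -/
def Interaction.GradApprox (Φ : Interaction d) (μ : Measure (Config d)) (Λ : Finset (Lattice d))
    (u : Config d → ℂ) (D : Λ → Config d → ℂ) : Prop :=
  ∀ ε : ℝ, 0 < ε → ∃ Γ, Φ.Covers Λ Γ ∧ ∃ g, IsTest Γ g ∧ l2sq μ (fun x => g x - u x) ≤ ε ∧
    ∀ j : Λ, l2sq μ (fun x => pderiv j g x - D j x) ≤ ε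

lemma Interaction.GradApprox.of_tendsto [IsFiniteMeasure μ] {u : ℕ → Config d → ℂ}
    {D : ℕ → Λ → Config d → ℂ} {v : Config d → ℂ} {E : Λ → Config d → ℂ}
    (h : ∀ n, Φ.GradApprox μ Λ (u n) (D n)) (hu : ∀ n, MemLp (u n) 2 μ)
    (hD : ∀ n j, MemLp (D n j) 2 μ) (hv : MemLp v 2 μ) (hE : ∀ j, MemLp (E j) 2 μ)
    (huv : Tendsto (fun n => l2sq μ (fun x => u n x - v x)) atTop (𝓝 0))
    (hDE : ∀ j, Tendsto (fun n => l2sq μ (fun x => D n j x - E j x)) atTop (𝓝 0)) :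
    Φ.GradApprox μ Λ v E := by
  intro ε hε
  have hε4 : 0 < ε / 4 := by positivity
  obtain ⟨n, h1, h2⟩ := ((huv.eventually_le_const hε4).and
    (eventually_all.2 fun j => (hDE j).eventually_le_const hε4)).exists
  obtain ⟨Γ, hΓ, g, hg, h3, h4⟩ := h n _ hε4
  refine ⟨Γ, hΓ, g, hg, ?_, fun j => ?_⟩
  · have := l2sq_sub_le (hg.memLp 2) (hu n) hv
    linarith
  · have := l2sq_sub_le ((hg.pderiv j).memLp 2) (hD n j) (hE j)
    linarith [h2 j, h4 j]

lemma tendsto_l2sq_cutoff [IsFiniteMeasure μ] {θ : ℕ → Config d → ℂ}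
    (hθ : ∀ n, IsTest Γ (θ n)) (hθ1 : ∀ n x, ‖θ n x‖ ≤ 1)
    (hθl : ∀ x, Tendsto (fun n => θ n x) atTop (𝓝 1)) {u : Config d → ℂ} (hu : MemLp u 2 μ) :
    Tendsto (fun n => l2sq μ (fun x => θ n x * u x - u x)) atTop (𝓝 0) := by
  refine tendsto_l2sq_of_dominated (b := fun x => 2 * u x)
    (fun n => (((hθ n).memLp_mul hu).sub hu).1) (hu.const_mul 2)
    (fun n => Eventually.of_forall fun x => ?_) (Eventually.of_forall fun x => ?_)
  · calc ‖θ n x * u x - u x‖ ≤ ‖θ n x * u x‖ + ‖u x‖ := norm_sub_le _ _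
      _ ≤ 1 * ‖u x‖ + ‖u x‖ := by
          rw [norm_mul]
          gcongr
          exact hθ1 n x
      _ = ‖2 * u x‖ := by
          rw [norm_mul]
          norm_num
          ring
  · simpa using ((hθl x).mul_const (u x)).sub_const (u x)

lemma tendsto_l2sq_cutoff_grad [IsFiniteMeasure μ] {θ : ℕ → Config d → ℂ}
    (hθ : ∀ n, IsTest Γ (θ n)) (hθ1 : ∀ n x, ‖θ n x‖ ≤ 1)
    (hθl : ∀ x, Tendsto (fun n => θ n x) atTop (𝓝 1)) {C : ℝ}
    (hθg : ∀ n x, ‖pderiv j (θ n) x‖ ≤ C / (n + 1)) {u D : Config d → ℂ} (hu : MemLp u 2 μ)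
    (hD : MemLp D 2 μ) :
    Tendsto (fun n => l2sq μ (fun x => (θ n x * D x + pderiv j (θ n) x * u x) - D x)) atTop
      (𝓝 0) := by
  have hC0 : Tendsto (fun n : ℕ => C / ((n : ℝ) + 1)) atTop (𝓝 0) :=
    by simpa [div_eq_mul_inv] using tendsto_one_div_add_atTop_nhds_zero_nat.const_mul C
  have hC : 0 ≤ C := by simpa using (norm_nonneg _).trans (hθg 0 0)
  have h2 : Tendsto (fun n => l2sq μ (fun x => pderiv j (θ n) x * u x)) atTop (𝓝 0) := by
    refine tendsto_l2sq_of_dominated (b := fun x => C * u x)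
      (fun n => (((hθ n).pderiv j).memLp_mul hu).1) (hu.const_mul _)
      (fun n => Eventually.of_forall fun x => ?_) (Eventually.of_forall fun x => ?_)
    · rw [norm_mul, norm_mul, Complex.norm_real, Real.norm_of_nonneg hC]
      gcongr
      exact (hθg n x).trans (div_le_self hC (by linarith [n.cast_nonneg (α := ℝ)]))
    · have : Tendsto (fun n => pderiv j (θ n) x) atTop (𝓝 0) :=
        squeeze_zero_norm (fun n => hθg n x) hC0
      simpa using this.mul_const (u x)
  have h3 := ((tendsto_l2sq_cutoff hθ hθ1 hθl hD).const_mul 2).add (h2.const_mul 2)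
  simp only [mul_zero, add_zero] at h3
  refine squeeze_zero (fun _ => l2sq_nonneg _) (fun n => ?_) h3
  have := l2sq_add_le (((hθ n).memLp_mul hD).sub hD) (((hθ n).pderiv j).memLp_mul hu)
  refine le_trans (le_of_eq ?_) this
  congr 1
  ext x
  simp only [Pi.sub_apply]
  ring

/-- Test functions are dense in the Sobolev space of functions with weak derivatives in the
directions of `Λ`. -/
lemma gradApprox_of_isWeakDeriv [IsFiniteMeasure μ] (hμ : Φ.IsGibbs μ) {u : Config d → ℂ}
    {D : Λ → Config d → ℂ} (hu : MemLp u 2 μ) (h : ∀ j : Λ, Φ.IsWeakDeriv μ j u (D j)) :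
    Φ.GradApprox μ Λ u D := by
  obtain ⟨Γ₁, hΓ₁⟩ := Φ.exists_covers Λ
  -- Cutoffs are used twice: the inner one, θ n, brings u and D into L² of the flat measure, where
  -- mollification works, and the outer one, θ m, turns approximation in that space into
  -- approximation in L²(μ).
  obtain ⟨θ, hθ, hθ1, hθl, hθg⟩ := exists_cutoff Γ₁
  choose C hC using hθg
  have hD : ∀ j, MemLp (D j) 2 μ := fun j => (h j).2.1
  set v : ℕ → Config d → ℂ := fun n x => θ n x * u x with hv
  set E : ℕ → Λ → Config d → ℂ := fun n j x => θ n x * D j x + pderiv j (θ n) x * u x with hE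
  have hvm : ∀ n, MemLp (v n) 2 μ := fun n => (hθ n).memLp_mul hu
  have hEm : ∀ n j, MemLp (E n j) 2 μ := fun n j =>
    ((hθ n).memLp_mul (hD j)).add (((hθ n).pderiv j).memLp_mul hu)
  refine Interaction.GradApprox.of_tendsto (u := v) (D := E) (fun n => ?_) hvm hEm hu hD
    (tendsto_l2sq_cutoff hθ hθ1 hθl hu)
    (fun j => tendsto_l2sq_cutoff_grad hθ hθ1 hθl (hC j) hu (hD j))
  have hvE : ∀ j : Λ, Φ.IsWeakDeriv μ j (v n) (E n j) := fun j => (h j).test_mul (hθ n)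
  refine Interaction.GradApprox.of_tendsto (u := fun m x => θ m x * v n x)
    (D := fun m j x => θ m x * E n j x + pderiv j (θ m) x * v n x) (fun m => ?_)
    (fun m => (hθ m).memLp_mul (hvm n))
    (fun m j => ((hθ m).memLp_mul (hEm n j)).add (((hθ m).pderiv j).memLp_mul (hvm n)))
    (hvm n) (hEm n) (tendsto_l2sq_cutoff hθ hθ1 hθl (hvm n))
    (fun j => tendsto_l2sq_cutoff_grad hθ hθ1 hθl (hC j) (hvm n) (hEm n j))
  intro ε hε
  obtain ⟨c, hc0, hc⟩ := (hθ n).memLp_flat_mul (μ := μ) hΓ₁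
  have hvf : MemLp (v n) 2 (Φ.flat μ Λ) := (hc u hu).1
  have hEf : ∀ j, MemLp (E n j) 2 (Φ.flat μ Λ) := fun j => by
    obtain ⟨c', -, hc'⟩ := ((hθ n).pderiv j).memLp_flat_mul (μ := μ) hΓ₁
    exact (hc _ (hD j)).1.add (hc' u hu).1
  obtain ⟨K, hK0, hK⟩ := (hθ m).l2sq_mul_le (μ := μ) hΓ₁
  choose K' hK'0 hK' using fun j : Λ => ((hθ m).pderiv j).l2sq_mul_le (μ := μ) hΓ₁
  -- The accuracy ε/A absorbs the norms of multiplication by θ m and by its derivatives.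
  set A := 1 + 2 * K + 2 * ∑ j, K' j with hA
  have hS : 0 ≤ ∑ j, K' j := Finset.sum_nonneg fun j _ => hK'0 j
  have hA0 : 0 < A := by positivity
  have av : TestApprox (Φ.flat μ Λ) (v n) := by
    have := testApprox_mul_add hΓ₁ (hθ n) (hθ n) hu (MemLp.zero' (p := 2) (μ := μ) (ε := ℂ))
    simpa using this
  obtain ⟨Γ, hΓ, g, hg, h1, h2⟩ := exists_test_approx_flat hμ hvf hEf av
    (fun j => testApprox_mul_add hΓ₁ (hθ n) ((hθ n).pderiv j) (hD j) hu)
    (fun j Γ hΓ g hg => (hvE j).integral_flat_mul hΓ j.2 (hg.isCTest 1))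
    (ε := ε / A) (by positivity)
  have hprod : IsTest (Γ₁ ∪ Γ) fun x => θ m x * g x := IsCTest.mul (hθ m) hg
  refine ⟨Γ₁ ∪ Γ, hΓ.mono Finset.subset_union_right, _, hprod, ?_, fun j => ?_⟩
  · have h3 := (hK _ ((hg.memLp_flat hΓ).sub hvf)).2
    have h4 : l2sq μ (fun x => θ m x * g x - θ m x * v n x) =
        l2sq μ fun x => θ m x * (g - v n) x := by
      simp only [Pi.sub_apply, mul_sub]
    rw [h4]
    refine h3.trans ?_
    calc K * l2sq (Φ.flat μ Λ) (g - v n) ≤ A * (ε / A) :=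
          mul_le_mul (by linarith) h1 (l2sq_nonneg _) hA0.le
      _ = ε := by field_simp
  · obtain ⟨m1, m2⟩ := hK _ (((hg.pderiv j).memLp_flat hΓ).sub (hEf j))
    obtain ⟨m3, m4⟩ := hK' j _ ((hg.memLp_flat hΓ).sub hvf)
    have h3 := l2sq_add_le m1 m3
    have h4 : (fun x => pderiv j (fun x => θ m x * g x) x -
        (θ m x * E n j x + pderiv j (θ m) x * v n x)) =
        fun x => θ m x * (pderiv j g - E n j) x + pderiv j (θ m) x * (g - v n) x := by
      ext x
      rw [pderiv_mul ((hθ m).isCTest 1).isCyl (hg.isCTest 1).isCyl]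
      simp only [Pi.sub_apply]
      ring
    rw [h4]
    refine h3.trans ?_
    have h5 : K * l2sq (Φ.flat μ Λ) (pderiv j g - E n j) ≤ K * (ε / A) :=
      mul_le_mul_of_nonneg_left (h2 j) hK0
    have h6 : K' j * l2sq (Φ.flat μ Λ) (g - v n) ≤ K' j * (ε / A) :=
      mul_le_mul_of_nonneg_left h1 (hK'0 j)
    have h7 : K' j ≤ ∑ j, K' j :=
      Finset.single_le_sum (f := K') (fun j _ => hK'0 j) (Finset.mem_univ j)
    have h8 : (2 * K + 2 * K' j) * (ε / A) ≤ A * (ε / A) := by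
      gcongr
      linarith
    have h9 : A * (ε / A) = ε := by field_simp
    linarith

end

/-! ### The weak gradient -/

section

variable {d : ℕ} {Φ : Interaction d} {Γ Γ' Λ : Finset (Lattice d)} {μ : Measure (Config d)}
  {j : Lattice d} {u v D E : Config d → ℂ}

lemma IsTest.memLp_dual [IsFiniteMeasure μ] (hΓ : Φ.Covers {j} Γ) {g : Config d → ℂ}
    (hg : IsTest Γ g) :
    MemLp (fun x => g x * ((LSE.pderiv j (Φ.U {j}) x : ℝ) : ℂ) - LSE.pderiv j g x) 2 μ := by
  obtain ⟨C, -, hC⟩ := (isCyl_pderiv_U hΓ).exists_norm_mul_le (hg.isCTest 1)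
  refine MemLp.sub (MemLp.of_bound ((hg.stronglyMeasurable.mul
    (isCyl_pderiv_U hΓ).stronglyMeasurable).aestronglyMeasurable) C
      (Eventually.of_forall fun x => (norm_mul _ _).trans_le (hC x))) ((hg.pderiv j).memLp 2)

lemma integral_mul_add' {Ω : Type*} [MeasurableSpace Ω] {m : Measure Ω} {g u v : Ω → ℂ}
    (hg : MemLp g 2 m) (hu : MemLp u 2 m) (hv : MemLp v 2 m) :
    ∫ x, g x * (u x + v x) ∂m = ∫ x, g x * u x ∂m + ∫ x, g x * v x ∂m := by
  simp only [mul_add]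
  exact integral_add (hg.integrable_mul hu) (hg.integrable_mul hv)

lemma integral_mul_sub' {Ω : Type*} [MeasurableSpace Ω] {m : Measure Ω} {g u v : Ω → ℂ}
    (hg : MemLp g 2 m) (hu : MemLp u 2 m) (hv : MemLp v 2 m) :
    ∫ x, g x * (u x - v x) ∂m = ∫ x, g x * u x ∂m - ∫ x, g x * v x ∂m := by
  simp only [mul_sub]
  exact integral_sub (hg.integrable_mul hu) (hg.integrable_mul hv)

lemma Interaction.IsWeakDeriv.congr (h : Φ.IsWeakDeriv μ j u D) (hu : u =ᵐ[μ] v)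
    (hD : D =ᵐ[μ] E) : Φ.IsWeakDeriv μ j v E := by
  refine ⟨(memLp_congr_ae hu).1 h.1, (memLp_congr_ae hD).1 h.2.1, fun Γ hΓ g hg => ?_⟩
  have h1 := h.2.2 Γ hΓ g hg
  rw [← integral_congr_ae (f := fun x => g x * D x) (g := fun x => g x * E x)
    (by filter_upwards [hD] with x hx; rw [hx]), h1]
  exact integral_congr_ae (by filter_upwards [hu] with x hx; rw [hx])

lemma Interaction.IsWeakDeriv.zero :
    Φ.IsWeakDeriv μ j (fun _ => 0) fun _ => 0 :=
  ⟨MemLp.zero', MemLp.zero', fun _ _ _ _ => by simp⟩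

lemma Interaction.IsWeakDeriv.add [IsFiniteMeasure μ] (h : Φ.IsWeakDeriv μ j u D)
    (h' : Φ.IsWeakDeriv μ j v E) :
    Φ.IsWeakDeriv μ j (fun x => u x + v x) fun x => D x + E x := by
  refine ⟨h.1.add h'.1, h.2.1.add h'.2.1, fun Γ hΓ g hg => ?_⟩
  have hgm := hg.memLp (μ := μ) 2
  have hd := hg.memLp_dual (μ := μ) hΓ
  rw [integral_mul_add' hgm h.2.1 h'.2.1, integral_mul_add' hd h.1 h'.1, h.2.2 Γ hΓ g hg,
    h'.2.2 Γ hΓ g hg]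

lemma Interaction.IsWeakDeriv.smul (c : ℂ) (h : Φ.IsWeakDeriv μ j u D) :
    Φ.IsWeakDeriv μ j (fun x => c * u x) fun x => c * D x := by
  refine ⟨h.1.const_mul c, h.2.1.const_mul c, fun Γ hΓ g hg => ?_⟩
  simp only [mul_left_comm _ c]
  rw [integral_const_mul, integral_const_mul, h.2.2 Γ hΓ g hg]

lemma tendsto_integral_mul {Ω : Type*} [MeasurableSpace Ω] {m : Measure Ω} {g : Ω → ℂ}
    {u : ℕ → Ω → ℂ} {v : Ω → ℂ} (hg : MemLp g 2 m) (hu : ∀ n, MemLp (u n) 2 m)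
    (hv : MemLp v 2 m) (h : Tendsto (fun n => l2sq m (fun x => u n x - v x)) atTop (𝓝 0)) :
    Tendsto (fun n => ∫ x, g x * u n x ∂m) atTop (𝓝 (∫ x, g x * v x ∂m)) := by
  rw [tendsto_iff_norm_sub_tendsto_zero]
  have h1 : Tendsto (fun n => √(l2sq m g) * √(l2sq m (fun x => u n x - v x))) atTop (𝓝 0) := by
    simpa using (h.sqrt).const_mul (√(l2sq m g))
  refine squeeze_zero (fun _ => norm_nonneg _) (fun n => ?_) h1
  have h2 := norm_integral_mul_le hg ((hu n).sub hv)
  refine le_trans (le_of_eq ?_) h2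
  rw [← integral_mul_sub' hg (hu n) hv]
  rfl

lemma Interaction.IsWeakDeriv.of_tendsto [IsFiniteMeasure μ] {u : ℕ → Config d → ℂ}
    {D : ℕ → Config d → ℂ} (h : ∀ n, Φ.IsWeakDeriv μ j (u n) (D n)) (hv : MemLp v 2 μ)
    (hE : MemLp E 2 μ) (huv : Tendsto (fun n => l2sq μ (fun x => u n x - v x)) atTop (𝓝 0))
    (hDE : Tendsto (fun n => l2sq μ (fun x => D n x - E x)) atTop (𝓝 0)) :
    Φ.IsWeakDeriv μ j v E := by
  refine ⟨hv, hE, fun Γ hΓ g hg => ?_⟩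
  refine tendsto_nhds_unique
    (tendsto_integral_mul (hg.memLp 2) (fun n => (h n).2.1) hE hDE) ?_
  refine (tendsto_integral_mul (hg.memLp_dual hΓ) (fun n => (h n).1) hv huv).congr fun n => ?_
  exact ((h n).2.2 Γ hΓ g hg).symm

lemma Interaction.IsWeakDeriv.unique [IsFiniteMeasure μ] (h : Φ.IsWeakDeriv μ j u D)
    (h' : Φ.IsWeakDeriv μ j u E) : D =ᵐ[μ] E := by
  obtain ⟨Γ₀, hΓ₀⟩ := Φ.exists_covers {j}
  have h1 := ae_eq_zero_of_integral_test Γ₀ (h.2.1.sub h'.2.1) fun Γ hΓ g hg => by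
    have hgm := hg.memLp (μ := μ) 2
    refine (integral_mul_sub' hgm h.2.1 h'.2.1).trans ?_
    rw [h.2.2 Γ (hΓ₀.mono hΓ) g hg, h'.2.2 Γ (hΓ₀.mono hΓ) g hg, sub_self]
  filter_upwards [h1] with x hx
  exact sub_eq_zero.1 hx

/-- Integration by parts against a constant. It is needed because F(g) is compactly supported in the
relevant coordinates only up to the constant F(0). -/
lemma isWeakDeriv_const [IsFiniteMeasure μ] (hμ : Φ.IsGibbs μ) (j : Lattice d) (c : ℂ) :
    Φ.IsWeakDeriv μ j (fun _ => c) fun _ => 0 := by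
  refine ⟨memLp_const c, MemLp.zero', fun Γ hΓ g hg => ?_⟩
  have h := integral_pderiv_sub hμ hΓ (hg.isCTest 1)
  rw [← neg_eq_zero, ← integral_neg] at h
  simp only [neg_sub] at h
  have h2 := integral_mul_const (μ := μ) c
    fun x => g x * ((pderiv j (Φ.U {j}) x : ℝ) : ℂ) - pderiv j g x
  rw [h, zero_mul] at h2
  simpa using h2.symm

lemma isWeakDeriv_comp_test [IsFiniteMeasure μ] (hμ : Φ.IsGibbs μ) {F : ℂ → ℂ}
    (hF : ContDiff ℝ 1 F) {g : Config d → ℂ} (hg : IsTest Γ g) (j : Lattice d) :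
    Φ.IsWeakDeriv μ j (fun x => F (g x)) fun x => fderiv ℝ F (g x) (pderiv j g x) := by
  have h1 : IsCTest 1 Γ fun x => F (g x) - F 0 :=
    (hg.isCTest 1).comp (F := fun z => F z - F 0) (hF.sub contDiff_const) (sub_self _)
  have h2 := (isWeakDeriv_pderiv hμ h1 j).add (isWeakDeriv_const hμ j (F 0))
  refine h2.congr (Eventually.of_forall fun x => by simp) (Eventually.of_forall fun x => ?_)
  simp only [add_zero]
  rw [pderiv_comp (F := fun z => F z - F 0) (hg.isCTest 1).isCyl (hF.sub contDiff_const),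
    fderiv_sub_const]

lemma norm_sub_le_of_norm_fderiv_le {F : ℂ → ℂ} {C : ℝ} (hF : ContDiff ℝ 1 F)
    (hC : ∀ z, ‖fderiv ℝ F z‖ ≤ C) (z w : ℂ) : ‖F z - F w‖ ≤ C * ‖z - w‖ :=
  convex_univ.norm_image_sub_le_of_norm_fderiv_le
    (fun z _ => hF.differentiable one_ne_zero z) (fun z _ => hC z) (mem_univ w) (mem_univ z)

/-- The weak gradient in the directions of `Λ`. -/
def Interaction.HasWeakGrad (Φ : Interaction d) (μ : Measure (Config d)) (Λ : Finset (Lattice d))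
    (u : Config d → ℂ) (D : Λ → Config d → ℂ) : Prop :=
  MemLp u 2 μ ∧ ∀ j : Λ, Φ.IsWeakDeriv μ j u (D j)

lemma l2sq_le_of_norm_le {Ω : Type*} [MeasurableSpace Ω] {m : Measure Ω} {f g : Ω → ℂ} {C : ℝ}
    (hg : MemLp g 2 m) (h : ∀ x, ‖f x‖ ≤ C * ‖g x‖) : l2sq m f ≤ C ^ 2 * l2sq m g := by
  rw [l2sq, l2sq, ← integral_const_mul]
  refine integral_mono_of_nonneg (Eventually.of_forall fun _ => by positivity)
    ((integrable_norm_sq hg).const_mul _) (Eventually.of_forall fun x => ?_)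
  simp only
  rw [← mul_pow]
  exact pow_le_pow_left₀ (norm_nonneg _) (h x) 2

lemma exists_seq_test_approx [IsFiniteMeasure μ] (hμ : Φ.IsGibbs μ)
    {u : Config d → ℂ} {D : Λ → Config d → ℂ} (h : Φ.HasWeakGrad μ Λ u D) :
    ∃ (g : ℕ → Config d → ℂ) (Γ : ℕ → Finset (Lattice d)), (∀ n, Φ.Covers Λ (Γ n)) ∧
      (∀ n, IsTest (Γ n) (g n)) ∧
      Tendsto (fun n => l2sq μ (fun x => g n x - u x)) atTop (𝓝 0) ∧
      (∀ j : Λ, Tendsto (fun n => l2sq μ (fun x => pderiv (j : Lattice d) (g n) x - D j x)) atTop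
        (𝓝 0)) ∧ ∀ᵐ x ∂μ, Tendsto (fun n => g n x) atTop (𝓝 (u x)) := by
  have happ := gradApprox_of_isWeakDeriv hμ h.1 h.2
  choose Γ hΓ g hg h1 h2 using fun n : ℕ => happ (1 / ((n : ℝ) + 1)) (by positivity)
  have hε0 : Tendsto (fun n : ℕ => 1 / ((n : ℝ) + 1)) atTop (𝓝 0) :=
    tendsto_one_div_add_atTop_nhds_zero_nat
  have t1 : Tendsto (fun n => l2sq μ (fun x => g n x - u x)) atTop (𝓝 0) :=
    squeeze_zero (fun _ => l2sq_nonneg _) h1 hε0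
  have t2 : ∀ j : Λ, Tendsto (fun n => l2sq μ (fun x => pderiv (j : Lattice d) (g n) x - D j x))
      atTop (𝓝 0) := fun j =>
    squeeze_zero (fun _ => l2sq_nonneg _) (fun n => h2 n j) hε0
  obtain ⟨ns, hns, hae⟩ := exists_subseq_tendsto_ae (fun n => (hg n).memLp 2) h.1 t1
  exact ⟨fun k => g (ns k), fun k => Γ (ns k), fun k => hΓ _, fun k => hg _,
    t1.comp hns.tendsto_atTop, fun j => (t2 j).comp hns.tendsto_atTop, hae⟩

section

variable {Ω : Type*} [MeasurableSpace Ω] {m : Measure Ω} {F : ℂ → ℂ} {C : ℝ}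

lemma tendsto_l2sq_comp (hF : ContDiff ℝ 1 F) (hC : ∀ z, ‖fderiv ℝ F z‖ ≤ C) {u : ℕ → Ω → ℂ}
    {v : Ω → ℂ} (hu : ∀ n, MemLp (u n) 2 m) (hv : MemLp v 2 m)
    (h : Tendsto (fun n => l2sq m (fun x => u n x - v x)) atTop (𝓝 0)) :
    Tendsto (fun n => l2sq m (fun x => F (u n x) - F (v x))) atTop (𝓝 0) := by
  have e0 := h.const_mul (C ^ 2)
  rw [mul_zero] at e0
  refine squeeze_zero (fun _ => l2sq_nonneg _) (fun n => ?_) e0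
  exact l2sq_le_of_norm_le (C := C) ((hu n).sub hv) fun x =>
    norm_sub_le_of_norm_fderiv_le hF hC _ _

lemma norm_fderiv_apply_le (hC : ∀ z, ‖fderiv ℝ F z‖ ≤ C) (z w : ℂ) :
    ‖fderiv ℝ F z w‖ ≤ C * ‖w‖ :=
  (ContinuousLinearMap.le_opNorm _ _).trans (by gcongr; exact hC z)

lemma memLp_fderiv_comp (hF : ContDiff ℝ 1 F) (hC : ∀ z, ‖fderiv ℝ F z‖ ≤ C) {v w : Ω → ℂ}
    (hv : AEStronglyMeasurable v m) (hw : MemLp w 2 m) :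
    MemLp (fun x => fderiv ℝ F (v x) (w x)) 2 m :=
  MemLp.of_le_mul (c := C) hw
    (Continuous.comp_aestronglyMeasurable₂ (g := fun z w => fderiv ℝ F z w)
      (((hF.continuous_fderiv one_ne_zero).comp continuous_fst).clm_apply continuous_snd) hv hw.1)
    (Eventually.of_forall fun _ => norm_fderiv_apply_le hC _ _)

/-- The difference splits as F'(u_n)(D_n - E) + (F'(u_n) - F'(v))E. The first part is small because
F' is bounded, the second by dominated convergence, since u_n tends to v almost everywhere. -/
lemma tendsto_l2sq_fderiv_comp (hF : ContDiff ℝ 1 F) (hC : ∀ z, ‖fderiv ℝ F z‖ ≤ C)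
    {u D : ℕ → Ω → ℂ} {v E : Ω → ℂ} (hu : ∀ n, MemLp (u n) 2 m) (hv : MemLp v 2 m)
    (hD : ∀ n, MemLp (D n) 2 m) (hE : MemLp E 2 m)
    (h : Tendsto (fun n => l2sq m (fun x => D n x - E x)) atTop (𝓝 0))
    (hae : ∀ᵐ x ∂m, Tendsto (fun n => u n x) atTop (𝓝 (v x))) :
    Tendsto (fun n => l2sq m (fun x => fderiv ℝ F (u n x) (D n x) - fderiv ℝ F (v x) (E x)))
      atTop (𝓝 0) := by
  have hC0 : 0 ≤ C := (norm_nonneg _).trans (hC 0)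
  have e1 : Tendsto (fun n => l2sq m (fun x =>
      fderiv ℝ F (u n x) (E x) - fderiv ℝ F (v x) (E x))) atTop (𝓝 0) := by
    refine tendsto_l2sq_of_dominated (b := fun x => ((2 * C : ℝ) : ℂ) * E x)
      (fun n => ((memLp_fderiv_comp hF hC (hu n).1 hE).sub (memLp_fderiv_comp hF hC hv.1 hE)).1)
      (hE.const_mul _) (fun n => Eventually.of_forall fun x => ?_) ?_
    · refine (norm_sub_le _ _).trans ?_
      rw [norm_mul, Complex.norm_real, Real.norm_of_nonneg (by positivity)]
      linarith [norm_fderiv_apply_le hC (u n x) (E x), norm_fderiv_apply_le hC (v x) (E x)]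
    · filter_upwards [hae] with x hx
      have h1 : Tendsto (fun n => fderiv ℝ F (u n x) (E x)) atTop
          (𝓝 (fderiv ℝ F (v x) (E x))) :=
        (((hF.continuous_fderiv one_ne_zero).clm_apply
          (continuous_const (y := E x))).tendsto (v x)).comp hx
      rw [← sub_self (fderiv ℝ F (v x) (E x))]
      exact h1.sub_const _
  have e2 := (h.const_mul (2 * C ^ 2)).add (e1.const_mul 2)
  simp only [mul_zero, add_zero] at e2
  refine squeeze_zero (fun _ => l2sq_nonneg _) (fun n => ?_) e2
  have e3 := l2sq_sub_le (memLp_fderiv_comp hF hC (hu n).1 (hD n))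
    (memLp_fderiv_comp hF hC (hu n).1 hE) (memLp_fderiv_comp hF hC hv.1 hE)
  have e4 : l2sq m (fun x => fderiv ℝ F (u n x) (D n x) - fderiv ℝ F (u n x) (E x)) ≤
      C ^ 2 * l2sq m (fun x => D n x - E x) := by
    refine l2sq_le_of_norm_le ((hD n).sub hE) fun x => ?_
    rw [← map_sub]
    exact norm_fderiv_apply_le hC _ _
  linarith

end

/-- The classical chain rule for approximating test functions passes to the limit because the
gradient is closed; this is where the density theorem enters. -/
lemma Interaction.HasWeakGrad.chain [IsFiniteMeasure μ] (hμ : Φ.IsGibbs μ)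
    {u : Config d → ℂ} {D : Λ → Config d → ℂ} (h : Φ.HasWeakGrad μ Λ u D) {F : ℂ → ℂ} {C : ℝ}
    (hF : ContDiff ℝ 1 F) (hC : ∀ z, ‖fderiv ℝ F z‖ ≤ C) :
    Φ.HasWeakGrad μ Λ (fun x => F (u x)) fun j x => fderiv ℝ F (u x) (D j x) := by
  obtain ⟨g, Γ, hΓ, hg, t1, t2, hae⟩ := exists_seq_test_approx hμ h
  have hFu : MemLp (fun x => F (u x)) 2 μ := by
    have h1 : MemLp (fun x => F (u x) - F 0) 2 μ := by
      refine MemLp.of_le_mul (c := C) h.1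
        ((hF.continuous.comp_aestronglyMeasurable h.1.1).sub aestronglyMeasurable_const)
        (Eventually.of_forall fun x => ?_)
      simpa using norm_sub_le_of_norm_fderiv_le hF hC (u x) 0
    exact (memLp_congr_ae (Eventually.of_forall fun x => by simp)).1 (h1.add (memLp_const (F 0)))
  have hgm : ∀ n, MemLp (g n) 2 μ := fun n => (hg n).memLp 2
  refine ⟨hFu, fun j => ?_⟩
  have hDj := (h.2 j).2.1
  exact Interaction.IsWeakDeriv.of_tendsto (fun n => isWeakDeriv_comp_test hμ hF (hg n) j) hFu
    (memLp_fderiv_comp hF hC h.1.1 hDj) (tendsto_l2sq_comp hF hC hgm h.1 t1)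
    (tendsto_l2sq_fderiv_comp hF hC hgm h.1 (fun n => ((hg n).pderiv j).memLp 2) hDj (t2 j) hae)

lemma isGradRel_hasWeakGrad [IsFiniteMeasure μ] (hμ : Φ.IsGibbs μ) :
    IsGradRel μ (Φ.HasWeakGrad μ Λ) where
  memLp h := h.1
  memLp_grad h j := (h.2 j).2.1
  congr h hu hD := ⟨(memLp_congr_ae hu).1 h.1, fun j => (h.2 j).congr hu (hD j)⟩
  zero := ⟨MemLp.zero', fun _ => Interaction.IsWeakDeriv.zero⟩
  add h h' := ⟨h.1.add h'.1, fun j => (h.2 j).add (h'.2 j)⟩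
  smul c h := ⟨h.1.const_mul c, fun j => (h.2 j).smul c⟩
  closed h hv hE hu hD := ⟨hv, fun j =>
    Interaction.IsWeakDeriv.of_tendsto (fun n => (h n).2 j) hv (hE j) hu (hD j)⟩
  unique h h' j := (h.2 j).unique (h'.2 j)
  chain h hF hC := h.chain hμ hF hC

end

/-! ### Solutions tested with bounded functions of the Sobolev space -/

/-- A pointwise limit of functions whose derivatives converge uniformly. -/
lemma hasDerivWithinAt_of_uniform_limit {s : Set ℝ} (hs : Convex ℝ s) {f : ℕ → ℝ → ℂ}
    {f' : ℕ → ℝ → ℂ} {g g' : ℝ → ℂ} (hf : ∀ n, ∀ x ∈ s, HasDerivWithinAt (f n) (f' n x) s x)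
    (hfg : ∀ x ∈ s, Tendsto (fun n => f n x) atTop (𝓝 (g x)))
    (hu : ∀ ε > 0, ∀ᶠ n in atTop, ∀ x ∈ s, ‖f' n x - g' x‖ ≤ ε) {x : ℝ} (hx : x ∈ s) :
    HasDerivWithinAt g (g' x) s x := by
  rw [hasDerivWithinAt_iff_isLittleO, Asymptotics.isLittleO_iff]
  intro c hc
  obtain ⟨N, hN⟩ := eventually_atTop.1 (hu (c / 6) (by positivity))
  have h1 := Asymptotics.isLittleO_iff.1 (hasDerivWithinAt_iff_isLittleO.1 (hf N x hx))
    (c := c / 6) (by positivity)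
  filter_upwards [h1, self_mem_nhdsWithin] with y hy hys
  have h2 : ∀ n ≥ N, ‖(f n y - f N y) - (f n x - f N x)‖ ≤ c / 3 * ‖y - x‖ := by
    intro n hn
    refine hs.norm_image_sub_le_of_norm_hasDerivWithin_le (f := fun z => f n z - f N z)
      (f' := fun z => f' n z - f' N z) (fun z hz => (hf n z hz).sub (hf N z hz))
      (fun z hz => ?_) hx hys
    have e1 := hN n hn z hz
    have e2 := hN N le_rfl z hz
    calc ‖f' n z - f' N z‖ = ‖(f' n z - g' z) - (f' N z - g' z)‖ := by congr 1; ring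
      _ ≤ c / 6 + c / 6 := (norm_sub_le _ _).trans (add_le_add e1 e2)
      _ = c / 3 := by ring
  have h3 : ‖(g y - f N y) - (g x - f N x)‖ ≤ c / 3 * ‖y - x‖ :=
    le_of_tendsto ((((hfg y hys).sub_const _).sub ((hfg x hx).sub_const _)).norm)
      (eventually_atTop.2 ⟨N, h2⟩)
  have h4 := hN N le_rfl x hx
  have h5 : g y - g x - (y - x) • g' x = ((g y - f N y) - (g x - f N x)) +
      (f N y - f N x - (y - x) • f' N x) + (y - x) • (f' N x - g' x) := by
    rw [smul_sub]
    ring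
  rw [h5]
  refine (norm_add₃_le).trans ?_
  rw [norm_smul]
  have h6 : ‖y - x‖ * ‖f' N x - g' x‖ ≤ ‖y - x‖ * (c / 6) :=
    mul_le_mul_of_nonneg_left h4 (norm_nonneg _)
  nlinarith [norm_nonneg (y - x)]

/-- The coefficient of b² can be made arbitrarily small, since b log b is negligible against b². For
b ≥ 1 one uses log b ≤ 2√b and Young's inequality twice. -/
lemma mul_abs_log_sq_le_add {b η : ℝ} (hb : 0 ≤ b) (hη : 0 < η) :
    b * |Real.log (b ^ 2)| ≤ (2 + 4 / η ^ 3) + 2 * η * b ^ 2 := by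
  rcases hb.eq_or_lt with rfl | hb
  · simp
    positivity
  have h4 : 0 < 4 / η ^ 3 := by positivity
  have h5 : 0 < η * b ^ 2 := by positivity
  rw [Real.log_pow, Nat.cast_ofNat]
  rcases le_total b 1 with h | h
  · rw [abs_of_nonpos (by linarith [Real.log_nonpos hb.le h])]
    have h1 := Real.one_sub_inv_le_log_of_pos hb
    have h2 : b * (1 - b⁻¹) ≤ b * Real.log b := mul_le_mul_of_nonneg_left h1 hb.le
    rw [mul_sub, mul_inv_cancel₀ hb.ne'] at h2
    linarith
  · rw [abs_of_nonneg (by linarith [Real.log_nonneg h])]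
    have h1 : Real.log b ≤ 2 * √b := by
      have := Real.log_le_sub_one_of_pos (Real.sqrt_pos.2 hb)
      rw [Real.log_sqrt hb.le] at this
      linarith
    have h2 : √b ^ 2 = b := Real.sq_sqrt hb.le
    have h3 : 4 * √b ≤ η * b + 4 / η := by
      have : η * b + 4 / η - 4 * √b = (η * √b - 2) ^ 2 / η := by
        rw [← h2, Real.sqrt_sq (Real.sqrt_nonneg _)]
        field_simp
        ring
      have h6 : 0 ≤ (η * √b - 2) ^ 2 / η := by positivity
      linarith
    have h7 : 4 / η * b ≤ η * b ^ 2 + 4 / η ^ 3 := by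
      have : η * b ^ 2 + 4 / η ^ 3 - 4 / η * b = (η ^ 2 * b - 2) ^ 2 / η ^ 3 := by
        field_simp
        ring
      have h6 : 0 ≤ (η ^ 2 * b - 2) ^ 2 / η ^ 3 := by positivity
      linarith
    have h8 : b * Real.log b ≤ b * (2 * √b) := mul_le_mul_of_nonneg_left h1 hb.le
    have h9 : b * (4 * √b) ≤ b * (η * b + 4 / η) := mul_le_mul_of_nonneg_left h3 hb.le
    nlinarith

section

variable {Ω : Type*} [MeasurableSpace Ω] {μ : Measure Ω} [IsProbabilityMeasure μ]

lemma integral_norm_le_sqrt {w : Ω → ℂ} (hw : MemLp w 2 μ) :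
    ∫ x, ‖w x‖ ∂μ ≤ √(l2sq μ w) := by
  have hi : Integrable (fun x => ‖w x‖) μ := (hw.integrable one_le_two).norm
  refine Real.le_sqrt_of_sq_le ?_
  set a := ∫ x, ‖w x‖ ∂μ with ha
  have h : ∫ x, 2 * a * ‖w x‖ ∂μ ≤ ∫ x, (a ^ 2 + ‖w x‖ ^ 2) ∂μ :=
    integral_mono (hi.const_mul _) ((integrable_const _).add (integrable_norm_sq hw))
      fun x => by nlinarith [sq_nonneg (a - ‖w x‖)]
  rw [integral_const_mul, integral_add (integrable_const _) (integrable_norm_sq hw),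
    integral_const, probReal_univ, one_smul, ← ha] at h
  change _ ≤ _ + l2sq μ w at h
  linarith

/-- Since the logarithmic term is controlled only in L¹, smallness of w in L² does not suffice
alone. Together with a uniform bound K it does: first η is chosen small, then ‖w‖. The estimate
depends on u through ‖u‖ only and is therefore uniform in time. -/
lemma norm_pair_logTerm_le_add {w u : Ω → ℂ} {K η : ℝ} (hw : MemLp w 2 μ)
    (hK : ∀ᵐ x ∂μ, ‖w x‖ ≤ K) (hu : MemLp u 2 μ) (hη : 0 < η) :
    ‖pair μ w (logTerm μ u)‖ ≤
      √(l2sq μ u) * ((2 + 4 / η ^ 3) * √(l2sq μ w) + 2 * η * K) := by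
  rcases (l2sq_nonneg (μ := μ) u).eq_or_lt with h0 | h0
  · have h1 := ae_eq_zero_of_l2sq_eq_zero hu h0.symm
    have h2 : pair μ w (logTerm μ u) = 0 := by
      refine integral_eq_zero_of_ae ?_
      filter_upwards [h1] with x hx
      simp [logTerm, hx]
    rw [h2, ← h0]
    simp
  set m := l2sq μ u with hm
  have hs : 0 < √m := Real.sqrt_pos.2 h0
  have hwi : Integrable (fun x => ‖w x‖) μ := (hw.integrable one_le_two).norm
  have hA : 0 ≤ 2 + 4 / η ^ 3 := by positivity
  have hui := integrable_norm_sq hu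
  calc ‖pair μ w (logTerm μ u)‖
      ≤ ∫ x, √m * ((2 + 4 / η ^ 3) * ‖w x‖ + 2 * η * K / m * ‖u x‖ ^ 2) ∂μ := by
        refine norm_integral_le_of_norm_le
          (((hwi.const_mul _).add (hui.const_mul _)).const_mul _) ?_
        filter_upwards [hK] with x hx
        have h1 := mul_abs_log_sq_le_add (b := ‖u x‖ / √m) (by positivity) hη
        rw [div_pow, Real.sq_sqrt h0.le] at h1
        rw [logTerm, norm_mul, norm_mul, norm_star, Complex.norm_real, Real.norm_eq_abs, ← hm]
        have h2 : ‖u x‖ * |Real.log (‖u x‖ ^ 2 / m)| =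
            √m * (‖u x‖ / √m * |Real.log (‖u x‖ ^ 2 / m)|) := by
          field_simp
        rw [h2]
        have h3 : ‖w x‖ * (2 * η * (‖u x‖ ^ 2 / m)) ≤ K * (2 * η * (‖u x‖ ^ 2 / m)) := by
          gcongr
        calc ‖w x‖ * (√m * (‖u x‖ / √m * |Real.log (‖u x‖ ^ 2 / m)|))
            ≤ ‖w x‖ * (√m * ((2 + 4 / η ^ 3) + 2 * η * (‖u x‖ ^ 2 / m))) := by gcongr
          _ = √m * ((2 + 4 / η ^ 3) * ‖w x‖ + ‖w x‖ * (2 * η * (‖u x‖ ^ 2 / m))) := by ring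
          _ ≤ √m * ((2 + 4 / η ^ 3) * ‖w x‖ + K * (2 * η * (‖u x‖ ^ 2 / m))) := by gcongr
          _ = √m * ((2 + 4 / η ^ 3) * ‖w x‖ + 2 * η * K / m * ‖u x‖ ^ 2) := by ring
    _ = √m * ((2 + 4 / η ^ 3) * ∫ x, ‖w x‖ ∂μ + 2 * η * K) := by
        rw [integral_const_mul, integral_add (hwi.const_mul _) (hui.const_mul _),
          integral_const_mul, integral_const_mul]
        change √m * (_ + 2 * η * K / m * m) = _
        rw [div_mul_cancel₀ _ h0.ne']
    _ ≤ √m * ((2 + 4 / η ^ 3) * √(l2sq μ w) + 2 * η * K) := by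
        gcongr
        exact integral_norm_le_sqrt hw

end

/-! ### From test functions to bounded Sobolev functions in the equation. -/

section

variable {d : ℕ} {Φ : Interaction d} {Γ Λ : Finset (Lattice d)} {μ : Measure (Config d)}

lemma exists_truncation {K : ℝ} (hK : 0 ≤ K) :
    ∃ F : ℂ → ℂ, ContDiff ℝ ((⊤ : ℕ∞) : WithTop ℕ∞) F ∧ F 0 = 0 ∧
      (∃ C, ∀ z, ‖fderiv ℝ F z‖ ≤ C) ∧ (∀ z, ‖z‖ ≤ K → F =ᶠ[𝓝 z] id) ∧ ∀ z, ‖F z‖ ≤ K + 2 := by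
  let b : ContDiffBump (0 : ℂ) := ⟨K + 1, K + 2, by positivity, by linarith⟩
  have hF : ContDiff ℝ ((⊤ : ℕ∞) : WithTop ℕ∞) fun z : ℂ => b z • z := b.contDiff.smul contDiff_id
  have hs : HasCompactSupport fun z : ℂ => b z • z := b.hasCompactSupport.smul_right
  refine ⟨fun z => b z • z, hF, smul_zero _, (hs.fderiv ℝ).exists_bound_of_continuous
    (hF.continuous_fderiv (by simp)), fun z hz => ?_, fun z => ?_⟩
  · have h1 : z ∈ Metric.ball (0 : ℂ) b.rIn := by
      rw [mem_ball_zero_iff]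
      exact hz.trans_lt (lt_add_one K)
    filter_upwards [b.eventuallyEq_one_of_mem_ball h1] with w hw
    simp [hw]
  · rw [norm_smul, Real.norm_of_nonneg b.nonneg]
    rcases le_total ‖z‖ (K + 2) with h | h
    · exact (mul_le_of_le_one_left (norm_nonneg _) b.le_one).trans h
    · rw [b.zero_of_le_dist (by rwa [dist_zero_right]), zero_mul]
      positivity

/-- Test functions approximating u are composed with a smooth truncation that is the identity near
every value u takes, so neither u nor its gradient changes in the limit. -/
lemma exists_seq_bounded_test_approx [IsFiniteMeasure μ] (hμ : Φ.IsGibbs μ) {M : ℝ}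
    {u : Config d → ℂ} {D : Λ → Config d → ℂ} (h : Φ.HasWeakGrad μ Λ u D)
    (hM : ∀ᵐ x ∂μ, ‖u x‖ ≤ M) :
    ∃ (K : ℝ) (g : ℕ → Config d → ℂ) (Γ : ℕ → Finset (Lattice d)),
      (∀ n, Φ.Covers Λ (Γ n)) ∧ (∀ n, IsTest (Γ n) (g n)) ∧ (∀ n x, ‖g n x‖ ≤ K) ∧
      Tendsto (fun n => l2sq μ (fun x => g n x - u x)) atTop (𝓝 0) ∧
      ∀ j : Λ, Tendsto (fun n => l2sq μ (fun x => pderiv (j : Lattice d) (g n) x - D j x)) atTop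
        (𝓝 0) := by
  obtain ⟨g, Γ, hΓ, hg, t1, t2, hae⟩ := exists_seq_test_approx hμ h
  obtain ⟨F, hF, hF0, ⟨C, hC⟩, hFid, hFb⟩ := exists_truncation (le_max_right M 0)
  have hF1 : ContDiff ℝ 1 F := hF.of_le (by simp)
  have hgm : ∀ n, MemLp (g n) 2 μ := fun n => (hg n).memLp 2
  refine ⟨_, fun n x => F (g n x), Γ, hΓ, fun n => IsCTest.comp (hg n) hF hF0,
    fun n x => hFb _, ?_, fun j => ?_⟩
  · refine (tendsto_l2sq_comp hF1 hC hgm h.1 t1).congr fun n => l2sq_congr ?_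
    filter_upwards [hM] with x hx
    rw [(hFid (u x) (hx.trans (le_max_left _ _))).eq_of_nhds, id]
  · refine (tendsto_l2sq_fderiv_comp hF1 hC hgm h.1 (fun n => ((hg n).pderiv j).memLp 2)
      (h.2 j).2.1 (t2 j) hae).congr fun n => l2sq_congr ?_
    filter_upwards [hM] with x hx
    rw [(hFid (u x) (hx.trans (le_max_left _ _))).fderiv_eq, fderiv_id,
      pderiv_comp ((hg n).isCTest 1).isCyl hF1, ContinuousLinearMap.id_apply]

lemma pderiv_star {g : Config d → ℂ} (hg : IsTest Γ g) (j : Lattice d) :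
    pderiv j (fun x => star (g x)) = fun x => star (pderiv j g x) :=
  funext fun x => pderiv_eq ((hg.isCTest 1).isCyl.hasDerivAt_zero one_ne_zero j x).star

/-- Integration by parts in the equation. -/
lemma integral_gen_mul [IsFiniteMeasure μ] (hΓ : Φ.Covers Λ Γ) {g : Config d → ℂ}
    (hg : IsTest Γ g) {u : Config d → ℂ} {D : Λ → Config d → ℂ} (h : Φ.HasWeakGrad μ Λ u D) :
    Integrable (fun x => -(Φ.gen Λ (fun x => star (g x)) x) * u x) μ ∧
    ∫ x, -(Φ.gen Λ (fun x => star (g x)) x) * u x ∂μ = ∑ j : Λ, pair μ (pderiv j g) (D j) := by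
  have hΓj : ∀ j : Λ, Φ.Covers {(j : Lattice d)} Γ := fun j => hΓ.anti (by simp [j.2])
  have ht : ∀ j : Lattice d, IsTest Γ fun x => star (pderiv j g x) := fun j => (hg.pderiv j).star
  have e1 : (fun x => -(Φ.gen Λ (fun x => star (g x)) x) * u x) = fun x => ∑ j : Λ,
      (star (pderiv (j : Lattice d) g x) * ((pderiv (j : Lattice d) (Φ.U {(j : Lattice d)}) x : ℝ) : ℂ)
        - pderiv (j : Lattice d) (fun x => star (pderiv (j : Lattice d) g x)) x) * u x := by
    funext x
    rw [Interaction.gen, ← Finset.sum_coe_sort, ← Finset.sum_neg_distrib, Finset.sum_mul]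
    refine Finset.sum_congr rfl fun j _ => ?_
    rw [pderiv_star hg, Interaction.pderiv_U j.2]
    ring
  have hi := fun j : Λ => ((ht j).memLp_dual (μ := μ) (hΓj j)).integrable_mul h.1
  rw [e1]
  refine ⟨integrable_finsetSum _ fun j _ => hi j, ?_⟩
  refine (integral_finsetSum _ fun j _ => hi j).trans ?_
  exact Finset.sum_congr rfl fun j _ => ((h.2 j).2.2 Γ (hΓj j) _ (ht j)).symm

variable [IsProbabilityMeasure μ] {lam : ℝ} {f : Config d → ℂ} {φ : ℝ → Lp ℂ 2 μ}
  {Dφ : ℝ → Λ → Config d → ℂ}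

lemma Interaction.IsSolution.hasDerivWithinAt_pair_test (hφ : Φ.IsSolution μ lam Λ f φ)
    (hD : ∀ t, 0 ≤ t → Φ.HasWeakGrad μ Λ (φ t) (Dφ t)) (hΓ : Φ.Covers Λ Γ) {g : Config d → ℂ}
    (hg : IsTest Γ g) {t : ℝ} (ht : 0 ≤ t) :
    HasDerivWithinAt (fun s => pair μ g (φ s)) (-Complex.I * (∑ j : Λ, pair μ (pderiv j g) (Dφ t j)
      + lam * pair μ g (logTerm μ (φ t)))) (Ici 0) t := by
  -- The pairing is conjugate linear in g while the equation is bilinear, so the equation is tested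
  -- with the conjugate of g.
  have h1 := (hφ.equation Γ hΓ _ hg.star t ht).const_mul (-Complex.I)
  have e1 : (fun s => -Complex.I * (Complex.I * ∫ x, star (g x) * φ s x ∂μ)) =
      fun s => pair μ g (φ s) := by
    funext s
    rw [← mul_assoc, neg_mul, Complex.I_mul_I, neg_neg, one_mul]
    rfl
  rw [e1] at h1
  refine h1.congr_deriv (congrArg _ (Eq.symm ?_))
  obtain ⟨C, -, hC⟩ := IsCTest.exists_bound hg
  have h2 := integral_gen_mul hΓ hg (hD t ht)
  have h3 := integrable_star_mul_logTerm (hg.stronglyMeasurable.aestronglyMeasurable (μ := μ))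
    (Eventually.of_forall hC) (hD t ht).1
  rw [← h2.2, pair, ← integral_const_mul, ← integral_add h2.1 (h3.const_mul _)]
  refine integral_congr_ae (Eventually.of_forall fun x => ?_)
  simp only [logTerm, l2sq]
  ring

/-- The pairings with approximating test functions converge pointwise in time and their derivatives
converge uniformly on [0, t + 1], so the limit is differentiable at every time. -/
lemma Interaction.IsSolution.isWeakSol (hμ : Φ.IsGibbs μ) (hφ : Φ.IsSolution μ lam Λ f φ)
    (hD : ∀ t, 0 ≤ t → Φ.HasWeakGrad μ Λ (φ t) (Dφ t))
    (hb : ∀ T, ∃ C : ℝ, ∀ t ∈ Icc 0 T, ∑ j, l2sq μ (Dφ t j) ≤ C) :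
    IsWeakSol μ (Φ.HasWeakGrad μ Λ) lam φ Dφ where
  cont := hφ.continuousOn
  grad := hD
  bdd := hb
  eqn := by
    intro g G M hg hM t ht
    obtain ⟨K, h, Γ, hΓ, hh, hK, t1, t2⟩ := exists_seq_bounded_test_approx hμ hg hM
    obtain ⟨C, hC⟩ := hb (t + 1)
    obtain ⟨B, hB⟩ := (isCompact_Icc (a := (0 : ℝ)) (b := t + 1)).exists_bound_of_continuousOn
      (hφ.continuousOn.mono Icc_subset_Ici_self)
    have hhm : ∀ n, MemLp (h n) 2 μ := fun n => (hh n).memLp 2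
    have hdm : ∀ n (j : Λ), MemLp (pderiv (j : Lattice d) (h n)) 2 μ :=
      fun n j => ((hh n).pderiv j).memLp 2
    refine HasDerivWithinAt.mono_of_mem_nhdsWithin (t := Icc 0 (t + 1))
      (hasDerivWithinAt_of_uniform_limit (convex_Icc _ _)
        (f := fun n s => pair μ (h n) (φ s)) (g' := fun r => -Complex.I * (∑ j, pair μ (G j) (Dφ r j)
          + lam * pair μ g (logTerm μ (φ r))))
        (fun n r hr => ((hφ.hasDerivWithinAt_pair_test hD (hΓ n) (hh n) hr.1)).mono
          Icc_subset_Ici_self) (fun r hr => ?_) ?_ ⟨ht, by linarith⟩) ?_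
    · rw [tendsto_iff_norm_sub_tendsto_zero]
      have e1 := t1.sqrt.mul_const (√(l2sq μ (φ r)))
      rw [Real.sqrt_zero, zero_mul] at e1
      refine squeeze_zero (fun _ => norm_nonneg _) (fun n => ?_) e1
      rw [← pair_sub_left (hhm n) hg.1 (Lp.memLp _)]
      exact norm_pair_le ((hhm n).sub hg.1) (Lp.memLp _)
    · intro ε hε
      have hB0 : 0 ≤ B := (norm_nonneg _).trans (hB 0 ⟨le_rfl, by linarith⟩)
      have hM' : ∀ n, ∀ᵐ x ∂μ, ‖h n x - g x‖ ≤ K + M := fun n => by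
        filter_upwards [hM] with x hx
        exact (norm_sub_le _ _).trans (add_le_add (hK n x) hx)
      -- Half of the error is absorbed by η; the other half is handled by the L² convergence.
      obtain ⟨η, hη, hηε⟩ : ∃ η > 0, |lam| * B * (2 * η * (K + M)) ≤ ε / 2 := by
        refine ⟨ε / (4 * (|lam| * B * |K + M| + 1)), by positivity, ?_⟩
        have h1 : |lam| * B * (K + M) ≤ |lam| * B * |K + M| + 1 :=
          (mul_le_mul_of_nonneg_left (le_abs_self _) (by positivity)).trans (by linarith)
        have h2 : 0 < |lam| * B * |K + M| + 1 := by positivity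
        calc _ = ε / 2 * ((|lam| * B * (K + M)) / (|lam| * B * |K + M| + 1)) := by
              field_simp
              ring
          _ ≤ ε / 2 * 1 := by
              gcongr
              exact (div_le_one h2).2 h1
          _ = ε / 2 := mul_one _
      have e1 : Tendsto (fun n => ∑ j : Λ, √(l2sq μ (fun x => pderiv (j : Lattice d) (h n) x - G j x)) * √C
          + |lam| * (B * ((2 + 4 / η ^ 3) * √(l2sq μ (fun x => h n x - g x))))) atTop
          (𝓝 (∑ j : Λ, √0 * √C + |lam| * (B * ((2 + 4 / η ^ 3) * √0)))) :=
        (tendsto_finsetSum _ fun j _ => (t2 j).sqrt.mul_const _).add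
          (((t1.sqrt.const_mul _).const_mul _).const_mul _)
      simp only [Real.sqrt_zero, zero_mul, mul_zero, Finset.sum_const_zero, add_zero] at e1
      filter_upwards [e1.eventually_le_const (half_pos hε)] with n hn r hr
      have hr0 : 0 ≤ r := hr.1
      have hφr : √(l2sq μ (φ r)) ≤ B := by
        rw [l2sq_coe, Real.sqrt_sq (norm_nonneg _)]
        exact hB r hr
      rw [← mul_sub, norm_mul, norm_neg, Complex.norm_I, one_mul, add_sub_add_comm,
        ← Finset.sum_sub_distrib, ← mul_sub]
      have i1 := integrable_star_mul_logTerm (hhm n).1 (Eventually.of_forall (hK n)) (Lp.memLp (φ r))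
      have i2 := integrable_star_mul_logTerm hg.1.1 hM (Lp.memLp (φ r))
      have e2 : pair μ (h n) (logTerm μ (φ r)) - pair μ g (logTerm μ (φ r)) =
          pair μ (fun x => h n x - g x) (logTerm μ (φ r)) := by
        simp only [pair, star_sub, sub_mul]
        exact (integral_sub i1 i2).symm
      have e3 : ∀ j : Λ, ‖pair μ (pderiv (j : Lattice d) (h n)) (Dφ r j) - pair μ (G j) (Dφ r j)‖ ≤
          √(l2sq μ (fun x => pderiv (j : Lattice d) (h n) x - G j x)) * √C := fun j => by
        have hDj := ((hD r hr0).2 j).2.1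
        rw [← pair_sub_left (hdm n j) (hg.2 j).2.1 hDj]
        refine (norm_pair_le ((hdm n j).sub (hg.2 j).2.1) hDj).trans ?_
        refine mul_le_mul_of_nonneg_left (Real.sqrt_le_sqrt ?_) (Real.sqrt_nonneg _)
        exact (Finset.single_le_sum (f := fun j => l2sq μ (Dφ r j)) (fun j _ => l2sq_nonneg _)
          (Finset.mem_univ j)).trans (hC r hr)
      have e4 := norm_pair_logTerm_le_add ((hhm n).sub hg.1) (hM' n) (Lp.memLp (φ r)) hη
      have hKM : 0 ≤ K + M := by
        obtain ⟨x, hx⟩ := (hM' n).exists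
        exact (norm_nonneg _).trans hx
      rw [e2]
      have e5 : ‖(lam : ℂ) * pair μ (fun x => h n x - g x) (logTerm μ (φ r))‖ ≤
          |lam| * (B * ((2 + 4 / η ^ 3) * √(l2sq μ (fun x => h n x - g x)))) + ε / 2 := by
        rw [norm_mul, Complex.norm_real, Real.norm_eq_abs]
        calc _ ≤ |lam| * (B * ((2 + 4 / η ^ 3) * √(l2sq μ (fun x => h n x - g x))
              + 2 * η * (K + M))) := by
              gcongr
              refine e4.trans (mul_le_mul_of_nonneg_right hφr ?_)
              positivity
          _ = |lam| * (B * ((2 + 4 / η ^ 3) * √(l2sq μ (fun x => h n x - g x))))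
              + |lam| * B * (2 * η * (K + M)) := by ring
          _ ≤ _ := by gcongr
      calc _ ≤ ∑ j : Λ, √(l2sq μ (fun x => pderiv (j : Lattice d) (h n) x - G j x)) * √C +
            (|lam| * (B * ((2 + 4 / η ^ 3) * √(l2sq μ (fun x => h n x - g x)))) + ε / 2) :=
            (norm_add_le _ _).trans (add_le_add ((norm_sum_le _ _).trans
              (Finset.sum_le_sum fun j _ => e3 j)) e5)
        _ ≤ ε := by linarith
    · exact mem_nhdsWithin.2 ⟨Iio (t + 1), isOpen_Iio, by simp,
        fun s hs => ⟨hs.2, le_of_lt hs.1⟩⟩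

end

/-! ### Extended real-valued energies and entropies -/

section

variable {d : ℕ} {Φ : Interaction d} {Λ : Finset (Lattice d)} {μ : Measure (Config d)}
  {j : Lattice d} {u v D : Config d → ℂ}

lemma lintegral_enorm_sq (hD : MemLp D 2 μ) : ∫⁻ x, ‖D x‖ₑ ^ 2 ∂μ = ENNReal.ofReal (l2sq μ D) := by
  rw [l2sq, ofReal_integral_eq_lintegral_ofReal (integrable_norm_sq hD)
    (Eventually.of_forall fun x => by positivity)]
  refine lintegral_congr fun x => ?_
  rw [← ofReal_norm, ENNReal.ofReal_pow (norm_nonneg _)]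

lemma Interaction.IsWeakDeriv.partialSq_eq [IsFiniteMeasure μ] (h : Φ.IsWeakDeriv μ j u D) :
    Φ.partialSq μ j u = ENNReal.ofReal (l2sq μ D) := by
  refine le_antisymm ((iInf₂_le D h).trans_eq (lintegral_enorm_sq h.2.1))
    (le_iInf₂ fun E hE => ?_)
  rw [lintegral_enorm_sq hE.2.1, l2sq_congr (h.unique hE)]

lemma Interaction.exists_isWeakDeriv (h : Φ.partialSq μ j u ≠ ∞) :
    ∃ D, Φ.IsWeakDeriv μ j u D := by
  by_contra! hne
  exact h (iInf₂_eq_top.2 fun _ hD => absurd hD (hne _))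

lemma Interaction.partialSq_congr (h : u =ᵐ[μ] v) : Φ.partialSq μ j u = Φ.partialSq μ j v :=
  iInf_congr fun _ => iInf_congr_Prop
    ⟨fun hD => hD.congr h .rfl, fun hD => hD.congr h.symm .rfl⟩ fun _ => rfl

lemma Interaction.HasWeakGrad.gradSqOn_eq [IsFiniteMeasure μ] {D : Λ → Config d → ℂ}
    (h : Φ.HasWeakGrad μ Λ u D) : Φ.gradSqOn μ Λ u = ENNReal.ofReal (energy μ D) := by
  rw [Interaction.gradSqOn, ← Finset.sum_coe_sort, energy,
    ENNReal.ofReal_sum_of_nonneg fun _ _ => l2sq_nonneg _]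
  exact Finset.sum_congr rfl fun j _ => (h.2 j).partialSq_eq

lemma Interaction.exists_hasWeakGrad (hu : MemLp u 2 μ) (h : Φ.gradSqOn μ Λ u ≠ ∞) :
    ∃ D, Φ.HasWeakGrad μ Λ u D := by
  have h1 : ∀ j : Λ, ∃ D, Φ.IsWeakDeriv μ j u D := fun j =>
    Interaction.exists_isWeakDeriv (ENNReal.sum_ne_top.1 h j j.2)
  choose D hD using h1
  exact ⟨D, hu, hD⟩

lemma entropy_congr (h : u =ᵐ[μ] v) :
    entropy μ (fun x => ‖u x‖ ^ 2) = entropy μ (fun x => ‖v x‖ ^ 2) := by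
  have h1 : (fun x => ‖u x‖ ^ 2) =ᵐ[μ] fun x => ‖v x‖ ^ 2 := by
    filter_upwards [h] with x hx
    rw [hx]
  rw [entropy, entropy, integral_congr_ae h1]
  congr 2 <;> refine lintegral_congr_ae ?_ <;> filter_upwards [h1] with x hx <;> rw [hx]

lemma mul_log_div_ae_eq (hu : MemLp u 2 μ) :
    (fun x => ‖u x‖ ^ 2 * Real.log (‖u x‖ ^ 2 / l2sq μ u)) =ᵐ[μ]
      fun x => ‖u x‖ ^ 2 * Real.log (‖u x‖ ^ 2) - Real.log (l2sq μ u) * ‖u x‖ ^ 2 := by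
  rcases eq_or_ne (l2sq μ u) 0 with h0 | h0
  · filter_upwards [ae_eq_zero_of_l2sq_eq_zero hu h0] with x hx
    simp [hx]
  · refine Eventually.of_forall fun x => ?_
    rcases eq_or_ne (‖u x‖ ^ 2) 0 with h | h
    · simp only [h]
      simp
    · simp only [Real.log_div h h0]
      ring

lemma integrable_mul_log_div_iff (hu : MemLp u 2 μ) :
    Integrable (fun x => ‖u x‖ ^ 2 * Real.log (‖u x‖ ^ 2 / l2sq μ u)) μ ↔
      Integrable (fun x => ‖u x‖ ^ 2 * Real.log (‖u x‖ ^ 2)) μ := by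
  rw [integrable_congr (mul_log_div_ae_eq hu)]
  have h1 := (integrable_norm_sq hu).const_mul (Real.log (l2sq μ u))
  exact ⟨fun h => (h.add h1).congr (Eventually.of_forall fun x => sub_add_cancel _ _),
    fun h => h.sub h1⟩

lemma entropy_eq (hu : MemLp u 2 μ)
    (h : Integrable (fun x => ‖u x‖ ^ 2 * Real.log (‖u x‖ ^ 2)) μ) :
    entropy μ (fun x => ‖u x‖ ^ 2) =
      ((∫ x, ‖u x‖ ^ 2 * Real.log (‖u x‖ ^ 2) ∂μ - Real.log (l2sq μ u) * l2sq μ u : ℝ) : EReal) := by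
  have h1 := (integrable_mul_log_div_iff hu).2 h
  have h2 := integral_congr_ae (mul_log_div_ae_eq hu)
  rw [integral_sub h ((integrable_norm_sq hu).const_mul _), integral_const_mul,
    integral_eq_lintegral_pos_part_sub_lintegral_neg_part h1] at h2
  change _ = _ - _ * l2sq μ u at h2
  rw [← h2, EReal.coe_sub, EReal.coe_ennreal_toReal h1.lintegral_lt_top.ne]
  erw [EReal.coe_ennreal_toReal h1.neg.lintegral_lt_top.ne]
  rfl

lemma sub_le_mul_log_div {s m : ℝ} (hs : 0 ≤ s) (hm : 0 ≤ m) : s - m ≤ s * Real.log (s / m) ∨ m = 0 := by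
  rcases hm.eq_or_lt with h | hm
  · exact Or.inr h.symm
  rcases hs.eq_or_lt with rfl | hs
  · left
    simpa using hm.le
  left
  have h1 := Real.one_sub_inv_le_log_of_pos (div_pos hs hm)
  rw [inv_div] at h1
  calc s - m = s * (1 - m / s) := by field_simp
    _ ≤ _ := mul_le_mul_of_nonneg_left h1 hs.le

lemma sub_le_mul_log_div_ae (hu : MemLp u 2 μ) : ∀ᵐ x ∂μ,
    ‖u x‖ ^ 2 - l2sq μ u ≤ ‖u x‖ ^ 2 * Real.log (‖u x‖ ^ 2 / l2sq μ u) := by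
  rcases eq_or_ne (l2sq μ u) 0 with h0 | h0
  · filter_upwards [ae_eq_zero_of_l2sq_eq_zero hu h0] with x hx
    simp [hx, h0]
  · exact Eventually.of_forall fun x =>
      (sub_le_mul_log_div (by positivity) (l2sq_nonneg _)).resolve_right h0

variable [IsProbabilityMeasure μ]

lemma entropy_nonneg (hu : MemLp u 2 μ)
    (h : Integrable (fun x => ‖u x‖ ^ 2 * Real.log (‖u x‖ ^ 2)) μ) :
    0 ≤ ∫ x, ‖u x‖ ^ 2 * Real.log (‖u x‖ ^ 2) ∂μ - Real.log (l2sq μ u) * l2sq μ u := by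
  have h1 := integral_congr_ae (mul_log_div_ae_eq hu)
  rw [integral_sub h ((integrable_norm_sq hu).const_mul _), integral_const_mul] at h1
  change _ = _ - _ * l2sq μ u at h1
  rw [← h1]
  have h2 := integral_mono_ae ((integrable_norm_sq hu).sub (integrable_const _))
    ((integrable_mul_log_div_iff hu).2 h) (sub_le_mul_log_div_ae hu)
  refine le_trans (le_of_eq ?_) h2
  refine Eq.trans ?_ (integral_sub (integrable_norm_sq hu) (integrable_const _)).symm
  rw [integral_const, probReal_univ, one_smul]
  exact (sub_self (l2sq μ u)).symm

/-- Since s log(s/m) ≥ s - m, the negative part is always integrable, and non-integrability can only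
come from the positive part. -/
lemma entropy_eq_top (hu : MemLp u 2 μ)
    (h : ¬ Integrable (fun x => ‖u x‖ ^ 2 * Real.log (‖u x‖ ^ 2)) μ) :
    entropy μ (fun x => ‖u x‖ ^ 2) = ⊤ := by
  rw [← integrable_mul_log_div_iff hu] at h
  have hn : AEMeasurable (fun x => ‖u x‖ ^ 2) μ := hu.1.norm.aemeasurable.pow_const 2
  have hm : AEStronglyMeasurable (fun x => ‖u x‖ ^ 2 * Real.log (‖u x‖ ^ 2 / l2sq μ u)) μ :=
    (hn.mul (Real.measurable_log.comp_aemeasurable (hn.div_const _))).aestronglyMeasurable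
  have hneg : ∫⁻ x, ENNReal.ofReal (-(‖u x‖ ^ 2 * Real.log (‖u x‖ ^ 2 / l2sq μ u))) ∂μ ≠ ∞ := by
    refine ne_top_of_le_ne_top (b := ∫⁻ _, ENNReal.ofReal (l2sq μ u) ∂μ) (by simp)
      (lintegral_mono_ae ?_)
    filter_upwards [sub_le_mul_log_div_ae hu] with x hx
    exact ENNReal.ofReal_le_ofReal (by linarith [sq_nonneg ‖u x‖])
  have hpos : ∫⁻ x, ENNReal.ofReal (‖u x‖ ^ 2 * Real.log (‖u x‖ ^ 2 / l2sq μ u)) ∂μ = ∞ := by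
    by_contra hp
    refine h ⟨hm, ?_⟩
    rw [hasFiniteIntegral_iff_norm]
    refine lt_of_le_of_lt (lintegral_mono fun x => ?_)
      ((lintegral_add_left' hm.aemeasurable.ennreal_ofReal
        fun x => ENNReal.ofReal (-(‖u x‖ ^ 2 * Real.log (‖u x‖ ^ 2 / l2sq μ u)))).trans_lt
        (ENNReal.add_lt_top.2 ⟨lt_top_iff_ne_top.2 hp, lt_top_iff_ne_top.2 hneg⟩))
    rw [Real.norm_eq_abs]
    rcases abs_cases (‖u x‖ ^ 2 * Real.log (‖u x‖ ^ 2 / l2sq μ u)) with ⟨e, -⟩ | ⟨e, -⟩ <;> rw [e]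
    · exact le_self_add
    · exact le_add_self
  change ((∫⁻ x, ENNReal.ofReal (‖u x‖ ^ 2 * Real.log (‖u x‖ ^ 2 / l2sq μ u)) ∂μ : ℝ≥0∞) : EReal)
    - ((∫⁻ x, ENNReal.ofReal (-(‖u x‖ ^ 2 * Real.log (‖u x‖ ^ 2 / l2sq μ u))) ∂μ : ℝ≥0∞) : EReal)
    = ⊤
  rw [hpos, EReal.coe_ennreal_top]
  exact EReal.top_sub (by simpa using hneg)

lemma Interaction.IsSolution.exists_isWeakSol (hμ : Φ.IsGibbs μ) {lam : ℝ} {f : Config d → ℂ}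
    {φ : ℝ → Lp ℂ 2 μ} (hφ : Φ.IsSolution μ lam Λ f φ) :
    ∃ Dφ, IsWeakSol μ (Φ.HasWeakGrad μ Λ) lam φ Dφ := by
  have h1 : ∀ t, ∃ D, 0 ≤ t → Φ.HasWeakGrad μ Λ (φ t) D := fun t => by
    by_cases ht : 0 ≤ t
    · obtain ⟨C, hC, h⟩ := hφ.bounded_grad t
      obtain ⟨D, hD⟩ := Interaction.exists_hasWeakGrad (Lp.memLp (φ t))
        ((h t ⟨ht, le_rfl⟩).trans_lt hC).ne
      exact ⟨D, fun _ => hD⟩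
    · exact ⟨fun _ _ => 0, fun h => absurd h ht⟩
  choose D hD using h1
  refine ⟨D, hφ.isWeakSol hμ hD fun T => ?_⟩
  obtain ⟨C, hC, h⟩ := hφ.bounded_grad T
  refine ⟨C.toReal, fun t ht => ?_⟩
  have h2 := h t ht
  rw [(hD t ht.1).gradSqOn_eq] at h2
  exact (ENNReal.ofReal_le_iff_le_toReal hC.ne).1 h2

lemma Interaction.gradSqOn_le_gradSq (u : Config d → ℂ) :
    Φ.gradSqOn μ Λ u ≤ Φ.gradSq μ u := ENNReal.sum_le_tsum _

lemma Interaction.gradSqOn_congr (h : u =ᵐ[μ] v) : Φ.gradSqOn μ Λ u = Φ.gradSqOn μ Λ v :=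
  Finset.sum_congr rfl fun _ _ => Interaction.partialSq_congr h

section

variable {lam S : ℝ} {φ : ℝ → Lp ℂ 2 μ} {Dφ : ℝ → Λ → Config d → ℂ}

/-- The entropy differs from the integral of |φ|² log|φ|² by a function of the mass alone, and the
mass is conserved. -/
lemma IsWeakSol.entropy_le (hμ : Φ.IsGibbs μ) (h : IsWeakSol μ (Φ.HasWeakGrad μ Λ) lam φ Dφ)
    {t : ℝ} (ht : 0 ≤ t)
    (h0 : Integrable (fun x => ‖φ 0 x‖ ^ 2 * Real.log (‖φ 0 x‖ ^ 2)) μ) :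
    ∃ e₀ e : ℝ, 0 ≤ e ∧ entropy μ (fun x => ‖φ 0 x‖ ^ 2) = e₀ ∧
      entropy μ (fun x => ‖φ t x‖ ^ 2) = e ∧
      e ≤ e₀ + 2 * ∫ s in (0 : ℝ)..t, totalTwist μ (φ s) (Dφ s) := by
  have hW := isGradRel_hasWeakGrad (Λ := Λ) hμ
  obtain ⟨h1, h2⟩ := h.entropy_balance hW ht h0
  have h3 : l2sq μ (φ t) = l2sq μ (φ 0) := by
    rw [l2sq_coe, l2sq_coe, (h.conservation hW ht).1]
  refine ⟨_, _, entropy_nonneg (Lp.memLp _) h1, entropy_eq (Lp.memLp _) h0,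
    entropy_eq (Lp.memLp _) h1, ?_⟩
  rw [h3]
  linarith

end

end

end LSE

theorem theorem5p2 {d : ℕ} (Φ : LSE.Interaction d) (hΦ : Φ.Normalizable)
    (μ : Measure (LSE.Config d)) [IsProbabilityMeasure μ] (hμ : Φ.IsGibbs μ)
    (lam : ℝ) (Λ Λf : Finset (LSE.Lattice d)) (f : LSE.Config d → ℂ)
    (hloc : LSE.IsLocalisedIn Λf f) (hf : Φ.InH1 μ f)
    (φ : ℝ → Lp ℂ 2 μ) (hφ : Φ.IsSolution μ lam Λ f φ) :
    (∀ t : ℝ, 0 ≤ t →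
      Φ.gradSqOn μ Λ (φ t) ≤ ENNReal.ofReal (Real.exp (2 * |lam| * t)) * Φ.gradSq μ f) ∧
    (lam ≠ 0 → ∀ t : ℝ, 0 ≤ t →
      LSE.entropy μ (fun x => ‖φ t x‖ ^ 2) ≤ LSE.entropy μ (fun x => ‖f x‖ ^ 2) +
        ((ENNReal.ofReal (1 / |lam| * (Real.exp (2 * |lam| * t) - 1)) * Φ.gradSq μ f : ℝ≥0∞) :
          EReal)) ∧
    (0 < lam → ∀ c : ℝ, 0 < c → Φ.LogSobolev μ c → ∀ t : ℝ, 0 ≤ t →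
      Φ.gradSqOn μ Λ (φ t) ≤ ENNReal.ofReal (1 + lam * c) * Φ.gradSq μ f ∧
      LSE.entropy μ (fun x => ‖φ t x‖ ^ 2) ≤
        ((ENNReal.ofReal (1 / lam + c) * Φ.gradSq μ f : ℝ≥0∞) : EReal)) := by 
  obtain ⟨Dφ, h⟩ := hφ.exists_isWeakSol hμ
  have hW := LSE.isGradRel_hasWeakGrad (Λ := Λ) hμ
  have hgrad := fun t ht => (h.grad t ht).gradSqOn_eq
  set S := (Φ.gradSq μ f).toReal
  have hS0 : 0 ≤ S := ENNReal.toReal_nonneg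
  have hS : Φ.gradSq μ f = ENNReal.ofReal S := (ENNReal.ofReal_toReal hf.2.ne).symm
  have hE0 : LSE.energy μ (Dφ 0) ≤ S := by
    refine (ENNReal.ofReal_le_ofReal_iff hS0).1 ?_
    rw [← hgrad 0 le_rfl, ← hS, LSE.Interaction.gradSqOn_congr hφ.initial]
    exact LSE.Interaction.gradSqOn_le_gradSq f
  have hent0 := LSE.entropy_congr hφ.initial
  refine ⟨fun t ht => ?_, fun hlam t ht => ?_, fun hlam c hc hLS t ht => ?_⟩
  · rw [hgrad t ht, hS, ← ENNReal.ofReal_mul (Real.exp_nonneg _)]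
    refine ENNReal.ofReal_le_ofReal ((h.energy_bound hW ht).1.trans ?_)
    gcongr
  · rw [← hent0, hS, ← ENNReal.ofReal_mul (mul_nonneg (by positivity)
      (sub_nonneg.2 (Real.one_le_exp (by positivity)))), EReal.coe_ennreal_ofReal]
    -- If the initial entropy is infinite, the bound is trivial.
    by_cases h0 : Integrable (fun x => ‖φ 0 x‖ ^ 2 * Real.log (‖φ 0 x‖ ^ 2)) μ
    · obtain ⟨e₀, e, -, h1, h2, h3⟩ := h.entropy_le hμ ht h0
      rw [h1, h2, ← EReal.coe_add, EReal.coe_le_coe_iff]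
      have h4 := (h.energy_bound hW ht).2
      rw [intervalIntegral.integral_const_mul, abs_mul] at h4
      have h5 : 0 < |lam| := abs_pos.2 hlam
      set I := ∫ s in (0 : ℝ)..t, LSE.totalTwist μ (φ s) (Dφ s)
      have h6 : (Real.exp (2 * |lam| * t) - 1) * LSE.energy μ (Dφ 0) ≤
          (Real.exp (2 * |lam| * t) - 1) * S :=
        mul_le_mul_of_nonneg_left hE0 (sub_nonneg.2 (Real.one_le_exp (by positivity)))
      have h7 : 2 * I ≤ 1 / |lam| * (Real.exp (2 * |lam| * t) - 1) * S := by
        rw [one_div, mul_assoc, inv_mul_eq_div, le_div_iff₀ h5]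
        nlinarith [le_abs_self I]
      linarith [le_max_left (1 / |lam| * (Real.exp (2 * |lam| * t) - 1) * S) 0]
    · rw [LSE.entropy_eq_top (Lp.memLp _) h0, EReal.top_add_coe]
      exact le_top
  · have hls := hLS f hf
    rw [← hent0, hS, ← ENNReal.ofReal_mul hc.le, EReal.coe_ennreal_ofReal,
      max_eq_left (by positivity)] at hls
    -- The log-Sobolev inequality makes the initial entropy finite.
    have h0 : Integrable (fun x => ‖φ 0 x‖ ^ 2 * Real.log (‖φ 0 x‖ ^ 2)) μ := by
      by_contra h0
      rw [LSE.entropy_eq_top (Lp.memLp _) h0, top_le_iff] at hls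
      exact EReal.coe_ne_top _ hls
    obtain ⟨e₀, e, he, h1, h2, h3⟩ := h.entropy_le hμ ht h0
    rw [h1, EReal.coe_le_coe_iff] at hls
    have h4 := (h.conservation hW ht).2.2
    rw [intervalIntegral.integral_const_mul] at h4
    set I := ∫ s in (0 : ℝ)..t, LSE.totalTwist μ (φ s) (Dφ s)
    -- In this combination the integrals of the twist cancel. Each of the two terms is nonnegative,
    -- so each is bounded by the right-hand side.
    have h5 : LSE.energy μ (Dφ t) + lam * e ≤ (1 + lam * c) * S := by
      have := mul_le_mul_of_nonneg_left (h3.trans (add_le_add_left hls _)) hlam.le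
      nlinarith
    rw [hgrad t ht, hS, ← ENNReal.ofReal_mul (by positivity),
      ← ENNReal.ofReal_mul (by positivity), EReal.coe_ennreal_ofReal,
      max_eq_left (by positivity), h2, EReal.coe_le_coe_iff]
    refine ⟨ENNReal.ofReal_le_ofReal (by nlinarith), ?_⟩
    have h6 : lam * e ≤ lam * ((1 / lam + c) * S) := by
      have h7 : lam * ((1 / lam + c) * S) = (1 + lam * c) * S := by field_simp
      linarith [LSE.energy_nonneg (μ := μ) (Dφ t)]
    exact le_of_mul_le_mul_left h6 hlam
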